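/- **Setting.** Let $\alpha:\mathbb R\to[0,1)$ be bounded and Lipschitz ($\alpha\in W^{1,\infty}(\mathbb R,[0,1))$) and $T\ge 0$. Fix smooth $\chi^\pm\in[0,1]$ with $\chi^++\chi^-=1$, $\operatorname{supp}\chi^+\subset(-1,\infty)$, $\operatorname{supp}\chi^-\subset(-\infty,1)$, and set $E_1=\{f+a\chi^+\}$, $E_2=\{f+a\chi^++b\chi^-\}$ with $f\in H^1(\mathbb R)$, $a,b\in\mathbb R$, and $E_1^0=\{f+a\chi^+\}$ with $f\in L^2(\mathbb R)$, $a\in\mathbb R$. Functions in $E_1,E_2$ are identified with their continuous representatives. *Eulerian data.* $\mathcal D_0^\alpha$ is the set of $(u,\mu,\nu)$ with $u\in E_2$, $\mu=\nu$ a finite positive Borel measure on $\mathbb R$, $d\mu_{\rm ac}=u_x^2\,dx$, and $\mu((-\infty,\cdot))\in E_1^0$. Write $F=G=\mu((-\infty,\cdot))$, $F_{\rm ac}$, $F_{\rm sing}$ for the primitives of $\mu_{\rm ac}$, $\mu_{\rm sing}$, and $G_\infty=\nu(\mathbb R)$. *Lagrangian coordinates.* $\mathcal F^\alpha$ is the set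 of $X=(y,U,V,H)$ with $(y-\mathrm{id},U,V,H)\in E_2\times E_2\times E_1\times E_1$, all four in $W^{1,\infty}(\mathbb R)$, and, a.e., $y_\xi,H_\xi\ge0$, $y_\xi+H_\xi\ge c$ for some $c>0$, $y_\xi V_\xi=U_\xi^2$, $0\le V_\xi\le H_\xi$, and $V_\xi=\kappa(y)H_\xi$ for some $\kappa:\mathbb R\to(0,1]$ with $\kappa(y(\xi))=1$ where $U_\xi(\xi)<0$. The map $L(u,\mu,\nu)=(y,U,V,H)$ is given by $$y(\xi)=\sup\{x: x+\nu((-\infty,x))<\xi\},\quad U=u\circ y,\quad H(\xi)=\xi-y(\xi),\quad V(\xi)=\int_{-\infty}^\xi \tfrac{d\mu}{d\nu}(y(\eta))H_\xi(\eta)\,d\eta ,$$ and $M(y,U,V,H)=(u,\mu,\nu)$ by $u(x)=U(\xi)$ whenever $y(\xi)=x$, $\mu=y_\#(V_\xi d\xi)$, $\nu=y_\#(H_\xi d\xi)$. *Exact solution.* For $X_0\in\mathcal F^\alpha$ let $\tau(\xi)=0$ if $y_{0,\xi}=U_{0,\xi}=0$, $\tau(\xi)=-2y_{0,\xi}/U_{0,\xi}$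 if $U_{0,\xi}<0$, and $\tau(\xi)=\infty$ otherwise. $S_t(X_0)=X(t)\in\mathcal F^\alpha$, $t\ge0$, is the solution with $X(0)=X_0$ of $$y_t=U,\quad U_t=\tfrac12V-\tfrac14V_\infty(t),\quad V(t,\xi)=\int_{-\infty}^\xi\bigl(1-\alpha(y(\tau(\eta),\eta))\chi_{\{t\ge\tau(\eta)>0\}}\bigr)V_{0,\xi}(\eta)\,d\eta,\quad H_t=0,$$ $V_\infty(t)=\lim_{\xi\to\infty}V(t,\xi)$, the first two equations being understood as integrated in time. For $(u_0,\mu_0,\nu_0)\in\mathcal D_0^\alpha$ put $X(t)=S_t(L(u_0,\mu_0,\nu_0))$ and $(u,\mu,\nu)(t)=M(X(t))$. *Projection.* For $\Delta x>0$ let $x_j=j\Delta x$, $f_j=f(x_j)$, $Df_{2j}=(f_{2j+2}-f_{2j})/(2\Delta x)$, $q_{2j}=\sqrt{DF_{{\rm ac},2j}-(Du_{2j})^2}$, and choose signs $\sigma_j\in\{1,-1\}$ arbitrarily (the sign selection may depend on $\Delta x$). $P_{\Delta x}(u,F,G)=(u_{\Delta x},F_{\Delta x},F_{\Delta x})$,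 where $F_{\Delta x}=F_{\Delta x,\rm ac}+F_{\Delta x,\rm sing}$, $F_{\Delta x,\rm sing}=F_{{\rm sing},2j+2}$ on $(x_{2j},x_{2j+2}]$, and, with $a=Du_{2j}-\sigma_jq_{2j}$ and $b=Du_{2j}+\sigma_jq_{2j}$, $$u_{\Delta x}(x)=u_{2j}+a(x-x_{2j}),\qquad F_{\Delta x,\rm ac}(x)=F_{{\rm ac},2j}+a^2(x-x_{2j})\qquad\text{on }(x_{2j},x_{2j+1}],$$ $$u_{\Delta x}(x)=u_{2j+2}+b(x-x_{2j+2}),\qquad F_{\Delta x,\rm ac}(x)=\tfrac12(F_{{\rm ac},2j+2}+F_{{\rm ac},2j})-2\sigma_jDu_{2j}q_{2j}\Delta x+b^2(x-x_{2j+1})\qquad\text{on }(x_{2j+1},x_{2j+2}].$$ *Numerical evolution.* Let $X_{\Delta x}(0)=L(P_{\Delta x}(u_0,\mu_0,\nu_0))$. It is piecewise linear with nodes $\xi_{3j}=x_{2j}+G_{\Delta x}(x_{2j})$, $\xi_{3j+1}=x_{2j}+G_{\Delta x}(x_{2j}+)$, $\xi_{3j+2}=x_{2j+1}+G_{\Delta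 x}(x_{2j+1})$. Write $\zeta=y-\mathrm{id}$, let a subscript $j+\frac12$ denote the value at the midpoint of $[\xi_j,\xi_{j+1}]$, let $w_j=\xi_{j+1}-\xi_j$, and let $\tau_{j+\frac12}$ be the value of the wave breaking function of $X_{\Delta x}(0)$ there; for a degenerate cell ($w_j=0$) the derivatives and $\tau_{j+\frac12}$ are set to $0$. Let $0=\hat\tau_0<\hat\tau_1<\dots$ be $0$ together with the distinct finite values of $\tau_{j+\frac12}$ ($\hat\tau_m=\infty$ if the list is exhausted). Let $\Delta t>0$ satisfy $\|\alpha'\|_\infty G_\infty\Delta t^2\le 8\Delta x$. Define $\tau_0^*=0$ and, given $\tau_k^*=\hat\tau_m$: $\tau_{k+1}^*=T$ (and stop) if $\hat\tau_{m+1}\ge T$; otherwise $\tau_{k+1}^*=\max\{\hat\tau_j:\tau_k^*<\hat\tau_j\le\min(\tau_k^*+\Delta t,T)\}$ if $\hat\tau_{m+2}-\tau_k^*\le\Delta t$ and $\hat\tau_{m+2}<T$ (stop if this equals $T$); otherwise $\tau_{k+1}^*=\hat\tau_{m+1}$. On $(\tau_k^*,\tau_{k+1}^*]$ the iterates $n=1,2,\dots$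 start at $\tau_k^*$ from the values already computed and solve, in each cell, $$\partial_t\zeta^n_{j+\frac12,\xi}=U^n_{j+\frac12,\xi},\quad \partial_tU^n_{j+\frac12,\xi}=\tfrac12V^n_{j+\frac12,\xi},\quad V^n_{j+\frac12,\xi}(t)=\bigl(1-\beta^n_{j+\frac12}\chi_{\{t\ge\tau_{j+\frac12}>\tau_k^*\}}\bigr)V_{j+\frac12,\xi}(\tau_k^*),$$ where $\beta^1=0$ and, for $n\ge2$, $\beta^n_{j+\frac12}=\alpha(y_j^{n-1}(\tau_{k+1}^*))$ if $\tau_{j+\frac12}\in(\tau_k^*,\tau_{k+1}^*]$ and $0$ otherwise. With $\ell_j(t)=\beta^n_{j+\frac12}\chi_{\{t\ge\tau_{j+\frac12}>\tau_k^*\}}V_{j+\frac12,\xi}(\tau_k^*)w_j$, $h=t-\tau_k^*$ and $V_\infty=\sum_jV_{j+\frac12,\xi}w_j$, the left asymptotes are $V^n_{-\infty}=0$, $$U^n_{-\infty}(t)=U_{-\infty}(\tau_k^*)-\tfrac14V_\infty(\tau_k^*)h+\tfrac14\sum_j\ell_j(t)(t-\tau_{j+\frac12}),$$ $$\zeta^n_{-\infty}(t)=\zeta_{-\infty}(\tau_k^*)+U_{-\infty}(\tau_k^*)h-\tfrac18V_\infty(\tau_k^*)h^2+\tfrac18\sum_j\ell_j(t)(t-\tau_{j+\frac12})^2,$$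 the node values are $f^n_j=f^n_{-\infty}+\sum_{m<j}f^n_{m+\frac12,\xi}w_m$ for $f\in\{\zeta,U,V\}$, and $y^n_j=\zeta^n_j+\xi_j$, $H_j(t)=H_j(0)$. The numerical values on $(\tau_k^*,\tau_{k+1}^*]$ are those of iterate $n=N_k$, where $N_k=1$ if no breaking time lies in $(\tau_k^*,T]$, $N_k=2$ if $\tau_{k+1}^*$ is the first breaking time after $\tau_k^*$, and otherwise $N_k\in\{2,3\}$ is such that $$\sup_{t\in[\tau_k^*,\tau_{k+1}^*]}\sup_j|y_j^{N_k}(t)-y_j^{N_k-1}(t)|\le\tfrac18G_\infty\Delta t^2\Delta x .$$ $X_{\Delta x}(t)=S_{\Delta x,t}(X_{\Delta x}(0))$ is obtained from the node values by linear interpolation, and $(u_{\Delta x},\mu_{\Delta x},\nu_{\Delta x})(t)=M(X_{\Delta x}(t))$. *The functions $g_p$.* For $X=(y,U,V,H)$ with $H_\infty=\lim_{\xi\to\infty}H(\xi)$: where $U_\xi<0$, $g_1(X)=(1-\alpha(y))V_\xi$, $g_2(X)=\|\alpha'\|_\infty H_\infty U_\xi$, $g_3(X)=\|\alpha'\|_\infty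 UU_\xi$; where $U_\xi\ge0$, $g_1(X)=V_\xi$ and $g_2(X)=g_3(X)=0$. **Theorem.** Let $(u_0,\mu_0,\nu_0)\in\mathcal D_0^\alpha$ and, for each $\Delta x>0$, let $\Delta t$, the signs $\sigma_j$ and the iteration numbers $N_k$ be any admissible choice as above. Then for every $t\in[0,T]$: $u(t)\in E_2$, $u_{\Delta x}(t)\in E_2$ for all sufficiently small $\Delta x$, and as $\Delta x\to0$ - $u_{\Delta x}(t)\to u(t)$ in $L^\infty(\mathbb R)$; - $u_{\Delta x,x}(t)\rightharpoonup u_x(t)$ weakly in $L^2(\mathbb R)$; - $\nu_{\Delta x}(t)\Rightarrow\nu(t)$, i.e. $\int\phi\,d\nu_{\Delta x}(t)\to\int\phi\,d\nu(t)$ for all bounded continuous $\phi$ (these measures being finite); - for $p=1,2,3$, $(y_{\Delta x}(t))_\#(g_p(X_{\Delta x}(t))\,d\xi)\overset{*}{\rightharpoonup}(y(t))_\#(g_p(X(t))\,d\xi)$, i.e. the integrals of every $\phi\in C_c(\mathbb R)$ converge. -/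

import Mathlib

open MeasureTheory Filter Set Topology
open scoped ENNReal BoundedContinuousFunction

namespace HunterSaxton

noncomputable section

/-! ## Function spaces and the dissipation coefficient -/

/-- The class `W^{1,∞}(ℝ, [0,1))`: Lipschitz functions with values in `[0,1)`. -/
def IsCoefficient (α : ℝ → ℝ) : Prop :=
  (∃ K, LipschitzWith K α) ∧ ∀ x, α x ∈ Ico (0 : ℝ) 1

/-- The norm `‖α'‖_∞`. -/
def derivSupNorm (α : ℝ → ℝ) : ℝ := (eLpNorm (deriv α) ⊤ volume).toReal

/-- Membership in `H¹(ℝ)` of an honest (continuous) function: it lies in `L²`, and it is the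
integral of its a.e. derivative, which lies in `L²`. -/
def MemH1 (f : ℝ → ℝ) : Prop :=
  MemLp f 2 volume ∧ MemLp (deriv f) 2 volume ∧
    ∀ a b : ℝ, f b - f a = ∫ x in a..b, deriv f x

/-- A smooth cut-off with `0 ≤ χ⁺ ≤ 1` that vanishes on `(-∞, -1/2]` and equals `1` on
`[1/2, ∞)`. The spaces below do not depend on the choice. -/
def chiPlus (x : ℝ) : ℝ := Real.smoothTransition (x + 1 / 2)

/-- The complementary cut-off. -/
def chiMinus (x : ℝ) : ℝ := 1 - chiPlus x

/-- `E₁ = {f̄ + a χ⁺ : f̄ ∈ H¹, a ∈ ℝ}`. -/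
def MemE1 (f : ℝ → ℝ) : Prop := ∃ a : ℝ, MemH1 (fun x => f x - a * chiPlus x)

/-- `E₂ = {f̄ + a χ⁺ + b χ⁻ : f̄ ∈ H¹, a, b ∈ ℝ}`. -/
def MemE2 (f : ℝ → ℝ) : Prop :=
  ∃ a b : ℝ, MemH1 (fun x => f x - a * chiPlus x - b * chiMinus x)

/-- `E₁⁰ = {f̄ + a χ⁺ : f̄ ∈ L², a ∈ ℝ}`. -/
def MemE10 (f : ℝ → ℝ) : Prop := ∃ a : ℝ, MemLp (fun x => f x - a * chiPlus x) 2 volume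

/-! ## Eulerian coordinates -/

/-- A triplet `(u, μ, ν)`. -/
structure Eul where
  u : ℝ → ℝ
  μ : Measure ℝ
  ν : Measure ℝ

/-- Absolutely continuous part of a measure with respect to Lebesgue measure. -/
def acPart (μ : Measure ℝ) : Measure ℝ := volume.withDensity (μ.rnDeriv volume)

/-- The set `𝒟^α` of Eulerian coordinates (`α` does not enter its definition). -/
structure MemD (Z : Eul) : Prop where
  u_mem : MemE2 Z.u
  finite_mu : IsFiniteMeasure Z.μ
  finite_nu : IsFiniteMeasure Z.ν
  mu_le_nu : Z.μ ≤ Z.ν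
  ac_le : acPart Z.μ ≤ acPart Z.ν
  ac_eq : acPart Z.μ = volume.withDensity (fun x => ENNReal.ofReal ((deriv Z.u x) ^ 2))
  F_mem : MemE10 (fun x => (Z.μ (Iio x)).toReal)
  G_mem : MemE10 (fun x => (Z.ν (Iio x)).toReal)
  density_pos : ∀ᵐ x ∂Z.ν, 0 < Z.μ.rnDeriv Z.ν x
  density_ac : ∀ᵐ x ∂(acPart Z.ν),
    deriv Z.u x < 0 → (acPart Z.μ).rnDeriv (acPart Z.ν) x = 1

/-- The subset `𝒟₀^α` of triplets with `μ = ν`. -/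
def MemD0 (Z : Eul) : Prop := MemD Z ∧ Z.μ = Z.ν

/-! ## Lagrangian coordinates -/

/-- A quadruplet `(y, U, V, H)`. -/
structure Lag where
  y : ℝ → ℝ
  U : ℝ → ℝ
  V : ℝ → ℝ
  H : ℝ → ℝ

/-- Membership in `W^{1,∞}(ℝ)` (bounded Lipschitz functions). -/
def MemW1Inf (f : ℝ → ℝ) : Prop := (∃ K, LipschitzWith K f) ∧ ∃ C : ℝ, ∀ x, |f x| ≤ C

/-- The set `ℱ^α` of Lagrangian coordinates (`α` does not enter its definition). -/
structure MemF (X : Lag) : Prop where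
  y_mem : MemE2 (fun ξ => X.y ξ - ξ)
  U_mem : MemE2 X.U
  V_mem : MemE1 X.V
  H_mem : MemE1 X.H
  y_lip : MemW1Inf (fun ξ => X.y ξ - ξ)
  U_lip : MemW1Inf X.U
  V_lip : MemW1Inf X.V
  H_lip : MemW1Inf X.H
  deriv_nonneg : ∀ᵐ ξ, 0 ≤ deriv X.y ξ ∧ 0 ≤ deriv X.H ξ
  deriv_lower : ∃ c : ℝ, 0 < c ∧ ∀ᵐ ξ, c ≤ deriv X.y ξ + deriv X.H ξ
  energy_rel : ∀ᵐ ξ, deriv X.y ξ * deriv X.V ξ = (deriv X.U ξ) ^ 2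
  energy_le : ∀ᵐ ξ, 0 ≤ deriv X.V ξ ∧ deriv X.V ξ ≤ deriv X.H ξ
  kappa : ∃ κ : ℝ → ℝ, (∀ x, κ x ∈ Ioc (0 : ℝ) 1) ∧
    (∀ᵐ ξ, deriv X.V ξ = κ (X.y ξ) * deriv X.H ξ) ∧
    ∀ᵐ ξ, deriv X.U ξ < 0 → κ (X.y ξ) = 1

/-- The map `L` from Eulerian to Lagrangian coordinates. -/
def mapL (Z : Eul) : Lag :=
  let y : ℝ → ℝ := fun ξ => sSup {x : ℝ | x + (Z.ν (Iio x)).toReal < ξ}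
  let H : ℝ → ℝ := fun ξ => ξ - y ξ
  { y := y
    U := fun ξ => Z.u (y ξ)
    V := fun ξ => ∫ η in Iic ξ, (Z.μ.rnDeriv Z.ν (y η)).toReal * deriv H η
    H := H }

/-- The map `M` from Lagrangian to Eulerian coordinates: `u(x) = U(ξ)` for any `ξ` with
`y(ξ) = x`, `μ = y_#(V_ξ dξ)`, `ν = y_#(H_ξ dξ)`. -/
def mapM (X : Lag) : Eul where
  u := fun x => X.U (Function.invFun X.y x)
  μ := (volume.withDensity (fun ξ => ENNReal.ofReal (deriv X.V ξ))).map X.y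
  ν := (volume.withDensity (fun ξ => ENNReal.ofReal (deriv X.H ξ))).map X.y

/-! ## The exact `α`-dissipative solution -/

open Classical in
/-- The wave breaking function `τ : ℝ → [0,∞]` of the initial data `X₀`. -/
def waveBreak (X₀ : Lag) (ξ : ℝ) : ℝ≥0∞ :=
  if deriv X₀.y ξ = 0 ∧ deriv X₀.U ξ = 0 then 0
  else if deriv X₀.U ξ < 0 then ENNReal.ofReal (-2 * deriv X₀.y ξ / deriv X₀.U ξ)
  else ⊤

/-- The limit `f(∞)`. -/
def limTop (f : ℝ → ℝ) : ℝ := limUnder atTop f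

open Classical in
/-- `t ↦ X t`, `t ≥ 0`, is an `α`-dissipative solution in Lagrangian coordinates with initial data
`X₀`. As `V` may jump in time, the equations `y_t = U` and `U_t = V/2 - V_∞/4` are integrated in
time. -/
structure IsSolution (α : ℝ → ℝ) (X₀ : Lag) (X : ℝ → Lag) : Prop where
  init : X 0 = X₀
  mem : ∀ t, 0 ≤ t → MemF (X t)
  eq_y : ∀ t, 0 ≤ t → ∀ ξ, (X t).y ξ = X₀.y ξ + ∫ s in (0 : ℝ)..t, (X s).U ξ
  eq_U : ∀ t, 0 ≤ t → ∀ ξ, (X t).U ξ =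
    X₀.U ξ + ∫ s in (0 : ℝ)..t, (1 / 2 * (X s).V ξ - 1 / 4 * limTop (X s).V)
  eq_V : ∀ t, 0 ≤ t → ∀ ξ, (X t).V ξ =
    ∫ η in Iic ξ,
      (1 - (if 0 < waveBreak X₀ η ∧ waveBreak X₀ η ≤ ENNReal.ofReal t
            then α ((X (waveBreak X₀ η).toReal).y η) else 0)) * deriv X₀.V η
  eq_H : ∀ t, 0 ≤ t → ∀ ξ, (X t).H ξ = X₀.H ξ

open Classical in
/-- The solution operator `S_t`: `S_t(X₀) = X(t)` for the solution `X` with initial data `X₀`.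
(The value if no solution exists is irrelevant.) -/
def solOp (α : ℝ → ℝ) (t : ℝ) (X₀ : Lag) : Lag :=
  if h : ∃ X : ℝ → Lag, IsSolution α X₀ X then h.choose t else X₀

/-! ## The functions `g₁, g₂, g₃` -/

open Classical in
/-- `g₁(X)`: equal to `(1 - α(y)) V_ξ` where `U_ξ < 0`, and to `V_ξ` elsewhere. -/
def g1 (α : ℝ → ℝ) (X : Lag) (ξ : ℝ) : ℝ :=
  if deriv X.U ξ < 0 then (1 - α (X.y ξ)) * deriv X.V ξ else deriv X.V ξ

open Classical in
/-- `g₂(X)`: equal to `‖α'‖_∞ H_∞ U_ξ` where `U_ξ < 0`, and to `0` elsewhere. -/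
def g2 (α : ℝ → ℝ) (X : Lag) (ξ : ℝ) : ℝ :=
  if deriv X.U ξ < 0 then derivSupNorm α * limTop X.H * deriv X.U ξ else 0

open Classical in
/-- `g₃(X)`: equal to `‖α'‖_∞ U U_ξ` where `U_ξ < 0`, and to `0` elsewhere. -/
def g3 (α : ℝ → ℝ) (X : Lag) (ξ : ℝ) : ℝ :=
  if deriv X.U ξ < 0 then derivSupNorm α * X.U ξ * deriv X.U ξ else 0

/-- Integral of `φ` against the signed Radon measure `y_#(g dξ)`, written as the difference of
the push-forwards of its positive and negative parts. -/
def pushIntegral (y g φ : ℝ → ℝ) : ℝ :=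
  (∫ x, φ x ∂((volume.withDensity (fun ξ => ENNReal.ofReal (g ξ))).map y)) -
    ∫ x, φ x ∂((volume.withDensity (fun ξ => ENNReal.ofReal (-(g ξ)))).map y)

/-! ## The projection operator -/

/-- `F_ac(x) = μ_ac((-∞,x))`. -/
def Fac (μ : Measure ℝ) (x : ℝ) : ℝ := (acPart μ (Iio x)).toReal

/-- `F_sing(x) = μ_sing((-∞,x))`. -/
def Fsing (μ : Measure ℝ) (x : ℝ) : ℝ := (μ.singularPart volume (Iio x)).toReal

/-- Grid point `x_i = i Δx`. -/
def gridX (dx : ℝ) (i : ℤ) : ℝ := (i : ℝ) * dx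

/-- The index `j` with `x_{2j} < x ≤ x_{2j+2}`. -/
def cellOf (dx x : ℝ) : ℤ := ⌈x / (2 * dx)⌉ - 1

/-- `D u_{2j}`, and likewise for other functions. -/
def diffD (dx : ℝ) (f : ℝ → ℝ) (j : ℤ) : ℝ :=
  (f (gridX dx (2 * j + 2)) - f (gridX dx (2 * j))) / (2 * dx)

/-- `q_{2j} = √(D F_ac,2j - (D u_{2j})²)`. -/
def projQ (dx : ℝ) (Z : Eul) (j : ℤ) : ℝ :=
  Real.sqrt (diffD dx (Fac Z.μ) j - (diffD dx Z.u j) ^ 2)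

/-- The signed `q_{2j}`; `σ j = 1` selects the upper signs and `σ j = -1` the lower signs in the
formulas below. -/
def projSQ (dx : ℝ) (σ : ℤ → ℤˣ) (Z : Eul) (j : ℤ) : ℝ := ((σ j : ℤ) : ℝ) * projQ dx Z j

open Classical in
/-- The projected function `u_Δx`. -/
def projU (dx : ℝ) (σ : ℤ → ℤˣ) (Z : Eul) (x : ℝ) : ℝ :=
  let j := cellOf dx x
  if x ≤ gridX dx (2 * j + 1) then
    Z.u (gridX dx (2 * j)) + (diffD dx Z.u j - projSQ dx σ Z j) * (x - gridX dx (2 * j))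
  else
    Z.u (gridX dx (2 * j + 2)) + (diffD dx Z.u j + projSQ dx σ Z j) * (x - gridX dx (2 * j + 2))

open Classical in
/-- The absolutely continuous part of the projected `F_Δx`. -/
def projFac (dx : ℝ) (σ : ℤ → ℤˣ) (Z : Eul) (x : ℝ) : ℝ :=
  let j := cellOf dx x
  if x ≤ gridX dx (2 * j + 1) then
    Fac Z.μ (gridX dx (2 * j)) +
      (diffD dx Z.u j - projSQ dx σ Z j) ^ 2 * (x - gridX dx (2 * j))
  else
    1 / 2 * (Fac Z.μ (gridX dx (2 * j + 2)) + Fac Z.μ (gridX dx (2 * j)))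
      - 2 * diffD dx Z.u j * projSQ dx σ Z j * dx
      + (diffD dx Z.u j + projSQ dx σ Z j) ^ 2 * (x - gridX dx (2 * j + 1))

/-- The projected function `F_Δx = F_Δx,ac + F_Δx,sing`. -/
def projF (dx : ℝ) (σ : ℤ → ℤˣ) (Z : Eul) (x : ℝ) : ℝ :=
  projFac dx σ Z x + Fsing Z.μ (gridX dx (2 * cellOf dx x + 2))

open Classical in
/-- The measure `m` with `m((-∞,x)) = F(x)`, for `F` nondecreasing, left-continuous and vanishing
at `-∞`: the Lebesgue-Stieltjes measure of the right-continuous modification of `F`. -/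
def measureOfPrimitive (F : ℝ → ℝ) : Measure ℝ :=
  if h : Monotone F then h.stieltjesFunction.measure else 0

/-- The projection operator `P_Δx` with sign choice `σ`. -/
def proj (dx : ℝ) (σ : ℤ → ℤˣ) (Z : Eul) : Eul where
  u := projU dx σ Z
  μ := measureOfPrimitive (projF dx σ Z)
  ν := measureOfPrimitive (projF dx σ Z)

/-! ## The numerical solution operator -/

/-- The Lagrangian grid points `ξ_{3j} = x_{2j} + G(x_{2j})`, `ξ_{3j+1} = x_{2j} + G(x_{2j}+)`,
`ξ_{3j+2} = x_{2j+1} + G(x_{2j+1})`, where `G(x) = ν((-∞,x))`, so `G(x+) = ν((-∞,x])`. -/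
def gridXi (dx : ℝ) (ν : Measure ℝ) (i : ℤ) : ℝ :=
  let j := i / 3
  if i % 3 = 0 then gridX dx (2 * j) + (ν (Iio (gridX dx (2 * j)))).toReal
  else if i % 3 = 1 then gridX dx (2 * j) + (ν (Iic (gridX dx (2 * j)))).toReal
  else gridX dx (2 * j + 1) + (ν (Iio (gridX dx (2 * j + 1)))).toReal

/-- The data of the scheme that do not change in time: the nodes `ξ_j`, the wave breaking times
`τ_{j+1/2}`, and the values `H_j` at the nodes. -/
structure Mesh where
  xi : ℤ → ℝ
  tau : ℤ → ℝ≥0∞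
  H : ℤ → ℝ

/-- A state of the scheme: the cell values `ζ_{j+1/2,ξ}`, `U_{j+1/2,ξ}`, `V_{j+1/2,ξ}`, and the
left asymptotes `ζ_{-∞}`, `U_{-∞}` (while `V_{-∞} = 0`). -/
structure State where
  zetaXi : ℤ → ℝ
  UXi : ℤ → ℝ
  VXi : ℤ → ℝ
  zetaInf : ℝ
  UInf : ℝ

/-- Cell widths `ξ_{j+1} - ξ_j`. -/
def Mesh.width (m : Mesh) (j : ℤ) : ℝ := m.xi (j + 1) - m.xi j

open Classical in
/-- The mesh belonging to Lagrangian initial data `X₀` and nodes `xi`. -/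
def initMesh (X₀ : Lag) (xi : ℤ → ℝ) : Mesh where
  xi := xi
  tau := fun j => if xi j = xi (j + 1) then 0 else waveBreak X₀ ((xi j + xi (j + 1)) / 2)
  H := fun j => X₀.H (xi j)

open Classical in
/-- The initial state: derivatives at the midpoints of the nondegenerate cells. -/
def initState (X₀ : Lag) (xi : ℤ → ℝ) : State where
  zetaXi := fun j =>
    if xi j = xi (j + 1) then 0 else deriv X₀.y ((xi j + xi (j + 1)) / 2) - 1
  UXi := fun j => if xi j = xi (j + 1) then 0 else deriv X₀.U ((xi j + xi (j + 1)) / 2)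
  VXi := fun j => if xi j = xi (j + 1) then 0 else deriv X₀.V ((xi j + xi (j + 1)) / 2)
  zetaInf := limUnder atBot (fun j : ℤ => X₀.y (xi j) - xi j)
  UInf := limUnder atBot (fun j : ℤ => X₀.U (xi j))

/-- The (possibly only conditionally convergent) sum `∑_{m=-∞}^{j-1} a_m`. -/
def leftSum (a : ℤ → ℝ) (j : ℤ) : ℝ :=
  limUnder atTop (fun n : ℕ => ∑ m ∈ Finset.Ico (j - (n : ℤ)) j, a m)

/-- Node values `ζ_j`. -/
def State.zetaNode (m : Mesh) (c : State) (j : ℤ) : ℝ :=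
  c.zetaInf + leftSum (fun i => c.zetaXi i * m.width i) j

/-- Node values `y_j = ζ_j + ξ_j`. -/
def State.yNode (m : Mesh) (c : State) (j : ℤ) : ℝ := c.zetaNode m j + m.xi j

/-- Node values `U_j`. -/
def State.UNode (m : Mesh) (c : State) (j : ℤ) : ℝ :=
  c.UInf + leftSum (fun i => c.UXi i * m.width i) j

/-- Node values `V_j`. -/
def State.VNode (m : Mesh) (c : State) (j : ℤ) : ℝ :=
  leftSum (fun i => c.VXi i * m.width i) j

/-- The total energy `V_∞`. -/
def State.VTotal (m : Mesh) (c : State) : ℝ := ∑' i : ℤ, c.VXi i * m.width i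

open Classical in
/-- The energy density `β_{j+1/2} χ_{t ≥ τ_{j+1/2} > s} V_{j+1/2,ξ}(s)` removed from cell `j`
during `(s, t]`. -/
def energyLoss (m : Mesh) (β : ℤ → ℝ) (c : State) (s t : ℝ) (j : ℤ) : ℝ :=
  if ENNReal.ofReal s < m.tau j ∧ m.tau j ≤ ENNReal.ofReal t then β j * c.VXi j else 0

/-- Evolution of the state `c` from time `s` to time `t` if the fraction `β_{j+1/2}` of the energy
is removed from cell `j` at its breaking time: the explicit solution of
`ζ_{tξ} = U_ξ`, `U_{tξ} = V_ξ/2`, `V_ξ(t) = (1 - β χ_{t ≥ τ > s}) V_ξ(s)` in every cell, and the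
corresponding left asymptotes. -/
def evolve (m : Mesh) (β : ℤ → ℝ) (c : State) (s t : ℝ) : State where
  zetaXi := fun j => c.zetaXi j + c.UXi j * (t - s) + 1 / 4 * c.VXi j * (t - s) ^ 2
    - 1 / 4 * energyLoss m β c s t j * (t - (m.tau j).toReal) ^ 2
  UXi := fun j => c.UXi j + 1 / 2 * c.VXi j * (t - s)
    - 1 / 2 * energyLoss m β c s t j * (t - (m.tau j).toReal)
  VXi := fun j => c.VXi j - energyLoss m β c s t j
  zetaInf := c.zetaInf + c.UInf * (t - s) - 1 / 8 * c.VTotal m * (t - s) ^ 2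
    + 1 / 8 * ∑' j : ℤ, energyLoss m β c s t j * m.width j * (t - (m.tau j).toReal) ^ 2
  UInf := c.UInf - 1 / 4 * c.VTotal m * (t - s)
    + 1 / 4 * ∑' j : ℤ, energyLoss m β c s t j * m.width j * (t - (m.tau j).toReal)

open Classical in
/-- The fractions `β^n` of the iteration scheme on `(s, s']`, started from the state `c` at time
`s`: `β¹ = 0`, and for `n ≥ 2`, `β^n_{j+1/2} = α(y_j^{n-1}(s'))` if `τ_{j+1/2} ∈ (s, s']` and `0`
otherwise. (The value at `n = 0` is not used.) -/
def iterBeta (α : ℝ → ℝ) (m : Mesh) (c : State) (s s' : ℝ) : ℕ → ℤ → ℝ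
  | 0 => fun _ => 0
  | 1 => fun _ => 0
  | n + 2 => fun j =>
      if ENNReal.ofReal s < m.tau j ∧ m.tau j ≤ ENNReal.ofReal s' then
        α ((evolve m (iterBeta α m c s s' (n + 1)) c s s').yNode m j)
      else 0

/-- The `n`-th iterate at time `t ∈ [s, s']`. -/
def iterate (α : ℝ → ℝ) (m : Mesh) (c : State) (s s' : ℝ) (n : ℕ) (t : ℝ) : State :=
  evolve m (iterBeta α m c s s' n) c s t

/-- The first breaking time after `s` (`⊤` if there is none): if `s = τ̂_m`, this is
`τ̂_{m+1}`. -/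
def nextBreak (m : Mesh) (s : ℝ) : ℝ≥0∞ := sInf {b | b ∈ range m.tau ∧ ENNReal.ofReal s < b}

open Classical in
/-- One step of the extraction of the times `τ*_k`: the time that follows `s = τ*_k = τ̂_m`.
It is `T` if `τ̂_{m+1} ≥ T`; it is the last breaking time in `(s, min (s + Δt) T]` if
`τ̂_{m+2} - s ≤ Δt` and `τ̂_{m+2} < T`; and it is `τ̂_{m+1}` otherwise. -/
def stepTime (m : Mesh) (T dt s : ℝ) : ℝ :=
  if ENNReal.ofReal T ≤ nextBreak m s then T
  else if nextBreak m (nextBreak m s).toReal ≤ ENNReal.ofReal (s + dt) ∧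
      nextBreak m (nextBreak m s).toReal < ENNReal.ofReal T then
    (sSup {b | b ∈ range m.tau ∧ ENNReal.ofReal s < b ∧
      b ≤ ENNReal.ofReal (min (s + dt) T)}).toReal
  else (nextBreak m s).toReal

/-- The times `τ*_k` (constantly `T` after `T` has been reached). -/
def tstar (m : Mesh) (T dt : ℝ) : ℕ → ℝ
  | 0 => 0
  | k + 1 => stepTime m T dt (tstar m T dt k)

/-- The numerical state at time `τ*_k`, if `N k` iterations are used on `(τ*_k, τ*_{k+1}]`. -/
def stateAt (α : ℝ → ℝ) (m : Mesh) (c₀ : State) (T dt : ℝ) (N : ℕ → ℕ) : ℕ → State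
  | 0 => c₀
  | k + 1 => iterate α m (stateAt α m c₀ T dt N k) (tstar m T dt k) (tstar m T dt (k + 1)) (N k)
      (tstar m T dt (k + 1))

/-- The numerical state at time `t ∈ [0, T]`: the `N k`-th iterate, where
`t ∈ (τ*_k, τ*_{k+1}]` (and `k = 0` for `t = 0`). -/
def numState (α : ℝ → ℝ) (m : Mesh) (c₀ : State) (T dt : ℝ) (N : ℕ → ℕ) (t : ℝ) : State :=
  let k := sInf {k : ℕ | t ≤ tstar m T dt (k + 1)}
  iterate α m (stateAt α m c₀ T dt N k) (tstar m T dt k) (tstar m T dt (k + 1)) (N k) t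

/-- Piecewise linear interpolation of the values `f j` at the nodes `xi j`. -/
def interpolate (xi f : ℤ → ℝ) (ξ : ℝ) : ℝ :=
  let j := sSup {i : ℤ | xi i ≤ ξ}
  f j + (ξ - xi j) / (xi (j + 1) - xi j) * (f (j + 1) - f j)

/-- The Lagrangian tuple obtained from a state by linear interpolation between the nodes. -/
def State.toLag (m : Mesh) (c : State) : Lag where
  y := interpolate m.xi (c.yNode m)
  U := interpolate m.xi (c.UNode m)
  V := interpolate m.xi (c.VNode m)
  H := interpolate m.xi m.H

/-- The free choices in the scheme for one value of `Δx`: the temporal parameter `Δt`, the signs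
in the projection, and the numbers of iterations. -/
structure Params where
  dt : ℝ
  sign : ℤ → ℤˣ
  iter : ℕ → ℕ

/-- The mesh for the projected initial data. -/
def numMesh (dx : ℝ) (p : Params) (Z : Eul) : Mesh :=
  initMesh (mapL (proj dx p.sign Z)) (gridXi dx (proj dx p.sign Z).ν)

/-- The initial state for the projected initial data. -/
def numInit (dx : ℝ) (p : Params) (Z : Eul) : State :=
  initState (mapL (proj dx p.sign Z)) (gridXi dx (proj dx p.sign Z).ν)

/-- The numerical solution in Lagrangian coordinates, `X_Δx(t) = S_{Δx,t} ∘ L ∘ P_Δx (Z)`. -/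
def numLag (α : ℝ → ℝ) (T dx : ℝ) (p : Params) (Z : Eul) (t : ℝ) : Lag :=
  (numState α (numMesh dx p Z) (numInit dx p Z) T p.dt p.iter t).toLag (numMesh dx p Z)

/-- The iteration has terminated at `n` on `(τ*_k, τ*_{k+1}]`: all values `y_j(t)` of the iterates
`n` and `n - 1` differ by at most `G_∞ Δt² Δx / 8`. -/
def Terminated (α : ℝ → ℝ) (T dx : ℝ) (p : Params) (Z : Eul) (k n : ℕ) : Prop :=
  let m := numMesh dx p Z
  let c := stateAt α m (numInit dx p Z) T p.dt p.iter k
  let s := tstar m T p.dt k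
  let s' := tstar m T p.dt (k + 1)
  ∀ t ∈ Icc s s', ∀ j : ℤ,
    |(iterate α m c s s' n t).yNode m j - (iterate α m c s s' (n - 1) t).yNode m j|
      ≤ 1 / 8 * (Z.ν univ).toReal * p.dt ^ 2 * dx

/-- The choices made in the scheme are admissible: `0 < Δt ≤ √(8 Δx / (‖α'‖_∞ G_∞))` (no upper
bound if `‖α'‖_∞ G_∞ = 0`), and the number of iterations on `(τ*_k, τ*_{k+1}]` is
`1` if no wave breaks in `(τ*_k, T]`, `2` if `τ*_{k+1}` is the first breaking time after `τ*_k`,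
and otherwise `2` or `3`, such that the termination criterion holds. -/
structure Admissible (α : ℝ → ℝ) (T dx : ℝ) (p : Params) (Z : Eul) : Prop where
  dt_pos : 0 < p.dt
  dt_le : derivSupNorm α * (Z.ν univ).toReal * p.dt ^ 2 ≤ 8 * dx
  iter_one : ∀ k, ENNReal.ofReal T < nextBreak (numMesh dx p Z) (tstar (numMesh dx p Z) T p.dt k) →
    p.iter k = 1
  iter_two : ∀ k, nextBreak (numMesh dx p Z) (tstar (numMesh dx p Z) T p.dt k) =
      ENNReal.ofReal (tstar (numMesh dx p Z) T p.dt (k + 1)) →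
    p.iter k = 2
  iter_else : ∀ k,
    nextBreak (numMesh dx p Z) (tstar (numMesh dx p Z) T p.dt k) <
      ENNReal.ofReal (tstar (numMesh dx p Z) T p.dt (k + 1)) →
    (p.iter k = 2 ∨ p.iter k = 3) ∧ Terminated α T dx p Z k (p.iter k)

/-! ## The Lagrangian and Eulerian solutions and the modes of convergence -/

/-- The exact solution in Lagrangian coordinates, `X(t) = S_t ∘ L (Z)`. -/
def exactLag (α : ℝ → ℝ) (Z : Eul) (t : ℝ) : Lag := solOp α t (mapL Z)

/-- The exact solution `(u, μ, ν)(t) = M ∘ S_t ∘ L (Z)`. -/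
def exactEul (α : ℝ → ℝ) (Z : Eul) (t : ℝ) : Eul := mapM (exactLag α Z t)

/-- The numerical solution `(u_Δx, μ_Δx, ν_Δx)(t) = M ∘ S_{Δx,t} ∘ L ∘ P_Δx (Z)`. -/
def numEul (α : ℝ → ℝ) (T dx : ℝ) (p : Params) (Z : Eul) (t : ℝ) : Eul :=
  mapM (numLag α T dx p Z t)

/-- Convergence in `L^∞(ℝ)`. -/
def TendstoLInf (f : ℝ → ℝ → ℝ) (l : Filter ℝ) (g : ℝ → ℝ) : Prop :=
  Tendsto (fun d => eLpNorm (fun x => f d x - g x) ⊤ volume) l (𝓝 0)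

/-- Weak convergence in `L²(ℝ)`. -/
def TendstoWeakL2 (f : ℝ → ℝ → ℝ) (l : Filter ℝ) (g : ℝ → ℝ) : Prop :=
  (∀ᶠ d in l, MemLp (f d) 2 volume) ∧ MemLp g 2 volume ∧
    ∀ φ : ℝ → ℝ, MemLp φ 2 volume →
      Tendsto (fun d => ∫ x, φ x * f d x) l (𝓝 (∫ x, φ x * g x))

/-- Narrow convergence of finite measures. -/
def TendstoNarrow (m : ℝ → Measure ℝ) (l : Filter ℝ) (m₀ : Measure ℝ) : Prop :=
  (∀ᶠ d in l, IsFiniteMeasure (m d)) ∧ IsFiniteMeasure m₀ ∧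
    ∀ φ : ℝ →ᵇ ℝ, Tendsto (fun d => ∫ x, φ x ∂(m d)) l (𝓝 (∫ x, φ x ∂m₀))

/-- Weak-* convergence, tested with `C_c(ℝ)`, of the push-forwards `(y_d)_#(g_d dξ)` to
`y_#(g dξ)`. -/
def TendstoPush (y g : ℝ → ℝ → ℝ) (l : Filter ℝ) (y₀ g₀ : ℝ → ℝ) : Prop :=
  ∀ φ : ℝ → ℝ, Continuous φ → HasCompactSupport φ →
    Tendsto (fun d => pushIntegral (y d) (g d) φ) l (𝓝 (pushIntegral y₀ g₀ φ))

end

end HunterSaxton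

open HunterSaxton

namespace HunterSaxton

/-! If `V = H` at time 0, the Lagrangian system can be solved explicitly once it is known which
fraction `β ξ` of its energy each label loses at its breaking time. This solution is `evo X β t`;
its densities are piecewise polynomial in `t`. An exact solution corresponds to a loss with `β ξ = α
(y (τ ξ, ξ))` (`IsLoss`), and every solution has this form (`IsSolution.eq_evo`,
`exists_exactLag_eq`). The scheme, started from the projected data, is itself exactly such an
evolution, with a loss that is constant in each cell and satisfies the fixed point relation up to a
small error (`exists_numLag_eq`). What remains is the stability of `evo` with respect to the data
and the losses, which is formulated for sequences in `StableSeq`.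

Stability: the losses enter `y` only through the integral of `β (t - τ)₊² H_ξ`. In a norm weighted
by `exp (l t)` with `l` large, the dependence of `y` on `β`, and of `β` on `y`, closes up to a
contraction with factor 1/4. Hence the distance of the characteristics is bounded by the errors in
the data and in the losses (`abs_evo_y_sub_evo_le_stabError`). The error in the data contains the L¹
distance of the `H_ξ` and the average difference of the breaking times.

Data: the projection preserves the total energy, so a.e. convergence of `H_ξ` implies L¹ convergence
(`tendsto_integral_abs_sub_of_integral_eq`). Labels with `y_ξ ≠ 0` are treated by differentiation of
`u` and of the energy at their position (`eventually_abs_slope_sub_le`). Labels with `y_ξ = 0` carry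
the singular energy. They are delicate: there `U_ξ = 0` and no energy is lost, but a perturbation
with slightly negative `U_ξ` may break almost immediately. Since the projection preserves both the
singular and the absolutely continuous mass of each cell, the set of flat labels of the projected
data differs from the original one only by a set of small measure
(`eventually_volume_symmDiff_flat`). By Borel–Cantelli, flat labels are eventually flat along a
subsequence (`exists_subseq_proj`). Passing to subsequences is harmless, because the limit is fixed
(`tendsto_numLag`).

Modes of convergence: `y` and `U` converge uniformly in the label, and `u` is Hölder continuous with
exponent 1/2, which gives uniform convergence of `u`. The other limits are integrals over labels of
`φ (y)` times a density. They follow from a.e. convergence of `U_ξ` and L¹ convergence of `H_ξ`. For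
`g1` one uses in addition that the fraction lost, read at time `min t τ`, depends continuously on
`τ`. -/

/-! ## One-variable calculus -/

/-- `f` is the integral of its locally integrable a.e. derivative. -/
def IsPrimitive (f : ℝ → ℝ) : Prop :=
  (∀ a b : ℝ, IntervalIntegrable (deriv f) volume a b) ∧
    ∀ a b : ℝ, f b - f a = ∫ x in a..b, deriv f x

lemma _root_.LipschitzWith.isPrimitive {f : ℝ → ℝ} {K : NNReal} (hf : LipschitzWith K f) :
    IsPrimitive f :=
  ⟨fun a b => (hf.lipschitzOnWith.absolutelyContinuousOnInterval (a := a) (b := b)).intervalIntegrable_deriv,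
   fun a b => (hf.lipschitzOnWith.absolutelyContinuousOnInterval (a := a) (b := b)).integral_deriv_eq_sub.symm⟩

lemma intervalIntegrable_of_memLp {g : ℝ → ℝ} (hg : MemLp g 2 volume) (a b : ℝ) :
    IntervalIntegrable g volume a b := by
  rw [intervalIntegrable_iff]
  have : IsFiniteMeasure (volume.restrict (uIoc a b)) := ⟨by simp [uIoc]⟩
  exact (hg.restrict _).integrable (by norm_num)

lemma locallyIntegrable_of_intervalIntegrable {g : ℝ → ℝ}
    (hg : ∀ a b : ℝ, IntervalIntegrable g volume a b) : LocallyIntegrable g volume := by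
  rw [locallyIntegrable_iff]
  intro K hK
  obtain ⟨R, hR⟩ := hK.isBounded.subset_closedBall 0
  rw [Real.closedBall_eq_Icc] at hR
  refine IntegrableOn.mono_set ?_ hR
  have := hg (0 - R) (0 + R)
  by_cases h : 0 - R ≤ 0 + R
  · exact (intervalIntegrable_iff_integrableOn_Icc_of_le h).1 this
  · rw [Icc_eq_empty h]; exact integrableOn_empty

/-- `deriv` enters `IsPrimitive` merely as an integrand and may be the default value 0; Lebesgue
differentiation of its integral makes it a genuine derivative almost everywhere. -/
lemma IsPrimitive.ae_differentiableAt {f : ℝ → ℝ} (hf : IsPrimitive f) :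
    ∀ᵐ x, DifferentiableAt ℝ f x := by
  filter_upwards [LocallyIntegrable.ae_hasDerivAt_integral (locallyIntegrable_of_intervalIntegrable hf.1)] with x hx
  have h : f = fun x => f 0 + ∫ t in (0 : ℝ)..x, deriv f t := by
    ext x; rw [← hf.2]; ring
  rw [h]
  exact ((hx 0).const_add (f 0)).differentiableAt

lemma IsPrimitive.continuous {f : ℝ → ℝ} (hf : IsPrimitive f) : Continuous f := by
  have h : f = fun x => f 0 + ∫ t in (0 : ℝ)..x, deriv f t := by
    ext x; rw [← hf.2]; ring
  rw [h]
  exact continuous_const.add (intervalIntegral.continuous_primitive hf.1 0)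

lemma IsPrimitive.add {f g : ℝ → ℝ} (hf : IsPrimitive f) (hg : IsPrimitive g) :
    IsPrimitive (fun x => f x + g x) ∧
      (∀ᵐ x, deriv (fun x => f x + g x) x = deriv f x + deriv g x) := by
  have h : ∀ᵐ x, deriv (fun x => f x + g x) x = deriv f x + deriv g x := by
    filter_upwards [hf.ae_differentiableAt, hg.ae_differentiableAt] with x h1 h2
    exact deriv_fun_add h1 h2
  refine ⟨⟨fun a b => ((hf.1 a b).add (hg.1 a b)).congr_ae ?_, fun a b => ?_⟩, h⟩
  · exact ae_restrict_of_ae (h.mono fun x hx => by simp [hx])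
  · rw [intervalIntegral.integral_congr_ae (h.mono fun x hx _ => hx),
      intervalIntegral.integral_add (hf.1 a b) (hg.1 a b), ← hf.2, ← hg.2]
    ring

lemma IsPrimitive.const_mul {f : ℝ → ℝ} (hf : IsPrimitive f) (c : ℝ) :
    IsPrimitive (fun x => c * f x) := by
  have h : deriv (fun x => c * f x) = fun x => c * deriv f x := by
    ext x; exact deriv_const_mul_field c
  refine ⟨fun a b => ?_, fun a b => ?_⟩
  · rw [h]; exact (hf.1 a b).const_mul c
  · rw [h, intervalIntegral.integral_const_mul, ← hf.2]; ring

/-- Cauchy–Schwarz against the constant 1: the integral of `(g - c)²` is nonnegative when `c` is the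
mean of `g`. -/
lemma sq_integral_le {g : ℝ → ℝ} {a b : ℝ} (hab : a ≤ b) (hg : IntervalIntegrable g volume a b)
    (hg2 : IntervalIntegrable (fun x => g x ^ 2) volume a b) :
    (∫ x in a..b, g x) ^ 2 ≤ (b - a) * ∫ x in a..b, g x ^ 2 := by
  rcases hab.eq_or_lt with rfl | hab
  · simp
  set c := (∫ x in a..b, g x) / (b - a) with hc
  have h0 : 0 ≤ ∫ x in a..b, (g x - c) ^ 2 :=
    intervalIntegral.integral_nonneg hab.le fun x _ => sq_nonneg _
  have h1 : ∫ x in a..b, (g x - c) ^ 2 =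
      (∫ x in a..b, g x ^ 2) - 2 * c * (∫ x in a..b, g x) + (b - a) * c ^ 2 := by
    have : ∀ x, (g x - c) ^ 2 = g x ^ 2 - 2 * c * g x + c ^ 2 := fun x => by ring
    simp_rw [this]
    rw [intervalIntegral.integral_add (hg2.sub (hg.const_mul _)) (by simp),
      intervalIntegral.integral_sub hg2 (hg.const_mul _), intervalIntegral.integral_const_mul]
    simp
  have hba : 0 < b - a := sub_pos.2 hab
  have h2 : ∫ x in a..b, g x = c * (b - a) := by rw [hc]; field_simp
  rw [h1, h2] at h0
  rw [h2]
  nlinarith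

lemma IsPrimitive.sq_sub_le {f : ℝ → ℝ} (hf : IsPrimitive f)
    (hf2 : MemLp (deriv f) 2 volume) {a b : ℝ} (hab : a ≤ b) :
    (f b - f a) ^ 2 ≤ (b - a) * ∫ x in a..b, deriv f x ^ 2 := by
  rw [hf.2]
  exact sq_integral_le hab (hf.1 a b) (hf2.integrable_sq.intervalIntegrable)

/-! ## Asymptotic tails and the spaces `E₁`, `E₂` -/

/-- `f - a ∈ L²(-∞,0)` and `f - b ∈ L²(0,∞)`. -/
def HasTails (f : ℝ → ℝ) (a b : ℝ) : Prop :=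
  MemLp (fun x => f x - a) 2 (volume.restrict (Iio 0)) ∧
    MemLp (fun x => f x - b) 2 (volume.restrict (Ioi 0))

lemma HasTails.add {f g : ℝ → ℝ} {a b c d : ℝ} (hf : HasTails f a b) (hg : HasTails g c d) :
    HasTails (fun x => f x + g x) (a + c) (b + d) := by
  refine ⟨(hf.1.add hg.1).ae_eq (ae_of_all _ fun x => ?_),
    (hf.2.add hg.2).ae_eq (ae_of_all _ fun x => ?_)⟩ <;> simp <;> ring

lemma HasTails.const_mul {f : ℝ → ℝ} {a b : ℝ} (hf : HasTails f a b) (c : ℝ) :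
    HasTails (fun x => c * f x) (c * a) (c * b) := by
  refine ⟨(hf.1.const_mul c).ae_eq (ae_of_all _ fun x => ?_),
    (hf.2.const_mul c).ae_eq (ae_of_all _ fun x => ?_)⟩ <;> simp <;> ring

lemma memLp_restrict_union {f : ℝ → ℝ} {s t : Set ℝ} (hs : MemLp f 2 (volume.restrict s))
    (ht : MemLp f 2 (volume.restrict t)) : MemLp f 2 (volume.restrict (s ∪ t)) := by
  have hm : AEStronglyMeasurable f (volume.restrict (s ∪ t)) :=
    aestronglyMeasurable_union_iff.2 ⟨hs.1, ht.1⟩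
  rw [memLp_two_iff_integrable_sq hm]
  exact IntegrableOn.union hs.integrable_sq ht.integrable_sq

lemma volume_eq_restrict_compl_zero : (volume : Measure ℝ) = volume.restrict (Iio 0 ∪ Ioi 0) := by
  rw [Iio_union_Ioi, Measure.restrict_eq_self_of_ae_mem]
  exact (measure_eq_zero_iff_ae_notMem.1 (measure_singleton (0 : ℝ)))

lemma chiPlus_contDiff : ContDiff ℝ 1 chiPlus :=
  (Real.smoothTransition.contDiff (n := 1)).comp (contDiff_id.add contDiff_const)

lemma chiPlus_of_le {x : ℝ} (h : x ≤ -1 / 2) : chiPlus x = 0 :=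
  Real.smoothTransition.zero_of_nonpos (by linarith)

lemma chiPlus_of_ge {x : ℝ} (h : 1 / 2 ≤ x) : chiPlus x = 1 :=
  Real.smoothTransition.one_of_one_le (by linarith)

lemma memLp_of_cutoff {f : ℝ → ℝ} (hf : Continuous f) {s : Set ℝ} (hs : MeasurableSet s)
    (h0 : ∀ x ∈ s, x ∉ Icc (-1 : ℝ) 1 → f x = 0) : MemLp f 2 (volume.restrict s) := by
  rw [memLp_two_iff_integrable_sq hf.aestronglyMeasurable]
  have h1 : IntegrableOn (fun x => f x ^ 2) (Icc (-1) 1) volume :=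
    (hf.pow 2).continuousOn.integrableOn_compact isCompact_Icc
  have h2 := (integrableOn_iff_integrable_of_support_subset
    (f := (Icc (-1 : ℝ) 1).indicator fun x => f x ^ 2) (s := Icc (-1 : ℝ) 1)
    (μ := volume) support_indicator_subset).1
      (h1.congr_fun (fun x hx => by simp [indicator_of_mem hx]) measurableSet_Icc)
  refine h2.integrableOn.congr_fun (fun x hx => ?_) hs
  by_cases hx1 : x ∈ Icc (-1 : ℝ) 1
  · simp [indicator_of_mem hx1]
  · simp [indicator_of_notMem hx1, h0 x hx hx1]

lemma chiPlus_hasTails : HasTails chiPlus 0 1 := by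
  have hc := chiPlus_contDiff.continuous
  refine ⟨memLp_of_cutoff (hc.sub continuous_const) measurableSet_Iio fun x hx h => ?_,
    memLp_of_cutoff (hc.sub continuous_const) measurableSet_Ioi fun x hx h => ?_⟩
  · simp only [mem_Iio] at hx
    have : chiPlus x = 0 := chiPlus_of_le (by by_contra h'; exact h ⟨by linarith, by linarith⟩)
    simp [this]
  · simp only [mem_Ioi] at hx
    have : chiPlus x = 1 := chiPlus_of_ge (by by_contra h'; exact h ⟨by linarith, by linarith⟩)
    simp [this]

lemma chiMinus_hasTails : HasTails chiMinus 1 0 := by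
  obtain ⟨h1, h2⟩ := chiPlus_hasTails.const_mul (-1)
  refine ⟨h1.ae_eq (ae_of_all _ fun x => ?_), h2.ae_eq (ae_of_all _ fun x => ?_)⟩
  · simp [chiMinus]
  · simp only [chiMinus]; ring

lemma deriv_chiPlus_memLp : MemLp (deriv chiPlus) 2 volume := by
  rw [← Measure.restrict_univ (μ := (volume : Measure ℝ))]
  refine memLp_of_cutoff (chiPlus_contDiff.continuous_deriv le_rfl) .univ fun x _ hx => ?_
  have : x < -1 ∨ 1 < x := by
    by_contra h; push Not at h; exact hx h
  rcases this with h | h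
  · have : chiPlus =ᶠ[𝓝 x] fun _ => 0 := by
      filter_upwards [Iio_mem_nhds h] with z hz
      exact chiPlus_of_le (by simp only [mem_Iio] at hz; linarith)
    rw [this.deriv_eq]; simp
  · have : chiPlus =ᶠ[𝓝 x] fun _ => 1 := by
      filter_upwards [Ioi_mem_nhds h] with z hz
      exact chiPlus_of_ge (by simp only [mem_Ioi] at hz; linarith)
    rw [this.deriv_eq]; simp

lemma HasTails.memLp {f : ℝ → ℝ} (hf : HasTails f 0 0) : MemLp f 2 volume := by
  rw [volume_eq_restrict_compl_zero]
  exact memLp_restrict_union (by simpa using hf.1) (by simpa using hf.2)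

lemma _root_.MeasureTheory.MemLp.hasTails {f : ℝ → ℝ} (hf : MemLp f 2 volume) : HasTails f 0 0 :=
  ⟨by simpa using hf.restrict _, by simpa using hf.restrict _⟩

lemma chiPlus_isPrimitive : IsPrimitive chiPlus := by
  have h := chiPlus_contDiff
  refine ⟨fun a b => (h.continuous_deriv le_rfl).intervalIntegrable a b, fun a b => ?_⟩
  rw [intervalIntegral.integral_deriv_eq_sub
    (fun x _ => (h.differentiable (by norm_num)).differentiableAt)
    ((h.continuous_deriv le_rfl).intervalIntegrable a b)]

lemma MemH1.isPrimitive {f : ℝ → ℝ} (hf : MemH1 f) : IsPrimitive f :=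
  ⟨fun a b => intervalIntegrable_of_memLp hf.2.1 a b, hf.2.2⟩

lemma const_isPrimitive (c : ℝ) : IsPrimitive (fun _ => c) := by
  refine ⟨fun a b => ?_, fun a b => ?_⟩ <;> simp

lemma deriv_const_add_mul_chiPlus (c d x : ℝ) :
    deriv (fun x => c + d * chiPlus x) x = d * deriv chiPlus x := by
  rw [deriv_const_add, deriv_const_mul_field]

lemma cutoff_isPrimitive (c d : ℝ) : IsPrimitive (fun x => c + d * chiPlus x) :=
  ((const_isPrimitive c).add (chiPlus_isPrimitive.const_mul d)).1

/-- Together with `MemE2.exists_hasTails` this removes the cut-offs: `E₂` consists of the primitives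
with square integrable derivative and square integrable tails around two constants. -/
lemma memE2_of_hasTails {f : ℝ → ℝ} {a b : ℝ} (ht : HasTails f a b) (hf : IsPrimitive f)
    (hd : MemLp (deriv f) 2 volume) : MemE2 f := by
  refine ⟨b, a, ?_⟩
  have hg : (fun x => f x - b * chiPlus x - a * chiMinus x) =
      fun x => f x + (-a + (a - b) * chiPlus x) := by
    ext x; simp only [chiMinus]; ring
  have hp := hf.add (cutoff_isPrimitive (-a) (a - b))
  refine ⟨HasTails.memLp ?_, ?_, ?_⟩
  · have := (ht.add (chiPlus_hasTails.const_mul (-b))).add (chiMinus_hasTails.const_mul (-a))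
    have h2 : HasTails (fun x => f x - b * chiPlus x - a * chiMinus x) 0 0 := by
      convert this using 1 <;> first | (ext x; ring) | ring
    exact h2
  · rw [hg]
    refine (hd.add (deriv_chiPlus_memLp.const_mul (a - b))).ae_eq ?_
    filter_upwards [hp.2] with x hx
    rw [hx, deriv_const_add_mul_chiPlus]; rfl
  · rw [hg]; exact hp.1.2

lemma memE1_of_hasTails {f : ℝ → ℝ} {b : ℝ} (ht : HasTails f 0 b) (hf : IsPrimitive f)
    (hd : MemLp (deriv f) 2 volume) : MemE1 f := by
  refine ⟨b, ?_⟩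
  have hg : (fun x => f x - b * chiPlus x) =
      fun x => f x + (0 + (- b) * chiPlus x) := by
    ext x; ring
  have hp := hf.add (cutoff_isPrimitive 0 (-b))
  refine ⟨HasTails.memLp ?_, ?_, ?_⟩
  · have := (ht.add (chiPlus_hasTails.const_mul (-b)))
    convert this using 1 <;> first | (ext x; ring) | ring
  · rw [hg]
    refine (hd.add (deriv_chiPlus_memLp.const_mul (-b))).ae_eq ?_
    filter_upwards [hp.2] with x hx
    rw [hx, deriv_const_add_mul_chiPlus]; rfl
  · rw [hg]; exact hp.1.2

lemma MemE2.exists_hasTails {f : ℝ → ℝ} (hf : MemE2 f) :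
    IsPrimitive f ∧ MemLp (deriv f) 2 volume ∧ ∃ a b, HasTails f a b := by
  obtain ⟨b, a, h⟩ := hf
  have hg : f = fun x => (f x - b * chiPlus x - a * chiMinus x) + (a + (b - a) * chiPlus x) := by
    ext x; simp only [chiMinus]; ring
  have hp := h.isPrimitive.add (cutoff_isPrimitive a (b - a))
  rw [← hg] at hp
  refine ⟨hp.1, ?_, a, b, ?_⟩
  · refine (h.2.1.add (deriv_chiPlus_memLp.const_mul (b - a))).ae_eq ?_
    filter_upwards [hp.2] with x hx
    rw [hx, deriv_const_add_mul_chiPlus]; rfl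
  · have := (h.1.hasTails.add (chiPlus_hasTails.const_mul b)).add (chiMinus_hasTails.const_mul a)
    convert this using 1 <;> first | (ext x; ring) | ring

lemma MemE10.exists_hasTails {f : ℝ → ℝ} (hf : MemE10 f) : ∃ b, HasTails f 0 b := by
  obtain ⟨b, h⟩ := hf
  refine ⟨b, ?_⟩
  have := (h.hasTails.add (chiPlus_hasTails.const_mul b))
  convert this using 1 <;> first | (ext x; ring) | ring

/-- If `|g| ≥ ε` at a point, uniform continuity keeps `g²` above `(ε/2)²` on a window of fixed
length, so the primitive of `g²` would violate the Cauchy condition. The filter is only required to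
be translation invariant, which covers both ends of the line. -/
lemma tendsto_zero_of_tendsto_primitive_sq {g : ℝ → ℝ} (hg : UniformContinuous g) {l : Filter ℝ}
    (hl : ∀ δ : ℝ, Tendsto (fun x => x + δ) l l) {c : ℝ}
    (hc : Tendsto (fun x => ∫ t in (0 : ℝ)..x, g t ^ 2) l (𝓝 c)) : Tendsto g l (𝓝 0) := by
  rw [Metric.tendsto_nhds]
  intro ε hε
  obtain ⟨δ, hδ, hgδ⟩ := Metric.uniformContinuous_iff.1 hg (ε / 2) (by positivity)
  have h1 : Tendsto (fun x => (∫ t in (0 : ℝ)..(x + δ / 2), g t ^ 2) - ∫ t in (0 : ℝ)..x, g t ^ 2) l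
      (𝓝 (c - c)) := (hc.comp (hl (δ / 2))).sub hc
  rw [sub_self] at h1
  have h2 := (Metric.tendsto_nhds.1 h1) (δ / 2 * (ε / 2) ^ 2) (by positivity)
  filter_upwards [h2] with x hx
  rw [Real.dist_eq, sub_zero] at hx ⊢
  have hi : ∀ a b : ℝ, IntervalIntegrable (fun t => g t ^ 2) volume a b := fun a b =>
    (hg.continuous.pow 2).intervalIntegrable a b
  rw [intervalIntegral.integral_interval_sub_left (hi _ _) (hi _ _)] at hx
  by_contra hgx
  push Not at hgx
  have h3 : ∫ t in x..(x + δ / 2), (ε / 2) ^ 2 ≤ ∫ t in x..(x + δ / 2), g t ^ 2 := by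
    refine intervalIntegral.integral_mono_on (by linarith) (by simp) (hi _ _) fun t ht => ?_
    have : dist t x < δ := by
      rw [Real.dist_eq, abs_lt]; constructor <;> linarith [ht.1, ht.2]
    have h4 := hgδ this
    rw [Real.dist_eq] at h4
    have h5 : ε / 2 ≤ |g t| := by
      have := abs_sub_abs_le_abs_sub (g x) (g t)
      rw [abs_sub_comm] at this
      linarith
    calc (ε / 2) ^ 2 ≤ |g t| ^ 2 := by gcongr
      _ = g t ^ 2 := sq_abs _
  simp only [intervalIntegral.integral_const, add_sub_cancel_left, smul_eq_mul] at h3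
  have := le_abs_self (∫ t in x..(x + δ / 2), g t ^ 2)
  linarith

lemma HasTails.tendsto_atTop {f : ℝ → ℝ} {a b : ℝ} (h : HasTails f a b)
    (hf : UniformContinuous f) : Tendsto f atTop (𝓝 b) := by
  have h1 : Tendsto (fun x => f x - b) atTop (𝓝 0) :=
    tendsto_zero_of_tendsto_primitive_sq (hf.sub uniformContinuous_const)
      (fun δ => tendsto_atTop_add_const_right _ _ tendsto_id)
      (intervalIntegral_tendsto_integral_Ioi 0 h.2.integrable_sq tendsto_id)
  simpa using h1.add_const b

lemma HasTails.tendsto_atBot {f : ℝ → ℝ} {a b : ℝ} (h : HasTails f a b)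
    (hf : UniformContinuous f) : Tendsto f atBot (𝓝 a) := by
  have h0 : IntegrableOn (fun x => (f x - a) ^ 2) (Iic 0) := by
    rw [integrableOn_Iic_iff_integrableOn_Iio]; exact h.1.integrable_sq
  have h2 := (intervalIntegral_tendsto_integral_Iic 0 h0 tendsto_id).neg
  have h1 : Tendsto (fun x => f x - a) atBot (𝓝 0) :=
    tendsto_zero_of_tendsto_primitive_sq (hf.sub uniformContinuous_const)
      (fun δ => tendsto_atBot_add_const_right _ _ tendsto_id)
      (h2.congr fun x => by rw [← intervalIntegral.integral_symm]; rfl)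
  simpa using h1.add_const a

lemma exists_bound_of_tendsto {f : ℝ → ℝ} (hf : Continuous f) {a b : ℝ}
    (ha : Tendsto f atBot (𝓝 a)) (hb : Tendsto f atTop (𝓝 b)) : ∃ C, ∀ x, |f x| ≤ C := by
  obtain ⟨M, hM⟩ := eventually_atBot.1 ((Metric.tendsto_nhds.1 ha) 1 one_pos)
  obtain ⟨N, hN⟩ := eventually_atTop.1 ((Metric.tendsto_nhds.1 hb) 1 one_pos)
  obtain ⟨C, hC⟩ := (isCompact_Icc (a := M) (b := N)).exists_bound_of_continuousOn hf.continuousOn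
  refine ⟨max C (max (|a| + 1) (|b| + 1)), fun x => ?_⟩
  by_cases h1 : x ≤ M
  · have := hM x h1
    rw [Real.dist_eq] at this
    refine le_trans ?_ ((le_max_left _ _).trans (le_max_right _ _))
    linarith [abs_sub_abs_le_abs_sub (f x) a]
  by_cases h2 : N ≤ x
  · have := hN x h2
    rw [Real.dist_eq] at this
    refine le_trans ?_ ((le_max_right _ _).trans (le_max_right _ _))
    linarith [abs_sub_abs_le_abs_sub (f x) b]
  · exact (hC x ⟨by linarith, by linarith⟩).trans (le_max_left _ _)

lemma IsPrimitive.abs_sub_le {f : ℝ → ℝ} (hf : IsPrimitive f) (hf2 : MemLp (deriv f) 2 volume)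
    (x y : ℝ) : |f x - f y| ≤ √((∫ t, deriv f t ^ 2) * |x - y|) := by
  wlog hxy : y ≤ x generalizing x y
  · rw [abs_sub_comm, abs_sub_comm x]; exact this y x (by linarith)
  refine Real.abs_le_sqrt ?_
  rw [abs_of_nonneg (by linarith), mul_comm]
  refine (hf.sq_sub_le hf2 hxy).trans (mul_le_mul_of_nonneg_left ?_ (by linarith))
  rw [intervalIntegral.integral_of_le hxy]
  exact setIntegral_le_integral hf2.integrable_sq (ae_of_all _ fun t => sq_nonneg _)

lemma IsPrimitive.uniformContinuous {f : ℝ → ℝ} (hf : IsPrimitive f)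
    (hf2 : MemLp (deriv f) 2 volume) : UniformContinuous f := by
  rw [Metric.uniformContinuous_iff]
  intro ε hε
  set A := ∫ t, deriv f t ^ 2
  have hA : 0 ≤ A := integral_nonneg fun t => sq_nonneg _
  refine ⟨ε ^ 2 / (A + 1), by positivity, fun x y hxy => ?_⟩
  rw [Real.dist_eq] at *
  refine (hf.abs_sub_le hf2 x y).trans_lt ?_
  rw [Real.sqrt_lt' hε]
  rw [lt_div_iff₀ (by positivity)] at hxy
  nlinarith [abs_nonneg (x - y)]

/-! ## Change of variables along monotone Lipschitz maps -/

lemma volume_image_eq_zero {y : ℝ → ℝ} {K : NNReal} (hl : LipschitzWith K y) {s : Set ℝ}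
    (hs : volume s = 0) : volume (y '' s) = 0 := by
  have h := hl.hausdorffMeasure_image_le (d := 1) zero_le_one s
  rw [hausdorffMeasure_real, hs, mul_zero] at h
  exact le_antisymm h bot_le

/-- The area formula on the set where `y` is differentiable. The remaining labels form a null set,
and so does their image because `y` is Lipschitz. -/
lemma lintegral_deriv_mul_comp {y : ℝ → ℝ} {K : NNReal} (hm : Monotone y)
    (hl : LipschitzWith K y) (hs : Function.Surjective y) (u : ℝ → ℝ≥0∞) :
    ∫⁻ ξ, ENNReal.ofReal (deriv y ξ) * u (y ξ) = ∫⁻ x, u x := by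
  set s := {ξ | DifferentiableAt ℝ y ξ}
  have hsm : MeasurableSet s := measurableSet_of_differentiableAt ℝ y
  have hs0 : volume sᶜ = 0 := (hl.isPrimitive.ae_differentiableAt)
  have h1 := lintegral_image_eq_lintegral_deriv_mul_of_monotoneOn hsm
    (fun x hx => (DifferentiableAt.hasDerivAt hx).hasDerivWithinAt) (hm.monotoneOn s) u
  have h2 : (y '' s : Set ℝ) =ᵐ[volume] univ := by
    rw [ae_eq_univ]
    refine measure_mono_null ?_ (volume_image_eq_zero hl hs0)
    intro x hx
    obtain ⟨ξ, rfl⟩ := hs x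
    exact ⟨ξ, fun h => hx ⟨ξ, h, rfl⟩, rfl⟩
  have h3 : (s : Set ℝ) =ᵐ[volume] univ := ae_eq_univ.2 hs0
  rw [setLIntegral_congr h2, setLIntegral_congr h3] at h1
  simpa using h1.symm

lemma map_withDensity_deriv {y : ℝ → ℝ} {K : NNReal} (hm : Monotone y)
    (hl : LipschitzWith K y) (hs : Function.Surjective y) :
    (volume.withDensity fun ξ => ENNReal.ofReal (deriv y ξ)).map y = volume := by
  ext A hA
  rw [Measure.map_apply hm.measurable hA, withDensity_apply _ (hm.measurable hA),
    ← lintegral_indicator (hm.measurable hA)]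
  have := lintegral_deriv_mul_comp hm hl hs (A.indicator 1)
  rw [lintegral_indicator_one hA] at this
  rw [← this]
  refine lintegral_congr fun ξ => ?_
  by_cases h : y ξ ∈ A <;> simp [indicator, h]

/-- The change of variables is applied to the indicator of a null set. In this way statements that
hold at a.e. position transfer to a.e. label with `y_ξ ≠ 0`. -/
lemma ae_deriv_eq_zero_of_mem_null {y : ℝ → ℝ} {K : NNReal} (hm : Monotone y)
    (hl : LipschitzWith K y) (hs : Function.Surjective y) {N : Set ℝ} (hN : volume N = 0) :
    ∀ᵐ ξ, y ξ ∈ N → deriv y ξ = 0 := by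
  set N' := toMeasurable volume N
  have hN' : volume N' = 0 := by rw [measure_toMeasurable, hN]
  have hNm : MeasurableSet N' := measurableSet_toMeasurable _ _
  have h := lintegral_deriv_mul_comp hm hl hs (N'.indicator 1)
  rw [lintegral_indicator_one hNm, hN', lintegral_eq_zero_iff] at h
  · filter_upwards [h] with ξ hξ hy
    have : y ξ ∈ N' := subset_toMeasurable _ _ hy
    simp [this] at hξ
    exact le_antisymm hξ (hm.deriv_nonneg)
  · exact (measurable_deriv y).ennreal_ofReal.mul
      ((measurable_one.indicator hNm).comp hm.measurable)

/-! ## Two limit theorems -/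

/-- Scheffé's argument: as the total masses agree, the L¹ distance is twice the integral of `(f -
fn)₊`, which is dominated by `f`. -/
lemma tendsto_integral_abs_sub_of_integral_eq {f : ℝ → ℝ} {fn : ℕ → ℝ → ℝ} {E : ℝ}
    (hf : Integrable f) (hfn : ∀ n, Integrable (fn n)) (h0 : ∀ᵐ x, 0 ≤ f x)
    (h0n : ∀ n, ∀ᵐ x, 0 ≤ fn n x) (hE : ∫ x, f x = E) (hEn : ∀ n, ∫ x, fn n x = E)
    (hlim : ∀ᵐ x, Tendsto (fun n => fn n x) atTop (𝓝 (f x))) :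
    Tendsto (fun n => ∫ x, |fn n x - f x|) atTop (𝓝 0) := by
  have h1 : ∀ n, ∫ x, |fn n x - f x| = 2 * ∫ x, max (f x - fn n x) 0 := by
    intro n
    have hi : Integrable (fun x => max (f x - fn n x) 0) := (hf.sub (hfn n)).pos_part
    have : ∀ x, |fn n x - f x| = (fn n x - f x) + 2 * max (f x - fn n x) 0 := by
      intro x
      rcases le_total (f x) (fn n x) with h | h
      · rw [abs_of_nonneg (by linarith), max_eq_right (by linarith)]; ring
      · rw [abs_of_nonpos (by linarith), max_eq_left (by linarith)]; ring
    simp_rw [this]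
    have hs : Integrable (fun x => fn n x - f x) := (hfn n).sub hf
    rw [integral_add hs (hi.const_mul 2), integral_sub (hfn n) hf, hE, hEn, sub_self, zero_add,
      integral_const_mul]
  simp_rw [h1]
  suffices Tendsto (fun n => ∫ x, max (f x - fn n x) 0) atTop (𝓝 (∫ _ : ℝ, (0 : ℝ))) by
    simpa using this.const_mul 2
  refine tendsto_integral_of_dominated_convergence f
    (fun n => ((hf.sub (hfn n)).pos_part).1) hf (fun n => ?_) ?_
  · filter_upwards [h0, h0n n] with x h h'
    rw [Real.norm_of_nonneg (le_max_right _ _)]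
    exact max_le (by linarith) h
  · filter_upwards [hlim] with x hx
    have : Tendsto (fun n => max (f x - fn n x) 0) atTop (𝓝 (max (f x - f x) 0)) :=
      (tendsto_const_nhds.sub hx).max tendsto_const_nhds
    simpa using this

lemma derivSupNorm_nonneg (α : ℝ → ℝ) : 0 ≤ derivSupNorm α := ENNReal.toReal_nonneg

/-- `α` is the integral of its derivative, so the essential supremum is a Lipschitz constant. Its
finiteness has to be checked first, because `toReal` sends `⊤` to 0. -/
lemma IsCoefficient.abs_sub_le {α : ℝ → ℝ} (hα : IsCoefficient α) (x y : ℝ) :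
    |α x - α y| ≤ derivSupNorm α * |x - y| := by
  obtain ⟨K, hK⟩ := hα.1
  have hfin : eLpNorm (deriv α) ⊤ volume ≠ ⊤ := by
    rw [eLpNorm_exponent_top]
    refine ne_top_of_le_ne_top ENNReal.coe_ne_top (b := (K : ℝ≥0∞)) ?_
    refine eLpNormEssSup_le_of_ae_nnnorm_bound (ae_of_all _ fun x => ?_)
    exact norm_deriv_le_of_lipschitz hK
  have hb : ∀ᵐ t, ‖deriv α t‖ ≤ derivSupNorm α := by
    have := ae_le_eLpNormEssSup (f := deriv α) (μ := volume)
    filter_upwards [this] with t ht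
    rw [derivSupNorm]
    rw [eLpNorm_exponent_top] at *
    have h2 := ENNReal.toReal_mono hfin ht
    simpa using h2
  have h2 := intervalIntegral.norm_integral_le_of_norm_le_const_ae (a := y) (b := x)
    (f := deriv α) (C := derivSupNorm α) (hb.mono fun t ht _ => ht)
  rwa [← hK.isPrimitive.2, Real.norm_eq_abs] at h2

/-! ## Distribution functions of finite measures -/

section Distribution

variable (ν : Measure ℝ) [IsFiniteMeasure ν]

lemma monotone_measureReal_Iio : Monotone fun x => ν.real (Iio x) := fun _ _ h =>
  measureReal_mono (Iio_subset_Iio h)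

/-- Continuity from below along half-lines increasing to `Iio x`: a distribution function with open
half-lines is left continuous. -/
lemma exists_lt_of_lt_measureReal_Iio {c x : ℝ} (h : c < ν.real (Iio x)) :
    ∀ᶠ x' in 𝓝[<] x, c < ν.real (Iio x') := by
  obtain ⟨u, hu, hux, hut⟩ := exists_seq_strictMono_tendsto x
  have h1 : Iio x = ⋃ n, Iio (u n) := by
    ext z; simp only [mem_Iio, mem_iUnion]
    exact ⟨fun hz => ((tendsto_order.1 hut).1 z hz).exists, fun ⟨n, hn⟩ => hn.trans (hux n)⟩
  have h2 : Tendsto (fun n => ν.real (Iio (u n))) atTop (𝓝 (ν.real (Iio x))) := by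
    have := tendsto_measure_iUnion_atTop (μ := ν) (s := fun n => Iio (u n))
      (fun m n hmn => Iio_subset_Iio (hu.monotone hmn))
    rw [← h1] at this
    exact (ENNReal.tendsto_toReal (measure_ne_top ν _)).comp this
  obtain ⟨n, hn⟩ := ((tendsto_order.1 h2).1 c h).exists
  filter_upwards [Ioo_mem_nhdsLT (hux n)] with z hz
  exact hn.trans_le (monotone_measureReal_Iio ν hz.1.le)

lemma tendsto_measureReal_Iio_nhdsGT (x : ℝ) :
    Tendsto (fun z => ν.real (Iio z)) (𝓝[>] x) (𝓝 (ν.real (Iic x))) := by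
  obtain ⟨u, hu, hux, hut⟩ := exists_seq_strictAnti_tendsto x
  have h1 : Iic x = ⋂ n, Iio (u n) := by
    ext z; simp only [mem_Iic, mem_iInter, mem_Iio]
    refine ⟨fun hz n => hz.trans_lt (hux n), fun h => ?_⟩
    exact ge_of_tendsto' hut fun n => (h n).le
  have h2 : Tendsto (fun n => ν.real (Iio (u n))) atTop (𝓝 (ν.real (Iic x))) := by
    have := tendsto_measure_iInter_atTop (μ := ν) (s := fun n => Iio (u n))
      (fun n => measurableSet_Iio.nullMeasurableSet)
      (fun m n hmn => Iio_subset_Iio (hu.antitone hmn)) ⟨0, measure_ne_top ν _⟩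
    rw [← h1] at this
    exact (ENNReal.tendsto_toReal (measure_ne_top ν _)).comp this
  rw [tendsto_order]
  refine ⟨fun c hc => ?_, fun c hc => ?_⟩
  · filter_upwards [self_mem_nhdsWithin] with z hz
    exact hc.trans_le (measureReal_mono (Iic_subset_Iio.2 hz))
  · obtain ⟨n, hn⟩ := ((tendsto_order.1 h2).2 c hc).exists
    filter_upwards [Ioo_mem_nhdsGT (hux n)] with z hz
    exact (monotone_measureReal_Iio ν hz.2.le).trans_lt hn

lemma tendsto_measureReal_Iio_atBot : Tendsto (fun x => ν.real (Iio x)) atBot (𝓝 0) := by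
  have h : Tendsto (fun x => ν.real univ - ν.real (Ici x)) atBot (𝓝 (ν.real univ - ν.real univ)) :=
    tendsto_const_nhds.sub ((ENNReal.tendsto_toReal (measure_ne_top ν _)).comp
      (tendsto_measure_Ici_atBot ν))
  rw [sub_self] at h
  refine h.congr fun x => ?_
  have := measureReal_compl (μ := ν) (measurableSet_Ici (a := x))
  rw [compl_Ici] at this
  exact this.symm

lemma tendsto_measureReal_Iio_atTop :
    Tendsto (fun x => ν.real (Iio x)) atTop (𝓝 (ν.real univ)) := by
  have h : Tendsto (fun x => ν.real (Iic x)) atTop (𝓝 (ν.real univ)) :=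
    (ENNReal.tendsto_toReal (measure_ne_top ν _)).comp (tendsto_measure_Iic_atTop ν)
  refine tendsto_of_tendsto_of_tendsto_of_le_of_le
    (h.comp (tendsto_atTop_add_const_right _ (-1) tendsto_id)) tendsto_const_nhds
    (fun x => measureReal_mono (Iic_subset_Iio.2 (by simp)))
    (fun x => measureReal_mono (subset_univ _))

lemma continuousAt_measureReal_Iio_iff {x : ℝ} (h : ContinuousAt (fun x => ν.real (Iio x)) x) :
    ν.real (Iic x) = ν.real (Iio x) :=
  tendsto_nhds_unique (tendsto_measureReal_Iio_nhdsGT ν x) (h.tendsto.mono_left nhdsWithin_le_nhds)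

/-- The right limit of `ν (Iio ·)` at `x` is `ν (Iic x)`, so the two measures agree on closed
half-lines. This gives access to the a.e. differentiability of monotone functions with the density
of `ν` as derivative. -/
lemma stieltjesFunction_measure_eq (h : Monotone fun x => ν.real (Iio x)) :
    h.stieltjesFunction.measure = ν := by
  have h1 : ∀ x, h.stieltjesFunction x = ν.real (Iic x) := fun x => by
    rw [h.stieltjesFunction_eq]
    exact tendsto_nhds_unique (h.tendsto_rightLim x) (tendsto_measureReal_Iio_nhdsGT ν x)
  have h2 : Tendsto h.stieltjesFunction atBot (𝓝 0) := by
    refine tendsto_of_tendsto_of_tendsto_of_le_of_le tendsto_const_nhds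
      ((tendsto_measureReal_Iio_atBot ν).comp (tendsto_atBot_add_const_right _ 1 tendsto_id))
      (fun x => ?_) (fun x => ?_)
    · simp only [h1]; exact measureReal_nonneg
    · simp only [h1]; exact measureReal_mono (Iic_subset_Iio.2 (by simp))
  refine (Measure.ext_of_Iic _ _ fun x => ?_).symm
  rw [StieltjesFunction.measure_Iic _ h2, h1, sub_zero, ofReal_measureReal]

lemma ae_hasDerivAt_measureReal_Iio :
    ∀ᵐ x, HasDerivAt (fun x => ν.real (Iio x)) (ν.rnDeriv volume x).toReal x := by
  have := (monotone_measureReal_Iio ν).ae_hasDerivAt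
  rwa [stieltjesFunction_measure_eq] at this

end Distribution

/-! ## The Lagrangian coordinates of a finite measure -/

lemma mapL_H_eq {Z : Eul} (ξ : ℝ) : (mapL Z).H ξ = ξ - (mapL Z).y ξ := rfl

lemma mapL_y_set_bddAbove {Z : Eul} (ξ : ℝ) :
    ξ ∈ upperBounds {x : ℝ | x + Z.ν.real (Iio x) < ξ} :=
  fun x hx => by
    simp only [mem_ofPred_eq] at hx
    linarith [measureReal_nonneg (μ := Z.ν) (s := Iio x)]

section MapL

variable {Z : Eul} [IsFiniteMeasure Z.ν]

lemma strictMono_add_measureReal_Iio : StrictMono fun x => x + Z.ν.real (Iio x) :=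
  strictMono_id.add_monotone (monotone_measureReal_Iio Z.ν)

/-- `y` is the generalized inverse of the strictly increasing function `x + ν (Iio x)`. Left
continuity of that function provides a point to the left of `x` where its value still exceeds `ξ`.
-/
lemma mapL_y_lt_iff {ξ x : ℝ} : (mapL Z).y ξ < x ↔ ξ < x + Z.ν.real (Iio x) := by
  have hy : (mapL Z).y ξ = sSup {x : ℝ | x + Z.ν.real (Iio x) < ξ} := rfl
  have hne : {x : ℝ | x + Z.ν.real (Iio x) < ξ}.Nonempty := by
    refine ⟨ξ - Z.ν.real univ - 1, ?_⟩
    simp only [mem_ofPred_eq]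
    linarith [measureReal_mono (μ := Z.ν) (subset_univ (Iio (ξ - Z.ν.real univ - 1)))]
  constructor
  · intro h
    by_contra h'
    push Not at h'
    refine h.not_ge (le_of_forall_lt fun z hz => ?_)
    obtain ⟨w, hzw, hwx⟩ := exists_between hz
    refine hzw.trans_le ?_
    rw [hy]
    exact le_csSup ⟨ξ, mapL_y_set_bddAbove ξ⟩ ((strictMono_add_measureReal_Iio hwx).trans_le h')
  · intro h
    -- Each of the two summands of `x' + ν (Iio x')` may lose half of the gap `x + ν (Iio x) - ξ`.
    have h1 : ∀ᶠ x' in 𝓝[<] x, (x + ξ - Z.ν.real (Iio x)) / 2 < x' := by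
      refine nhdsWithin_le_nhds (Ioi_mem_nhds ?_); linarith
    have h2 := exists_lt_of_lt_measureReal_Iio Z.ν
      (x := x) (c := (Z.ν.real (Iio x) + ξ - x) / 2) (by linarith)
    obtain ⟨x', hx', hx1, hx2⟩ := (h1.and (h2.and self_mem_nhdsWithin)).exists
    refine lt_of_le_of_lt ?_ hx2
    rw [hy]
    refine csSup_le hne fun z hz => ?_
    by_contra hlt
    push Not at hlt
    have := strictMono_add_measureReal_Iio (Z := Z) hlt
    simp only [mem_ofPred_eq] at hz this
    linarith

lemma mapL_y_le_iff {ξ x : ℝ} : (mapL Z).y ξ ≤ x ↔ ξ ≤ x + Z.ν.real (Iic x) := by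
  constructor
  · intro h
    refine ge_of_tendsto (f := fun z => z + Z.ν.real (Iio z)) (x := 𝓝[>] x)
      ((tendsto_id.mono_left nhdsWithin_le_nhds).add (tendsto_measureReal_Iio_nhdsGT Z.ν x)) ?_
    filter_upwards [self_mem_nhdsWithin] with z hz
    exact (mapL_y_lt_iff.1 (h.trans_lt hz)).le
  · intro h
    refine le_of_forall_gt fun z hz => ?_
    rw [mapL_y_lt_iff]
    linarith [measureReal_mono (μ := Z.ν) (Iic_subset_Iio.2 hz)]

/-- At an atom of `ν` a whole interval of labels sits at the single position `x`. -/
lemma mapL_y_eq_of_mem {ξ x : ℝ} (h1 : x + Z.ν.real (Iio x) ≤ ξ)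
    (h2 : ξ ≤ x + Z.ν.real (Iic x)) : (mapL Z).y ξ = x :=
  le_antisymm (mapL_y_le_iff.2 h2) (not_lt.1 fun h => (mapL_y_lt_iff.1 h).not_ge h1)

lemma mapL_y_add (x : ℝ) : (mapL Z).y (x + Z.ν.real (Iio x)) = x :=
  mapL_y_eq_of_mem le_rfl (add_le_add_right (measureReal_mono Iio_subset_Iic_self) x)

lemma mapL_H_le (ξ : ℝ) : (mapL Z).H ξ ≤ Z.ν.real (Iic ((mapL Z).y ξ)) := by
  have := mapL_y_le_iff.1 (le_refl ((mapL Z).y ξ))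
  rw [mapL_H_eq]; linarith

lemma le_mapL_H (ξ : ℝ) : Z.ν.real (Iio ((mapL Z).y ξ)) ≤ (mapL Z).H ξ := by
  have := mt mapL_y_lt_iff.2 (lt_irrefl ((mapL Z).y ξ))
  rw [mapL_H_eq]; linarith

lemma mapL_H_nonneg (ξ : ℝ) : 0 ≤ (mapL Z).H ξ := measureReal_nonneg.trans (le_mapL_H ξ)

lemma mapL_H_le_univ (ξ : ℝ) : (mapL Z).H ξ ≤ Z.ν.real univ :=
  (mapL_H_le ξ).trans (measureReal_mono (subset_univ _))

lemma mapL_y_mono : Monotone (mapL Z).y := fun a b h => by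
  rw [mapL_y_le_iff]
  exact h.trans (mapL_y_le_iff.1 le_rfl)

lemma mapL_H_mono : Monotone (mapL Z).H := fun a b h => by
  have : (mapL Z).y b ≤ (mapL Z).y a + (b - a) := by
    rw [mapL_y_le_iff]
    have h1 := mapL_y_le_iff.1 (le_refl ((mapL Z).y a))
    have h2 : Z.ν.real (Iic ((mapL Z).y a)) ≤ Z.ν.real (Iic ((mapL Z).y a + (b - a))) :=
      measureReal_mono (Iic_subset_Iic.2 (by linarith))
    linarith
  simp only [mapL_H_eq]; linarith

lemma mapL_H_tendsto_atBot : Tendsto (mapL Z).H atBot (𝓝 0) := by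
  refine tendsto_of_tendsto_of_tendsto_of_le_of_le tendsto_const_nhds
    ((tendsto_measureReal_Iio_atBot Z.ν).comp (tendsto_atBot_add_const_right _ 1 tendsto_id))
    (fun ξ => mapL_H_nonneg ξ) (fun ξ => (mapL_H_le ξ).trans ?_)
  have := mapL_H_nonneg (Z := Z) ξ
  rw [mapL_H_eq] at this
  exact measureReal_mono (Iic_subset_Iio.2 (by simp; linarith))

lemma mapL_H_tendsto_atTop : Tendsto (mapL Z).H atTop (𝓝 (Z.ν.real univ)) := by
  refine tendsto_of_tendsto_of_tendsto_of_le_of_le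
    ((tendsto_measureReal_Iio_atTop Z.ν).comp
      (tendsto_atTop_add_const_right _ (- Z.ν.real univ) tendsto_id)) tendsto_const_nhds
    (fun ξ => le_trans ?_ (le_mapL_H ξ)) (fun ξ => mapL_H_le_univ ξ)
  have := mapL_H_le_univ (Z := Z) ξ
  rw [mapL_H_eq] at this
  exact measureReal_mono (Iio_subset_Iio (by simp; linarith))

end MapL

/-! ## Lagrangian initial data -/

/-- Meant for `y` and `H`, two nondecreasing functions whose sum is the identity. -/
lemma lipschitzWith_one_of_monotone {f : ℝ → ℝ} (h1 : Monotone f) (h2 : Monotone fun x => x - f x) :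
    LipschitzWith 1 f := by
  refine LipschitzWith.of_le_add fun x y => ?_
  rw [Real.dist_eq]
  rcases le_total x y with h | h
  · linarith [h1 h, abs_nonneg (x - y)]
  · have := h2 h
    simp only at this
    rw [abs_of_nonneg (by linarith)]; linarith

/-- The part of the conditions on Lagrangian initial data of energy `E` that involves only the
characteristics `y` and the cumulative energy `H`. -/
structure EnergyData (X : Lag) (E : ℝ) : Prop where
  add_eq : ∀ ξ, X.y ξ + X.H ξ = ξ
  y_mono : Monotone X.y
  H_mono : Monotone X.H
  H_bot : Tendsto X.H atBot (𝓝 0)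
  H_top : Tendsto X.H atTop (𝓝 E)

/-- Lagrangian coordinates at time `0` with `V = H` and total energy `E`. -/
structure InitData (X : Lag) (E : ℝ) : Prop extends EnergyData X E where
  V_eq : X.V = X.H
  H_tails : HasTails X.H 0 E
  U_lip : ∃ K, LipschitzWith K X.U
  U_tails : ∃ a b, HasTails X.U a b
  rel : ∀ᵐ ξ, deriv X.U ξ ^ 2 = deriv X.y ξ * deriv X.H ξ

namespace EnergyData

variable {X : Lag} {E : ℝ} (h : EnergyData X E)
include h

lemma y_lip : LipschitzWith 1 X.y :=
  lipschitzWith_one_of_monotone h.y_mono (by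
    convert h.H_mono using 2; linarith [h.add_eq ‹_›])

lemma H_lip : LipschitzWith 1 X.H :=
  lipschitzWith_one_of_monotone h.H_mono (by
    convert h.y_mono using 2; linarith [h.add_eq ‹_›])

lemma H_nonneg (ξ : ℝ) : 0 ≤ X.H ξ := h.H_mono.le_of_tendsto h.H_bot ξ

lemma H_le (ξ : ℝ) : X.H ξ ≤ E := h.H_mono.ge_of_tendsto h.H_top ξ

lemma E_nonneg : 0 ≤ E := (h.H_nonneg 0).trans (h.H_le 0)

lemma deriv_H_nonneg (ξ : ℝ) : 0 ≤ deriv X.H ξ := h.H_mono.deriv_nonneg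

lemma deriv_y_nonneg (ξ : ℝ) : 0 ≤ deriv X.y ξ := h.y_mono.deriv_nonneg

lemma deriv_H_le (ξ : ℝ) : deriv X.H ξ ≤ 1 := by
  simpa using (le_abs_self _).trans (norm_deriv_le_of_lipschitz h.H_lip (x₀ := ξ))

lemma deriv_add : ∀ᵐ ξ, deriv X.y ξ + deriv X.H ξ = 1 := by
  filter_upwards [h.y_lip.isPrimitive.ae_differentiableAt,
    h.H_lip.isPrimitive.ae_differentiableAt] with ξ h1 h2
  rw [← deriv_fun_add h1 h2, funext h.add_eq]
  exact deriv_id ξ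

lemma integral_H (a b : ℝ) : ∫ x in a..b, deriv X.H x = X.H b - X.H a :=
  (h.H_lip.isPrimitive.2 a b).symm

lemma integrable_deriv_H : Integrable (deriv X.H) := by
  refine integrable_of_intervalIntegral_norm_bounded E (a := fun n : ℝ => -n) (b := fun n => n)
    (l := atTop) (fun n => ?_) tendsto_neg_atTop_atBot tendsto_id (Eventually.of_forall fun n => ?_)
  · exact (h.H_lip.isPrimitive.1 (-n) n).1
  · have : ∀ x, ‖deriv X.H x‖ = deriv X.H x := fun x => Real.norm_of_nonneg (h.deriv_H_nonneg x)
    simp_rw [this]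
    rw [h.integral_H]
    linarith [h.H_le n, h.H_nonneg (-n)]

lemma integral_Iic_deriv_H (ξ : ℝ) : ∫ η in Iic ξ, deriv X.H η = X.H ξ := by
  have h1 := intervalIntegral_tendsto_integral_Iic ξ h.integrable_deriv_H.integrableOn tendsto_id
  refine tendsto_nhds_unique h1 ?_
  have h2 : Tendsto (fun i => X.H ξ - X.H i) atBot (𝓝 (X.H ξ - 0)) := tendsto_const_nhds.sub h.H_bot
  rw [sub_zero] at h2
  exact h2.congr fun i => (h.integral_H i ξ).symm

lemma integral_deriv_H : ∫ η, deriv X.H η = E := by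
  have h1 := intervalIntegral_tendsto_integral h.integrable_deriv_H
    tendsto_neg_atTop_atBot tendsto_id
  refine tendsto_nhds_unique h1 ?_
  have h2 : Tendsto (fun i => X.H i - X.H (-i)) atTop (𝓝 (E - 0)) :=
    h.H_top.sub (h.H_bot.comp tendsto_neg_atTop_atBot)
  rw [sub_zero] at h2
  exact h2.congr fun i => (h.integral_H (-i) i).symm

lemma y_surjective : Function.Surjective X.y := by
  have hc := h.y_lip.continuous
  refine hc.surjective ?_ ?_
  · refine tendsto_atTop_mono (f := fun x : ℝ => x - E) (fun x => ?_)
      (tendsto_atTop_add_const_right _ (-E) tendsto_id)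
    linarith [h.add_eq x, h.H_le x]
  · have h1 : ∀ x, X.y x ≤ id x := fun x => by
      simp only [id]; linarith [h.add_eq x, h.H_nonneg x]
    exact tendsto_atBot_mono h1 tendsto_id

lemma lintegral_Iic_deriv_H (ξ : ℝ) :
    ∫⁻ η in Iic ξ, ENNReal.ofReal (deriv X.H η) = ENNReal.ofReal (X.H ξ) := by
  rw [← ofReal_integral_eq_lintegral_ofReal h.integrable_deriv_H.integrableOn
    (ae_of_all _ h.deriv_H_nonneg), h.integral_Iic_deriv_H]

lemma lintegral_deriv_H :
    ∫⁻ η, ENNReal.ofReal (deriv X.H η) = ENNReal.ofReal E := by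
  rw [← ofReal_integral_eq_lintegral_ofReal h.integrable_deriv_H
    (ae_of_all _ h.deriv_H_nonneg), h.integral_deriv_H]

end EnergyData

lemma mapL_energyData (Z : Eul) [IsFiniteMeasure Z.ν] : EnergyData (mapL Z) (Z.ν.real univ) where
  add_eq ξ := by rw [mapL_H_eq]; ring
  y_mono := mapL_y_mono
  H_mono := mapL_H_mono
  H_bot := mapL_H_tendsto_atBot
  H_top := mapL_H_tendsto_atTop

/-- Checked on half-lines: `y ξ ≤ x` means `ξ ≤ x + ν (Iic x)`, and at this last label `H` equals `ν
(Iic x)`. -/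
lemma map_mapL_deriv_H (Z : Eul) [IsFiniteMeasure Z.ν] :
    (volume.withDensity fun ξ => ENNReal.ofReal (deriv (mapL Z).H ξ)).map (mapL Z).y = Z.ν := by
  have h := mapL_energyData Z
  have : IsFiniteMeasure (volume.withDensity fun ξ => ENNReal.ofReal (deriv (mapL Z).H ξ)) :=
    isFiniteMeasure_withDensity (by rw [h.lintegral_deriv_H]; exact ENNReal.ofReal_ne_top)
  refine Measure.ext_of_Iic _ _ fun x => ?_
  rw [Measure.map_apply h.y_mono.measurable measurableSet_Iic]
  have h1 : (mapL Z).y ⁻¹' Iic x = Iic (x + Z.ν.real (Iic x)) := by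
    ext ξ; simp only [mem_preimage, mem_Iic, mapL_y_le_iff]
  rw [h1, withDensity_apply _ measurableSet_Iic, h.lintegral_Iic_deriv_H, mapL_H_eq,
    mapL_y_eq_of_mem (add_le_add_right (measureReal_mono Iio_subset_Iic_self) x) le_rfl]
  simp

/-- `y_ξ + H_ξ = 1` splits `dξ` into two parts, whose images are `dx` and `ν`. -/
lemma map_mapL_volume (Z : Eul) [IsFiniteMeasure Z.ν] :
    (volume : Measure ℝ).map (mapL Z).y = volume + Z.ν := by
  have h := mapL_energyData Z
  have h1 : (volume : Measure ℝ) = (volume.withDensity fun ξ => ENNReal.ofReal (deriv (mapL Z).y ξ))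
      + volume.withDensity fun ξ => ENNReal.ofReal (deriv (mapL Z).H ξ) := by
    rw [← withDensity_add_left (measurable_deriv _).ennreal_ofReal]
    nth_rw 1 [← withDensity_one (μ := (volume : Measure ℝ))]
    refine withDensity_congr_ae ?_
    filter_upwards [h.deriv_add] with ξ hξ
    rw [Pi.add_apply, ← ENNReal.ofReal_add (h.deriv_y_nonneg ξ) (h.deriv_H_nonneg ξ), hξ]
    simp
  nth_rw 1 [h1]
  rw [Measure.map_add _ _ h.y_mono.measurable, map_mapL_deriv_H,
    map_withDensity_deriv h.y_mono h.y_lip h.y_surjective]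

/-- `dμ/dν = 1` holds ν-a.e., that is, at `y η` for a.e. label with `H_ξ ≠ 0`; at the other labels
the factor `H_ξ` vanishes. -/
lemma mapL_V_eq (Z : Eul) [IsFiniteMeasure Z.ν] (hZ : Z.μ = Z.ν) : (mapL Z).V = (mapL Z).H := by
  have h := mapL_energyData Z
  ext ξ
  rw [← h.integral_Iic_deriv_H]
  refine setIntegral_congr_ae measurableSet_Iic ?_
  have h1 : ∀ᵐ x ∂Z.ν, Z.μ.rnDeriv Z.ν x = 1 := by rw [hZ]; exact Z.ν.rnDeriv_self
  rw [← map_mapL_deriv_H] at h1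
  have h2 := ae_of_ae_map h.y_mono.measurable.aemeasurable h1
  rw [ae_withDensity_iff (measurable_deriv _).ennreal_ofReal] at h2
  filter_upwards [h2] with η hη _
  by_cases h3 : deriv (mapL Z).H η = 0
  · change _ * deriv (mapL Z).H η = _
    rw [h3, mul_zero]
  · have h4 := hη (by
      have := (h.deriv_H_nonneg η).lt_of_ne' h3
      simpa using this)
    rw [map_mapL_deriv_H] at h4
    change (Z.μ.rnDeriv Z.ν ((mapL Z).y η)).toReal * deriv (mapL Z).H η = _
    rw [h4]; simp

/-! ## Tails -/

lemma memLp_restrict_of_bounded {f : ℝ → ℝ} (hf : Measurable f) (hb : ∃ C, ∀ x, |f x| ≤ C)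
    (a c d : ℝ) : MemLp (fun x => f x - a) 2 (volume.restrict (Icc c d)) := by
  obtain ⟨C, hC⟩ := hb
  have : IsFiniteMeasure (volume.restrict (Icc c d)) := ⟨by simp⟩
  refine MemLp.of_bound (hf.sub_const a).aestronglyMeasurable (C + |a|) (ae_of_all _ fun x => ?_)
  exact (norm_sub_le _ _).trans (add_le_add_left (hC x) _)

lemma hasTails_of_bounded {f : ℝ → ℝ} (hf : Measurable f) (hb : ∃ C, ∀ x, |f x| ≤ C) {a b R : ℝ}
    (h1 : MemLp (fun x => f x - a) 2 (volume.restrict (Iio (-R))))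
    (h2 : MemLp (fun x => f x - b) 2 (volume.restrict (Ioi R))) : HasTails f a b := by
  refine ⟨(memLp_restrict_union h1 (memLp_restrict_of_bounded hf hb a (-R) 0)).mono_measure
    (Measure.restrict_mono (fun x hx => ?_) le_rfl),
    (memLp_restrict_union h2 (memLp_restrict_of_bounded hf hb b 0 R)).mono_measure
    (Measure.restrict_mono (fun x hx => ?_) le_rfl)⟩
  · by_cases h : x < -R
    · exact Or.inl h
    · exact Or.inr ⟨by linarith, le_of_lt hx⟩
  · by_cases h : R < x
    · exact Or.inl h
    · exact Or.inr ⟨le_of_lt hx, by linarith⟩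

lemma HasTails.comp_add {f : ℝ → ℝ} {a b : ℝ} (h : HasTails f a b) (hf : Measurable f)
    (hb : ∃ C, ∀ x, |f x| ≤ C) (c : ℝ) : HasTails (fun x => f (x + c)) a b := by
  have hp := measurePreserving_add_right (volume : Measure ℝ) c
  have hb' : ∃ C, ∀ x, |f (x + c)| ≤ C := hb.imp fun C hC x => hC _
  refine hasTails_of_bounded (R := |c|) (hf.comp (measurable_id.add_const c)) hb' ?_ ?_
  · refine (h.1.comp_measurePreserving (hp.restrict_preimage measurableSet_Iio)).mono_measure
      (Measure.restrict_mono (fun x hx => ?_) le_rfl)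
    simp only [mem_Iio, mem_preimage] at *
    linarith [le_abs_self c]
  · refine (h.2.comp_measurePreserving (hp.restrict_preimage measurableSet_Ioi)).mono_measure
      (Measure.restrict_mono (fun x hx => ?_) le_rfl)
    simp only [mem_Ioi, mem_preimage] at *
    linarith [neg_abs_le c]

lemma HasTails.of_squeeze {f g k : ℝ → ℝ} {a b : ℝ} (hg : HasTails g a b) (hk : HasTails k a b)
    (hf : Measurable f) (h1 : ∀ x, g x ≤ f x) (h2 : ∀ x, f x ≤ k x) : HasTails f a b := by
  have key : ∀ (c : ℝ) (s : Set ℝ), MemLp (fun x => g x - c) 2 (volume.restrict s) →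
      MemLp (fun x => k x - c) 2 (volume.restrict s) →
      MemLp (fun x => f x - c) 2 (volume.restrict s) := fun c s hg hk => by
    refine (hg.norm.add hk.norm).mono' (hf.sub_const c).aestronglyMeasurable
      (ae_of_all _ fun x => ?_)
    simp only [Pi.add_apply, Real.norm_eq_abs]
    rw [abs_le]
    constructor
    · linarith [neg_abs_le (g x - c), abs_nonneg (k x - c), h1 x]
    · linarith [le_abs_self (k x - c), abs_nonneg (g x - c), h2 x]
  exact ⟨key _ _ hg.1 hk.1, key _ _ hg.2 hk.2⟩

/-- A different limit would make a positive constant integrable on a half-line. -/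
lemma HasTails.right_eq_of_tendsto {f : ℝ → ℝ} {a b E : ℝ} (h : HasTails f a b)
    (hf : Tendsto f atTop (𝓝 E)) : b = E := by
  by_contra hne
  have h1 : Tendsto (fun x => (f x - b) ^ 2) atTop (𝓝 ((E - b) ^ 2)) := (hf.sub_const b).pow 2
  have hpos : 0 < (E - b) ^ 2 := by
    have : E - b ≠ 0 := sub_ne_zero.2 (Ne.symm hne)
    positivity
  obtain ⟨N, hN⟩ := eventually_atTop.1 ((tendsto_order.1 h1).1 _ (half_lt_self hpos))
  have h2 : IntegrableOn (fun _ : ℝ => (E - b) ^ 2 / 2) (Ioi (max N 0)) := by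
    refine Integrable.mono' (IntegrableOn.mono_set h.2.integrable_sq
      (Ioi_subset_Ioi (le_max_right N 0))) aestronglyMeasurable_const ?_
    refine (ae_restrict_iff' measurableSet_Ioi).2 (ae_of_all _ fun x hx => ?_)
    rw [Real.norm_of_nonneg (by positivity)]
    exact (hN x ((le_max_left _ _).trans (le_of_lt hx))).le
  rw [integrableOn_const_iff] at h2
  simp [hpos.ne'] at h2

/-! ## Eulerian initial data -/

/-- Eulerian data with `μ = ν` for which `ν_ac = u_x² dx`, the latter being expressed through the
derivative of the distribution function. -/
structure EulData (Z : Eul) : Prop where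
  finite : IsFiniteMeasure Z.ν
  eq : Z.μ = Z.ν
  u_prim : IsPrimitive Z.u
  u_tails : ∃ a b, HasTails Z.u a b
  G_tails : ∃ b, HasTails (fun x => Z.ν.real (Iio x)) 0 b
  deriv_G : ∀ᵐ x, HasDerivAt (fun x => Z.ν.real (Iio x)) (deriv Z.u x ^ 2) x

namespace EulData

variable {Z : Eul} (h : EulData Z)
include h

lemma rnDeriv_eq : (fun x => Z.ν.rnDeriv volume x) =ᵐ[volume]
    fun x => ENNReal.ofReal (deriv Z.u x ^ 2) := by
  have := h.finite
  filter_upwards [h.deriv_G, ae_hasDerivAt_measureReal_Iio Z.ν, Z.ν.rnDeriv_lt_top volume]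
    with x h1 h2 h3
  rw [h1.unique h2, ENNReal.ofReal_toReal h3.ne]

lemma lintegral_deriv_sq_le (s : Set ℝ) :
    ∫⁻ x in s, ENNReal.ofReal (deriv Z.u x ^ 2) ≤ Z.ν s := by
  rw [← lintegral_congr_ae (ae_restrict_of_ae h.rnDeriv_eq)]
  exact Measure.setLIntegral_rnDeriv_le s

lemma memLp_deriv_u : MemLp (deriv Z.u) 2 volume := by
  have := h.finite
  rw [memLp_two_iff_integrable_sq (measurable_deriv _).aestronglyMeasurable]
  refine ⟨((measurable_deriv _).pow_const 2).aestronglyMeasurable, ?_⟩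
  rw [hasFiniteIntegral_iff_ofReal (ae_of_all _ fun x => sq_nonneg _)]
  have h1 := h.lintegral_deriv_sq_le univ
  rw [Measure.restrict_univ] at h1
  exact h1.trans_lt (measure_lt_top _ _)

lemma integral_deriv_sq_le {a b : ℝ} (hab : a ≤ b) :
    ∫ x in a..b, deriv Z.u x ^ 2 ≤ Z.ν.real (Ioo a b) := by
  have := h.finite
  rw [intervalIntegral.integral_of_le hab, integral_Ioc_eq_integral_Ioo,
    integral_eq_lintegral_of_nonneg_ae (ae_of_all _ fun x => sq_nonneg _)
      ((measurable_deriv _).pow_const 2).aestronglyMeasurable]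
  exact ENNReal.toReal_mono (measure_ne_top _ _) (h.lintegral_deriv_sq_le _)

lemma sq_u_sub_le {a b : ℝ} (hab : a ≤ b) :
    (Z.u b - Z.u a) ^ 2 ≤ (b - a) * Z.ν.real (Ioo a b) :=
  (h.u_prim.sq_sub_le h.memLp_deriv_u hab).trans
    (mul_le_mul_of_nonneg_left (h.integral_deriv_sq_le hab) (by linarith))

lemma u_bounded : ∃ C, ∀ x, |Z.u x| ≤ C := by
  obtain ⟨a, b, ht⟩ := h.u_tails
  have hu := h.u_prim.uniformContinuous h.memLp_deriv_u
  exact exists_bound_of_tendsto hu.continuous (ht.tendsto_atBot hu) (ht.tendsto_atTop hu)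

/-- Cauchy–Schwarz in Eulerian variables. The interval of positions has to be open: atoms at its two
ends may be crossed only in part, whereas the mass strictly between them is entirely contained in
the increment of `H`. -/
lemma sq_U_sub_le {ξ η : ℝ} (hξ : ξ ≤ η) : ((mapL Z).U η - (mapL Z).U ξ) ^ 2 ≤
    ((mapL Z).y η - (mapL Z).y ξ) * ((mapL Z).H η - (mapL Z).H ξ) := by
  have := h.finite
  have hm := mapL_y_mono (Z := Z) hξ
  refine (h.sq_u_sub_le hm).trans (mul_le_mul_of_nonneg_left ?_ (by linarith))
  rcases hm.eq_or_lt with he | hlt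
  · rw [he]; simp only [Ioo_self, measureReal_empty]
    linarith [mapL_H_mono (Z := Z) hξ]
  · have h1 := mapL_H_le (Z := Z) ξ
    have h2 := le_mapL_H (Z := Z) η
    have h3 : Z.ν.real (Iio ((mapL Z).y η)) = Z.ν.real (Iic ((mapL Z).y ξ)) +
        Z.ν.real (Ioo ((mapL Z).y ξ) ((mapL Z).y η)) := by
      rw [← measureReal_union _ measurableSet_Ioo, Iic_union_Ioo_eq_Iio hlt]
      rw [Set.disjoint_left]
      intro x hx hx'
      exact absurd hx'.1 (not_lt.2 hx)
    linarith

/-- The increments of `y` and `H` are nonnegative and add up to that of `ξ`, so their product is at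
most its square. -/
lemma U_lip : LipschitzWith 1 (mapL Z).U := by
  have := h.finite
  have hE := mapL_energyData Z
  have key : ∀ ξ η, ξ ≤ η → |(mapL Z).U η - (mapL Z).U ξ| ≤ η - ξ := fun ξ η hξ => by
    refine abs_le_of_sq_le_sq ?_ (by linarith)
    refine (h.sq_U_sub_le hξ).trans ?_
    have h1 := hE.y_mono hξ
    have h2 := hE.H_mono hξ
    have h3 := hE.add_eq ξ
    have h4 := hE.add_eq η
    nlinarith
  refine LipschitzWith.of_dist_le_mul fun x y => ?_
  simp only [Real.dist_eq, NNReal.coe_one, one_mul]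
  rcases le_total x y with hxy | hxy
  · rw [abs_sub_comm, abs_sub_comm x, abs_of_nonneg (a := y - x) (by linarith)]; exact key _ _ hxy
  · rw [abs_of_nonneg (a := x - y) (by linarith)]; exact key _ _ hxy

/-- The exceptional set of `ξ` that `y` maps to points at which `u` or `ν((-∞,·))` is not nicely
differentiable carries no absolutely continuous part. -/
lemma ae_deriv_mapL : ∀ᵐ ξ, (deriv (mapL Z).y ξ = 0 ∧ deriv (mapL Z).U ξ = 0) ∨
    (DifferentiableAt ℝ Z.u ((mapL Z).y ξ) ∧
      HasDerivAt (fun x => Z.ν.real (Iio x)) (deriv Z.u ((mapL Z).y ξ) ^ 2) ((mapL Z).y ξ) ∧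
      deriv (mapL Z).y ξ * (1 + deriv Z.u ((mapL Z).y ξ) ^ 2) = 1 ∧
      deriv (mapL Z).U ξ = deriv Z.u ((mapL Z).y ξ) * deriv (mapL Z).y ξ) := by
  have := h.finite
  have hE := mapL_energyData Z
  have hgood := h.u_prim.ae_differentiableAt.and h.deriv_G
  filter_upwards [ae_deriv_eq_zero_of_mem_null hE.y_mono hE.y_lip hE.y_surjective
      (show volume {x | ¬ (DifferentiableAt ℝ Z.u x ∧ HasDerivAt (fun x => Z.ν.real (Iio x)) (deriv Z.u x ^ 2) x)} = 0
        from hgood),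
    hE.y_lip.isPrimitive.ae_differentiableAt, h.U_lip.isPrimitive.ae_differentiableAt]
    with ξ h1 hy hU
  set x := (mapL Z).y ξ with hx
  by_cases hg : DifferentiableAt ℝ Z.u x ∧
      HasDerivAt (fun x => Z.ν.real (Iio x)) (deriv Z.u x ^ 2) x
  · refine Or.inr ⟨hg.1, hg.2, ?_, ?_⟩
    · have h2 := continuousAt_measureReal_Iio_iff Z.ν hg.2.continuousAt
      have h3 : x + Z.ν.real (Iio x) = ξ := by
        have h4 := mapL_H_le (Z := Z) ξ
        have h5 := le_mapL_H (Z := Z) ξ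
        rw [← hx, mapL_H_eq, ← hx] at h4 h5
        linarith
      -- `y` is a left inverse of `z + ν (Iio z)`, so the chain rule determines `y_ξ`.
      have h6 : HasDerivAt (fun z => z + Z.ν.real (Iio z)) (1 + deriv Z.u x ^ 2) x :=
        (hasDerivAt_id x).add hg.2
      have h7 : HasDerivAt (mapL Z).y (deriv (mapL Z).y ξ) (x + Z.ν.real (Iio x)) := by
        rw [h3]; exact hy.hasDerivAt
      have h8 := h7.comp x h6
      have h9 : ((mapL Z).y ∘ fun z => z + Z.ν.real (Iio z)) = id := by
        ext z; exact mapL_y_add z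
      rw [h9] at h8
      exact h8.unique (hasDerivAt_id x)
    · exact (hg.1.hasDerivAt.comp ξ hy.hasDerivAt).deriv
  · left
    have hy0 := h1 hg
    refine ⟨hy0, ?_⟩
    have hy' : Tendsto (fun t => slope (mapL Z).y ξ t) (𝓝[>] ξ) (𝓝 0) := by
      rw [← hy0]
      exact (hasDerivAt_iff_tendsto_slope.1 hy.hasDerivAt).mono_left
        (nhdsWithin_mono _ fun t ht => ne_of_gt ht)
    have hU' : Tendsto (fun t => slope (mapL Z).U ξ t ^ 2) (𝓝[>] ξ) (𝓝 (deriv (mapL Z).U ξ ^ 2)) :=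
      ((hasDerivAt_iff_tendsto_slope.1 hU.hasDerivAt).mono_left
        (nhdsWithin_mono _ fun t ht => ne_of_gt ht)).pow 2
    -- The increment of `H` is at most that of `ξ`, so the squared difference quotients of `U` are
    -- bounded by those of `y`, which tend to 0.
    have h2 : deriv (mapL Z).U ξ ^ 2 ≤ 0 := by
      refine le_of_tendsto_of_tendsto hU' hy' ?_
      filter_upwards [self_mem_nhdsWithin] with t ht
      have h6 : 0 < t - ξ := sub_pos.2 (mem_Ioi.1 ht)
      rw [slope_def_field, slope_def_field, div_pow, div_le_div_iff₀ (by positivity) h6]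
      have h3 := h.sq_U_sub_le (le_of_lt ht)
      have h4 : (mapL Z).H t - (mapL Z).H ξ ≤ t - ξ := by
        simp only [mapL_H_eq]; linarith [hE.y_mono (le_of_lt ht)]
      have h5 := hE.y_mono (le_of_lt ht)
      calc _ ≤ ((mapL Z).y t - (mapL Z).y ξ) * ((mapL Z).H t - (mapL Z).H ξ) * (t - ξ) := by gcongr
        _ ≤ ((mapL Z).y t - (mapL Z).y ξ) * (t - ξ) * (t - ξ) := by
          have : 0 ≤ (mapL Z).y t - (mapL Z).y ξ := by linarith
          gcongr
        _ = _ := by ring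
    exact pow_eq_zero_iff (two_ne_zero) |>.1 (le_antisymm h2 (sq_nonneg _))

/-- `y` maps `dξ` to `dx + ν`; square integrability handles the first part and boundedness the
second. -/
lemma memLp_comp_mapL_y {w : ℝ → ℝ} (hw : Measurable w) (hw2 : MemLp w 2 volume)
    (hb : ∃ C, ∀ x, |w x| ≤ C) : MemLp (fun ξ => w ((mapL Z).y ξ)) 2 volume := by
  have := h.finite
  have hE := mapL_energyData Z
  have h1 : MemLp w 2 (volume + Z.ν) := by
    obtain ⟨C, hC⟩ := hb
    have h2 : MemLp w 2 Z.ν := MemLp.of_bound hw.aestronglyMeasurable C (ae_of_all _ hC)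
    rw [memLp_two_iff_integrable_sq hw.aestronglyMeasurable] at *
    exact hw2.add_measure h2
  rw [← map_mapL_volume Z] at h1
  exact (memLp_map_measure_iff hw.aestronglyMeasurable hE.y_mono.measurable.aemeasurable).1 h1

lemma initData : InitData (mapL Z) (Z.ν.real univ) := by
  have := h.finite
  have hE := mapL_energyData Z
  obtain ⟨C, hC⟩ := h.u_bounded
  refine { hE with
    V_eq := mapL_V_eq Z h.eq
    H_tails := ?_
    U_lip := ⟨1, h.U_lip⟩
    U_tails := ?_
    rel := ?_ }
  · obtain ⟨b, hb⟩ := h.G_tails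
    have hbE := hb.right_eq_of_tendsto (tendsto_measureReal_Iio_atTop Z.ν)
    have hm := monotone_measureReal_Iio Z.ν
    have hbd : ∃ C, ∀ x, |Z.ν.real (Iio x)| ≤ C := ⟨Z.ν.real univ, fun x => by
      rw [abs_of_nonneg measureReal_nonneg]; exact measureReal_mono (subset_univ _)⟩
    rw [hbE] at hb
    -- As `ξ - E ≤ y ξ ≤ ξ`, the value `H ξ` lies between `ν (Iio ·)` at `ξ - E` and at `ξ + 1`, and
    -- translations preserve tails.
    refine (hb.comp_add hm.measurable hbd (-Z.ν.real univ)).of_squeeze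
      (hb.comp_add hm.measurable hbd 1) hE.H_mono.measurable (fun ξ => ?_) (fun ξ => ?_)
    · refine le_trans (hm ?_) (le_mapL_H ξ)
      linarith [hE.H_le ξ, hE.add_eq ξ]
    · refine (mapL_H_le ξ).trans (measureReal_mono (Iic_subset_Iio.2 ?_))
      linarith [hE.H_nonneg ξ, hE.add_eq ξ]
  · obtain ⟨a, b, ht⟩ := h.u_tails
    refine ⟨a, b, hasTails_of_bounded (R := Z.ν.real univ) h.U_lip.continuous.measurable
      ⟨C, fun x => hC _⟩ ?_ ?_⟩
    · have hw : MemLp ((Iio (0 : ℝ)).indicator fun x => Z.u x - a) 2 volume :=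
        (memLp_indicator_iff_restrict measurableSet_Iio).2 ht.1
      have := (h.memLp_comp_mapL_y ((h.u_prim.continuous.measurable.sub_const a).indicator
        measurableSet_Iio) hw ⟨C + |a|, fun x => ?_⟩).restrict (Iio (-Z.ν.real univ))
      · refine this.ae_eq ((ae_restrict_iff' measurableSet_Iio).2 (ae_of_all _ fun ξ hξ => ?_))
        have h1 : (mapL Z).y ξ ∈ Iio (0 : ℝ) := by
          have := hE.add_eq ξ; have := hE.H_nonneg ξ; have := hE.E_nonneg
          simp only [mem_Iio] at *; linarith
        simp only [indicator_of_mem h1]; rfl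
      · rw [← Real.norm_eq_abs]
        refine (norm_indicator_le_norm_self _ _).trans ?_
        exact (norm_sub_le _ _).trans (add_le_add_left (hC x) _)
    · have hw : MemLp ((Ioi (0 : ℝ)).indicator fun x => Z.u x - b) 2 volume :=
        (memLp_indicator_iff_restrict measurableSet_Ioi).2 ht.2
      have := (h.memLp_comp_mapL_y ((h.u_prim.continuous.measurable.sub_const b).indicator
        measurableSet_Ioi) hw ⟨C + |b|, fun x => ?_⟩).restrict (Ioi (Z.ν.real univ))
      · refine this.ae_eq ((ae_restrict_iff' measurableSet_Ioi).2 (ae_of_all _ fun ξ hξ => ?_))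
        have h1 : (mapL Z).y ξ ∈ Ioi (0 : ℝ) := by
          have := hE.add_eq ξ; have := hE.H_le ξ
          simp only [mem_Ioi] at *; linarith
        simp only [indicator_of_mem h1]; rfl
      · rw [← Real.norm_eq_abs]
        refine (norm_indicator_le_norm_self _ _).trans ?_
        exact (norm_sub_le _ _).trans (add_le_add_left (hC x) _)
  · filter_upwards [h.ae_deriv_mapL, hE.deriv_add] with ξ h1 h2
    rcases h1 with ⟨h3, h4⟩ | ⟨-, -, h3, h4⟩
    · rw [h3, h4]; ring
    · rw [h4]
      have : deriv (mapL Z).H ξ = deriv Z.u ((mapL Z).y ξ) ^ 2 * deriv (mapL Z).y ξ := by linarith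
      rw [this]; ring

end EulData

lemma MemD0.eulData {Z : Eul} (hZ : MemD0 Z) : EulData Z := by
  have := hZ.1.finite_nu
  obtain ⟨hp, h2, ht⟩ := hZ.1.u_mem.exists_hasTails
  refine ⟨hZ.1.finite_nu, hZ.2, hp, ht, hZ.1.G_mem.exists_hasTails, ?_⟩
  have h3 := hZ.1.ac_eq
  rw [hZ.2, acPart, withDensity_eq_iff_of_sigmaFinite (Measure.measurable_rnDeriv _ _).aemeasurable
    ((measurable_deriv _).pow_const 2).ennreal_ofReal.aemeasurable] at h3
  filter_upwards [h3, ae_hasDerivAt_measureReal_Iio Z.ν] with x h4 h5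
  rw [h4, ENNReal.toReal_ofReal (sq_nonneg _)] at h5
  exact h5

namespace EnergyData

variable {X : Lag} {E : ℝ} (h : EnergyData X E)
include h

lemma memLp_deriv_H : MemLp (deriv X.H) 2 volume := by
  rw [memLp_two_iff_integrable_sq (measurable_deriv _).aestronglyMeasurable]
  refine h.integrable_deriv_H.mono' ((measurable_deriv _).pow_const 2).aestronglyMeasurable
    (ae_of_all _ fun ξ => ?_)
  rw [Real.norm_of_nonneg (sq_nonneg _)]
  nlinarith [h.deriv_H_nonneg ξ, h.deriv_H_le ξ]

end EnergyData

lemma InitData.memLp_deriv_U {X : Lag} {E : ℝ} (h : InitData X E) :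
    MemLp (deriv X.U) 2 volume := by
  rw [memLp_two_iff_integrable_sq (measurable_deriv _).aestronglyMeasurable]
  refine h.integrable_deriv_H.mono' ((measurable_deriv _).pow_const 2).aestronglyMeasurable ?_
  filter_upwards [h.rel, h.deriv_add] with ξ h1 h2
  rw [Real.norm_of_nonneg (sq_nonneg _), h1]
  nlinarith [h.deriv_H_nonneg ξ, h.deriv_H_le ξ, h.deriv_y_nonneg ξ]

/-! ## Cumulative distribution of an integrable density -/

section Cumulative

variable {f : ℝ → ℝ}

lemma integral_Iic_sub (hf : Integrable f) (a b : ℝ) :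
    (∫ η in Iic b, f η) - ∫ η in Iic a, f η = ∫ η in a..b, f η :=
  intervalIntegral.integral_Iic_sub_Iic hf.integrableOn hf.integrableOn

lemma ae_hasDerivAt_integral_Iic (hf : Integrable f) :
    ∀ᵐ ξ, HasDerivAt (fun ξ => ∫ η in Iic ξ, f η) (f ξ) ξ := by
  filter_upwards [LocallyIntegrable.ae_hasDerivAt_integral hf.locallyIntegrable] with ξ hξ
  have h1 : (fun ξ => ∫ η in Iic ξ, f η) = fun ξ => (∫ η in Iic 0, f η) + ∫ η in (0 : ℝ)..ξ, f η := by
    ext ξ; rw [← integral_Iic_sub hf]; ring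
  rw [h1]
  exact (hξ 0).const_add _

lemma lipschitzWith_integral_Iic (hf : Integrable f) {C : NNReal} (hC : ∀ x, |f x| ≤ C) :
    LipschitzWith C (fun ξ => ∫ η in Iic ξ, f η) := by
  refine LipschitzWith.of_dist_le_mul fun x y => ?_
  rw [Real.dist_eq, integral_Iic_sub hf, Real.dist_eq]
  exact intervalIntegral.norm_integral_le_of_norm_le_const (f := f) fun t _ => hC t

/-- As `0 ≤ f ≤ C H_ξ`, the distance of the cumulative function from its limits is at most `C` times
that of `H`, at both ends. -/
lemma hasTails_integral_Iic {X : Lag} {E : ℝ} (h : EnergyData X E) (ht : HasTails X.H 0 E)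
    (hf : Integrable f) {C : ℝ} (h0 : ∀ x, 0 ≤ f x) (hC : ∀ x, f x ≤ C * deriv X.H x) :
    HasTails (fun ξ => ∫ η in Iic ξ, f η) 0 (∫ η, f η) := by
  have hi := h.integrable_deriv_H.const_mul C
  have hm : Monotone fun ξ => ∫ η in Iic ξ, f η := fun a b hab => by
    have := integral_Iic_sub hf a b
    have h2 : 0 ≤ ∫ η in a..b, f η := intervalIntegral.integral_nonneg hab fun x _ => h0 x
    simp only; linarith
  refine ⟨((ht.1.const_mul C)).mono' (hm.measurable.sub_const _).aestronglyMeasurable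
    (ae_of_all _ fun ξ => ?_), ((ht.2.const_mul (-C))).mono'
    (hm.measurable.sub_const _).aestronglyMeasurable (ae_of_all _ fun ξ => ?_)⟩
  · rw [sub_zero, sub_zero, Real.norm_of_nonneg (integral_nonneg h0), ← h.integral_Iic_deriv_H,
      ← integral_const_mul]
    exact integral_mono hf.integrableOn hi.integrableOn hC
  · have h1 : ∀ g : ℝ → ℝ, Integrable g → ∫ η in Iic ξ, g η = (∫ η, g η) - ∫ η in Ioi ξ, g η := by
      intro g hg
      rw [← integral_add_compl (measurableSet_Iic (a := ξ)) hg, compl_Iic]; ring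
    beta_reduce
    rw [h1 f hf, ← h.integral_Iic_deriv_H, ← h.integral_deriv_H, h1 _ h.integrable_deriv_H]
    rw [sub_sub_cancel_left, sub_sub_cancel_left, norm_neg, neg_mul_neg,
      Real.norm_of_nonneg (integral_nonneg h0), ← integral_const_mul]
    exact integral_mono hf.integrableOn hi.integrableOn hC

lemma HasTails.bounded {a b : ℝ} {K : NNReal} (ht : HasTails f a b) (hf : LipschitzWith K f) :
    ∃ C, ∀ x, |f x| ≤ C :=
  exists_bound_of_tendsto hf.continuous (ht.tendsto_atBot hf.uniformContinuous)
    (ht.tendsto_atTop hf.uniformContinuous)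

end Cumulative

/-! ## The evolution with prescribed energy losses -/

/-- The wave breaking time at points where `U_ξ < 0`. -/
noncomputable def breakTime (X : Lag) (η : ℝ) : ℝ := -2 * deriv X.y η / deriv X.U η

open Classical in
/-- The indicator function of the event that wave breaking has occurred until time `t`. -/
noncomputable def broken (X : Lag) (t η : ℝ) : ℝ :=
  if deriv X.U η < 0 ∧ breakTime X η ≤ t then 1 else 0

open Classical in
/-- The time that has elapsed since wave breaking. -/
noncomputable def elapsed (X : Lag) (t η : ℝ) : ℝ :=
  if deriv X.U η < 0 then max (t - breakTime X η) 0 else 0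

/-- The energy density at time `t` if the fraction `β` is lost at wave breaking. -/
noncomputable def dens0 (X : Lag) (β : ℝ → ℝ) (t η : ℝ) : ℝ :=
  (1 - β η * broken X t η) * deriv X.H η

/-- The time integral of `dens0`. -/
noncomputable def dens1 (X : Lag) (β : ℝ → ℝ) (t η : ℝ) : ℝ :=
  (t - β η * elapsed X t η) * deriv X.H η

/-- The time integral of `dens1`. -/
noncomputable def dens2 (X : Lag) (β : ℝ → ℝ) (t η : ℝ) : ℝ :=
  (t ^ 2 / 2 - β η * (elapsed X t η ^ 2 / 2)) * deriv X.H η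

/-- The solution of the Lagrangian system with initial data `X`, if the fraction `β` of the energy
is lost at wave breaking. -/
noncomputable def evo (X : Lag) (β : ℝ → ℝ) (t : ℝ) : Lag where
  y := fun ξ => X.y ξ + t * X.U ξ + 1 / 2 * (∫ η in Iic ξ, dens2 X β t η)
    - 1 / 4 * ∫ η, dens2 X β t η
  U := fun ξ => X.U ξ + 1 / 2 * (∫ η in Iic ξ, dens1 X β t η) - 1 / 4 * ∫ η, dens1 X β t η
  V := fun ξ => ∫ η in Iic ξ, dens0 X β t η
  H := X.H

lemma measurable_breakTime (X : Lag) : Measurable (breakTime X) :=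
  ((measurable_deriv _).const_mul (-2)).div (measurable_deriv _)

lemma measurable_broken (X : Lag) : Measurable fun p : ℝ × ℝ => broken X p.1 p.2 := by
  refine Measurable.ite (MeasurableSet.inter ?_ ?_) measurable_const measurable_const
  · exact measurableSet_lt ((measurable_deriv X.U).comp measurable_snd)
      (measurable_const (a := (0 : ℝ)))
  · exact measurableSet_le ((measurable_breakTime X).comp measurable_snd) measurable_fst

lemma measurable_elapsed (X : Lag) : Measurable fun p : ℝ × ℝ => elapsed X p.1 p.2 := by
  refine Measurable.ite ?_ ?_ measurable_const
  · exact measurableSet_lt ((measurable_deriv X.U).comp measurable_snd)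
      (measurable_const (a := (0 : ℝ)))
  · exact (measurable_fst.sub ((measurable_breakTime X).comp measurable_snd)).max
      (measurable_const (a := (0 : ℝ)))

lemma broken_mem (X : Lag) (t η : ℝ) : 0 ≤ broken X t η ∧ broken X t η ≤ 1 := by
  unfold broken; split_ifs <;> norm_num

lemma elapsed_nonneg (X : Lag) (t η : ℝ) : 0 ≤ elapsed X t η := by
  unfold elapsed; split_ifs
  · exact le_max_right _ _
  · exact le_rfl

/-! ### Bounds, measurability and integrability of the densities -/

section Densities

variable {X : Lag} {E : ℝ} (h : EnergyData X E) {β : ℝ → ℝ}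

include h in
lemma breakTime_nonneg {η : ℝ} (hU : deriv X.U η < 0) : 0 ≤ breakTime X η :=
  div_nonneg_of_nonpos (by linarith [h.deriv_y_nonneg η]) hU.le

include h in
lemma elapsed_le {t : ℝ} (ht : 0 ≤ t) (η : ℝ) : elapsed X t η ≤ t := by
  unfold elapsed; split_ifs with hU
  · exact max_le (by linarith [breakTime_nonneg h hU]) ht
  · exact ht

lemma measurable_dens0 (hβ : Measurable β) : Measurable fun p : ℝ × ℝ => dens0 X β p.1 p.2 :=
  (measurable_const.sub ((hβ.comp measurable_snd).mul (measurable_broken X))).mul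
    ((measurable_deriv _).comp measurable_snd)

lemma measurable_dens1 (hβ : Measurable β) : Measurable fun p : ℝ × ℝ => dens1 X β p.1 p.2 :=
  (measurable_fst.sub ((hβ.comp measurable_snd).mul (measurable_elapsed X))).mul
    ((measurable_deriv _).comp measurable_snd)

lemma measurable_dens2 (hβ : Measurable β) : Measurable fun p : ℝ × ℝ => dens2 X β p.1 p.2 :=
  (((measurable_fst.pow_const 2).div_const 2).sub ((hβ.comp measurable_snd).mul
    (((measurable_elapsed X).pow_const 2).div_const 2))).mul
    ((measurable_deriv _).comp measurable_snd)

include h in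
lemma integrable_of_le_deriv_H {f : ℝ → ℝ} (hf : Measurable f) {C : ℝ} (h0 : ∀ x, 0 ≤ f x)
    (hC : ∀ x, f x ≤ C * deriv X.H x) : Integrable f :=
  (h.integrable_deriv_H.const_mul C).mono' hf.aestronglyMeasurable (ae_of_all _ fun x => by
    rw [Real.norm_of_nonneg (h0 x)]; exact hC x)

variable (hb : ∀ η, β η ∈ Icc (0 : ℝ) 1)
include h hb

lemma dens0_nonneg (t η : ℝ) : 0 ≤ dens0 X β t η := by
  refine mul_nonneg ?_ (h.deriv_H_nonneg η)
  have := broken_mem X t η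
  nlinarith [(hb η).1, (hb η).2]

lemma dens0_le (t η : ℝ) : dens0 X β t η ≤ 1 * deriv X.H η := by
  refine mul_le_mul_of_nonneg_right ?_ (h.deriv_H_nonneg η)
  have := broken_mem X t η
  nlinarith [(hb η).1, (hb η).2, mul_nonneg (hb η).1 this.1]

lemma dens1_nonneg {t : ℝ} (ht : 0 ≤ t) (η : ℝ) : 0 ≤ dens1 X β t η := by
  refine mul_nonneg ?_ (h.deriv_H_nonneg η)
  have h1 := elapsed_nonneg X t η
  have h2 := elapsed_le h ht η
  nlinarith [(hb η).1, (hb η).2]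

lemma dens1_le (t η : ℝ) : dens1 X β t η ≤ t * deriv X.H η := by
  refine mul_le_mul_of_nonneg_right ?_ (h.deriv_H_nonneg η)
  linarith [mul_nonneg (hb η).1 (elapsed_nonneg X t η)]

lemma dens2_nonneg {t : ℝ} (ht : 0 ≤ t) (η : ℝ) : 0 ≤ dens2 X β t η := by
  refine mul_nonneg ?_ (h.deriv_H_nonneg η)
  have h1 := elapsed_nonneg X t η
  have h2 := elapsed_le h ht η
  have h3 : elapsed X t η ^ 2 ≤ t ^ 2 := by gcongr
  nlinarith [(hb η).1, (hb η).2, sq_nonneg (elapsed X t η)]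

lemma dens2_le (t η : ℝ) : dens2 X β t η ≤ t ^ 2 / 2 * deriv X.H η := by
  refine mul_le_mul_of_nonneg_right ?_ (h.deriv_H_nonneg η)
  have := mul_nonneg (hb η).1 (sq_nonneg (elapsed X t η))
  linarith

variable (hβ : Measurable β)
include hβ

lemma integrable_dens0 (t : ℝ) : Integrable (dens0 X β t) :=
  integrable_of_le_deriv_H h ((measurable_dens0 hβ).comp measurable_prodMk_left)
    (dens0_nonneg h hb t) (dens0_le h hb t)

lemma integrable_dens1 {t : ℝ} (ht : 0 ≤ t) : Integrable (dens1 X β t) :=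
  integrable_of_le_deriv_H h ((measurable_dens1 hβ).comp measurable_prodMk_left)
    (dens1_nonneg h hb ht) (dens1_le h hb t)

lemma integrable_dens2 {t : ℝ} (ht : 0 ≤ t) : Integrable (dens2 X β t) :=
  integrable_of_le_deriv_H h ((measurable_dens2 hβ).comp measurable_prodMk_left)
    (dens2_nonneg h hb ht) (dens2_le h hb t)

end Densities

/-! ### Integration in time -/

lemma integral_indicator_le {b t : ℝ} (hb : 0 ≤ b) (ht : 0 ≤ t) :
    IntervalIntegrable (fun s => if b ≤ s then (1 : ℝ) else 0) volume 0 t ∧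
      ∫ s in (0 : ℝ)..t, (if b ≤ s then (1 : ℝ) else 0) = max (t - b) 0 := by
  have hm : Monotone fun s : ℝ => if b ≤ s then (1 : ℝ) else 0 := fun x y hxy => by
    simp only
    split_ifs with h1 h2
    · exact le_rfl
    · exact absurd (h1.trans hxy) h2
    · exact zero_le_one
    · exact le_rfl
  have hi : ∀ x y, IntervalIntegrable (fun s => if b ≤ s then (1 : ℝ) else 0) volume x y :=
    fun x y => hm.intervalIntegrable
  refine ⟨hi _ _, ?_⟩
  have h0 : ∀ c, c ≤ b → 0 ≤ c → ∫ s in (0 : ℝ)..c, (if b ≤ s then (1 : ℝ) else 0) = 0 := by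
    intro c hc hc0
    rw [intervalIntegral.integral_of_le hc0, integral_Ioc_eq_integral_Ioo]
    refine setIntegral_eq_zero_of_forall_eq_zero fun s hs => ?_
    rw [if_neg (by linarith [hs.2])]
  rcases le_total t b with htb | hbt
  · rw [h0 t htb ht, max_eq_right (by linarith)]
  · rw [← intervalIntegral.integral_add_adjacent_intervals (hi 0 b) (hi b t), h0 b le_rfl hb,
      zero_add, max_eq_left (by linarith)]
    rw [intervalIntegral.integral_congr (g := fun _ => (1 : ℝ)) fun s hs => ?_]
    · simp
    · rw [uIcc_of_le hbt] at hs
      simp [hs.1]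

lemma integral_posPart_sub {b t : ℝ} (hb : 0 ≤ b) (ht : 0 ≤ t) :
    ∫ s in (0 : ℝ)..t, max (s - b) 0 = max (t - b) 0 ^ 2 / 2 := by
  have hc : Continuous fun s : ℝ => max (s - b) 0 := by fun_prop
  have h0 : ∀ c, c ≤ b → 0 ≤ c → ∫ s in (0 : ℝ)..c, max (s - b) 0 = 0 := by
    intro c hc hc0
    rw [intervalIntegral.integral_congr (g := fun _ => (0 : ℝ)) fun s hs => ?_]
    · simp
    · rw [uIcc_of_le hc0] at hs
      exact max_eq_right (by linarith [hs.2])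
  rcases le_total t b with htb | hbt
  · rw [h0 t htb ht, max_eq_right (by linarith)]; norm_num
  · rw [← intervalIntegral.integral_add_adjacent_intervals (hc.intervalIntegrable 0 b)
      (hc.intervalIntegrable b t), h0 b le_rfl hb, zero_add, max_eq_left (by linarith)]
    rw [intervalIntegral.integral_congr (g := fun s => s - b) fun s hs => ?_]
    · rw [intervalIntegral.integral_comp_sub_right (fun s => s) b, integral_id]; ring
    · rw [uIcc_of_le hbt] at hs
      exact max_eq_left (by linarith [hs.1])

section TimeIntegral

variable {X : Lag} {E : ℝ} (h : EnergyData X E) {β : ℝ → ℝ}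
include h

lemma integral_dens0 {t : ℝ} (ht : 0 ≤ t) (η : ℝ) :
    ∫ s in (0 : ℝ)..t, dens0 X β s η = dens1 X β t η := by
  unfold dens0 dens1 broken elapsed
  by_cases hU : deriv X.U η < 0
  · simp only [hU, true_and, if_true]
    have hi := integral_indicator_le (breakTime_nonneg h hU) ht
    rw [intervalIntegral.integral_mul_const, intervalIntegral.integral_sub (by simp)
      (hi.1.const_mul _), intervalIntegral.integral_const_mul, hi.2]
    simp
  · simp [hU]

lemma integral_dens1 {t : ℝ} (ht : 0 ≤ t) (η : ℝ) :
    ∫ s in (0 : ℝ)..t, dens1 X β s η = dens2 X β t η := by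
  unfold dens1 dens2 elapsed
  by_cases hU : deriv X.U η < 0
  · simp only [hU, if_true]
    have hc : Continuous fun s : ℝ => max (s - breakTime X η) 0 := by fun_prop
    rw [intervalIntegral.integral_mul_const, intervalIntegral.integral_sub (by simp)
      ((hc.intervalIntegrable _ _).const_mul _), intervalIntegral.integral_const_mul,
      integral_posPart_sub (breakTime_nonneg h hU) ht, integral_id]
    simp
  · simp [hU]

omit h in
lemma intervalIntegral_setIntegral_swap {f : ℝ → ℝ → ℝ} {g : ℝ → ℝ} {t : ℝ} (ht : 0 ≤ t)
    (hf : Measurable fun p : ℝ × ℝ => f p.1 p.2) (hg : Integrable g)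
    (hfg : ∀ s ∈ Ioc 0 t, ∀ η, |f s η| ≤ g η) (A : Set ℝ) :
    ∫ s in (0 : ℝ)..t, ∫ η in A, f s η = ∫ η in A, ∫ s in (0 : ℝ)..t, f s η := by
  simp_rw [intervalIntegral.integral_of_le ht]
  refine integral_integral_swap ?_
  have : IsFiniteMeasure (volume.restrict (Ioc 0 t)) := ⟨by simp⟩
  refine Integrable.mono' ((hg.integrableOn (s := A)).integrable.comp_snd (volume.restrict (Ioc 0 t)))
    hf.aestronglyMeasurable ?_
  have h1 : ∀ᵐ s ∂(volume.restrict (Ioc 0 t)), s ∈ Ioc 0 t := ae_restrict_mem measurableSet_Ioc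
  have h2 := (Measure.quasiMeasurePreserving_fst (μ := volume.restrict (Ioc 0 t))
    (ν := volume.restrict A)).ae h1
  filter_upwards [h2] with p hp
  exact hfg _ hp _

variable (hb : ∀ η, β η ∈ Icc (0 : ℝ) 1) (hβ : Measurable β)
include hb hβ

lemma integral_setIntegral_dens0 {t : ℝ} (ht : 0 ≤ t) (A : Set ℝ) :
    ∫ s in (0 : ℝ)..t, ∫ η in A, dens0 X β s η = ∫ η in A, dens1 X β t η := by
  rw [intervalIntegral_setIntegral_swap ht (measurable_dens0 hβ)
    (h.integrable_deriv_H.const_mul 1) fun s _ η => by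
      rw [abs_of_nonneg (dens0_nonneg h hb s η)]; exact dens0_le h hb s η]
  simp_rw [integral_dens0 h ht]

lemma integral_setIntegral_dens1 {t : ℝ} (ht : 0 ≤ t) (A : Set ℝ) :
    ∫ s in (0 : ℝ)..t, ∫ η in A, dens1 X β s η = ∫ η in A, dens2 X β t η := by
  rw [intervalIntegral_setIntegral_swap ht (measurable_dens1 hβ)
    (h.integrable_deriv_H.const_mul t) fun s hs η => by
      rw [abs_of_nonneg (dens1_nonneg h hb hs.1.le η)]
      exact (dens1_le h hb s η).trans
        (mul_le_mul_of_nonneg_right hs.2 (h.deriv_H_nonneg η))]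
  simp_rw [integral_dens1 h ht]

end TimeIntegral

/-! ## Pointwise structure of the evolution -/

/-- The relations between the derivatives of Lagrangian initial data at a point. -/
structure RegularAt (X : Lag) (ξ : ℝ) : Prop where
  y_nonneg : 0 ≤ deriv X.y ξ
  H_nonneg : 0 ≤ deriv X.H ξ
  add_eq : deriv X.y ξ + deriv X.H ξ = 1
  rel : deriv X.U ξ ^ 2 = deriv X.y ξ * deriv X.H ξ

lemma InitData.ae_regularAt {X : Lag} {E : ℝ} (h : InitData X E) : ∀ᵐ ξ, RegularAt X ξ := by
  filter_upwards [h.deriv_add, h.rel] with ξ h1 h2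
  exact ⟨h.deriv_y_nonneg ξ, h.deriv_H_nonneg ξ, h1, h2⟩

namespace RegularAt

variable {X : Lag} {ξ : ℝ} (h : RegularAt X ξ)
include h

/-- Given `U_ξ² = y_ξ H_ξ`, the breaking time `τ` and `H_ξ` determine everything: `y_ξ` and `U_ξ`
are the value at `t = 0` of `H_ξ (t - τ)² / 4` and of its time derivative. -/
lemma pos_of_neg (hU : deriv X.U ξ < 0) :
    0 < deriv X.y ξ ∧ 0 < deriv X.H ξ ∧ 0 < breakTime X ξ ∧
      deriv X.U ξ = -(breakTime X ξ * deriv X.H ξ / 2) ∧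
      deriv X.y ξ = breakTime X ξ ^ 2 * deriv X.H ξ / 4 := by
  have h1 : 0 < deriv X.y ξ * deriv X.H ξ := by rw [← h.rel]; nlinarith
  have hy : 0 < deriv X.y ξ := (pos_of_mul_pos_left h1 h.H_nonneg)
  have hH : 0 < deriv X.H ξ := (pos_of_mul_pos_right h1 h.y_nonneg)
  have hb : breakTime X ξ * deriv X.U ξ = -2 * deriv X.y ξ := by
    exact div_mul_cancel₀ _ hU.ne
  have hb0 : 0 < breakTime X ξ := div_pos_of_neg_of_neg (by linarith) hU
  have h2 : breakTime X ξ * deriv X.H ξ = -2 * deriv X.U ξ := by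
    have : deriv X.y ξ * (breakTime X ξ * deriv X.H ξ + 2 * deriv X.U ξ) = 0 := by
      have h3 : breakTime X ξ * (deriv X.y ξ * deriv X.H ξ) = deriv X.U ξ * (-2 * deriv X.y ξ) := by
        rw [← h.rel, ← hb]; ring
      linarith
    rcases mul_eq_zero.1 this with h4 | h4 <;> linarith
  refine ⟨hy, hH, hb0, by linarith, ?_⟩
  have : breakTime X ξ ^ 2 * deriv X.H ξ = breakTime X ξ * (-2 * deriv X.U ξ) := by rw [← h2]; ring
  rw [this]; linarith

variable {β : ℝ → ℝ} {t : ℝ}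

/-- Before breaking. -/
lemma formulas_of_lt (hU : deriv X.U ξ < 0) (ht : t < breakTime X ξ) :
    deriv X.y ξ + t * deriv X.U ξ + 1 / 2 * dens2 X β t ξ
      = deriv X.H ξ / 4 * (t - breakTime X ξ) ^ 2 ∧
    deriv X.U ξ + 1 / 2 * dens1 X β t ξ = deriv X.H ξ / 2 * (t - breakTime X ξ) ∧
    dens0 X β t ξ = deriv X.H ξ := by
  obtain ⟨-, -, -, h1, h2⟩ := h.pos_of_neg hU
  have he : elapsed X t ξ = 0 := by
    simp only [elapsed, hU, if_true]; exact max_eq_right (by linarith)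
  have hi : broken X t ξ = 0 := by simp [broken, ht]
  unfold dens0 dens1 dens2
  rw [he, hi, h1, h2]
  refine ⟨by ring, by ring, by ring⟩

/-- After breaking. -/
lemma formulas_of_le (hU : deriv X.U ξ < 0) (ht : breakTime X ξ ≤ t) :
    deriv X.y ξ + t * deriv X.U ξ + 1 / 2 * dens2 X β t ξ
      = (1 - β ξ) * deriv X.H ξ / 4 * (t - breakTime X ξ) ^ 2 ∧
    deriv X.U ξ + 1 / 2 * dens1 X β t ξ = (1 - β ξ) * deriv X.H ξ / 2 * (t - breakTime X ξ) ∧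
    dens0 X β t ξ = (1 - β ξ) * deriv X.H ξ := by
  obtain ⟨-, -, -, h1, h2⟩ := h.pos_of_neg hU
  have he : elapsed X t ξ = t - breakTime X ξ := by
    simp only [elapsed, hU, if_true]; exact max_eq_left (by linarith)
  have hi : broken X t ξ = 1 := by simp [broken, ht, hU]
  unfold dens0 dens1 dens2
  rw [he, hi, h1, h2]
  refine ⟨by ring, by ring, by ring⟩

omit h in
/-- At points that never break. -/
lemma formulas_of_nonneg (hU : ¬ deriv X.U ξ < 0) :
    deriv X.y ξ + t * deriv X.U ξ + 1 / 2 * dens2 X β t ξ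
      = deriv X.y ξ + t * deriv X.U ξ + t ^ 2 / 4 * deriv X.H ξ ∧
    deriv X.U ξ + 1 / 2 * dens1 X β t ξ = deriv X.U ξ + t / 2 * deriv X.H ξ ∧
    dens0 X β t ξ = deriv X.H ξ := by
  have he : elapsed X t ξ = 0 := by simp [elapsed, hU]
  have hi : broken X t ξ = 0 := by simp [broken, hU]
  unfold dens0 dens1 dens2
  rw [he, hi]
  refine ⟨by ring, by ring, by ring⟩

variable (ht : 0 ≤ t) (hb : β ξ ∈ Icc (0 : ℝ) 1)
include ht hb

/-- For a label with `U_ξ < 0` initially, `y_ξ = c (t - τ)² / 4`, `U_ξ = c (t - τ) / 2` and `V_ξ =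
c`, where `c` is `H_ξ` before breaking and `(1 - β) H_ξ` afterwards. The identity and the sign
statement can be read off from this; the remaining labels never acquire a negative `U_ξ`. -/
lemma evolved :
    0 ≤ deriv X.y ξ + t * deriv X.U ξ + 1 / 2 * dens2 X β t ξ ∧
    (deriv X.y ξ + t * deriv X.U ξ + 1 / 2 * dens2 X β t ξ) * dens0 X β t ξ =
      (deriv X.U ξ + 1 / 2 * dens1 X β t ξ) ^ 2 ∧
    1 / (2 * (1 + t ^ 2)) ≤
      deriv X.y ξ + t * deriv X.U ξ + 1 / 2 * dens2 X β t ξ + deriv X.H ξ ∧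
    (deriv X.U ξ + 1 / 2 * dens1 X β t ξ < 0 → broken X t ξ = 0) := by
  have hb1 : 0 ≤ 1 - β ξ := by linarith [hb.2]
  have hc : 1 / (2 * (1 + t ^ 2)) ≤ 1 := by
    rw [div_le_one (by positivity)]; nlinarith [sq_nonneg t]
  by_cases hU : deriv X.U ξ < 0
  · obtain ⟨hy, hH, hbt, e1, e2⟩ := h.pos_of_neg hU
    have hsum : deriv X.H ξ * (1 + breakTime X ξ ^ 2 / 4) = 1 := by
      have := h.add_eq; rw [e2] at this; linarith
    rcases lt_or_ge t (breakTime X ξ) with hlt | hge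
    · obtain ⟨f1, f2, f3⟩ := h.formulas_of_lt (β := β) hU hlt
      rw [f1, f2, f3]
      refine ⟨by positivity, by ring, ?_, fun _ => by simp [broken, hlt]⟩
      rw [div_le_iff₀ (by positivity)]
      -- Follows from `τ² ≤ 2 (t - τ)² + 2 t²`; it is combined with the normalization `H_ξ (1 +
      -- τ²/4) = 1`.
      have : 1 + breakTime X ξ ^ 2 / 4 ≤ ((t - breakTime X ξ) ^ 2 / 4 + 1) * (2 * (1 + t ^ 2)) := by
        nlinarith [sq_nonneg (t - breakTime X ξ), sq_nonneg (2 * t - breakTime X ξ), sq_nonneg t,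
          mul_nonneg (sq_nonneg (t - breakTime X ξ)) (sq_nonneg t)]
      calc (1 : ℝ) = deriv X.H ξ * (1 + breakTime X ξ ^ 2 / 4) := hsum.symm
        _ ≤ deriv X.H ξ * (((t - breakTime X ξ) ^ 2 / 4 + 1) * (2 * (1 + t ^ 2))) := by gcongr
        _ = _ := by ring
    · obtain ⟨f1, f2, f3⟩ := h.formulas_of_le (β := β) hU hge
      rw [f1, f2, f3]
      have hn : 0 ≤ (1 - β ξ) * deriv X.H ξ / 4 * (t - breakTime X ξ) ^ 2 := by positivity
      refine ⟨hn, by ring, ?_, fun hneg => absurd hneg (not_lt.2 ?_)⟩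
      · rw [div_le_iff₀ (by positivity)]
        have h3 : 1 + breakTime X ξ ^ 2 / 4 ≤ 2 * (1 + t ^ 2) := by nlinarith
        have h4 : 0 ≤ (1 - β ξ) * deriv X.H ξ / 4 * (t - breakTime X ξ) ^ 2 * (2 * (1 + t ^ 2)) := by
          positivity
        nlinarith
      · have := sub_nonneg.2 hge
        positivity
  · obtain ⟨f1, f2, f3⟩ := formulas_of_nonneg (X := X) (β := β) (t := t) hU
    push Not at hU
    have := h.H_nonneg
    have := h.y_nonneg
    rw [f1, f2, f3]
    refine ⟨by positivity, ?_, ?_, fun hneg => by simp [broken, not_lt.2 hU]⟩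
    · have := h.rel; nlinarith
    · have h5 : 0 ≤ t * deriv X.U ξ + t ^ 2 / 4 * deriv X.H ξ := by positivity
      linarith [h.add_eq]

-- As the loss is strictly less than 1, a positive multiple of `(t - τ)²` survives breaking and
-- vanishes only at `t = τ`. A label with `U_ξ ≥ 0` has `y_ξ > 0` at positive times: if `y_ξ`
-- vanishes initially, then `H_ξ = 1`.
omit ht hb in
lemma breaks_of_evolved_y_eq_zero (hb1 : β ξ < 1) (ht0 : 0 < t)
    (h0 : deriv X.y ξ + t * deriv X.U ξ + 1 / 2 * dens2 X β t ξ = 0) :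
    deriv X.U ξ < 0 ∧ breakTime X ξ = t := by
  by_cases hU : deriv X.U ξ < 0
  · refine ⟨hU, ?_⟩
    obtain ⟨hy, hH, hbt, e1, e2⟩ := h.pos_of_neg hU
    have hb2 : 0 < 1 - β ξ := by linarith
    have key : (t - breakTime X ξ) ^ 2 = 0 := by
      rcases lt_or_ge t (breakTime X ξ) with hlt | hge
      · rw [(h.formulas_of_lt (β := β) hU hlt).1] at h0
        rcases mul_eq_zero.1 h0 with h1 | h1
        · linarith
        · exact h1
      · rw [(h.formulas_of_le (β := β) hU hge).1] at h0
        rcases mul_eq_zero.1 h0 with h1 | h1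
        · have : 0 < (1 - β ξ) * deriv X.H ξ / 4 := by positivity
          linarith
        · exact h1
    have := pow_eq_zero_iff (two_ne_zero) |>.1 key
    linarith
  · exfalso
    rw [(formulas_of_nonneg (X := X) (β := β) (t := t) hU).1] at h0
    push Not at hU
    have h1 := h.H_nonneg
    have h2 := h.y_nonneg
    have h3 : 0 ≤ t * deriv X.U ξ := by positivity
    have h4 : 0 ≤ t ^ 2 / 4 * deriv X.H ξ := by positivity
    have h5 : deriv X.y ξ = 0 := by linarith
    have h6 : deriv X.H ξ = 1 := by linarith [h.add_eq]
    rw [h6] at h0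
    have : 0 < t ^ 2 := by positivity
    linarith

end RegularAt

/-! ## Regularity of the evolution -/

section Evo

variable {X : Lag} {E : ℝ} (h : InitData X E) {β : ℝ → ℝ} (hb : ∀ η, β η ∈ Icc (0 : ℝ) 1)
  (hβ : Measurable β) {t : ℝ} (ht : 0 ≤ t)
include h hb hβ

lemma ae_hasDerivAt_evo_V :
    ∀ᵐ ξ, HasDerivAt (evo X β t).V (dens0 X β t ξ) ξ :=
  ae_hasDerivAt_integral_Iic (integrable_dens0 h.toEnergyData hb hβ t)

lemma lipschitzWith_evo_V : LipschitzWith 1 (evo X β t).V := by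
  refine lipschitzWith_integral_Iic (integrable_dens0 h.toEnergyData hb hβ t) fun x => ?_
  rw [abs_of_nonneg (dens0_nonneg h.toEnergyData hb t x)]
  have := dens0_le h.toEnergyData hb t x
  simpa using (this.trans (by linarith [h.deriv_H_le x]))

lemma hasTails_evo_V : HasTails (evo X β t).V 0 (∫ η, dens0 X β t η) :=
  hasTails_integral_Iic h.toEnergyData h.H_tails (integrable_dens0 h.toEnergyData hb hβ t)
    (dens0_nonneg h.toEnergyData hb t) (dens0_le h.toEnergyData hb t)

include ht

lemma ae_hasDerivAt_evo_U :
    ∀ᵐ ξ, HasDerivAt (evo X β t).U (deriv X.U ξ + 1 / 2 * dens1 X β t ξ) ξ := by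
  obtain ⟨K, hK⟩ := h.U_lip
  filter_upwards [ae_hasDerivAt_integral_Iic (integrable_dens1 h.toEnergyData hb hβ ht),
    hK.isPrimitive.ae_differentiableAt] with ξ h1 h2
  exact (h2.hasDerivAt.add (h1.const_mul (1 / 2))).sub_const _

lemma ae_hasDerivAt_evo_y :
    ∀ᵐ ξ, HasDerivAt (evo X β t).y
      (deriv X.y ξ + t * deriv X.U ξ + 1 / 2 * dens2 X β t ξ) ξ := by
  obtain ⟨K, hK⟩ := h.U_lip
  filter_upwards [ae_hasDerivAt_integral_Iic (integrable_dens2 h.toEnergyData hb hβ ht),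
    hK.isPrimitive.ae_differentiableAt, h.y_lip.isPrimitive.ae_differentiableAt] with ξ h1 h2 h3
  exact ((h3.hasDerivAt.add (h2.hasDerivAt.const_mul t)).add (h1.const_mul (1 / 2))).sub_const _

lemma lipschitzWith_evo_U : ∃ K, LipschitzWith K (evo X β t).U := by
  obtain ⟨K, hK⟩ := h.U_lip
  have h1 : LipschitzWith (Real.toNNReal t) fun ξ => ∫ η in Iic ξ, dens1 X β t η := by
    refine lipschitzWith_integral_Iic (integrable_dens1 h.toEnergyData hb hβ ht) fun x => ?_
    rw [abs_of_nonneg (dens1_nonneg h.toEnergyData hb ht x), Real.coe_toNNReal _ ht]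
    refine (dens1_le h.toEnergyData hb t x).trans ?_
    nlinarith [h.deriv_H_le x]
  exact ⟨_, (hK.add ((lipschitzWith_smul (1 / 2 : ℝ)).comp h1)).sub
    (LipschitzWith.const (1 / 4 * ∫ η, dens1 X β t η))⟩

lemma lipschitzWith_evo_y : ∃ K, LipschitzWith K (evo X β t).y := by
  obtain ⟨K, hK⟩ := h.U_lip
  have h1 : LipschitzWith (Real.toNNReal (t ^ 2 / 2)) fun ξ => ∫ η in Iic ξ, dens2 X β t η := by
    refine lipschitzWith_integral_Iic (integrable_dens2 h.toEnergyData hb hβ ht) fun x => ?_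
    rw [abs_of_nonneg (dens2_nonneg h.toEnergyData hb ht x), Real.coe_toNNReal _ (by positivity)]
    refine (dens2_le h.toEnergyData hb t x).trans ?_
    nlinarith [h.deriv_H_le x, sq_nonneg t]
  exact ⟨_, ((h.y_lip.add ((lipschitzWith_smul t).comp hK)).add
    ((lipschitzWith_smul (1 / 2 : ℝ)).comp h1)).sub
    (LipschitzWith.const (1 / 4 * ∫ η, dens2 X β t η))⟩

lemma hasTails_evo_U : ∃ a b, HasTails (evo X β t).U a b := by
  obtain ⟨a, b, hab⟩ := h.U_tails
  have h1 := hasTails_integral_Iic h.toEnergyData h.H_tails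
    (integrable_dens1 h.toEnergyData hb hβ ht)
    (dens1_nonneg h.toEnergyData hb ht) (dens1_le h.toEnergyData hb t)
  refine ⟨a - 1 / 4 * ∫ η, dens1 X β t η, b + 1 / 4 * ∫ η, dens1 X β t η, ?_⟩
  have h2 := hab.add (h1.const_mul (1 / 2))
  refine ⟨h2.1.ae_eq (ae_of_all _ fun x => ?_), h2.2.ae_eq (ae_of_all _ fun x => ?_)⟩ <;>
    simp only [evo] <;> ring

lemma hasTails_evo_y : ∃ a b, HasTails (fun ξ => (evo X β t).y ξ - ξ) a b := by
  obtain ⟨a, b, hab⟩ := h.U_tails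
  have h1 := hasTails_integral_Iic h.toEnergyData h.H_tails
    (integrable_dens2 h.toEnergyData hb hβ ht)
    (dens2_nonneg h.toEnergyData hb ht) (dens2_le h.toEnergyData hb t)
  have h2 := ((h.H_tails.const_mul (-1)).add (hab.const_mul t)).add (h1.const_mul (1 / 2))
  refine ⟨t * a - 1 / 4 * ∫ η, dens2 X β t η, -E + t * b + 1 / 4 * ∫ η, dens2 X β t η,
    h2.1.ae_eq (ae_of_all _ fun x => ?_), h2.2.ae_eq (ae_of_all _ fun x => ?_)⟩ <;>
    simp only [evo] <;> linarith [h.add_eq x]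

lemma evo_y_mono : Monotone (evo X β t).y := by
  obtain ⟨K, hK⟩ := lipschitzWith_evo_y h hb hβ ht
  intro a b hab
  rw [← sub_nonneg, hK.isPrimitive.2]
  refine intervalIntegral.integral_nonneg_of_ae hab ?_
  filter_upwards [ae_hasDerivAt_evo_y h hb hβ ht, h.ae_regularAt] with ξ h1 h2
  rw [h1.deriv]
  exact (h2.evolved ht (hb ξ)).1

lemma memLp_dens : MemLp (dens0 X β t) 2 volume ∧ MemLp (dens1 X β t) 2 volume ∧
    MemLp (dens2 X β t) 2 volume := by
  have hH := h.memLp_deriv_H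
  refine ⟨(hH.const_mul 1).mono' (integrable_dens0 h.toEnergyData hb hβ t).1
      (ae_of_all _ fun x => ?_),
    (hH.const_mul t).mono' (integrable_dens1 h.toEnergyData hb hβ ht).1
      (ae_of_all _ fun x => ?_),
    (hH.const_mul (t ^ 2 / 2)).mono' (integrable_dens2 h.toEnergyData hb hβ ht).1
      (ae_of_all _ fun x => ?_)⟩
  · rw [Real.norm_of_nonneg (dens0_nonneg h.toEnergyData hb t x)]
    exact dens0_le h.toEnergyData hb t x
  · rw [Real.norm_of_nonneg (dens1_nonneg h.toEnergyData hb ht x)]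
    exact dens1_le h.toEnergyData hb t x
  · rw [Real.norm_of_nonneg (dens2_nonneg h.toEnergyData hb ht x)]
    exact dens2_le h.toEnergyData hb t x

/-- The evolution stays in `ℱ` if the losses are given by a function of the position at wave
breaking. -/
lemma memF_evo {α : ℝ → ℝ} (hα : ∀ x, α x ∈ Ico (0 : ℝ) 1)
    (hfix : ∀ η, deriv X.U η < 0 → β η = α ((evo X β (breakTime X η)).y η))
    (hb1 : ∀ η, β η < 1) : MemF (evo X β t) := by
  obtain ⟨Ky, hKy⟩ := lipschitzWith_evo_y h hb hβ ht
  obtain ⟨KU, hKU⟩ := lipschitzWith_evo_U h hb hβ ht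
  have hKV := lipschitzWith_evo_V h hb hβ (t := t)
  obtain ⟨a, b, hUt⟩ := hasTails_evo_U h hb hβ ht
  obtain ⟨c, d, hyt⟩ := hasTails_evo_y h hb hβ ht
  have hVt := hasTails_evo_V h hb hβ (t := t)
  have hdy := ae_hasDerivAt_evo_y h hb hβ ht
  have hdU := ae_hasDerivAt_evo_U h hb hβ ht
  have hdV := ae_hasDerivAt_evo_V h hb hβ (t := t)
  obtain ⟨m0, m1, m2⟩ := memLp_dens h hb hβ ht
  have hKyi : LipschitzWith (Ky + 1) fun ξ => (evo X β t).y ξ - ξ := hKy.sub LipschitzWith.id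
  have hmono := evo_y_mono h hb hβ ht
  refine ⟨memE2_of_hasTails hyt hKyi.isPrimitive ?_, memE2_of_hasTails hUt hKU.isPrimitive ?_,
    memE1_of_hasTails hVt hKV.isPrimitive ?_,
    memE1_of_hasTails h.H_tails h.H_lip.isPrimitive h.memLp_deriv_H, ⟨⟨_, hKyi⟩, hyt.bounded hKyi⟩,
    ⟨⟨_, hKU⟩, hUt.bounded hKU⟩, ⟨⟨_, hKV⟩, hVt.bounded hKV⟩,
    ⟨⟨_, h.H_lip⟩, h.H_tails.bounded h.H_lip⟩, ?_, ⟨1 / (2 * (1 + t ^ 2)), by positivity, ?_⟩,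
    ?_, ?_, ?_⟩
  · refine (((h.memLp_deriv_H.const_mul (-1)).add (h.memLp_deriv_U.const_mul t)).add
      (m2.const_mul (1 / 2))).ae_eq ?_
    filter_upwards [hdy, h.deriv_add] with ξ h1 h2
    have h3 : HasDerivAt (fun ξ => (evo X β t).y ξ - ξ) _ ξ := h1.sub (hasDerivAt_id ξ)
    rw [h3.deriv]
    simp only [Pi.add_apply]; linarith
  · refine (h.memLp_deriv_U.add (m1.const_mul (1 / 2))).ae_eq ?_
    filter_upwards [hdU] with ξ h1
    rw [h1.deriv]; rfl
  · refine m0.ae_eq ?_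
    filter_upwards [hdV] with ξ h1
    rw [h1.deriv]
  · exact ae_of_all _ fun ξ => ⟨hmono.deriv_nonneg, h.deriv_H_nonneg ξ⟩
  · filter_upwards [hdy, h.ae_regularAt] with ξ h1 h2
    rw [h1.deriv]
    exact (h2.evolved ht (hb ξ)).2.2.1
  · filter_upwards [hdy, hdU, hdV, h.ae_regularAt] with ξ h1 h2 h3 h4
    rw [h1.deriv, h2.deriv, h3.deriv]
    exact (h4.evolved ht (hb ξ)).2.1
  · filter_upwards [hdV] with ξ h1
    rw [h1.deriv]
    exact ⟨dens0_nonneg h.toEnergyData hb t ξ, (dens0_le h.toEnergyData hb t ξ).trans_eq (one_mul _)⟩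
  · classical
    -- `κ` may depend on the position only. If exactly one label sits at `x`, its own surviving
    -- fraction is taken. If several do, `y` is constant between them, so at a.e. such label `y_ξ =
    -- 0`; for `t > 0` this label breaks exactly at time `t` and loses the fraction `α x`. At `t =
    -- 0` nothing has been lost.
    let Y := (evo X β t).y
    refine ⟨fun x => if hx : ∃ ξ, Y ξ = x ∧ ∀ ξ', Y ξ' = x → ξ' = ξ
      then 1 - β hx.choose * broken X t hx.choose
      else if 0 < t then 1 - α x else 1, fun x => ?_, ?_, ?_⟩
    · dsimp only
      split_ifs with hx h0
      · have h1 := broken_mem X t hx.choose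
        have h2 := hb hx.choose
        have h3 := hb1 hx.choose
        constructor <;> nlinarith [h2.1, mul_nonneg h2.1 h1.1]
      · have := hα x
        constructor <;> linarith [this.1, this.2]
      · simp
    all_goals
      have key : ∀ ξ, HasDerivAt Y (deriv X.y ξ + t * deriv X.U ξ + 1 / 2 * dens2 X β t ξ) ξ →
          (¬ ∃ ξ', Y ξ' = Y ξ ∧ ∀ ξ'', Y ξ'' = Y ξ → ξ'' = ξ') →
          deriv X.y ξ + t * deriv X.U ξ + 1 / 2 * dens2 X β t ξ = 0 := by
        intro ξ hd hx
        push Not at hx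
        obtain ⟨ζ, hζ, hne⟩ := hx ξ rfl
        have hconst : ∀ s ∈ uIcc ξ ζ, Y s = Y ξ := fun s hs => by
          rcases le_total ξ ζ with hle | hle
          · rw [uIcc_of_le hle] at hs
            exact le_antisymm ((hmono hs.2).trans hζ.le) (hmono hs.1)
          · rw [uIcc_of_ge hle] at hs
            exact le_antisymm (hmono hs.2) (hζ.ge.trans (hmono hs.1))
        have h1 : HasDerivWithinAt Y 0 (uIcc ξ ζ) ξ :=
          (hasDerivWithinAt_const ξ _ (Y ξ)).congr hconst rfl
        have huniq : UniqueDiffWithinAt ℝ (uIcc ξ ζ) ξ :=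
          uniqueDiffOn_Icc (by simpa [min_lt_max] using hne) ξ left_mem_uIcc
        exact huniq.eq_deriv _ hd.hasDerivWithinAt h1
    · filter_upwards [hdy, hdV, h.ae_regularAt] with ξ h1 h2 h3
      rw [h2.deriv]
      change dens0 X β t ξ = _ * deriv X.H ξ
      unfold dens0
      congr 1
      split_ifs with hx h0
      · rw [← hx.choose_spec.2 ξ rfl]
      · obtain ⟨hU, hbt⟩ := h3.breaks_of_evolved_y_eq_zero (hb1 ξ) h0 (key ξ h1 hx)
        have h4 := hfix ξ hU
        rw [hbt] at h4
        rw [h4]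
        simp [broken, hU, hbt]
      · have h5 : t = 0 := le_antisymm (not_lt.1 h0) ht
        have : broken X t ξ = 0 := by
          simp only [broken, ite_eq_right_iff, one_ne_zero, imp_false, not_and, not_le]
          intro hU
          rw [h5]; exact (h3.pos_of_neg hU).2.2.1
        rw [this]; ring
    · filter_upwards [hdy, hdU, h.ae_regularAt] with ξ h1 h2 h3
      rw [h2.deriv]
      intro hneg
      have h4 := h3.evolved ht (hb ξ)
      split_ifs with hx h0
      · rw [← hx.choose_spec.2 ξ rfl, h4.2.2.2 hneg]; ring
      · have h5 := h4.2.1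
        rw [key ξ h1 hx, zero_mul] at h5
        nlinarith
      · rfl

end Evo

/-! ## Existence of solutions -/

/-- The combination is a quarter of the difference between the integrals over `Iic ξ` and over its
complement. -/
lemma abs_half_integral_Iic_sub_le {f : ℝ → ℝ} (hf : Integrable f) (ξ : ℝ) :
    |1 / 2 * (∫ η in Iic ξ, f η) - 1 / 4 * ∫ η, f η| ≤ 1 / 4 * ∫ η, |f η| := by
  have h1 := integral_add_compl (measurableSet_Iic (a := ξ)) hf
  have h2 := integral_add_compl (measurableSet_Iic (a := ξ)) hf.abs
  have h3 := abs_integral_le_integral_abs (f := f) (μ := volume.restrict (Iic ξ))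
  have h4 := abs_integral_le_integral_abs (f := f) (μ := volume.restrict (Iic ξ)ᶜ)
  rw [← h1, ← h2]
  rw [abs_le] at *
  constructor <;> linarith [h3.1, h3.2, h4.1, h4.2]

section Measurability

variable {X : Lag} {β : ℝ → ℝ}

lemma measurable_integral_Iic {f : ℝ → ℝ → ℝ} (hf : Measurable fun p : ℝ × ℝ => f p.1 p.2) :
    Measurable fun p : ℝ × ℝ => ∫ η in Iic p.2, f p.1 η := by
  have h1 : ∀ p : ℝ × ℝ, ∫ η in Iic p.2, f p.1 η =
      ∫ η, {q : (ℝ × ℝ) × ℝ | q.2 ≤ q.1.2}.indicator (fun q => f q.1.1 q.2) (p, η) := fun p => by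
    rw [← integral_indicator measurableSet_Iic]
    rfl
  simp_rw [h1]
  have hm : Measurable ({q : (ℝ × ℝ) × ℝ | q.2 ≤ q.1.2}.indicator fun q => f q.1.1 q.2) :=
    (hf.comp ((measurable_fst.comp measurable_fst).prodMk measurable_snd)).indicator
      (measurableSet_le measurable_snd (measurable_snd.comp measurable_fst))
  exact (hm.stronglyMeasurable.integral_prod_right' (ν := volume)).measurable

lemma measurable_integral_univ {f : ℝ → ℝ → ℝ} (hf : Measurable fun p : ℝ × ℝ => f p.1 p.2) :
    Measurable fun t : ℝ => ∫ η, f t η :=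
  (hf.stronglyMeasurable.integral_prod_right' (ν := volume)).measurable

lemma measurable_evo_y {E : ℝ} (h : InitData X E) (hβ : Measurable β) :
    Measurable fun p : ℝ × ℝ => (evo X β p.1).y p.2 := by
  obtain ⟨K, hK⟩ := h.U_lip
  have h1 := measurable_integral_Iic (measurable_dens2 (X := X) hβ)
  have h2 := measurable_integral_univ (measurable_dens2 (X := X) hβ)
  exact (((h.y_mono.measurable.comp measurable_snd).add
    (measurable_fst.mul (hK.continuous.measurable.comp measurable_snd))).add
    (h1.const_mul _)).sub ((h2.comp measurable_fst).const_mul _)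

end Measurability

/-- Follows from `x² / 2 ≤ exp x` at `x = l (t - b)`. The exponential weight converts the two
integrations in time into the factor `2 / l²`, which is small for large `l`. -/
lemma sq_mul_exp_le {l b t : ℝ} (hl : 0 < l) :
    max (t - b) 0 ^ 2 * Real.exp (l * b) ≤ 2 / l ^ 2 * Real.exp (l * t) := by
  rcases le_total (t - b) 0 with h | h
  · rw [max_eq_right h]; have := Real.exp_pos (l * t); simp; positivity
  · rw [max_eq_left h]
    have h1 := Real.quadratic_le_exp_of_nonneg (mul_nonneg hl.le h)
    have h2 : (t - b) ^ 2 ≤ 2 / l ^ 2 * Real.exp (l * (t - b)) := by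
      rw [div_mul_eq_mul_div, le_div_iff₀ (by positivity)]
      nlinarith [mul_nonneg hl.le h]
    calc (t - b) ^ 2 * Real.exp (l * b)
        ≤ 2 / l ^ 2 * Real.exp (l * (t - b)) * Real.exp (l * b) := by gcongr
      _ = _ := by rw [mul_assoc, ← Real.exp_add]; congr 2; ring

/-! ### Contraction in an exponentially weighted norm -/

section Contraction

variable {X : Lag} {E : ℝ} (h : InitData X E) {β β' : ℝ → ℝ} (hb : ∀ η, β η ∈ Icc (0 : ℝ) 1)
  (hβ : Measurable β) (hb' : ∀ η, β' η ∈ Icc (0 : ℝ) 1)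
  (hβ' : Measurable β') {t : ℝ} (ht : 0 ≤ t)
include h hb hβ hb' hβ' ht

/-- `β` enters `y` only through `β (t - τ)₊² / 2` times `H_ξ`, so a difference of size `exp (l τ)`
in the losses produces one of size `exp (l t)` in the characteristics, with the gain `l⁻²`. -/
lemma abs_evo_y_sub_le {l D : ℝ} (hl : 0 < l) (hD : 0 ≤ D)
    (hββ : ∀ η, deriv X.U η < 0 → |β η - β' η| ≤ D * Real.exp (l * breakTime X η)) (ξ : ℝ) :
    |(evo X β t).y ξ - (evo X β' t).y ξ| ≤ D * E / (4 * l ^ 2) * Real.exp (l * t) := by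
  have i1 := integrable_dens2 h.toEnergyData hb hβ ht
  have i2 := integrable_dens2 h.toEnergyData hb' hβ' ht
  have hi : Integrable (fun η => dens2 X β t η - dens2 X β' t η) := i1.sub i2
  have h1 : (evo X β t).y ξ - (evo X β' t).y ξ =
      1 / 2 * (∫ η in Iic ξ, (dens2 X β t η - dens2 X β' t η)) -
        1 / 4 * ∫ η, (dens2 X β t η - dens2 X β' t η) := by
    rw [integral_sub i1 i2, integral_sub i1.integrableOn i2.integrableOn]
    simp only [evo]; ring
  rw [h1]
  refine (abs_half_integral_Iic_sub_le hi ξ).trans ?_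
  have h2 : ∫ η, |dens2 X β t η - dens2 X β' t η| ≤
      ∫ η, D / l ^ 2 * Real.exp (l * t) * deriv X.H η := by
    refine integral_mono hi.abs (h.integrable_deriv_H.const_mul _) fun η => ?_
    have e1 : dens2 X β t η - dens2 X β' t η =
        -((β η - β' η) * (elapsed X t η ^ 2 / 2)) * deriv X.H η := by unfold dens2; ring
    simp only [e1]
    rw [abs_mul, abs_of_nonneg (h.deriv_H_nonneg η), abs_neg, abs_mul,
      abs_of_nonneg (a := elapsed X t η ^ 2 / 2) (by positivity)]
    refine mul_le_mul_of_nonneg_right ?_ (h.deriv_H_nonneg η)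
    by_cases hU : deriv X.U η < 0
    · simp only [elapsed, hU, if_true]
      have h3 := sq_mul_exp_le (b := breakTime X η) (t := t) hl
      calc |β η - β' η| * (max (t - breakTime X η) 0 ^ 2 / 2)
          ≤ D * Real.exp (l * breakTime X η) * (max (t - breakTime X η) 0 ^ 2 / 2) := by
            gcongr; exact hββ η hU
        _ = D / 2 * (max (t - breakTime X η) 0 ^ 2 * Real.exp (l * breakTime X η)) := by ring
        _ ≤ D / 2 * (2 / l ^ 2 * Real.exp (l * t)) := by gcongr
        _ = _ := by ring
    · simp only [elapsed, hU, if_false]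
      simp; positivity
  rw [integral_const_mul, h.integral_deriv_H] at h2
  calc _ ≤ 1 / 4 * (D / l ^ 2 * Real.exp (l * t) * E) := by gcongr
    _ = _ := by field_simp

end Contraction

/-- The losses are given by `α` evaluated at the position at wave breaking. -/
structure IsLoss (α : ℝ → ℝ) (X : Lag) (β : ℝ → ℝ) : Prop where
  meas : Measurable β
  mem : ∀ η, β η ∈ Ico (0 : ℝ) 1
  fix : ∀ η, deriv X.U η < 0 → β η = α ((evo X β (breakTime X η)).y η)

lemma IsLoss.mem_Icc {α : ℝ → ℝ} {X : Lag} {β : ℝ → ℝ} (h : IsLoss α X β) (η : ℝ) :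
    β η ∈ Icc (0 : ℝ) 1 := Ico_subset_Icc_self (h.mem η)

open Classical in
/-- One step of the fixed point iteration for the losses. -/
noncomputable def lossStep (α : ℝ → ℝ) (X : Lag) (β : ℝ → ℝ) (η : ℝ) : ℝ :=
  if deriv X.U η < 0 then α ((evo X β (breakTime X η)).y η) else 0

lemma IsCoefficient.continuous {α : ℝ → ℝ} (hα : IsCoefficient α) : Continuous α := by
  obtain ⟨K, hK⟩ := hα.1; exact hK.continuous

lemma lossStep_mem {α : ℝ → ℝ} (hα : IsCoefficient α) (X : Lag) (β : ℝ → ℝ) (η : ℝ) :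
    lossStep α X β η ∈ Ico (0 : ℝ) 1 := by
  unfold lossStep; split_ifs
  · exact hα.2 _
  · simp

lemma measurable_lossStep {α : ℝ → ℝ} (hα : IsCoefficient α) {X : Lag} {E : ℝ} (h : InitData X E)
    {β : ℝ → ℝ} (hβ : Measurable β) : Measurable (lossStep α X β) :=
  Measurable.ite (measurableSet_lt (measurable_deriv _) measurable_const)
    (hα.continuous.measurable.comp ((measurable_evo_y h hβ).comp
      ((measurable_breakTime X).prodMk measurable_id))) measurable_const

/-- Picard iteration of `lossStep`, which contracts by the factor 1/4 in the norm weighted with `exp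
(l τ)`. Since the iterates converge at every label, the limit is measurable. -/
lemma exists_isLoss {α : ℝ → ℝ} (hα : IsCoefficient α) {X : Lag} {E : ℝ} (h : InitData X E) :
    ∃ β, IsLoss α X β := by
  set K := derivSupNorm α
  have hK : 0 ≤ K := derivSupNorm_nonneg α
  have hE := h.E_nonneg
  -- With this choice `K E / l² ≤ 1`, which leaves the factor 1/4 from the estimate for `y`.
  set l := K * E + 1 with hl
  have hl1 : 1 ≤ l := by have := mul_nonneg hK hE; linarith
  have hl0 : 0 < l := by linarith
  let b : ℕ → ℝ → ℝ := fun n => (lossStep α X)^[n] 0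
  have hbs : ∀ n, b (n + 1) = lossStep α X (b n) := fun n => Function.iterate_succ_apply' _ _ _
  have hb : ∀ n η, b n η ∈ Icc (0 : ℝ) 1 := fun n η => by
    cases n with
    | zero => simp [b]
    | succ n => rw [hbs]; exact Ico_subset_Icc_self (lossStep_mem hα X _ η)
  have hbm : ∀ n, Measurable (b n) := fun n => by
    induction n with
    | zero => exact measurable_const
    | succ n ih => rw [hbs]; exact measurable_lossStep hα h ih
  have hcon : ∀ (β β' : ℝ → ℝ), (∀ η, β η ∈ Icc (0 : ℝ) 1) → Measurable β →
      (∀ η, β' η ∈ Icc (0 : ℝ) 1) → Measurable β' → ∀ D, 0 ≤ D →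
      (∀ η, deriv X.U η < 0 → |β η - β' η| ≤ D * Real.exp (l * breakTime X η)) →
      ∀ η, |lossStep α X β η - lossStep α X β' η| ≤ D / 4 * Real.exp (l * breakTime X η) := by
    intro β β' h1 h2 h3 h4 D hD h5 η
    unfold lossStep
    split_ifs with hU
    · refine (hα.abs_sub_le _ _).trans ?_
      have h6 := abs_evo_y_sub_le h h1 h2 h3 h4 (breakTime_nonneg h.toEnergyData hU) hl0 hD h5 η
      calc _ ≤ K * (D * E / (4 * l ^ 2) * Real.exp (l * breakTime X η)) := by gcongr
        _ = (K * E / l ^ 2) * (D / 4 * Real.exp (l * breakTime X η)) := by field_simp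
        _ ≤ 1 * (D / 4 * Real.exp (l * breakTime X η)) := by
          gcongr
          rw [div_le_one (by positivity)]; nlinarith
        _ = _ := one_mul _
    · simp; positivity
  have hdist : ∀ n η, |b n η - b (n + 1) η| ≤ Real.exp (l * breakTime X η) * (1 / 4) ^ n := by
    have aux : ∀ n η, deriv X.U η < 0 →
        |b n η - b (n + 1) η| ≤ (1 / 4) ^ n * Real.exp (l * breakTime X η) := by
      intro n
      induction n with
      | zero =>
        intro η hU
        have h1 := hb 0 η; have h2 := hb 1 η
        have h3 : 1 ≤ Real.exp (l * breakTime X η) :=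
          Real.one_le_exp (mul_nonneg hl0.le (breakTime_nonneg h.toEnergyData hU))
        simp only [pow_zero, one_mul]
        rw [abs_le]; constructor <;> linarith [h1.1, h1.2, h2.1, h2.2]
      | succ n ih =>
        intro η hU
        rw [hbs n, hbs (n + 1)]
        refine (hcon _ _ (hb n) (hbm n) (hb _) (hbm _) ((1 / 4) ^ n) (by positivity) ih η).trans ?_
        rw [pow_succ]; apply le_of_eq; ring
    intro n η
    by_cases hU : deriv X.U η < 0
    · rw [mul_comm]; exact aux n η hU
    · have h0 : ∀ n, b n η = 0 := fun n => by
        cases n with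
        | zero => rfl
        | succ n => rw [hbs]; simp [lossStep, hU]
      rw [h0, h0]; simp; positivity
  have hlim : ∀ η, ∃ c, Tendsto (fun n => b n η) atTop (𝓝 c) := fun η =>
    cauchySeq_tendsto_of_complete (cauchySeq_of_le_geometric _ _ (by norm_num) fun n => hdist n η)
  choose β hβ using hlim
  have hβm : Measurable β := measurable_of_tendsto_metrizable hbm (tendsto_pi_nhds.2 hβ)
  have hβI : ∀ η, β η ∈ Icc (0 : ℝ) 1 := fun η =>
    isClosed_Icc.mem_of_tendsto (hβ η) (Eventually.of_forall fun n => hb n η)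
  have hstep : ∀ η, β η = lossStep α X β η := fun η => by
    refine tendsto_nhds_unique ((hβ η).comp (tendsto_add_atTop_nat 1)) ?_
    rw [tendsto_iff_dist_tendsto_zero]
    have h1 : ∀ n, dist (b (n + 1) η) (lossStep α X β η) ≤
        Real.exp (l * breakTime X η) / 3 * (1 / 4) ^ n := fun n => by
      rw [hbs, Real.dist_eq]
      -- The tail of the geometric series bounds the distance from `b n` to `β` by `4/3 (1/4)^n`, in
      -- the weighted norm.
      refine (hcon _ _ (hb n) (hbm n) hβI hβm (4 / 3 * (1 / 4) ^ n) (by positivity)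
        (fun η _ => ?_) η).trans (le_of_eq ?_)
      · have := dist_le_of_le_geometric_of_tendsto _ _ (by norm_num)
          (fun n => hdist n η) (hβ η) n
        rw [Real.dist_eq] at this
        refine this.trans (le_of_eq ?_); ring
      · ring
    refine squeeze_zero (fun n => dist_nonneg) h1 ?_
    have := (tendsto_pow_atTop_nhds_zero_of_lt_one (r := (1 / 4 : ℝ)) (by norm_num)
      (by norm_num)).const_mul (Real.exp (l * breakTime X η) / 3)
    simpa using this
  refine ⟨β, hβm, fun η => ?_, fun η hU => ?_⟩
  · rw [hstep]; exact lossStep_mem hα X β η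
  · rw [hstep]; simp [lossStep, hU]

lemma RegularAt.waveBreak_eq {X : Lag} {η : ℝ} (h : RegularAt X η) (hU : deriv X.U η < 0) :
    waveBreak X η = ENNReal.ofReal (breakTime X η) ∧ 0 < breakTime X η := by
  refine ⟨?_, (h.pos_of_neg hU).2.2.1⟩
  unfold waveBreak
  rw [if_neg (by intro h'; linarith [h'.2]), if_pos hU]
  rfl

lemma waveBreak_of_not_neg {X : Lag} {η : ℝ} (hU : ¬ deriv X.U η < 0) :
    waveBreak X η = 0 ∨ waveBreak X η = ⊤ := by
  unfold waveBreak
  split_ifs <;> simp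

-- Translates the event `t ≥ τ > 0`, expressed with the extended value `waveBreak`, into `broken`.
-- The values 0 and `⊤` belong to labels with `U_ξ ≥ 0`, and both mean that nothing is lost.
open Classical in
lemma dens0_eq_of_regularAt {X : Lag} {η t : ℝ} (h : RegularAt X η) (ht : 0 ≤ t) (a : ℝ → ℝ)
    {β : ℝ → ℝ} (hβ : deriv X.U η < 0 → β η = a (breakTime X η)) :
    (1 - (if 0 < waveBreak X η ∧ waveBreak X η ≤ ENNReal.ofReal t
      then a (waveBreak X η).toReal else 0)) * deriv X.H η = dens0 X β t η := by
  unfold dens0 broken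
  by_cases hU : deriv X.U η < 0
  · obtain ⟨h1, h2⟩ := h.waveBreak_eq hU
    have h3 : (0 < waveBreak X η ∧ waveBreak X η ≤ ENNReal.ofReal t) ↔ breakTime X η ≤ t := by
      rw [h1, ENNReal.ofReal_le_ofReal_iff ht]; simp [h2]
    have h4 : (waveBreak X η).toReal = breakTime X η := by rw [h1, ENNReal.toReal_ofReal h2.le]
    rw [h4, hβ hU]
    by_cases h5 : breakTime X η ≤ t <;> simp [h3, h5, hU]
  · have : ¬ (0 < waveBreak X η ∧ waveBreak X η ≤ ENNReal.ofReal t) := by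
      rcases waveBreak_of_not_neg hU with h1 | h1 <;> simp [h1]
    rw [if_neg this, if_neg (by tauto)]; simp

/-! ### The explicit evolution solves the Lagrangian system -/

section Solution

variable {α : ℝ → ℝ} {X : Lag} {E : ℝ} (h : InitData X E)
include h

lemma evo_V_tendsto {β : ℝ → ℝ} (hb : ∀ η, β η ∈ Icc (0 : ℝ) 1) (hβ : Measurable β) (t : ℝ) :
    Tendsto (evo X β t).V atTop (𝓝 (∫ η, dens0 X β t η)) :=
  (hasTails_evo_V h hb hβ).tendsto_atTop (lipschitzWith_evo_V h hb hβ).uniformContinuous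

lemma intervalIntegrable_setIntegral {f : ℝ → ℝ → ℝ} {C t : ℝ}
    (ht : 0 ≤ t) (hf : Measurable fun p : ℝ × ℝ => f p.1 p.2)
    (h0 : ∀ s ∈ Icc 0 t, ∀ η, 0 ≤ f s η) (h1 : ∀ s ∈ Icc 0 t, ∀ η, f s η ≤ C * deriv X.H η)
    (ξ : ℝ) :
    IntervalIntegrable (fun s => ∫ η in Iic ξ, f s η) volume 0 t ∧
      IntervalIntegrable (fun s => ∫ η, f s η) volume 0 t := by
  have m1 : Measurable fun s => ∫ η in Iic ξ, f s η :=
    (measurable_integral_Iic hf).comp (measurable_id.prodMk measurable_const)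
  have m2 := measurable_integral_univ hf
  have hC : ∀ s ∈ Icc 0 t, ∀ A : Set ℝ, |∫ η in A, f s η| ≤ ∫ η in A, C * deriv X.H η := by
    intro s hs A
    rw [abs_of_nonneg (integral_nonneg (h0 s hs))]
    exact integral_mono_of_nonneg (ae_of_all _ (h0 s hs))
      (h.integrable_deriv_H.const_mul C).integrableOn (ae_of_all _ (h1 s hs))
  have hfin : volume (uIoc 0 t) < ⊤ := by simp [uIoc]
  constructor
  · rw [intervalIntegrable_iff]
    refine Measure.integrableOn_of_bounded (M := ∫ η in Iic ξ, C * deriv X.H η) hfin.ne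
      m1.aestronglyMeasurable ?_
    refine (ae_restrict_iff' measurableSet_uIoc).2 (ae_of_all _ fun s hs => ?_)
    rw [uIoc_of_le ht] at hs
    exact hC s ⟨hs.1.le, hs.2⟩ _
  · rw [intervalIntegrable_iff]
    refine Measure.integrableOn_of_bounded (M := ∫ η, C * deriv X.H η) hfin.ne
      m2.aestronglyMeasurable ?_
    refine (ae_restrict_iff' measurableSet_uIoc).2 (ae_of_all _ fun s hs => ?_)
    rw [uIoc_of_le ht] at hs
    simpa using hC s ⟨hs.1.le, hs.2⟩ univ

lemma evo_U_eq_integral {β : ℝ → ℝ} (hb : ∀ η, β η ∈ Icc (0 : ℝ) 1) (hβ : Measurable β) {t : ℝ}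
    (ht : 0 ≤ t) (ξ : ℝ) : (evo X β t).U ξ = X.U ξ + ∫ s in (0 : ℝ)..t,
      (1 / 2 * (∫ η in Iic ξ, dens0 X β s η) - 1 / 4 * ∫ η, dens0 X β s η) := by
  obtain ⟨i1, i2⟩ := intervalIntegrable_setIntegral h ht (measurable_dens0 (X := X) hβ)
    (fun s _ => dens0_nonneg h.toEnergyData hb s) (fun s _ => dens0_le h.toEnergyData hb s) ξ
  rw [intervalIntegral.integral_sub (i1.const_mul _) (i2.const_mul _),
    intervalIntegral.integral_const_mul, intervalIntegral.integral_const_mul,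
    integral_setIntegral_dens0 h.toEnergyData hb hβ ht]
  have := integral_setIntegral_dens0 h.toEnergyData hb hβ ht univ
  simp only [Measure.restrict_univ] at this
  rw [this]
  simp only [evo]; ring

lemma evo_y_eq_integral {β : ℝ → ℝ} (hb : ∀ η, β η ∈ Icc (0 : ℝ) 1) (hβ : Measurable β) {t : ℝ}
    (ht : 0 ≤ t) (ξ : ℝ) :
    (evo X β t).y ξ = X.y ξ + ∫ s in (0 : ℝ)..t, (evo X β s).U ξ := by
  obtain ⟨i1, i2⟩ := intervalIntegrable_setIntegral (C := t) h ht (measurable_dens1 (X := X) hβ)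
    (fun s hs => dens1_nonneg h.toEnergyData hb hs.1)
    (fun s hs η => (dens1_le h.toEnergyData hb s η).trans
      (mul_le_mul_of_nonneg_right hs.2 (h.deriv_H_nonneg η))) ξ
  simp only [evo]
  rw [intervalIntegral.integral_sub (intervalIntegrable_const.add (i1.const_mul _)) (i2.const_mul _),
    intervalIntegral.integral_add (by simp) (i1.const_mul _),
    intervalIntegral.integral_const_mul, intervalIntegral.integral_const_mul,
    integral_setIntegral_dens1 h.toEnergyData hb hβ ht]
  have := integral_setIntegral_dens1 h.toEnergyData hb hβ ht univ
  simp only [Measure.restrict_univ] at this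
  rw [this]
  simp; ring

/-- At a.e. label with `U_ξ < 0` the breaking time is positive, so the density at time 0 is the full
`H_ξ`, and `V = H` initially. -/
lemma evo_zero (β : ℝ → ℝ) : evo X β 0 = X := by
  have he : ∀ η, elapsed X 0 η = 0 := fun η =>
    le_antisymm (elapsed_le h.toEnergyData le_rfl η) (elapsed_nonneg X 0 η)
  have h1 : ∀ η, dens1 X β 0 η = 0 := fun η => by simp [dens1, he]
  have h2 : ∀ η, dens2 X β 0 η = 0 := fun η => by simp [dens2, he]
  have h0 : ∀ ξ, ∫ η in Iic ξ, dens0 X β 0 η = X.V ξ := fun ξ => by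
    rw [h.V_eq, ← h.integral_Iic_deriv_H]
    refine setIntegral_congr_ae measurableSet_Iic ?_
    filter_upwards [h.ae_regularAt] with η hη _
    have : broken X 0 η = 0 := by
      simp only [broken, ite_eq_right_iff, one_ne_zero, imp_false, not_and, not_le]
      intro hU; exact (hη.pos_of_neg hU).2.2.1
    simp [dens0, this]
  cases X
  simp only [evo, h1, h2, h0, Lag.mk.injEq]
  simp

lemma isSolution_evo (hα : IsCoefficient α) {β : ℝ → ℝ} (hβ : IsLoss α X β) :
    IsSolution α X (evo X β) where
  init := evo_zero h β
  mem t ht := memF_evo h hβ.mem_Icc hβ.meas ht hα.2 hβ.fix fun η => (hβ.mem η).2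
  eq_y t ht ξ := evo_y_eq_integral h hβ.mem_Icc hβ.meas ht ξ
  eq_U t ht ξ := by
    rw [evo_U_eq_integral h hβ.mem_Icc hβ.meas ht ξ]
    have : ∀ s, limTop (evo X β s).V = ∫ η, dens0 X β s η := fun s =>
      (evo_V_tendsto h hβ.mem_Icc hβ.meas s).limUnder_eq
    simp_rw [this]; rfl
  eq_V t ht ξ := by
    refine (setIntegral_congr_ae measurableSet_Iic ?_).symm
    filter_upwards [h.ae_regularAt] with η hη _
    rw [h.V_eq]
    exact dens0_eq_of_regularAt hη ht (fun s => α ((evo X β s).y η)) (hβ.fix η)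
  eq_H t ht ξ := rfl

end Solution

/-! ## Uniqueness of solutions -/

lemma MemE1.memE2 {f : ℝ → ℝ} (hf : MemE1 f) : MemE2 f := by
  obtain ⟨a, ha⟩ := hf
  exact ⟨a, 0, by simpa using ha⟩

lemma MemF.tendsto_V {X : Lag} (hX : MemF X) : Tendsto X.V atTop (𝓝 (limTop X.V)) := by
  obtain ⟨-, -, a, b, hab⟩ := hX.V_mem.memE2.exists_hasTails
  obtain ⟨K, hK⟩ := hX.V_lip.1
  have := hab.tendsto_atTop hK.uniformContinuous
  rwa [limTop, this.limUnder_eq]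

/-- Freezing the upper limit at 0 for negative times extends the function to the whole line,
although the integrand is controlled only on `[0, ∞)`. -/
lemma continuous_primitive_max {g : ℝ → ℝ}
    (hg : ∀ t, 0 ≤ t → IntervalIntegrable g volume 0 t) :
    Continuous fun t : ℝ => ∫ s in (0 : ℝ)..max t 0, g s := by
  have h1 : ∀ a b, IntervalIntegrable (fun s => (Ici (0 : ℝ)).indicator g s) volume a b := by
    have h2 : ∀ t, IntervalIntegrable (fun s => (Ici (0 : ℝ)).indicator g s) volume 0 t := by
      intro t
      rcases le_total 0 t with ht | ht
      · refine (hg t ht).congr_uIoo fun s hs => ?_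
        rw [uIoo_of_le ht] at hs
        rw [indicator_of_mem (mem_Ici.2 hs.1.le)]
      · refine (IntervalIntegrable.zero (μ := volume) (a := 0) (b := t) (E := ℝ)).congr_uIoo
          fun s hs => ?_
        rw [uIoo_of_ge ht] at hs
        rw [indicator_of_notMem (by simpa using hs.2)]; rfl
    exact fun a b => (h2 a).symm.trans (h2 b)
  have h3 : (fun t : ℝ => ∫ s in (0 : ℝ)..max t 0, g s) =
      fun t => ∫ s in (0 : ℝ)..max t 0, (Ici (0 : ℝ)).indicator g s := by
    ext t
    refine intervalIntegral.integral_congr fun s hs => ?_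
    rw [uIcc_of_le (le_max_right _ _)] at hs
    rw [indicator_of_mem (mem_Ici.2 hs.1)]
  rw [h3]
  exact (intervalIntegral.continuous_primitive h1 0).comp (by fun_prop)

section

variable {X : Lag} {E : ℝ} (h : InitData X E) {β : ℝ → ℝ} (hb : ∀ η, β η ∈ Icc (0 : ℝ) 1)
include h hb

lemma dens0_antitone {s t : ℝ} (hst : s ≤ t) (η : ℝ) : dens0 X β t η ≤ dens0 X β s η := by
  refine mul_le_mul_of_nonneg_right ?_ (h.deriv_H_nonneg η)
  have : broken X s η ≤ broken X t η := by
    unfold broken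
    split_ifs with h1 h2 h2
    · exact le_rfl
    · exact absurd ⟨h1.1, h1.2.trans hst⟩ h2
    · exact zero_le_one
    · exact le_rfl
  have := mul_le_mul_of_nonneg_left this (hb η).1
  linarith

/-- `β` is not assumed measurable here, so an integral could be the default value 0. Integrability
at the later time implies it at the earlier one: on the labels broken by time `s` the two densities
coincide, and elsewhere the earlier one is `H_ξ`. -/
lemma setIntegral_dens0_antitone {s t : ℝ} (hst : s ≤ t) (A : Set ℝ) :
    ∫ η in A, dens0 X β t η ≤ ∫ η in A, dens0 X β s η := by
  by_cases hs : IntegrableOn (dens0 X β s) A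
  · exact integral_mono_of_nonneg (ae_of_all _ (dens0_nonneg h.toEnergyData hb t)) hs
      (ae_of_all _ (dens0_antitone h hb hst))
  · have ht : ¬ IntegrableOn (dens0 X β t) A := by
      intro ht
      refine hs ?_
      have h1 : dens0 X β s = fun η => {η | broken X s η = 1}.indicator (dens0 X β t) η +
          {η | broken X s η = 1}ᶜ.indicator (deriv X.H) η := by
        ext η
        by_cases h2 : broken X s η = 1
        · have h3 : η ∈ {η | broken X s η = 1} := h2
          have h4 : broken X t η = 1 := by
            simp only [broken, ite_eq_left_iff, zero_ne_one, imp_false, not_not] at h2 ⊢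
            exact ⟨h2.1, h2.2.trans hst⟩
          rw [indicator_of_mem h3, indicator_of_notMem (by simpa using h3)]
          simp [dens0, h2, h4]
        · have h3 : η ∉ {η | broken X s η = 1} := h2
          have h4 : broken X s η = 0 := by
            unfold broken at h2 ⊢
            split_ifs at h2 ⊢ <;> simp_all
          rw [indicator_of_notMem h3, indicator_of_mem (by simpa using h3)]
          simp [dens0, h4]
      rw [h1]
      have hm : MeasurableSet {η | broken X s η = 1} :=
        ((measurable_broken X).comp measurable_prodMk_left) (measurableSet_singleton _)
      exact (ht.indicator hm).add (h.integrable_deriv_H.integrableOn.indicator hm.compl)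
    rw [integral_undef hs, integral_undef ht]

end

open Classical in
/-- Every solution is given by the explicit formulas. -/
lemma IsSolution.eq_evo {α : ℝ → ℝ} (hα : IsCoefficient α) {X : Lag} {E : ℝ} (h : InitData X E)
    {Y : ℝ → Lag} (hY : IsSolution α X Y) :
    ∃ β, IsLoss α X β ∧ ∀ t, 0 ≤ t → Y t = evo X β t := by
  -- The loss read off from the given solution. Its measurability is not known in advance and is
  -- extracted from the equations below.
  set β : ℝ → ℝ := fun η => if deriv X.U η < 0 then α ((Y (breakTime X η)).y η) else 0 with hβd
  have hbI : ∀ η, β η ∈ Ico (0 : ℝ) 1 := fun η => by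
    simp only [hβd]; split_ifs
    · exact hα.2 _
    · simp
  have hb : ∀ η, β η ∈ Icc (0 : ℝ) 1 := fun η => Ico_subset_Icc_self (hbI η)
  have hV : ∀ t, 0 ≤ t → ∀ ξ, (Y t).V ξ = ∫ η in Iic ξ, dens0 X β t η := by
    intro t ht ξ
    rw [hY.eq_V t ht ξ]
    refine setIntegral_congr_ae measurableSet_Iic ?_
    filter_upwards [h.ae_regularAt] with η hη _
    rw [h.V_eq]
    exact dens0_eq_of_regularAt hη ht (fun s => α ((Y s).y η)) fun hU => by simp [hβd, hU]
  -- Being monotone in time, `V` and its limit are integrable over time intervals. The integrated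
  -- equations then show that `U`, and next `y`, are continuous in time.
  have hVa : ∀ ξ, AntitoneOn (fun t => (Y t).V ξ) (Ici 0) := fun ξ s hs t ht hst => by
    simp only
    rw [hV s hs, hV t ht]
    exact setIntegral_dens0_antitone h hb hst _
  have hVl : AntitoneOn (fun t => limTop (Y t).V) (Ici 0) := fun s hs t ht hst =>
    le_of_tendsto_of_tendsto' (hY.mem t ht).tendsto_V (hY.mem s hs).tendsto_V
      fun ξ => hVa ξ hs ht hst
  have hI : ∀ t : ℝ, 0 ≤ t → uIcc 0 t ⊆ Ici 0 := fun t ht => by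
    rw [uIcc_of_le ht]; exact Icc_subset_Ici_self
  have hU : ∀ ξ, Continuous fun t => (Y (max t 0)).U ξ := fun ξ => by
    have h1 : (fun t => (Y (max t 0)).U ξ) = fun t => X.U ξ + ∫ s in (0 : ℝ)..max t 0,
        (1 / 2 * (Y s).V ξ - 1 / 4 * limTop (Y s).V) := by
      ext t; exact hY.eq_U _ (le_max_right _ _) ξ
    rw [h1]
    exact continuous_const.add (continuous_primitive_max fun t ht =>
      ((((hVa ξ).mono (hI t ht)).intervalIntegrable).const_mul _).sub
        (((hVl.mono (hI t ht)).intervalIntegrable).const_mul _))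
  have hy : ∀ ξ, Continuous fun t => (Y (max t 0)).y ξ := fun ξ => by
    have h1 : (fun t => (Y (max t 0)).y ξ) = fun t => X.y ξ + ∫ s in (0 : ℝ)..max t 0,
        (Y s).U ξ := by
      ext t; exact hY.eq_y _ (le_max_right _ _) ξ
    rw [h1]
    refine continuous_const.add (continuous_primitive_max fun t ht => ?_)
    refine ((hU ξ).intervalIntegrable 0 t).congr_uIoo fun s hs => ?_
    rw [uIoo_of_le ht] at hs
    simp only
    rw [max_eq_left hs.1.le]
  -- Continuity in time and measurability in the label give joint measurability, so `y` may be
  -- evaluated at the breaking time of each label.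
  have hm : Measurable (Function.uncurry fun t ξ => (Y (max t 0)).y ξ) := by
    refine measurable_uncurry_of_continuous_of_measurable hy fun t => ?_
    obtain ⟨K, hK⟩ := (hY.mem _ (le_max_right t 0)).y_lip.1
    have h1 : (Y (max t 0)).y = fun ξ => ((Y (max t 0)).y ξ - ξ) + ξ := by ext; ring
    rw [h1]
    exact (hK.continuous.add continuous_id).measurable
  have hβ : Measurable β := by
    have h1 : β = fun η => if deriv X.U η < 0 then
        α ((Y (max (breakTime X η) 0)).y η) else 0 := by
      ext η
      simp only [hβd]
      split_ifs with hU
      · rw [max_eq_left (breakTime_nonneg h.toEnergyData hU)]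
      · rfl
    rw [h1]
    exact Measurable.ite (measurableSet_lt (measurable_deriv _) measurable_const)
      (hα.continuous.measurable.comp (hm.comp ((measurable_breakTime X).prodMk measurable_id)))
      measurable_const
  have hVe : ∀ t, 0 ≤ t → (Y t).V = (evo X β t).V := fun t ht => funext fun ξ => hV t ht ξ
  have hUe : ∀ t, 0 ≤ t → (Y t).U = (evo X β t).U := fun t ht => funext fun ξ => by
    rw [hY.eq_U t ht, evo_U_eq_integral h hb hβ ht]
    congr 1
    refine intervalIntegral.integral_congr fun s hs => ?_
    have hs0 : 0 ≤ s := hI t ht hs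
    rw [hVe s hs0, limTop, (evo_V_tendsto h hb hβ s).limUnder_eq]
    rfl
  have hye : ∀ t, 0 ≤ t → (Y t).y = (evo X β t).y := fun t ht => funext fun ξ => by
    rw [hY.eq_y t ht, evo_y_eq_integral h hb hβ ht]
    congr 1
    refine intervalIntegral.integral_congr fun s hs => ?_
    rw [hUe s (hI t ht hs)]
  have hHe : ∀ t, 0 ≤ t → (Y t).H = (evo X β t).H := fun t ht => funext fun ξ => hY.eq_H t ht ξ
  refine ⟨β, ⟨hβ, hbI, fun η hU => ?_⟩, fun t ht => ?_⟩
  · rw [← hye _ (breakTime_nonneg h.toEnergyData hU)]; simp [hβd, hU]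
  · have h1 := hye t ht; have h2 := hUe t ht; have h3 := hVe t ht; have h4 := hHe t ht
    cases hYt : Y t
    simp_all [evo]

/-- `solOp` selects an unspecified solution. Hence one needs that solutions exist and that each of
them is given by the explicit formulas with some admissible loss. -/
lemma exists_exactLag_eq {α : ℝ → ℝ} (hα : IsCoefficient α) {Z : Eul} {E : ℝ}
    (h : InitData (mapL Z) E) :
    ∃ β, IsLoss α (mapL Z) β ∧ ∀ t, 0 ≤ t → exactLag α Z t = evo (mapL Z) β t := by
  have hex : ∃ Y, IsSolution α (mapL Z) Y := by
    obtain ⟨β, hβ⟩ := exists_isLoss hα h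
    exact ⟨_, isSolution_evo h hα hβ⟩
  obtain ⟨β, h1, h2⟩ := hex.choose_spec.eq_evo hα h
  refine ⟨β, h1, fun t ht => ?_⟩
  rw [← h2 t ht]
  simp only [exactLag, solOp, dif_pos hex]

/-! ## From Lagrangian to Eulerian coordinates -/

/-- The discriminant of `p x² - 2 d x + q` cannot be positive. This turns Young's inequality with
arbitrary weight `l` into Cauchy–Schwarz. -/
lemma sq_le_mul_of_forall_two_mul_le {d p q : ℝ} (hd : 0 ≤ d) (hp : 0 ≤ p) (hq : 0 ≤ q)
    (h : ∀ l : ℝ, 0 < l → 2 * d * l ≤ l ^ 2 * p + q) : d ^ 2 ≤ p * q := by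
  have h1 : ∀ x : ℝ, 0 ≤ p * (x * x) + (-(2 * d)) * x + q := fun x => by
    rcases le_or_gt x 0 with hx | hx
    · nlinarith [mul_nonneg hp (mul_self_nonneg x), mul_nonneg hd (neg_nonneg.2 hx)]
    · nlinarith [h x hx]
  have := discrim_le_zero h1
  unfold discrim at this
  nlinarith

/-- A monotone change of variables `y` and a function `U` with `U_ξ² = y_ξ w`. -/
structure Transport (y U w : ℝ → ℝ) : Prop where
  y_mono : Monotone y
  y_lip : ∃ K, LipschitzWith K y
  y_surj : Function.Surjective y
  U_lip : ∃ K, LipschitzWith K U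
  w_nonneg : ∀ ξ, 0 ≤ w ξ
  w_int : Integrable w
  rel : ∀ᵐ ξ, deriv U ξ ^ 2 = deriv y ξ * w ξ

/-- A monotone function with equal values at two points is constant in between, which forces a
vanishing one-sided derivative. -/
lemma eq_of_deriv_ne_zero_of_eq {y : ℝ → ℝ} (hy : Monotone y) {ξ η : ℝ} (h : deriv y ξ ≠ 0)
    (he : y η = y ξ) : η = ξ := by
  by_contra hne
  have hd := (differentiableAt_of_deriv_ne_zero h).hasDerivAt
  rcases lt_or_gt_of_ne hne with hlt | hlt
  · have h1 : HasDerivWithinAt y 0 (Iic ξ) ξ := by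
      refine (hasDerivWithinAt_const ξ (Iic ξ) (y ξ)).congr_of_eventuallyEq ?_ rfl
      filter_upwards [Icc_mem_nhdsLE hlt] with x hx
      exact le_antisymm (hy hx.2) (he ▸ hy hx.1)
    exact h ((uniqueDiffWithinAt_Iic ξ).eq_deriv _ hd.hasDerivWithinAt h1)
  · have h1 : HasDerivWithinAt y 0 (Ici ξ) ξ := by
      refine (hasDerivWithinAt_const ξ (Ici ξ) (y ξ)).congr_of_eventuallyEq ?_ rfl
      filter_upwards [Icc_mem_nhdsGE hlt] with x hx
      exact le_antisymm (he ▸ hy hx.2) (hy hx.1)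
    exact h ((uniqueDiffWithinAt_Ici ξ).eq_deriv _ hd.hasDerivWithinAt h1)

namespace Transport

variable {y U w : ℝ → ℝ} (h : Transport y U w)
include h

lemma deriv_y_nonneg (ξ : ℝ) : 0 ≤ deriv y ξ := h.y_mono.deriv_nonneg

/-- Cauchy–Schwarz for `|U_ξ| = √y_ξ √w`, obtained by integrating Young's inequality, so that only
the integrals of `y_ξ` and `w` occur. -/
lemma sq_sub_le {a b : ℝ} (hab : a ≤ b) : (U b - U a) ^ 2 ≤ (y b - y a) * ∫ ξ, w ξ := by
  obtain ⟨K, hK⟩ := h.y_lip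
  obtain ⟨L, hL⟩ := h.U_lip
  rw [← sq_abs]
  refine sq_le_mul_of_forall_two_mul_le (abs_nonneg _) (sub_nonneg.2 (h.y_mono hab))
    (integral_nonneg h.w_nonneg) fun l hl => ?_
  have h1 : |U b - U a| ≤ ∫ ξ in a..b, |deriv U ξ| := by
    rw [hL.isPrimitive.2]; exact intervalIntegral.abs_integral_le_integral_abs hab
  have iw : IntervalIntegrable w volume a b := h.w_int.intervalIntegrable
  have iy := hK.isPrimitive.1 a b
  have h2 : ∫ ξ in a..b, 2 * l * |deriv U ξ| ≤ ∫ ξ in a..b, (l ^ 2 * deriv y ξ + w ξ) := by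
    refine intervalIntegral.integral_mono_ae hab ((hL.isPrimitive.1 a b).abs.const_mul _)
      ((iy.const_mul _).add iw) ?_
    filter_upwards [h.rel] with ξ hξ
    have hy := h.deriv_y_nonneg ξ
    have hw := h.w_nonneg ξ
    have h3 : |deriv U ξ| = √(deriv y ξ) * √(w ξ) := by
      rw [← Real.sqrt_mul hy, ← hξ, Real.sqrt_sq_eq_abs]
    rw [h3]
    nlinarith [sq_nonneg (l * √(deriv y ξ) - √(w ξ)), Real.sq_sqrt hy, Real.sq_sqrt hw]
  rw [intervalIntegral.integral_const_mul, intervalIntegral.integral_add (iy.const_mul _) iw,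
    intervalIntegral.integral_const_mul, ← hK.isPrimitive.2] at h2
  have h4 : ∫ ξ in a..b, w ξ ≤ ∫ ξ, w ξ := by
    rw [intervalIntegral.integral_of_le hab]
    exact setIntegral_le_integral h.w_int (ae_of_all _ h.w_nonneg)
  nlinarith

lemma sq_sub_le_abs (a b : ℝ) : (U b - U a) ^ 2 ≤ |y b - y a| * ∫ ξ, w ξ := by
  rcases le_total a b with hab | hab
  · rw [abs_of_nonneg (sub_nonneg.2 (h.y_mono hab))]; exact h.sq_sub_le hab
  · rw [abs_sub_comm, abs_of_nonneg (sub_nonneg.2 (h.y_mono hab))]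
    have := h.sq_sub_le hab
    nlinarith

/-- Labels at the same position carry the same `U`, so it is irrelevant which preimage `invFun`
selects. -/
lemma u_comp (ξ : ℝ) : U (Function.invFun y (y ξ)) = U ξ := by
  have h1 : y (Function.invFun y (y ξ)) = y ξ := Function.invFun_eq ⟨ξ, rfl⟩
  have h2 := h.sq_sub_le_abs ξ (Function.invFun y (y ξ))
  rw [h1, sub_self, abs_zero, zero_mul] at h2
  nlinarith

/-- Converts uniform closeness of characteristics into uniform closeness of the Eulerian velocities.
-/
lemma sq_u_sub_le (a b : ℝ) :
    (U (Function.invFun y b) - U (Function.invFun y a)) ^ 2 ≤ |b - a| * ∫ ξ, w ξ := by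
  have := h.sq_sub_le_abs (Function.invFun y a) (Function.invFun y b)
  rwa [Function.invFun_eq (h.y_surj a), Function.invFun_eq (h.y_surj b)] at this

lemma monotone_invFun : Monotone (Function.invFun y) := fun a b hab => by
  by_contra! hlt
  have := h.y_mono hlt.le
  rw [Function.invFun_eq (h.y_surj a), Function.invFun_eq (h.y_surj b)] at this
  rw [le_antisymm hab this] at hlt
  exact lt_irrefl _ hlt

lemma integral_eq {f : ℝ → ℝ} (hf : AEStronglyMeasurable f volume) :
    ∫ x, f x = ∫ ξ, deriv y ξ * f (y ξ) := by
  obtain ⟨K, hK⟩ := h.y_lip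
  have h1 := map_withDensity_deriv h.y_mono hK h.y_surj
  conv_lhs => rw [← h1]
  rw [integral_map h.y_mono.measurable.aemeasurable (by rwa [h1]),
    integral_withDensity_eq_integral_toReal_smul (measurable_deriv y).ennreal_ofReal
      (ae_of_all _ fun _ => ENNReal.ofReal_lt_top)]
  simp_rw [ENNReal.toReal_ofReal (h.deriv_y_nonneg _), smul_eq_mul]

/-- The spatial derivative of `u = U ∘ y⁻¹`. -/
lemma exists_deriv : ∃ g : ℝ → ℝ, Measurable g ∧ MemLp g 2 volume ∧
    (∫ x, g x ^ 2) ≤ ∫ ξ, w ξ ∧ (∀ᵐ ξ, deriv y ξ * g (y ξ) = deriv U ξ) := by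
  obtain ⟨K, hK⟩ := h.y_lip
  -- Where `y_ξ ≠ 0` the label is determined by its position and `g (y ξ)` is `U_ξ / y_ξ`. Where
  -- `y_ξ = 0`, the relation for `U_ξ²` forces `U_ξ = 0`.
  set g : ℝ → ℝ := fun x => deriv U (Function.invFun y x) / deriv y (Function.invFun y x) with hg
  have hgm : Measurable g := ((measurable_deriv U).comp h.monotone_invFun.measurable).div
    ((measurable_deriv y).comp h.monotone_invFun.measurable)
  have h1 : ∀ᵐ ξ, deriv y ξ * g (y ξ) = deriv U ξ ∧ deriv y ξ * g (y ξ) ^ 2 ≤ w ξ := by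
    filter_upwards [h.rel] with ξ hξ
    by_cases hy : deriv y ξ = 0
    · have : deriv U ξ = 0 := by rw [hy, zero_mul] at hξ; exact pow_eq_zero_iff two_ne_zero |>.1 hξ
      simp [hy, this, h.w_nonneg ξ]
    · have h2 : Function.invFun y (y ξ) = ξ :=
        eq_of_deriv_ne_zero_of_eq h.y_mono hy (Function.invFun_eq ⟨ξ, rfl⟩)
      simp only [hg, h2]
      refine ⟨by field_simp, le_of_eq ?_⟩
      rw [div_pow, hξ]; field_simp
  have h3 : ∫⁻ x, ENNReal.ofReal (g x ^ 2) ≤ ENNReal.ofReal (∫ ξ, w ξ) := by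
    rw [← lintegral_deriv_mul_comp h.y_mono hK h.y_surj fun x => ENNReal.ofReal (g x ^ 2),
      ofReal_integral_eq_lintegral_ofReal h.w_int (ae_of_all _ h.w_nonneg)]
    refine lintegral_mono_ae ?_
    filter_upwards [h1] with ξ hξ
    rw [← ENNReal.ofReal_mul (h.deriv_y_nonneg ξ)]
    exact ENNReal.ofReal_le_ofReal hξ.2
  have h4 : Integrable fun x => g x ^ 2 := by
    refine ⟨(hgm.pow_const 2).aestronglyMeasurable, ?_⟩
    rw [hasFiniteIntegral_iff_ofReal (ae_of_all _ fun x => sq_nonneg _)]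
    exact h3.trans_lt ENNReal.ofReal_lt_top
  refine ⟨g, hgm, (memLp_two_iff_integrable_sq hgm.aestronglyMeasurable).2 h4, ?_,
    h1.mono fun ξ hξ => hξ.1⟩
  rw [integral_eq_lintegral_of_nonneg_ae (ae_of_all _ fun x => sq_nonneg _)
    (hgm.pow_const 2).aestronglyMeasurable]
  exact ENNReal.toReal_le_of_le_ofReal (integral_nonneg h.w_nonneg) h3

/-- The conditions `y ξ ∈ (y a, y b]` and `ξ ∈ (a, b]` differ only for labels at the positions `y a`
and `y b`, where `y_ξ = 0` almost everywhere. -/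
lemma integral_deriv_comp {g : ℝ → ℝ} (hg : Measurable g)
    (hgU : ∀ᵐ ξ, deriv y ξ * g (y ξ) = deriv U ξ) {a b : ℝ} (hab : a ≤ b) :
    ∫ x in y a..y b, g x = ∫ ξ in a..b, deriv U ξ := by
  obtain ⟨K, hK⟩ := h.y_lip
  rw [intervalIntegral.integral_of_le hab, intervalIntegral.integral_of_le (h.y_mono hab),
    ← integral_indicator measurableSet_Ioc, ← integral_indicator measurableSet_Ioc,
    h.integral_eq ((hg.indicator measurableSet_Ioc).aestronglyMeasurable)]
  have h0 := ae_deriv_eq_zero_of_mem_null h.y_mono hK h.y_surj (N := {y a, y b})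
    (Set.Finite.measure_zero (by simp) _)
  refine integral_congr_ae ?_
  filter_upwards [hgU, h0] with ξ h1 h2
  by_cases h3 : y ξ ∈ Ioc (y a) (y b) <;> by_cases h4 : ξ ∈ Ioc a b
  · rw [indicator_of_mem h3, indicator_of_mem h4, h1]
  · have h5 : a < ξ := by
      by_contra! h5; exact absurd (h.y_mono h5) (not_le.2 h3.1)
    have h6 : b < ξ := by
      by_contra! h6; exact h4 ⟨h5, h6⟩
    have h7 : y ξ = y b := le_antisymm h3.2 (h.y_mono h6.le)
    rw [h2 (by simp [h7]), zero_mul, indicator_of_notMem h4]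
  · have h5 : y ξ = y a := by
      refine le_antisymm ?_ (h.y_mono h4.1.le)
      by_contra! h5; exact h3 ⟨h5, h.y_mono h4.2⟩
    rw [indicator_of_notMem h3, indicator_of_mem h4, ← h1, h2 (by simp [h5]), mul_zero, zero_mul]
  · rw [indicator_of_notMem h3, indicator_of_notMem h4, mul_zero]

/-- Increments of `u` are integrals of the candidate derivative `g`, which is therefore `u_x` a.e.
The energy estimate is only an inequality, because the part of `w` on labels with `y_ξ = 0` is
invisible to `u_x`. -/
lemma eulerian :
    IsPrimitive (fun x => U (Function.invFun y x)) ∧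
    MemLp (deriv fun x => U (Function.invFun y x)) 2 volume ∧
    (∫ x, (deriv (fun x => U (Function.invFun y x)) x) ^ 2) ≤ ∫ ξ, w ξ ∧
    ∀ᵐ ξ, deriv y ξ * deriv (fun x => U (Function.invFun y x)) (y ξ) = deriv U ξ := by
  obtain ⟨K, hK⟩ := h.y_lip
  obtain ⟨L, hL⟩ := h.U_lip
  obtain ⟨g, hgm, hg2, hgi, hgU⟩ := h.exists_deriv
  set u : ℝ → ℝ := fun x => U (Function.invFun y x) with hu
  have hgloc : ∀ a b, IntervalIntegrable g volume a b := intervalIntegrable_of_memLp hg2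
  have h1 : ∀ a b, a ≤ b → u b - u a = ∫ x in a..b, g x := by
    intro a b hab
    have h2 := h.integral_deriv_comp hgm hgU (h.monotone_invFun hab)
    rw [Function.invFun_eq (h.y_surj a), Function.invFun_eq (h.y_surj b), ← hL.isPrimitive.2] at h2
    exact h2.symm
  have h2 : ∀ a b, u b - u a = ∫ x in a..b, g x := fun a b => by
    rcases le_total a b with hab | hab
    · exact h1 a b hab
    · rw [intervalIntegral.integral_symm, ← h1 b a hab]; ring
  have h3 : ∀ᵐ x, deriv u x = g x := by
    filter_upwards [LocallyIntegrable.ae_hasDerivAt_integral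
      (locallyIntegrable_of_intervalIntegrable hgloc)] with x hx
    have h4 : u = fun x => u 0 + ∫ t in (0 : ℝ)..x, g t := by ext x; rw [← h2]; ring
    rw [h4]
    exact ((hx 0).const_add _).deriv
  refine ⟨⟨fun a b => (hgloc a b).congr_ae (ae_restrict_of_ae (h3.mono fun x hx => hx.symm)),
    fun a b => ?_⟩,
    (memLp_congr_ae h3).2 hg2, ?_, ?_⟩
  · rw [h2]
    exact intervalIntegral.integral_congr_ae (h3.mono fun x hx _ => hx.symm)
  · refine le_trans (le_of_eq ?_) hgi
    exact integral_congr_ae (h3.mono fun x hx => by simp only [hx])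
  · have h5 := ae_deriv_eq_zero_of_mem_null h.y_mono hK h.y_surj (N := {x | deriv u x ≠ g x}) h3
    filter_upwards [hgU, h5] with ξ h6 h7
    by_cases h8 : deriv u (y ξ) = g (y ξ)
    · rw [h8, h6]
    · rw [← h6, h7 h8]; simp

lemma integral_mul_deriv {φ : ℝ → ℝ} (hφ : Continuous φ) :
    ∫ x, φ x * deriv (fun x => U (Function.invFun y x)) x = ∫ ξ, φ (y ξ) * deriv U ξ := by
  rw [h.integral_eq (f := fun x => φ x * deriv (fun x => U (Function.invFun y x)) x)
    (hφ.measurable.mul (measurable_deriv _)).aestronglyMeasurable]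
  refine integral_congr_ae ?_
  filter_upwards [h.eulerian.2.2.2] with ξ hξ
  rw [← hξ]; ring

/-- `dx` is the image of `y_ξ dξ`, and `y_ξ` is at most the Lipschitz constant. -/
lemma memLp_of_comp {f : ℝ → ℝ} (hf : AEStronglyMeasurable f volume)
    (hfy : MemLp (fun ξ => f (y ξ)) 2 volume) : MemLp f 2 volume := by
  obtain ⟨K, hK⟩ := h.y_lip
  have h1 := map_withDensity_deriv h.y_mono hK h.y_surj
  rw [← h1] at hf ⊢
  rw [memLp_map_measure_iff hf h.y_mono.measurable.aemeasurable]
  refine hfy.of_measure_le_smul (c := (K : ℝ≥0∞)) (by simp) ?_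
  rw [← withDensity_const]
  refine withDensity_mono (ae_of_all _ fun ξ => ?_)
  refine ENNReal.ofReal_le_of_le_toReal ?_
  have := norm_deriv_le_of_lipschitz hK (x₀ := ξ)
  exact (le_abs_self _).trans this

/-- Since `y` displaces labels by at most `C`, the labels over a half-line lie in the same half-line
enlarged by a bounded interval, on which the continuous `U` is bounded. -/
lemma hasTails {a b C : ℝ} (hU : HasTails U a b) (hC : ∀ ξ, |y ξ - ξ| ≤ C) :
    HasTails (fun x => U (Function.invFun y x)) a b := by
  obtain ⟨L, hL⟩ := h.U_lip
  have hm : Measurable fun x => U (Function.invFun y x) :=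
    hL.continuous.measurable.comp h.monotone_invFun.measurable
  have key : ∀ (c : ℝ) (s : Set ℝ) (t : Set ℝ), MeasurableSet s → (∀ ξ, y ξ ∈ s → ξ ∈ t) →
      MemLp (fun ξ => U ξ - c) 2 (volume.restrict t) →
      MemLp (fun x => U (Function.invFun y x) - c) 2 (volume.restrict s) := by
    intro c s t hs hst hU
    rw [← memLp_indicator_iff_restrict hs]
    refine h.memLp_of_comp ((hm.sub_const c).indicator hs).aestronglyMeasurable ?_
    have e : (fun ξ => s.indicator (fun x => U (Function.invFun y x) - c) (y ξ)) =
        (y ⁻¹' s).indicator fun ξ => U ξ - c := by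
      ext ξ
      by_cases hξ : y ξ ∈ s
      · rw [indicator_of_mem hξ, indicator_of_mem (by exact hξ), h.u_comp]
      · rw [indicator_of_notMem hξ, indicator_of_notMem (by exact hξ)]
    rw [e, memLp_indicator_iff_restrict (h.y_mono.measurable hs)]
    exact hU.mono_measure (Measure.restrict_mono hst le_rfl)
  have hb : ∀ c : ℝ, MemLp (fun ξ => U ξ - c) 2 (volume.restrict (Icc (-|C|) |C|)) := fun c => by
    have : IsFiniteMeasure (volume.restrict (Icc (-|C|) |C|)) := ⟨by simp⟩
    have hc : Continuous fun ξ => U ξ - c := hL.continuous.sub continuous_const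
    obtain ⟨B, hB⟩ := (isCompact_Icc (a := -|C|) (b := |C|)).exists_bound_of_continuousOn
      hc.continuousOn
    exact MemLp.of_bound hc.aestronglyMeasurable B
      ((ae_restrict_iff' measurableSet_Icc).2 (ae_of_all _ hB))
  constructor
  · refine key a (Iio 0) (Iio 0 ∪ Icc (-|C|) |C|) measurableSet_Iio (fun ξ hξ => ?_)
      (memLp_restrict_union hU.1 (hb a))
    have h1 := abs_le.1 (hC ξ)
    have h2 : y ξ < 0 := hξ
    rcases lt_or_ge ξ 0 with h3 | h3
    · exact Or.inl h3
    · exact Or.inr ⟨by linarith [abs_nonneg C], by linarith [le_abs_self C]⟩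
  · refine key b (Ioi 0) (Ioi 0 ∪ Icc (-|C|) |C|) measurableSet_Ioi (fun ξ hξ => ?_)
      (memLp_restrict_union hU.2 (hb b))
    have h1 := abs_le.1 (hC ξ)
    have h2 : 0 < y ξ := hξ
    rcases lt_or_ge 0 ξ with h3 | h3
    · exact Or.inl h3
    · exact Or.inr ⟨by linarith [le_abs_self C], by linarith [abs_nonneg C]⟩

lemma memE2 {a b C : ℝ} (hU : HasTails U a b) (hC : ∀ ξ, |y ξ - ξ| ≤ C) :
    MemE2 fun x => U (Function.invFun y x) :=
  memE2_of_hasTails (h.hasTails hU hC) h.eulerian.1 h.eulerian.2.1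

end Transport

lemma integral_map_withDensity_ofReal {y g φ : ℝ → ℝ} (hy : Measurable y) (hg : AEMeasurable g)
    (hφ : Continuous φ) :
    ∫ x, φ x ∂((volume.withDensity fun ξ => ENNReal.ofReal (g ξ)).map y) =
      ∫ ξ, φ (y ξ) * max (g ξ) 0 := by
  rw [integral_map hy.aemeasurable hφ.aestronglyMeasurable,
    integral_withDensity_eq_integral_toReal_smul₀ hg.ennreal_ofReal
      (ae_of_all _ fun _ => ENNReal.ofReal_lt_top)]
  refine integral_congr_ae (ae_of_all _ fun ξ => ?_)
  simp only [ENNReal.toReal_ofReal', smul_eq_mul]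
  ring

/-- Recombines the positive and negative parts into one integral over labels, which requires the
product with `φ` to be integrable. -/
lemma pushIntegral_eq {y g φ : ℝ → ℝ} (hy : Measurable y) (hg : AEMeasurable g)
    (hφ : Continuous φ) (hi : Integrable fun ξ => φ (y ξ) * g ξ) :
    pushIntegral y g φ = ∫ ξ, φ (y ξ) * g ξ := by
  have hm : AEMeasurable fun ξ => φ (y ξ) := (hφ.measurable.comp hy).aemeasurable
  have hi' : ∀ {f : ℝ → ℝ}, AEMeasurable f → (∀ ξ, |f ξ| ≤ |g ξ|) →
      Integrable fun ξ => φ (y ξ) * f ξ := fun hf hfg => by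
    refine hi.mono (hm.mul hf).aestronglyMeasurable (ae_of_all _ fun ξ => ?_)
    simp only [norm_mul, Real.norm_eq_abs]
    exact mul_le_mul_of_nonneg_left (hfg ξ) (abs_nonneg _)
  have hg' : AEMeasurable fun ξ => -g ξ := hg.neg
  unfold pushIntegral
  rw [integral_map_withDensity_ofReal hy hg hφ, integral_map_withDensity_ofReal hy hg' hφ,
    ← integral_sub (hi' (hg.max aemeasurable_const) fun ξ => ?_)
      (hi' (hg'.max aemeasurable_const) fun ξ => ?_)]
  · refine integral_congr_ae (ae_of_all _ fun ξ => ?_)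
    simp only
    rcases le_total (g ξ) 0 with h | h
    · rw [max_eq_right h, max_eq_left (by simpa using h)]; simp
    · rw [max_eq_left h, max_eq_right (by simpa using h)]; simp
  · rcases le_total (g ξ) 0 with h | h
    · rw [max_eq_right h]; simp
    · rw [max_eq_left h]
  · rcases le_total (g ξ) 0 with h | h
    · rw [max_eq_left (by simpa using h)]; simp
    · rw [max_eq_right (by simpa using h)]; simp

/-! ## Stability -/

/-- The initial velocity contributes `B`. The density `dens2` changes at a rate of at most `T H_ξ`,
and the factor 1/4 comes from `abs_half_integral_Iic_sub_le`. -/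
lemma abs_evo_y_sub_time_le {X : Lag} {E B T : ℝ} (h : InitData X E) {β : ℝ → ℝ}
    (hb : ∀ η, β η ∈ Icc (0 : ℝ) 1) (hβ : Measurable β) (hB : ∀ ξ, |X.U ξ| ≤ B) {s t : ℝ}
    (hs : s ∈ Icc 0 T) (ht : t ∈ Icc 0 T) (ξ : ℝ) :
    |(evo X β t).y ξ - (evo X β s).y ξ| ≤ (B + T * E / 4) * |t - s| := by
  wlog hst : s ≤ t generalizing s t
  · rw [abs_sub_comm, abs_sub_comm t]; exact this ht hs (by linarith)
  have i1 := integrable_dens2 h.toEnergyData hb hβ ht.1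
  have i2 := integrable_dens2 h.toEnergyData hb hβ hs.1
  have hi : Integrable (fun η => dens2 X β t η - dens2 X β s η) := i1.sub i2
  have h1 : (evo X β t).y ξ - (evo X β s).y ξ = (t - s) * X.U ξ +
      (1 / 2 * (∫ η in Iic ξ, (dens2 X β t η - dens2 X β s η)) -
        1 / 4 * ∫ η, (dens2 X β t η - dens2 X β s η)) := by
    rw [integral_sub i1 i2, integral_sub i1.integrableOn i2.integrableOn]
    simp only [evo]; ring
  have h2 : ∫ η, |dens2 X β t η - dens2 X β s η| ≤ ∫ η, T * (t - s) * deriv X.H η := by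
    refine integral_mono hi.abs (h.integrable_deriv_H.const_mul _) fun η => ?_
    have e1 : dens2 X β t η - dens2 X β s η = ((t ^ 2 - s ^ 2) / 2 -
        β η * ((elapsed X t η ^ 2 - elapsed X s η ^ 2) / 2)) * deriv X.H η := by
      unfold dens2; ring
    simp only [e1]
    rw [abs_mul, abs_of_nonneg (h.deriv_H_nonneg η)]
    refine mul_le_mul_of_nonneg_right ?_ (h.deriv_H_nonneg η)
    have e2 : 0 ≤ elapsed X t η - elapsed X s η ∧ elapsed X t η - elapsed X s η ≤ t - s := by
      unfold elapsed; split_ifs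
      · rcases max_cases (t - breakTime X η) 0 with h3 | h3 <;>
          rcases max_cases (s - breakTime X η) 0 with h4 | h4 <;> constructor <;> linarith
      · simp [hst]
    have e3 := elapsed_le h.toEnergyData ht.1 η
    have e4 := elapsed_le h.toEnergyData hs.1 η
    have e5 := elapsed_nonneg X s η
    have e6 := elapsed_nonneg X t η
    set d := elapsed X t η ^ 2 - elapsed X s η ^ 2
    have e7 : 0 ≤ d := by
      simp only [d]; nlinarith
    have e8 : d ≤ t ^ 2 - s ^ 2 := by
      simp only [d]
      nlinarith [mul_nonneg e2.1 (by linarith : 0 ≤ t + s - (elapsed X t η + elapsed X s η)),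
        mul_nonneg (sub_nonneg.2 e2.2) (by linarith [hs.1, ht.1] : 0 ≤ t + s)]
    have e9 := mul_nonneg (hb η).1 e7
    have e10 := mul_le_mul_of_nonneg_right (hb η).2 e7
    rw [abs_of_nonneg (by linarith)]
    nlinarith [hs.1, ht.2, hs.2]
  rw [integral_const_mul, h.integral_deriv_H] at h2
  have h3 := abs_half_integral_Iic_sub_le hi ξ
  rw [h1]
  refine (abs_add_le _ _).trans ?_
  rw [abs_mul, abs_of_nonneg (sub_nonneg.2 hst)]
  have h4 := mul_le_mul_of_nonneg_left (hB ξ) (sub_nonneg.2 hst)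
  nlinarith

open Classical in
/-- A bound for the difference of the wave breaking times of `X` and `X'`, capped at `T`. -/
noncomputable def delayGap (T : ℝ) (X X' : Lag) (η : ℝ) : ℝ :=
  if deriv X.U η < 0 then
    if deriv X'.U η < 0 then min T |breakTime X' η - breakTime X η| else T
  else if deriv X'.U η < 0 then T else 0

lemma delayGap_nonneg {T : ℝ} (hT : 0 ≤ T) (X X' : Lag) (η : ℝ) : 0 ≤ delayGap T X X' η := by
  unfold delayGap; split_ifs <;> positivity

lemma delayGap_le {T : ℝ} (hT : 0 ≤ T) (X X' : Lag) (η : ℝ) : delayGap T X X' η ≤ T := by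
  unfold delayGap; split_ifs <;> first | exact min_le_left _ _ | exact hT | exact le_rfl

lemma measurable_delayGap (T : ℝ) (X X' : Lag) : Measurable (delayGap T X X') := by
  have hU := fun X : Lag => measurableSet_lt (measurable_deriv X.U) (measurable_const (a := (0 : ℝ)))
  exact Measurable.ite (hU X) (Measurable.ite (hU X') (measurable_const.min
    ((measurable_breakTime X').sub (measurable_breakTime X)).abs) measurable_const)
    (Measurable.ite (hU X') measurable_const measurable_const)

/-! ### Comparison of two evolutions with the same total energy -/

section Pair

variable {α : ℝ → ℝ} {X X' : Lag} {E : ℝ} (h : InitData X E) (h' : InitData X' E)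
include h h'

lemma abs_elapsed_sub_le {t T : ℝ} (ht : t ∈ Icc 0 T) (η : ℝ) :
    |elapsed X' t η - elapsed X t η| ≤ delayGap T X X' η := by
  have a1 := elapsed_nonneg X t η
  have a2 := elapsed_le h.toEnergyData ht.1 η
  have a3 := elapsed_nonneg X' t η
  have a4 := elapsed_le h'.toEnergyData ht.1 η
  have h0 : |elapsed X' t η - elapsed X t η| ≤ T := by
    rw [abs_le]; constructor <;> linarith [ht.2]
  unfold delayGap
  split_ifs with h1 h2 h2
  · refine le_min h0 ?_
    simp only [elapsed, h1, h2, if_true]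
    rw [abs_sub_comm (breakTime X' η)]
    refine (abs_max_sub_max_le_abs _ _ _).trans (le_of_eq ?_)
    congr 1; ring
  · exact h0
  · exact h0
  · simp [elapsed, h1, h2]

lemma abs_elapsed_sq_sub_le {t T : ℝ} (ht : t ∈ Icc 0 T) (η : ℝ) :
    |elapsed X' t η ^ 2 - elapsed X t η ^ 2| ≤ 2 * T * delayGap T X X' η := by
  have a1 := elapsed_nonneg X t η
  have a2 := elapsed_le h.toEnergyData ht.1 η
  have a3 := elapsed_nonneg X' t η
  have a4 := elapsed_le h'.toEnergyData ht.1 η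
  have e : elapsed X' t η ^ 2 - elapsed X t η ^ 2 =
      (elapsed X' t η + elapsed X t η) * (elapsed X' t η - elapsed X t η) := by ring
  rw [e, abs_mul, abs_of_nonneg (by linarith)]
  exact mul_le_mul (by linarith [ht.2]) (abs_elapsed_sub_le h h' ht η) (abs_nonneg _)
    (by linarith [ht.1, ht.2])

lemma delayGap_eq {T η : ℝ} (h1 : deriv X.U η < 0) (h2 : deriv X'.U η < 0)
    (h3 : breakTime X η ≤ T) (h4 : breakTime X' η ≤ T) :
    delayGap T X X' η = |breakTime X' η - breakTime X η| := by
  have a1 := breakTime_nonneg h.toEnergyData h1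
  have a2 := breakTime_nonneg h'.toEnergyData h2
  simp only [delayGap, h1, h2, if_true]
  refine min_eq_right ?_
  rw [abs_le]; constructor <;> linarith

/-- If one of the two waves has not broken, only the elapsed times matter. If both have, the losses
differ by the defect `δ`, by the motion of `y'` between the two breaking times, and by the distance
of the characteristics at time `τ`, whose weight `exp (l τ)` is absorbed by `(t - τ)²`. -/
lemma abs_loss_mul_sq_sub_le (hα : IsCoefficient α) {β β' : ℝ → ℝ}
    (hb : ∀ η, β η ∈ Icc (0 : ℝ) 1) (hb' : ∀ η, β' η ∈ Icc (0 : ℝ) 1) {δ C D l t T η : ℝ}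
    (ht : t ∈ Icc 0 T) (hl : 0 < l) (hD : 0 ≤ D) (hC : 0 ≤ C) (hδ : 0 ≤ δ)
    (hfix : deriv X.U η < 0 → β η = α ((evo X β (breakTime X η)).y η))
    (hfix' : deriv X'.U η < 0 → breakTime X' η ≤ T →
      |β' η - α ((evo X' β' (breakTime X' η)).y η)| ≤ δ)
    (hlip : ∀ s ∈ Icc 0 T, ∀ s' ∈ Icc 0 T,
      |(evo X' β' s).y η - (evo X' β' s').y η| ≤ C * |s - s'|)
    (hy : ∀ s ∈ Icc 0 T, |(evo X' β' s).y η - (evo X β s).y η| ≤ D * Real.exp (l * s)) :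
    |β' η * elapsed X' t η ^ 2 - β η * elapsed X t η ^ 2| ≤
      (2 * T + T ^ 2 * (derivSupNorm α * C)) * delayGap T X X' η + T ^ 2 * δ +
        derivSupNorm α * D * (2 / l ^ 2) * Real.exp (l * t) := by
  have hK := derivSupNorm_nonneg α
  have hT : 0 ≤ T := ht.1.trans ht.2
  have hg := delayGap_nonneg hT X X' η
  have h0 := abs_elapsed_sq_sub_le h h' ht η
  have r1 : 0 ≤ T ^ 2 * (derivSupNorm α * C) * delayGap T X X' η := by positivity
  have r2 : 0 ≤ T ^ 2 * δ := by positivity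
  have r3 : 0 ≤ derivSupNorm α * D * (2 / l ^ 2) * Real.exp (l * t) := by positivity
  by_cases hX : elapsed X t η = 0
  · rw [hX] at h0 ⊢
    have h1 : |β' η * elapsed X' t η ^ 2 - β η * 0 ^ 2| ≤ |elapsed X' t η ^ 2 - 0 ^ 2| := by
      rw [zero_pow two_ne_zero, mul_zero, sub_zero, sub_zero, abs_mul, abs_of_nonneg (hb' η).1]
      exact mul_le_of_le_one_left (abs_nonneg _) (hb' η).2
    refine (h1.trans h0).trans ?_
    rw [add_mul]
    linarith only [r1, r2, r3]
  by_cases hX' : elapsed X' t η = 0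
  · rw [hX'] at h0 ⊢
    have h1 : |β' η * 0 ^ 2 - β η * elapsed X t η ^ 2| ≤ |0 ^ 2 - elapsed X t η ^ 2| := by
      rw [zero_pow two_ne_zero, mul_zero, zero_sub, zero_sub, abs_neg, abs_neg, abs_mul,
        abs_of_nonneg (hb η).1]
      exact mul_le_of_le_one_left (abs_nonneg _) (hb η).2
    refine (h1.trans h0).trans ?_
    rw [add_mul]
    linarith only [r1, r2, r3]
  have key : ∀ {Y : Lag}, elapsed Y t η ≠ 0 → deriv Y.U η < 0 ∧ breakTime Y η < t := by
    intro Y hY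
    unfold elapsed at hY
    split_ifs at hY with h1
    · refine ⟨h1, ?_⟩
      by_contra! h2
      exact hY (max_eq_right (by linarith))
    · exact absurd rfl hY
  obtain ⟨hU, hbt⟩ := key hX
  obtain ⟨hU', hbt'⟩ := key hX'
  have hbT : breakTime X η ∈ Icc 0 T := ⟨breakTime_nonneg h.toEnergyData hU, hbt.le.trans ht.2⟩
  have hbT' : breakTime X' η ∈ Icc 0 T :=
    ⟨breakTime_nonneg h'.toEnergyData hU', hbt'.le.trans ht.2⟩
  have hgap := delayGap_eq h h' hU hU' hbT.2 hbT'.2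
  have h1 : |β' η - β η| ≤ δ + derivSupNorm α * C * delayGap T X X' η +
      derivSupNorm α * D * Real.exp (l * breakTime X η) := by
    have e1 := hfix' hU' hbT'.2
    have e2 := hα.abs_sub_le ((evo X' β' (breakTime X' η)).y η) ((evo X β (breakTime X η)).y η)
    have e3 := hlip _ hbT' _ hbT
    have e4 := hy _ hbT
    have e5 := abs_sub_le ((evo X' β' (breakTime X' η)).y η) ((evo X' β' (breakTime X η)).y η)
      ((evo X β (breakTime X η)).y η)
    have e6 := mul_le_mul_of_nonneg_left (e5.trans (add_le_add e3 e4)) hK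
    rw [← hfix hU] at e2
    rw [hgap]
    have e7 := abs_sub_le (β' η) (α ((evo X' β' (breakTime X' η)).y η)) (β η)
    linarith
  have h2 : β' η * elapsed X' t η ^ 2 - β η * elapsed X t η ^ 2 =
      β' η * (elapsed X' t η ^ 2 - elapsed X t η ^ 2) + (β' η - β η) * elapsed X t η ^ 2 := by ring
  have h3 : elapsed X t η ^ 2 ≤ T ^ 2 := by
    have := elapsed_nonneg X t η
    have := (elapsed_le h.toEnergyData ht.1 η).trans ht.2
    gcongr
  have h4 : elapsed X t η ^ 2 * Real.exp (l * breakTime X η) ≤ 2 / l ^ 2 * Real.exp (l * t) := by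
    have := sq_mul_exp_le (b := breakTime X η) (t := t) hl
    simpa only [elapsed, hU, if_true] using this
  rw [h2]
  refine (abs_add_le _ _).trans ?_
  rw [abs_mul, abs_mul, abs_of_nonneg (hb' η).1, abs_of_nonneg (sq_nonneg (elapsed X t η))]
  have h5 : β' η * |elapsed X' t η ^ 2 - elapsed X t η ^ 2| ≤ 2 * T * delayGap T X X' η :=
    (mul_le_of_le_one_left (abs_nonneg _) (hb' η).2).trans h0
  have h6 := mul_le_mul_of_nonneg_right h1 (sq_nonneg (elapsed X t η))
  have h7 := mul_le_mul_of_nonneg_left h3 (by positivity :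
    0 ≤ δ + derivSupNorm α * C * delayGap T X X' η)
  have h8 := mul_le_mul_of_nonneg_left h4 (mul_nonneg hK hD)
  linarith

/-- Total contribution of the data and of the errors in the losses to `y' - y`. -/
noncomputable def stabError (α : ℝ → ℝ) (E T C δ : ℝ) (X X' : Lag) : ℝ :=
  (1 + T) * δ + 1 / 4 * (T ^ 2 * (∫ η, |deriv X'.H η - deriv X.H η|) +
    1 / 2 * ((2 * T + T ^ 2 * (derivSupNorm α * C)) * (∫ η, delayGap T X X' η * deriv X.H η) +
      T ^ 2 * δ * E))

omit h' in
lemma integrable_delayGap {T : ℝ} (hT : 0 ≤ T) :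
    Integrable fun η => delayGap T X X' η * deriv X.H η := by
  refine (h.integrable_deriv_H.const_mul T).mono'
    ((measurable_delayGap T X X').mul (measurable_deriv _)).aestronglyMeasurable
    (ae_of_all _ fun η => ?_)
  rw [Real.norm_of_nonneg (mul_nonneg (delayGap_nonneg hT X X' η) (h.deriv_H_nonneg η))]
  exact mul_le_mul_of_nonneg_right (delayGap_le hT X X' η) (h.deriv_H_nonneg η)

/-- Bootstrap step: `D` returns only through the losses, and there with the factor `K E / l² ≤ 1`
times 1/4. -/
lemma abs_evo_y_sub_evo_le (hα : IsCoefficient α) {β β' : ℝ → ℝ} (hβ : IsLoss α X β)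
    (hb' : ∀ η, β' η ∈ Icc (0 : ℝ) 1) (hm' : Measurable β') {δ C D l T : ℝ}
    (hT : 0 ≤ T) (hl : derivSupNorm α * E + 1 ≤ l) (hD : 0 ≤ D) (hC : 0 ≤ C) (hδ : 0 ≤ δ)
    (hy0 : ∀ ξ, |X'.y ξ - X.y ξ| ≤ δ) (hU0 : ∀ ξ, |X'.U ξ - X.U ξ| ≤ δ)
    (hfix' : ∀ᵐ η, deriv X'.U η < 0 → breakTime X' η ≤ T →
      |β' η - α ((evo X' β' (breakTime X' η)).y η)| ≤ δ)
    (hlip : ∀ η, ∀ s ∈ Icc 0 T, ∀ s' ∈ Icc 0 T,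
      |(evo X' β' s).y η - (evo X' β' s').y η| ≤ C * |s - s'|)
    (hy : ∀ η, ∀ s ∈ Icc 0 T, |(evo X' β' s).y η - (evo X β s).y η| ≤ D * Real.exp (l * s))
    (ξ : ℝ) {t : ℝ} (ht : t ∈ Icc 0 T) :
    |(evo X' β' t).y ξ - (evo X β t).y ξ| ≤
      (stabError α E T C δ X X' + D / 4) * Real.exp (l * t) := by
  have hK := derivSupNorm_nonneg α
  have hE := h.E_nonneg
  have hl1 : 1 ≤ l := by linarith [mul_nonneg hK hE]
  have hl0 : 0 < l := by linarith
  have i1 := integrable_dens2 h'.toEnergyData hb' hm' ht.1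
  have i2 := integrable_dens2 h.toEnergyData hβ.mem_Icc hβ.meas ht.1
  have hi : Integrable (fun η => dens2 X' β' t η - dens2 X β t η) := i1.sub i2
  have h1 : (evo X' β' t).y ξ - (evo X β t).y ξ = (X'.y ξ - X.y ξ) + t * (X'.U ξ - X.U ξ) +
      (1 / 2 * (∫ η in Iic ξ, (dens2 X' β' t η - dens2 X β t η)) -
        1 / 4 * ∫ η, (dens2 X' β' t η - dens2 X β t η)) := by
    rw [integral_sub i1 i2, integral_sub i1.integrableOn i2.integrableOn]
    simp only [evo]; ring
  set c1 := 2 * T + T ^ 2 * (derivSupNorm α * C)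
  set c2 := T ^ 2 * δ + derivSupNorm α * D * (2 / l ^ 2) * Real.exp (l * t) with hc2
  have j1 : Integrable fun η => T ^ 2 * |deriv X'.H η - deriv X.H η| :=
    ((h'.integrable_deriv_H.sub h.integrable_deriv_H).abs).const_mul _
  have j2 : Integrable fun η => c1 / 2 * (delayGap T X X' η * deriv X.H η) :=
    (integrable_delayGap h hT).const_mul _
  have j3 : Integrable fun η => c2 / 2 * deriv X.H η := h.integrable_deriv_H.const_mul _
  have j12 : Integrable fun η => T ^ 2 * |deriv X'.H η - deriv X.H η| +
      c1 / 2 * (delayGap T X X' η * deriv X.H η) := j1.add j2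
  have h2 : ∫ η, |dens2 X' β' t η - dens2 X β t η| ≤
      ∫ η, (T ^ 2 * |deriv X'.H η - deriv X.H η| +
        c1 / 2 * (delayGap T X X' η * deriv X.H η) + c2 / 2 * deriv X.H η) := by
    refine integral_mono_ae hi.abs (j12.add j3) ?_
    filter_upwards [hfix'] with η hη
    have a1 := abs_loss_mul_sq_sub_le h h' hα hβ.mem_Icc hb' ht hl0 hD hC hδ (hβ.fix η) hη
      (hlip η) (hy η)
    have hv := h.deriv_H_nonneg η
    have e1 : dens2 X' β' t η - dens2 X β t η =
        (t ^ 2 / 2 - β' η * (elapsed X' t η ^ 2 / 2)) * (deriv X'.H η - deriv X.H η) -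
        (β' η * elapsed X' t η ^ 2 - β η * elapsed X t η ^ 2) / 2 * deriv X.H η := by
      unfold dens2; ring
    have e2 : |t ^ 2 / 2 - β' η * (elapsed X' t η ^ 2 / 2)| ≤ T ^ 2 := by
      have b1 := elapsed_nonneg X' t η
      have b2 := elapsed_le h'.toEnergyData ht.1 η
      have b3 : elapsed X' t η ^ 2 ≤ t ^ 2 := by gcongr
      have b4 := mul_le_mul_of_nonneg_right (hb' η).2 (sq_nonneg (elapsed X' t η))
      have b5 := mul_nonneg (hb' η).1 (sq_nonneg (elapsed X' t η))
      have b6 : t ^ 2 ≤ T ^ 2 := pow_le_pow_left₀ ht.1 ht.2 2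
      rw [abs_le]; constructor <;> nlinarith
    rw [e1]
    refine (abs_sub _ _).trans ?_
    rw [abs_mul, abs_mul, abs_div, abs_of_nonneg hv, abs_two]
    have e3 := mul_le_mul_of_nonneg_right e2 (abs_nonneg (deriv X'.H η - deriv X.H η))
    have e4 := mul_le_mul_of_nonneg_right a1 hv
    simp only [hc2]
    linarith
  rw [integral_add j12 j3, integral_add j1 j2, integral_const_mul, integral_const_mul,
    integral_const_mul, h.integral_deriv_H] at h2
  have h3 := abs_half_integral_Iic_sub_le hi ξ
  have h4 : derivSupNorm α * D * (2 / l ^ 2) * Real.exp (l * t) * E ≤ 2 * D * Real.exp (l * t) := by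
    have : derivSupNorm α * E / l ^ 2 ≤ 1 := by
      rw [div_le_one (by positivity)]; nlinarith
    calc _ = derivSupNorm α * E / l ^ 2 * (2 * D * Real.exp (l * t)) := by ring
      _ ≤ 1 * (2 * D * Real.exp (l * t)) := by gcongr
      _ = _ := one_mul _
  have h5 : |(evo X' β' t).y ξ - (evo X β t).y ξ| ≤
      stabError α E T C δ X X' + D / 4 * Real.exp (l * t) := by
    rw [h1]
    refine (abs_add_le _ _).trans ?_
    have h6 := abs_add_le (X'.y ξ - X.y ξ) (t * (X'.U ξ - X.U ξ))
    rw [abs_mul, abs_of_nonneg ht.1] at h6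
    have h7 := mul_le_mul ht.2 (hU0 ξ) (abs_nonneg _) hT
    have h8 := hy0 ξ
    unfold stabError
    simp only [hc2] at h2
    linarith
  have h9 : 0 ≤ stabError α E T C δ X X' := by
    have : 0 ≤ ∫ η, delayGap T X X' η * deriv X.H η := integral_nonneg fun η =>
      mul_nonneg (delayGap_nonneg hT X X' η) (h.deriv_H_nonneg η)
    have : 0 ≤ ∫ η, |deriv X'.H η - deriv X.H η| := integral_nonneg fun η => abs_nonneg _
    unfold stabError; positivity
  refine h5.trans ?_
  rw [add_mul]
  have : 1 ≤ Real.exp (l * t) := Real.one_le_exp (mul_nonneg hl0.le ht.1)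
  nlinarith

/-- Iterating the bootstrap step `D ↦ o + D / 4` removes the crude initial bound; what survives is
at most `2 o`. -/
lemma abs_evo_y_sub_evo_le_stabError (hα : IsCoefficient α) {β β' : ℝ → ℝ} (hβ : IsLoss α X β)
    (hb' : ∀ η, β' η ∈ Icc (0 : ℝ) 1) (hm' : Measurable β') {δ C T : ℝ}
    (hT : 0 ≤ T) (hC : 0 ≤ C) (hδ : 0 ≤ δ)
    (hy0 : ∀ ξ, |X'.y ξ - X.y ξ| ≤ δ) (hU0 : ∀ ξ, |X'.U ξ - X.U ξ| ≤ δ)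
    (hfix' : ∀ᵐ η, deriv X'.U η < 0 → breakTime X' η ≤ T →
      |β' η - α ((evo X' β' (breakTime X' η)).y η)| ≤ δ)
    (hlip : ∀ η, ∀ s ∈ Icc 0 T, ∀ s' ∈ Icc 0 T,
      |(evo X' β' s).y η - (evo X' β' s').y η| ≤ C * |s - s'|)
    (hlip0 : ∀ η, ∀ s ∈ Icc 0 T, ∀ s' ∈ Icc 0 T,
      |(evo X β s).y η - (evo X β s').y η| ≤ C * |s - s'|)
    (ξ : ℝ) {t : ℝ} (ht : t ∈ Icc 0 T) :
    |(evo X' β' t).y ξ - (evo X β t).y ξ| ≤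
      2 * stabError α E T C δ X X' * Real.exp ((derivSupNorm α * E + 1) * T) := by
  set l := derivSupNorm α * E + 1 with hl
  have hl0 : 0 < l := by
    have := mul_nonneg (derivSupNorm_nonneg α) h.E_nonneg; linarith
  set o := stabError α E T C δ X X'
  have ho : 0 ≤ o := by
    have : 0 ≤ ∫ η, delayGap T X X' η * deriv X.H η := integral_nonneg fun η =>
      mul_nonneg (delayGap_nonneg hT X X' η) (h.deriv_H_nonneg η)
    have : 0 ≤ ∫ η, |deriv X'.H η - deriv X.H η| := integral_nonneg fun η => abs_nonneg _
    have := h.E_nonneg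
    have := derivSupNorm_nonneg α
    simp only [o, stabError]; positivity
  -- The initial bound is `δ + 2 C T`: both characteristics move by at most `C T`, from positions at
  -- distance at most `δ`.
  have hk : ∀ k : ℕ, ∀ η, ∀ s ∈ Icc 0 T, |(evo X' β' s).y η - (evo X β s).y η| ≤
      (2 * o + (1 / 4) ^ k * (δ + 2 * C * T)) * Real.exp (l * s) := by
    intro k
    induction k with
    | zero =>
      intro η s hs
      have h0 : (0 : ℝ) ∈ Icc 0 T := ⟨le_rfl, hT⟩
      have a1 := hlip η s hs 0 h0
      have a2 := hlip0 η 0 h0 s hs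
      rw [evo_zero h', sub_zero, abs_of_nonneg hs.1] at a1
      rw [evo_zero h, zero_sub, abs_neg, abs_of_nonneg hs.1] at a2
      have a3 := abs_sub_le ((evo X' β' s).y η) (X'.y η) ((evo X β s).y η)
      have a4 := abs_sub_le (X'.y η) (X.y η) ((evo X β s).y η)
      have a5 := mul_le_mul_of_nonneg_left hs.2 hC
      have a6 : 1 ≤ Real.exp (l * s) := Real.one_le_exp (mul_nonneg hl0.le hs.1)
      have a7 : 0 ≤ 2 * o + (δ + 2 * C * T) := by positivity
      have a8 := hy0 η
      rw [pow_zero, one_mul]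
      nlinarith
    | succ k ih =>
      intro η s hs
      refine (abs_evo_y_sub_evo_le h h' hα hβ hb' hm' hT hl.symm.le (by positivity) hC hδ hy0 hU0
        hfix' hlip ih η hs).trans ?_
      refine mul_le_mul_of_nonneg_right ?_ (Real.exp_pos _).le
      rw [pow_succ]
      simp only [o] at ho ⊢
      linarith
  have hlim : Tendsto (fun k : ℕ => (2 * o + (1 / 4) ^ k * (δ + 2 * C * T)) * Real.exp (l * t))
      atTop (𝓝 ((2 * o + 0 * (δ + 2 * C * T)) * Real.exp (l * t))) :=
    ((((tendsto_pow_atTop_nhds_zero_of_lt_one (by norm_num) (by norm_num)).mul_const _).const_add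
      _).mul_const _)
  have := ge_of_tendsto' hlim fun k => hk k ξ t ht
  refine this.trans ?_
  rw [zero_mul, add_zero]
  gcongr
  exact ht.2

end Pair

/-! ## Convergence along stable sequences -/

/-- The difference of the products is at most `M |vn - v| + |fn - f| v`, so the factors need to
converge only where the limit density is positive. -/
lemma tendsto_integral_mul_of_L1 {v : ℝ → ℝ} {vn : ℕ → ℝ → ℝ} {f : ℝ → ℝ} {fn : ℕ → ℝ → ℝ} {M : ℝ}
    (hv : Integrable v) (hvn : ∀ n, Integrable (vn n)) (hv0 : ∀ x, 0 ≤ v x)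
    (hlim : Tendsto (fun n => ∫ x, |vn n x - v x|) atTop (𝓝 0))
    (hf : Measurable f) (hfn : ∀ n, Measurable (fn n)) (hfM : ∀ x, |f x| ≤ M)
    (hfnM : ∀ n x, |fn n x| ≤ M)
    (hl : ∀ᵐ x, 0 < v x → Tendsto (fun n => fn n x) atTop (𝓝 (f x))) :
    Tendsto (fun n => ∫ x, |fn n x * vn n x - f x * v x|) atTop (𝓝 0) ∧
      Tendsto (fun n => ∫ x, fn n x * vn n x) atTop (𝓝 (∫ x, f x * v x)) := by
  have i1 : ∀ n, Integrable fun x => fn n x * vn n x := fun n =>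
    (hvn n).bdd_mul (hfn n).aestronglyMeasurable (ae_of_all _ (hfnM n))
  have i2 : Integrable fun x => f x * v x :=
    hv.bdd_mul hf.aestronglyMeasurable (ae_of_all _ hfM)
  have i3 : ∀ n, Integrable fun x => |fn n x - f x| * v x := fun n =>
    hv.bdd_mul (c := M + M) ((hfn n).sub hf).abs.aestronglyMeasurable (ae_of_all _ fun x => by
      simp only [Real.norm_eq_abs, abs_abs]
      exact (abs_sub _ _).trans (add_le_add (hfnM n x) (hfM x)))
  have l1 : Tendsto (fun n => ∫ x, |fn n x - f x| * v x) atTop (𝓝 0) := by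
    have := tendsto_integral_of_dominated_convergence (μ := volume)
      (F := fun n x => |fn n x - f x| * v x) (f := fun _ => (0 : ℝ)) (fun x => (M + M) * v x)
      (fun n => (i3 n).1) (hv.const_mul _) (fun n => ae_of_all _ fun x => ?_) ?_
    · simpa using this
    · rw [Real.norm_of_nonneg (mul_nonneg (abs_nonneg _) (hv0 x))]
      exact mul_le_mul_of_nonneg_right ((abs_sub _ _).trans (add_le_add (hfnM n x) (hfM x)))
        (hv0 x)
    · filter_upwards [hl] with x hx
      rcases (hv0 x).eq_or_lt with h0 | h0
      · simp [← h0]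
      · have := ((hx h0).sub_const (f x)).abs.mul_const (v x)
        simpa using this
  have l2 : Tendsto (fun n => ∫ x, |fn n x * vn n x - f x * v x|) atTop (𝓝 0) := by
    refine squeeze_zero (fun n => integral_nonneg fun x => abs_nonneg _) (fun n => ?_)
      (by simpa using (hlim.const_mul M).add l1)
    have i4 : Integrable fun x => M * |vn n x - v x| := (((hvn n).sub hv).abs).const_mul M
    rw [← integral_const_mul, ← integral_add i4 (i3 n)]
    refine integral_mono ((i1 n).sub i2).abs (i4.add (i3 n)) fun x => ?_
    have e : fn n x * vn n x - f x * v x =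
      fn n x * (vn n x - v x) + (fn n x - f x) * v x := by ring
    rw [e]
    refine (abs_add_le _ _).trans ?_
    rw [abs_mul, abs_mul, abs_of_nonneg (hv0 x)]
    exact add_le_add (mul_le_mul_of_nonneg_right (hfnM n x) (abs_nonneg _)) le_rfl
  refine ⟨l2, ?_⟩
  rw [tendsto_iff_dist_tendsto_zero]
  refine squeeze_zero (fun n => dist_nonneg) (fun n => ?_) l2
  rw [Real.dist_eq, ← integral_sub (i1 n) i2]
  exact abs_integral_le_integral_abs

/-- Dominated convergence: as `|yn ξ - ξ| ≤ C`, labels that reach the support of `φ` stay in one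
bounded interval. -/
lemma tendsto_integral_comp_mul {φ : ℝ → ℝ} (hφ : Continuous φ) (hc : HasCompactSupport φ)
    {y f : ℝ → ℝ} {yn fn : ℕ → ℝ → ℝ} {C M : ℝ} (hyn : ∀ n, Measurable (yn n))
    (hlim : ∀ ξ, Tendsto (fun n => yn n ξ) atTop (𝓝 (y ξ))) (hC : ∀ n ξ, |yn n ξ - ξ| ≤ C)
    (hfn : ∀ n, AEStronglyMeasurable (fn n) volume) (hM : ∀ n, ∀ᵐ ξ, |fn n ξ| ≤ M)
    (hf : ∀ᵐ ξ, Tendsto (fun n => fn n ξ) atTop (𝓝 (f ξ))) :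
    Tendsto (fun n => ∫ ξ, φ (yn n ξ) * fn n ξ) atTop (𝓝 (∫ ξ, φ (y ξ) * f ξ)) := by
  obtain ⟨B, hB⟩ := hc.exists_bound_of_continuous hφ
  obtain ⟨R, hR⟩ := hc.isCompact.isBounded.subset_closedBall 0
  refine tendsto_integral_of_dominated_convergence
    ((Icc (-(R + C)) (R + C)).indicator fun _ => B * M)
    (fun n => (hφ.measurable.comp (hyn n)).aestronglyMeasurable.mul (hfn n)) ?_ (fun n => ?_) ?_
  · exact (integrable_indicator_iff measurableSet_Icc).2
      continuous_const.integrableOn_Icc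
  · filter_upwards [hM n] with ξ hξ
    by_cases h0 : φ (yn n ξ) = 0
    · rw [h0, zero_mul, norm_zero]
      refine indicator_nonneg (fun _ _ => ?_) _
      exact mul_nonneg ((norm_nonneg _).trans (hB 0)) ((abs_nonneg _).trans hξ)
    · have h1 : yn n ξ ∈ Metric.closedBall (0 : ℝ) R := hR (subset_tsupport _ h0)
      rw [mem_closedBall_zero_iff, Real.norm_eq_abs] at h1
      have h2 := abs_le.1 (hC n ξ)
      have h3 := abs_le.1 h1
      rw [indicator_of_mem (mem_Icc.2 ⟨by linarith, by linarith⟩), norm_mul]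
      exact mul_le_mul (hB _) hξ (norm_nonneg _) ((norm_nonneg _).trans (hB 0))
  · filter_upwards [hf] with ξ hξ
    exact ((hφ.tendsto _).comp (hlim ξ)).mul hξ

lemma abs_integral_mul_le {f g : ℝ → ℝ} (hf : MemLp f 2 volume) (hg : MemLp g 2 volume) {k : ℝ}
    (hk : 0 < k) : |∫ x, f x * g x| ≤ k * (∫ x, g x ^ 2) + (∫ x, f x ^ 2) / k := by
  refine abs_integral_le_integral_abs.trans ?_
  rw [← integral_const_mul, ← integral_div,
    ← integral_add (hg.integrable_sq.const_mul k) (hf.integrable_sq.div_const k)]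
  refine integral_mono (hf.integrable_mul hg).abs
    ((hg.integrable_sq.const_mul k).add (hf.integrable_sq.div_const k)) fun x => ?_
  simp only [abs_mul]
  rw [← sq_abs (g x), ← sq_abs (f x)]
  have h1 : k * |g x| ^ 2 + |f x| ^ 2 / k - |f x| * |g x| =
      ((k * |g x| - |f x|) ^ 2 + k * |f x| * |g x|) / k := by field_simp; ring
  have h2 : 0 ≤ ((k * |g x| - |f x|) ^ 2 + k * |f x| * |g x|) / k := by positivity
  linarith

/-- Continuous functions with compact support are dense in L², and the norms are uniformly bounded.
-/
lemma tendsto_integral_mul_of_compactSupport {F : ℝ → ℝ} {Fn : ℕ → ℝ → ℝ} {A : ℝ}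
    (hF : MemLp F 2 volume) (hFn : ∀ n, MemLp (Fn n) 2 volume) (hA : ∫ x, F x ^ 2 ≤ A)
    (hAn : ∀ n, ∫ x, Fn n x ^ 2 ≤ A)
    (hlim : ∀ ψ : ℝ → ℝ, Continuous ψ → HasCompactSupport ψ →
      Tendsto (fun n => ∫ x, ψ x * Fn n x) atTop (𝓝 (∫ x, ψ x * F x)))
    {φ : ℝ → ℝ} (hφ : MemLp φ 2 volume) :
    Tendsto (fun n => ∫ x, φ x * Fn n x) atTop (𝓝 (∫ x, φ x * F x)) := by
  rw [Metric.tendsto_atTop]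
  intro ε hε
  have hA0 : 0 ≤ A := (integral_nonneg fun x => sq_nonneg _).trans hA
  -- The weight in Young's inequality: `k A ≤ ε / 8`, and `φ` is approximated with squared error at
  -- most `k ε / 8`.
  set k := ε / (8 * (A + 1)) with hk
  have hk0 : 0 < k := by positivity
  obtain ⟨ψ, hψc, hψ, hψ0, hψ2⟩ := hφ.exists_hasCompactSupport_eLpNorm_sub_le (by simp)
    (ε := ENNReal.ofReal (√(k * (ε / 8)))) (by simp; positivity)
  have hd : MemLp (fun x => φ x - ψ x) 2 volume := hφ.sub hψ2
  have hd2 : ∫ x, (φ x - ψ x) ^ 2 ≤ k * (ε / 8) := by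
    have h1 : eLpNorm (fun x => φ x - ψ x) 2 volume ≤ ENNReal.ofReal (√(k * (ε / 8))) := hψ
    rw [hd.eLpNorm_eq_integral_rpow_norm (by simp) (by simp),
      ENNReal.ofReal_le_ofReal_iff (Real.sqrt_nonneg _)] at h1
    simp only [ENNReal.toReal_ofNat, Real.rpow_ofNat, Real.norm_eq_abs, sq_abs] at h1
    have h2 : 0 ≤ ∫ x, (φ x - ψ x) ^ 2 := integral_nonneg fun x => sq_nonneg _
    rw [show (2 : ℝ)⁻¹ = 1 / 2 by norm_num, ← Real.sqrt_eq_rpow] at h1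
    exact (Real.sqrt_le_sqrt_iff (by positivity)).1 h1
  have hsmall : ∀ G : ℝ → ℝ, MemLp G 2 volume → ∫ x, G x ^ 2 ≤ A →
      |∫ x, (φ x - ψ x) * G x| ≤ ε / 4 := fun G hG hGA => by
    refine (abs_integral_mul_le hd hG hk0).trans ?_
    have h1 : k * ∫ x, G x ^ 2 ≤ ε / 8 := by
      refine (mul_le_mul_of_nonneg_left hGA hk0.le).trans ?_
      rw [hk, div_mul_eq_mul_div, div_le_div_iff₀ (by positivity) (by norm_num)]
      nlinarith
    have h2 : (∫ x, (φ x - ψ x) ^ 2) / k ≤ ε / 8 := by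
      rw [div_le_iff₀ hk0]; linarith
    linarith
  obtain ⟨N, hN⟩ := Metric.tendsto_atTop.1 (hlim ψ hψ0 hψc) (ε / 2) (by positivity)
  refine ⟨N, fun n hn => ?_⟩
  have h1 := hN n hn
  have h2 := hsmall _ (hFn n) (hAn n)
  have h3 := hsmall _ hF hA
  rw [Real.dist_eq] at h1 ⊢
  have e : ∀ G : ℝ → ℝ, MemLp G 2 volume →
      ∫ x, (φ x - ψ x) * G x = (∫ x, φ x * G x) - ∫ x, ψ x * G x := fun G hG => by
    have i1 : Integrable fun x => φ x * G x := hφ.integrable_mul hG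
    have i2 : Integrable fun x => ψ x * G x := hψ2.integrable_mul hG
    rw [← integral_sub i1 i2]
    simp_rw [sub_mul]
  rw [e _ (hFn n)] at h2
  rw [e _ hF] at h3
  rw [abs_lt] at h1 ⊢
  rw [abs_le] at h2 h3
  constructor <;> linarith [h1.1, h1.2, h2.1, h2.2, h3.1, h3.2]

/-! ### The Eulerian side of an evolution -/

section Evolved

variable {X : Lag} {E : ℝ} (h : InitData X E) {β : ℝ → ℝ} (hb : ∀ η, β η ∈ Icc (0 : ℝ) 1)
  (hβ : Measurable β) {t : ℝ} (ht : 0 ≤ t)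
include h hb hβ ht

lemma exists_abs_evo_y_sub_le : ∃ C, ∀ ξ, |(evo X β t).y ξ - ξ| ≤ C := by
  obtain ⟨a, b, hab⟩ := hasTails_evo_y h hb hβ ht
  obtain ⟨K, hK⟩ := lipschitzWith_evo_y h hb hβ ht
  exact hab.bounded (hK.sub LipschitzWith.id)

lemma transport_evo : Transport (evo X β t).y (evo X β t).U (dens0 X β t) where
  y_mono := evo_y_mono h hb hβ ht
  y_lip := lipschitzWith_evo_y h hb hβ ht
  y_surj := by
    obtain ⟨C, hC⟩ := exists_abs_evo_y_sub_le h hb hβ ht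
    obtain ⟨K, hK⟩ := lipschitzWith_evo_y h hb hβ ht
    refine hK.continuous.surjective
      (tendsto_atTop_mono (fun ξ => ?_) (tendsto_atTop_add_const_right _ (-C) tendsto_id))
      (tendsto_atBot_mono (fun ξ => ?_) (tendsto_atBot_add_const_right _ C tendsto_id))
    · have := (abs_le.1 (hC ξ)).1; simp only [id]; linarith
    · have := (abs_le.1 (hC ξ)).2; simp only [id]; linarith
  U_lip := lipschitzWith_evo_U h hb hβ ht
  w_nonneg := dens0_nonneg h.toEnergyData hb t
  w_int := integrable_dens0 h.toEnergyData hb hβ t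
  rel := by
    filter_upwards [ae_hasDerivAt_evo_U h hb hβ ht, ae_hasDerivAt_evo_y h hb hβ ht,
      h.ae_regularAt] with ξ h1 h2 h3
    rw [h1.deriv, h2.deriv]
    exact (h3.evolved ht (hb ξ)).2.1.symm

omit ht in
lemma integral_dens0_le : ∫ η, dens0 X β t η ≤ E := by
  rw [← h.integral_deriv_H]
  refine integral_mono (integrable_dens0 h.toEnergyData hb hβ t) h.integrable_deriv_H fun η => ?_
  simpa using dens0_le h.toEnergyData hb t η

lemma memE2_evo : MemE2 (mapM (evo X β t)).u := by
  obtain ⟨a, b, hab⟩ := hasTails_evo_U h hb hβ ht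
  obtain ⟨C, hC⟩ := exists_abs_evo_y_sub_le h hb hβ ht
  exact (transport_evo h hb hβ ht).memE2 hab hC

lemma abs_deriv_evo_U_le : ∀ᵐ ξ, |deriv (evo X β t).U ξ| ≤ 1 + t := by
  filter_upwards [ae_hasDerivAt_evo_U h hb hβ ht, h.ae_regularAt] with ξ h1 h2
  rw [h1.deriv]
  have h3 : |deriv X.U ξ| ≤ 1 := by
    rw [← sq_le_one_iff_abs_le_one, h2.rel]
    nlinarith [h2.add_eq, h2.y_nonneg, h2.H_nonneg]
  have h4 := dens1_nonneg h.toEnergyData hb ht ξ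
  have h5 := dens1_le (β := β) h.toEnergyData hb t ξ
  have h6 := mul_le_mul_of_nonneg_left (h.deriv_H_le ξ) ht
  rw [abs_le] at h3 ⊢
  constructor <;> linarith

end Evolved

/-- A sequence of data `Xn` with losses `βn` that approximates data `X` with the exact losses
`β`. -/
structure StableSeq (α : ℝ → ℝ) (T E : ℝ) (X : Lag) (β : ℝ → ℝ) (Xn : ℕ → Lag) (βn : ℕ → ℝ → ℝ)
    (δ : ℕ → ℝ) : Prop where
  coeff : IsCoefficient α
  T_nonneg : 0 ≤ T
  init : InitData X E
  init_n : ∀ n, InitData (Xn n) E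
  δ_nonneg : ∀ n, 0 ≤ δ n
  δ_tendsto : Tendsto δ atTop (𝓝 0)
  y_le : ∀ n ξ, |(Xn n).y ξ - X.y ξ| ≤ δ n
  U_le : ∀ n ξ, |(Xn n).U ξ - X.U ξ| ≤ δ n
  H_tendsto : ∀ᵐ ξ, Tendsto (fun n => deriv (Xn n).H ξ) atTop (𝓝 (deriv X.H ξ))
  U_tendsto : ∀ᵐ ξ, Tendsto (fun n => deriv (Xn n).U ξ) atTop (𝓝 (deriv X.U ξ))
  flat : ∀ᵐ ξ, deriv X.y ξ = 0 → ∀ᶠ n in atTop, deriv (Xn n).y ξ = 0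
  loss : IsLoss α X β
  loss_meas : ∀ n, Measurable (βn n)
  loss_mem : ∀ n η, βn n η ∈ Ico (0 : ℝ) 1
  loss_le : ∀ n, ∀ᵐ η, deriv (Xn n).U η < 0 → breakTime (Xn n) η ≤ T →
    |βn n η - α ((evo (Xn n) (βn n) (breakTime (Xn n) η)).y η)| ≤ δ n

open Classical in
/-- The fraction of the energy that is lost at time `t` if all waves that have not broken yet
break at time `t`. -/
noncomputable def lossAt (α : ℝ → ℝ) (X : Lag) (β : ℝ → ℝ) (t η : ℝ) : ℝ :=
  if deriv X.U η < 0 then if breakTime X η ≤ t then β η else α ((evo X β t).y η) else 0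

lemma measurable_lossAt {α : ℝ → ℝ} (hα : IsCoefficient α) {X : Lag} {E : ℝ} (h : InitData X E)
    {β : ℝ → ℝ} (hβ : Measurable β) (t : ℝ) : Measurable (lossAt α X β t) :=
  Measurable.ite (measurableSet_lt (measurable_deriv _) measurable_const)
    (Measurable.ite (measurableSet_le (measurable_breakTime X) measurable_const) hβ
      (hα.continuous.measurable.comp ((measurable_evo_y h hβ).comp measurable_prodMk_left)))
    measurable_const

lemma lossAt_mem {α : ℝ → ℝ} (hα : IsCoefficient α) (X : Lag) {β : ℝ → ℝ}
    (hb : ∀ η, β η ∈ Ico (0 : ℝ) 1) (t η : ℝ) : lossAt α X β t η ∈ Ico (0 : ℝ) 1 := by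
  unfold lossAt; split_ifs
  · exact hb η
  · exact hα.2 _
  · simp

/-- Before breaking, `V_ξ = H_ξ` and `g1` supplies the factor `1 - α (y)`; after breaking, `V_ξ`
already contains the factor `1 - β`. `lossAt` unites both cases and, for exact losses, has no jump
at the breaking time. -/
lemma g1_evo {α : ℝ → ℝ} {X : Lag} {E : ℝ} (h : InitData X E) {β : ℝ → ℝ}
    (hb : ∀ η, β η ∈ Ico (0 : ℝ) 1) (hβ : Measurable β) {t : ℝ} (ht : 0 ≤ t) :
    ∀ᵐ η, g1 α (evo X β t) η = (1 - lossAt α X β t η) * deriv X.H η := by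
  have hb' : ∀ η, β η ∈ Icc (0 : ℝ) 1 := fun η => Ico_subset_Icc_self (hb η)
  filter_upwards [ae_hasDerivAt_evo_U h hb' hβ ht, ae_hasDerivAt_evo_V h hb' hβ (t := t),
    h.ae_regularAt] with η h1 h2 h3
  unfold g1 lossAt
  rw [h1.deriv, h2.deriv]
  by_cases hU : deriv X.U η < 0
  · obtain ⟨-, hH, -⟩ := h3.pos_of_neg hU
    by_cases hbt : breakTime X η ≤ t
    · obtain ⟨-, e1, e2⟩ := h3.formulas_of_le (β := β) hU hbt
      have : ¬ (1 - β η) * deriv X.H η / 2 * (t - breakTime X η) < 0 := by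
        have := (hb η).2
        have : 0 ≤ (1 - β η) * deriv X.H η / 2 * (t - breakTime X η) :=
          mul_nonneg (div_nonneg (mul_nonneg (by linarith) hH.le) two_pos.le) (by linarith)
        linarith
      rw [e1, e2, if_neg this, if_pos hU, if_pos hbt]
    · obtain ⟨-, e1, e2⟩ := h3.formulas_of_lt (β := β) hU (not_le.1 hbt)
      have : deriv X.H η / 2 * (t - breakTime X η) < 0 :=
        mul_neg_of_pos_of_neg (by positivity) (by linarith)
      rw [e1, e2, if_pos this, if_pos hU, if_neg hbt]
  · obtain ⟨-, e1, e2⟩ := RegularAt.formulas_of_nonneg (X := X) (β := β) (t := t) hU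
    have : ¬ deriv X.U η + t / 2 * deriv X.H η < 0 := by
      have := h3.H_nonneg
      have : 0 ≤ t / 2 * deriv X.H η := by positivity
      linarith
    rw [e1, e2, if_neg this, if_neg hU]; simp

/-! ### Limits along stable sequences -/

namespace StableSeq

variable {α : ℝ → ℝ} {T E : ℝ} {X : Lag} {β : ℝ → ℝ} {Xn : ℕ → Lag} {βn : ℕ → ℝ → ℝ} {δ : ℕ → ℝ}
  (S : StableSeq α T E X β Xn βn δ)
include S

lemma loss_mem_Icc (n : ℕ) (η : ℝ) : βn n η ∈ Icc (0 : ℝ) 1 := Ico_subset_Icc_self (S.loss_mem n η)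

lemma tendsto_L1 : Tendsto (fun n => ∫ x, |deriv (Xn n).H x - deriv X.H x|) atTop (𝓝 0) :=
  tendsto_integral_abs_sub_of_integral_eq S.init.integrable_deriv_H
    (fun n => (S.init_n n).integrable_deriv_H) (ae_of_all _ S.init.deriv_H_nonneg)
    (fun n => ae_of_all _ (S.init_n n).deriv_H_nonneg) S.init.integral_deriv_H
    (fun n => (S.init_n n).integral_deriv_H) S.H_tendsto

/-- The breaking time depends continuously on the data where `U_ξ ≠ 0`. The critical labels have
`U_ξ = 0` and `H_ξ > 0`, hence `y_ξ = 0`; an approximation with small negative `U_ξ` might break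
almost at once. The field `flat` rules this out, since `y_ξ = 0` forces `U_ξ = 0` for the
approximation too. -/
lemma breakTime_tendsto : ∀ᵐ η, 0 < deriv X.H η →
    (deriv X.U η < 0 ∧ (∀ᶠ n in atTop, deriv (Xn n).U η < 0) ∧
      Tendsto (fun n => breakTime (Xn n) η) atTop (𝓝 (breakTime X η))) ∨
    (¬ deriv X.U η < 0 ∧ ∀ᶠ n in atTop, ¬ deriv (Xn n).U η < 0) := by
  filter_upwards [S.H_tendsto, S.U_tendsto, S.flat, S.init.ae_regularAt,
    ae_all_iff.2 fun n => (S.init_n n).ae_regularAt] with η hH hU hflat hr hrn hv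
  rcases lt_trichotomy (deriv X.U η) 0 with h0 | h0 | h0
  · refine Or.inl ⟨h0, hU.eventually_lt_const h0, ?_⟩
    have hy : Tendsto (fun n => deriv (Xn n).y η) atTop (𝓝 (deriv X.y η)) := by
      have e : ∀ {Y : Lag}, RegularAt Y η → deriv Y.y η = 1 - deriv Y.H η := fun h => by
        linarith [h.add_eq]
      rw [e hr]
      simp_rw [fun n => e (hrn n)]
      exact hH.const_sub 1
    exact (hy.const_mul (-2)).div hU h0.ne
  · refine Or.inr ⟨by simp [h0], ?_⟩
    have hy : deriv X.y η = 0 := by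
      have := hr.rel
      rw [h0, zero_pow two_ne_zero] at this
      rcases mul_eq_zero.1 this.symm with h1 | h1
      · exact h1
      · exact absurd h1 hv.ne'
    filter_upwards [hflat hy] with n hn
    have := (hrn n).rel
    rw [hn, zero_mul] at this
    rw [pow_eq_zero_iff two_ne_zero |>.1 this]
    exact lt_irrefl 0
  · refine Or.inr ⟨by linarith, ?_⟩
    filter_upwards [hU.eventually_const_lt h0] with n hn
    linarith

lemma delayGap_tendsto : ∀ᵐ η, 0 < deriv X.H η →
    Tendsto (fun n => delayGap T X (Xn n) η) atTop (𝓝 0) := by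
  filter_upwards [S.breakTime_tendsto] with η h hv
  rcases h hv with ⟨h1, h2, h3⟩ | ⟨h1, h2⟩
  · have h4 : Tendsto (fun n => min T |breakTime (Xn n) η - breakTime X η|) atTop (𝓝 0) := by
      have := (tendsto_const_nhds (x := T)).min (h3.sub_const (breakTime X η)).abs
      rwa [sub_self, abs_zero, min_eq_right S.T_nonneg] at this
    refine h4.congr' ?_
    filter_upwards [h2] with n hn
    simp [delayGap, h1, hn]
  · refine tendsto_const_nhds.congr' ?_
    filter_upwards [h2] with n hn
    simp only [delayGap, h1, hn, if_false]

lemma exists_time_lipschitz : ∃ C, 0 ≤ C ∧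
    (∀ n ξ, ∀ s ∈ Icc 0 T, ∀ s' ∈ Icc 0 T,
      |(evo (Xn n) (βn n) s).y ξ - (evo (Xn n) (βn n) s').y ξ| ≤ C * |s - s'|) ∧
    ∀ ξ, ∀ s ∈ Icc 0 T, ∀ s' ∈ Icc 0 T,
      |(evo X β s).y ξ - (evo X β s').y ξ| ≤ C * |s - s'| := by
  obtain ⟨K, hK⟩ := S.init.U_lip
  obtain ⟨a, b, hab⟩ := S.init.U_tails
  obtain ⟨B, hB⟩ := hab.bounded hK
  obtain ⟨Δ, hΔ⟩ := S.δ_tendsto.bddAbove_range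
  have hΔ' : ∀ n, δ n ≤ Δ := fun n => hΔ ⟨n, rfl⟩
  have hE := S.init.E_nonneg
  have hT := S.T_nonneg
  have hB0 : 0 ≤ B := (abs_nonneg _).trans (hB 0)
  have hΔ0 : 0 ≤ Δ := (S.δ_nonneg 0).trans (hΔ' 0)
  refine ⟨B + Δ + T * E / 4, by positivity, fun n ξ s hs s' hs' => ?_, fun ξ s hs s' hs' => ?_⟩
  · refine abs_evo_y_sub_time_le (S.init_n n) (S.loss_mem_Icc n) (S.loss_meas n) (fun ξ => ?_)
      hs' hs ξ
    have h1 := abs_sub_abs_le_abs_sub ((Xn n).U ξ) (X.U ξ)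
    linarith [S.U_le n ξ, hΔ' n, hB ξ]
  · exact abs_evo_y_sub_time_le S.init S.loss.mem_Icc S.loss.meas
      (fun ξ => (hB ξ).trans (by linarith)) hs' hs ξ

lemma exists_y_error : ∃ o : ℕ → ℝ, Tendsto o atTop (𝓝 0) ∧ ∀ n, ∀ t ∈ Icc 0 T, ∀ ξ,
    |(evo (Xn n) (βn n) t).y ξ - (evo X β t).y ξ| ≤ o n := by
  obtain ⟨C, hC, h1, h2⟩ := S.exists_time_lipschitz
  refine ⟨fun n => 2 * stabError α E T C (δ n) X (Xn n) *
    Real.exp ((derivSupNorm α * E + 1) * T), ?_, fun n t ht ξ =>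
    abs_evo_y_sub_evo_le_stabError S.init (S.init_n n) S.coeff S.loss (S.loss_mem_Icc n)
      (S.loss_meas n) S.T_nonneg hC (S.δ_nonneg n) (S.y_le n) (S.U_le n) (S.loss_le n) (h1 n) h2
      ξ ht⟩
  have h3 : Tendsto (fun n => ∫ η, delayGap T X (Xn n) η * deriv X.H η) atTop (𝓝 0) := by
    have := (tendsto_integral_mul_of_L1 (M := T) S.init.integrable_deriv_H
      (fun _ => S.init.integrable_deriv_H) S.init.deriv_H_nonneg (by simp)
      (measurable_const (a := (0 : ℝ))) (fun n => measurable_delayGap T X (Xn n))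
      (fun x => by simpa using S.T_nonneg)
      (fun n x => by
        rw [abs_of_nonneg (delayGap_nonneg S.T_nonneg _ _ _)]
        exact delayGap_le S.T_nonneg _ _ _) S.delayGap_tendsto).2
    simpa using this
  have h4 := S.tendsto_L1
  have h5 := S.δ_tendsto
  have h6 : Tendsto (fun n => stabError α E T C (δ n) X (Xn n)) atTop (𝓝 0) := by
    have := (h5.const_mul (1 + T)).add (((h4.const_mul (T ^ 2)).add
      (((h3.const_mul (2 * T + T ^ 2 * (derivSupNorm α * C))).add
        ((h5.const_mul (T ^ 2)).mul_const E)).const_mul (1 / 2))).const_mul (1 / 4))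
    simpa [stabError] using this
  simpa using (h6.const_mul 2).mul_const (Real.exp ((derivSupNorm α * E + 1) * T))

lemma y_tendsto {t : ℝ} (ht : t ∈ Icc 0 T) (ξ : ℝ) :
    Tendsto (fun n => (evo (Xn n) (βn n) t).y ξ) atTop (𝓝 ((evo X β t).y ξ)) := by
  obtain ⟨o, ho, h⟩ := S.exists_y_error
  rw [tendsto_iff_dist_tendsto_zero]
  exact squeeze_zero (fun n => dist_nonneg) (fun n => h n t ht ξ) ho

/-- Up to `δ`, both branches of `lossAt` are `α` evaluated on the characteristic at time `min t τ`,
which depends continuously on `τ`, even at `τ = t`. -/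
lemma lossAt_tendsto {t : ℝ} (ht : t ∈ Icc 0 T) : ∀ᵐ η, 0 < deriv X.H η →
    Tendsto (fun n => lossAt α (Xn n) (βn n) t η) atTop (𝓝 (lossAt α X β t η)) := by
  obtain ⟨o, ho, hy⟩ := S.exists_y_error
  obtain ⟨C, hC, -, hlip⟩ := S.exists_time_lipschitz
  have hK := derivSupNorm_nonneg α
  filter_upwards [S.breakTime_tendsto, ae_all_iff.2 S.loss_le] with η h hle hv
  rcases h hv with ⟨h1, h2, h3⟩ | ⟨h1, h2⟩
  · have e0 : lossAt α X β t η = α ((evo X β (min t (breakTime X η))).y η) := by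
      simp only [lossAt, h1, if_true]
      split_ifs with hb
      · rw [min_eq_right hb, S.loss.fix η h1]
      · rw [min_eq_left (not_le.1 hb).le]
    rw [e0, tendsto_iff_dist_tendsto_zero]
    have h4 : Tendsto (fun n => δ n + derivSupNorm α *
        (o n + C * |min t (breakTime (Xn n) η) - min t (breakTime X η)|)) atTop (𝓝 0) := by
      have := S.δ_tendsto.add ((ho.add (((((tendsto_const_nhds (x := t)).min h3).sub_const
        (min t (breakTime X η))).abs).const_mul C)).const_mul (derivSupNorm α))
      simpa using this
    refine squeeze_zero' (Eventually.of_forall fun n => dist_nonneg) ?_ h4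
    filter_upwards [h2] with n hn
    have hm : ∀ {Y : Lag}, InitData Y E → deriv Y.U η < 0 → min t (breakTime Y η) ∈ Icc 0 T :=
      fun hY hU => ⟨le_min ht.1 (breakTime_nonneg hY.toEnergyData hU), (min_le_left _ _).trans ht.2⟩
    have a1 : |lossAt α (Xn n) (βn n) t η -
        α ((evo (Xn n) (βn n) (min t (breakTime (Xn n) η))).y η)| ≤ δ n := by
      simp only [lossAt, hn, if_true]
      split_ifs with hb
      · rw [min_eq_right hb]; exact hle n hn (hb.trans ht.2)
      · rw [min_eq_left (not_le.1 hb).le, sub_self, abs_zero]; exact S.δ_nonneg n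
    have a2 := S.coeff.abs_sub_le ((evo (Xn n) (βn n) (min t (breakTime (Xn n) η))).y η)
      ((evo X β (min t (breakTime X η))).y η)
    have a3 := hy n _ (hm (S.init_n n) hn) η
    have a4 := hlip η _ (hm (S.init_n n) hn) _ (hm S.init h1)
    have a5 := abs_sub_le ((evo (Xn n) (βn n) (min t (breakTime (Xn n) η))).y η)
      ((evo X β (min t (breakTime (Xn n) η))).y η) ((evo X β (min t (breakTime X η))).y η)
    have a6 := mul_le_mul_of_nonneg_left (a5.trans (add_le_add a3 a4)) hK
    rw [Real.dist_eq]
    refine (abs_sub_le _ (α ((evo (Xn n) (βn n) (min t (breakTime (Xn n) η))).y η)) _).trans ?_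
    linarith
  · refine tendsto_const_nhds.congr' ?_
    filter_upwards [h2] with n hn
    simp only [lossAt, h1, hn, if_false]

/-- The losses are controlled only at labels that break by time `T`. In the product they can be
replaced by `lossAt`, because the elapsed time vanishes before breaking. -/
lemma loss_mul_elapsed_tendsto {t : ℝ} (ht : t ∈ Icc 0 T) : ∀ᵐ η, 0 < deriv X.H η →
    Tendsto (fun n => βn n η * elapsed (Xn n) t η) atTop (𝓝 (β η * elapsed X t η)) := by
  filter_upwards [S.breakTime_tendsto, S.lossAt_tendsto ht] with η h hl hv
  rcases h hv with ⟨h1, h2, h3⟩ | ⟨h1, h2⟩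
  · have h4 : Tendsto (fun n => lossAt α (Xn n) (βn n) t η * max (t - breakTime (Xn n) η) 0)
        atTop (𝓝 (lossAt α X β t η * max (t - breakTime X η) 0)) :=
      (hl hv).mul ((h3.const_sub t).max tendsto_const_nhds)
    have e : ∀ {Y : Lag} {b : ℝ → ℝ}, deriv Y.U η < 0 →
        lossAt α Y b t η * max (t - breakTime Y η) 0 = b η * elapsed Y t η := by
      intro Y b hU
      simp only [lossAt, elapsed, hU, if_true]
      split_ifs with hb
      · rfl
      · rw [max_eq_right (by linarith [not_le.1 hb])]; simp
    rw [e h1] at h4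
    refine h4.congr' ?_
    filter_upwards [h2] with n hn
    rw [e hn]
  · refine tendsto_const_nhds.congr' ?_
    filter_upwards [h2] with n hn
    simp only [elapsed, h1, hn, if_false, mul_zero]

lemma dens1_tendsto_L1 {t : ℝ} (ht : t ∈ Icc 0 T) :
    Tendsto (fun n => ∫ η, |dens1 (Xn n) (βn n) t η - dens1 X β t η|) atTop (𝓝 0) := by
  have hm : ∀ {Y : Lag} {b : ℝ → ℝ}, Measurable b → Measurable fun η => t - b η * elapsed Y t η :=
    fun hb => measurable_const.sub (hb.mul ((measurable_elapsed _).comp measurable_prodMk_left))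
  have hM : ∀ {Y : Lag} {b : ℝ → ℝ}, InitData Y E → (∀ η, b η ∈ Icc (0 : ℝ) 1) → ∀ η,
      |t - b η * elapsed Y t η| ≤ T := by
    intro Y b hY hb η
    have h1 := elapsed_nonneg Y t η
    have h2 := elapsed_le hY.toEnergyData ht.1 η
    have h3 := mul_nonneg (hb η).1 h1
    have h4 := mul_le_mul_of_nonneg_right (hb η).2 h1
    rw [abs_le]; constructor <;> linarith [ht.1, ht.2]
  refine (tendsto_integral_mul_of_L1 S.init.integrable_deriv_H
    (fun n => (S.init_n n).integrable_deriv_H) S.init.deriv_H_nonneg S.tendsto_L1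
    (hm S.loss.meas) (fun n => hm (S.loss_meas n)) (hM S.init S.loss.mem_Icc)
    (fun n => hM (S.init_n n) (S.loss_mem_Icc n)) ?_).1
  filter_upwards [S.loss_mul_elapsed_tendsto ht] with η h hv
  exact (h hv).const_sub t

lemma exists_U_error {t : ℝ} (ht : t ∈ Icc 0 T) : ∃ o : ℕ → ℝ, Tendsto o atTop (𝓝 0) ∧ ∀ n ξ,
    |(evo (Xn n) (βn n) t).U ξ - (evo X β t).U ξ| ≤ o n := by
  refine ⟨fun n => δ n + 1 / 4 * ∫ η, |dens1 (Xn n) (βn n) t η - dens1 X β t η|, ?_,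
    fun n ξ => ?_⟩
  · have := S.δ_tendsto.add ((S.dens1_tendsto_L1 ht).const_mul (1 / 4))
    rwa [mul_zero, add_zero] at this
  · have i1 := integrable_dens1 (S.init_n n).toEnergyData (S.loss_mem_Icc n) (S.loss_meas n) ht.1
    have i2 := integrable_dens1 S.init.toEnergyData S.loss.mem_Icc S.loss.meas ht.1
    have hi : Integrable fun η => dens1 (Xn n) (βn n) t η - dens1 X β t η := i1.sub i2
    have e : (evo (Xn n) (βn n) t).U ξ - (evo X β t).U ξ = ((Xn n).U ξ - X.U ξ) +
        (1 / 2 * (∫ η in Iic ξ, (dens1 (Xn n) (βn n) t η - dens1 X β t η)) -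
          1 / 4 * ∫ η, (dens1 (Xn n) (βn n) t η - dens1 X β t η)) := by
      rw [integral_sub i1 i2, integral_sub i1.integrableOn i2.integrableOn]
      simp only [evo]; ring
    rw [e]
    exact (abs_add_le _ _).trans (add_le_add (S.U_le n ξ) (abs_half_integral_Iic_sub_le hi ξ))

lemma deriv_U_tendsto {t : ℝ} (ht : t ∈ Icc 0 T) : ∀ᵐ ξ,
    Tendsto (fun n => deriv (evo (Xn n) (βn n) t).U ξ) atTop (𝓝 (deriv (evo X β t).U ξ)) := by
  filter_upwards [ae_hasDerivAt_evo_U S.init S.loss.mem_Icc S.loss.meas ht.1,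
    ae_all_iff.2 fun n => ae_hasDerivAt_evo_U (S.init_n n) (S.loss_mem_Icc n) (S.loss_meas n) ht.1,
    S.loss_mul_elapsed_tendsto ht, S.U_tendsto, S.H_tendsto] with ξ h1 h2 h3 h4 h5
  rw [h1.deriv]
  simp_rw [(h2 _).deriv]
  refine h4.add (Tendsto.const_mul _ ?_)
  -- Where `H_ξ = 0` nothing is known about the losses, but there `dens1 ≤ t H_ξ` tends to 0.
  rcases (S.init.deriv_H_nonneg ξ).eq_or_lt with h0 | h0
  · have e : dens1 X β t ξ = 0 := by simp [dens1, ← h0]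
    rw [e]
    refine squeeze_zero (fun n => dens1_nonneg (S.init_n n).toEnergyData (S.loss_mem_Icc n) ht.1 ξ)
      (fun n => dens1_le (S.init_n n).toEnergyData (S.loss_mem_Icc n) t ξ) ?_
    rw [← h0] at h5
    simpa using h5.const_mul t
  · exact ((h3 h0).const_sub t).mul h5

/-! ### The modes of convergence -/

/-- The label that the approximation puts at `x` sits within `o n` of `x` in the limit. Comparing
through this label costs the error of `U` and one Hölder increment of the limit. -/
lemma tendsto_u {t : ℝ} (ht : t ∈ Icc 0 T) :
    Tendsto (fun n => eLpNorm (fun x => (mapM (evo (Xn n) (βn n) t)).u x - (mapM (evo X β t)).u x)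
      ⊤ volume) atTop (𝓝 0) := by
  obtain ⟨o, ho, hy⟩ := S.exists_y_error
  obtain ⟨o', ho', hU⟩ := S.exists_U_error ht
  have tr := transport_evo S.init S.loss.mem_Icc S.loss.meas ht.1
  have h1 : ∀ n x, |(mapM (evo (Xn n) (βn n) t)).u x - (mapM (evo X β t)).u x| ≤
      o' n + √(o n * E) := by
    intro n x
    have trn := transport_evo (S.init_n n) (S.loss_mem_Icc n) (S.loss_meas n) ht.1
    set ξ := Function.invFun (evo (Xn n) (βn n) t).y x with hξ
    have hx : (evo (Xn n) (βn n) t).y ξ = x := Function.invFun_eq (trn.y_surj x)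
    have a1 := tr.sq_u_sub_le x ((evo X β t).y ξ)
    rw [tr.u_comp] at a1
    have a2 : |(evo X β t).y ξ - x| ≤ o n := by
      have := hy n t ht ξ
      rwa [hx, abs_sub_comm] at this
    have a3 : |(evo X β t).U ξ - (evo X β t).U (Function.invFun (evo X β t).y x)| ≤ √(o n * E) := by
      refine Real.abs_le_sqrt (a1.trans ?_)
      exact mul_le_mul a2 (integral_dens0_le S.init S.loss.mem_Icc S.loss.meas)
        (integral_nonneg (dens0_nonneg S.init.toEnergyData S.loss.mem_Icc t))
        ((abs_nonneg _).trans a2)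
    exact (abs_sub_le _ ((evo X β t).U ξ) _).trans (add_le_add (hU n ξ) a3)
  have h2 : Tendsto (fun n => ENNReal.ofReal (o' n + √(o n * E))) atTop (𝓝 0) := by
    have h3 : Tendsto (fun n => o' n + √(o n * E)) atTop (𝓝 0) := by
      simpa using ho'.add ((Real.continuous_sqrt.tendsto _).comp (ho.mul_const E))
    simpa using ENNReal.tendsto_ofReal h3
  refine tendsto_of_tendsto_of_tendsto_of_le_of_le tendsto_const_nhds h2 (fun _ => zero_le)
    fun n => ?_
  rw [eLpNorm_exponent_top]
  exact eLpNormEssSup_le_of_ae_bound (ae_of_all _ (h1 n))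

lemma exists_abs_y_sub_le {t : ℝ} (ht : t ∈ Icc 0 T) :
    ∃ C, ∀ n ξ, |(evo (Xn n) (βn n) t).y ξ - ξ| ≤ C := by
  obtain ⟨o, ho, hy⟩ := S.exists_y_error
  obtain ⟨O, hO⟩ := ho.bddAbove_range
  obtain ⟨C, hC⟩ := exists_abs_evo_y_sub_le S.init S.loss.mem_Icc S.loss.meas ht.1
  refine ⟨O + C, fun n ξ => ?_⟩
  have := abs_sub_le ((evo (Xn n) (βn n) t).y ξ) ((evo X β t).y ξ) ξ
  have h1 : o n ≤ O := hO ⟨n, rfl⟩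
  linarith [hy n t ht ξ, hC ξ]

lemma measurable_y (n : ℕ) (t : ℝ) : Measurable (evo (Xn n) (βn n) t).y :=
  (measurable_evo_y (S.init_n n) (S.loss_meas n)).comp measurable_prodMk_left

lemma tendsto_integral_comp {t M : ℝ} (ht : t ∈ Icc 0 T) {f : ℝ → ℝ} {fn : ℕ → ℝ → ℝ}
    (hfn : ∀ n, AEStronglyMeasurable (fn n) volume) (hM : ∀ n, ∀ᵐ ξ, |fn n ξ| ≤ M)
    (hf : ∀ᵐ ξ, Tendsto (fun n => fn n ξ) atTop (𝓝 (f ξ))) {φ : ℝ → ℝ} (hφ : Continuous φ)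
    (hc : HasCompactSupport φ) :
    Tendsto (fun n => ∫ ξ, φ ((evo (Xn n) (βn n) t).y ξ) * fn n ξ) atTop
      (𝓝 (∫ ξ, φ ((evo X β t).y ξ) * f ξ)) := by
  obtain ⟨C, hC⟩ := S.exists_abs_y_sub_le ht
  exact tendsto_integral_comp_mul hφ hc (fun n => S.measurable_y n t) (S.y_tendsto ht) hC hfn hM hf

/-- The L² norms are bounded by the energy, so test functions in `C_c` suffice. For these, passing
to labels turns the integral into that of `ψ (y) U_ξ`, where `U_ξ` converges a.e. and is bounded. -/
lemma tendsto_weak {t : ℝ} (ht : t ∈ Icc 0 T) {φ : ℝ → ℝ} (hφ : MemLp φ 2 volume) :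
    Tendsto (fun n => ∫ x, φ x * deriv (mapM (evo (Xn n) (βn n) t)).u x) atTop
      (𝓝 (∫ x, φ x * deriv (mapM (evo X β t)).u x)) := by
  have tr := transport_evo S.init S.loss.mem_Icc S.loss.meas ht.1
  have trn := fun n => transport_evo (S.init_n n) (S.loss_mem_Icc n) (S.loss_meas n) ht.1
  refine tendsto_integral_mul_of_compactSupport (A := E) tr.eulerian.2.1
    (fun n => (trn n).eulerian.2.1)
    (tr.eulerian.2.2.1.trans (integral_dens0_le S.init S.loss.mem_Icc S.loss.meas))
    (fun n => (trn n).eulerian.2.2.1.trans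
      (integral_dens0_le (S.init_n n) (S.loss_mem_Icc n) (S.loss_meas n))) (fun ψ h1 h2 => ?_) hφ
  have e1 := tr.integral_mul_deriv h1
  have e2 := fun n => (trn n).integral_mul_deriv h1
  change Tendsto (fun n => ∫ x, ψ x * deriv (fun x => (evo (Xn n) (βn n) t).U (Function.invFun (evo (Xn n) (βn n) t).y x)) x)
    atTop (𝓝 (∫ x, ψ x * deriv (fun x => (evo X β t).U (Function.invFun (evo X β t).y x)) x))
  rw [e1]
  refine Tendsto.congr (fun n => (e2 n).symm) ?_
  exact S.tendsto_integral_comp ht (fun n => (measurable_deriv _).aestronglyMeasurable)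
    (fun n => abs_deriv_evo_U_le (S.init_n n) (S.loss_mem_Icc n) (S.loss_meas n) ht.1)
    (S.deriv_U_tendsto ht) h1 h2

/-- L¹ convergence of `H_ξ` prevents energy from escaping to infinity, so `φ` needs only to be
bounded and continuous. This serves both the narrow convergence of `ν` and the limit for `g1`. -/
lemma tendsto_mul_deriv_H {t M : ℝ} (ht : t ∈ Icc 0 T) {φ : ℝ → ℝ} (hφ : Continuous φ)
    (hM : ∀ x, |φ x| ≤ M) {f : ℝ → ℝ} {fn : ℕ → ℝ → ℝ} (hf : Measurable f)
    (hfn : ∀ n, Measurable (fn n)) (hf1 : ∀ x, |f x| ≤ 1) (hfn1 : ∀ n x, |fn n x| ≤ 1)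
    (hlim : ∀ᵐ x, 0 < deriv X.H x → Tendsto (fun n => fn n x) atTop (𝓝 (f x))) :
    Tendsto (fun n => ∫ ξ, φ ((evo (Xn n) (βn n) t).y ξ) * (fn n ξ * deriv (Xn n).H ξ)) atTop
      (𝓝 (∫ ξ, φ ((evo X β t).y ξ) * (f ξ * deriv X.H ξ))) := by
  have hM0 : 0 ≤ M := (abs_nonneg _).trans (hM 0)
  simp_rw [← mul_assoc]
  have hy : Measurable (evo X β t).y :=
    (measurable_evo_y S.init S.loss.meas).comp measurable_prodMk_left
  have hb : ∀ {a b : ℝ}, |a| ≤ M → |b| ≤ 1 → |a * b| ≤ M := fun h1 h2 => by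
    rw [abs_mul]; exact (mul_le_mul h1 h2 (abs_nonneg _) hM0).trans (mul_one M).le
  refine (tendsto_integral_mul_of_L1 (M := M) S.init.integrable_deriv_H
    (fun n => (S.init_n n).integrable_deriv_H) S.init.deriv_H_nonneg S.tendsto_L1
    ((hφ.measurable.comp hy).mul hf) (fun n => (hφ.measurable.comp (S.measurable_y n t)).mul (hfn n))
    (fun x => hb (hM _) (hf1 x)) (fun n x => hb (hM _) (hfn1 n x)) ?_).2
  filter_upwards [hlim] with x hx hv
  exact ((hφ.tendsto _).comp (S.y_tendsto ht x)).mul (hx hv)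

lemma tendsto_nu {t : ℝ} (ht : t ∈ Icc 0 T) (φ : ℝ →ᵇ ℝ) :
    Tendsto (fun n => ∫ x, φ x ∂(mapM (evo (Xn n) (βn n) t)).ν) atTop
      (𝓝 (∫ x, φ x ∂(mapM (evo X β t)).ν)) := by
  have hy : Measurable (evo X β t).y :=
    (measurable_evo_y S.init S.loss.meas).comp measurable_prodMk_left
  have e : ∀ {Y : Lag} {b : ℝ → ℝ}, InitData Y E → Measurable (evo Y b t).y →
      ∫ x, φ x ∂(mapM (evo Y b t)).ν = ∫ ξ, φ ((evo Y b t).y ξ) * (1 * deriv Y.H ξ) := by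
    intro Y b hY hm
    simp only [mapM]
    rw [integral_map_withDensity_ofReal hm (measurable_deriv _).aemeasurable φ.continuous]
    refine integral_congr_ae (ae_of_all _ fun ξ => ?_)
    simp only [evo, one_mul]
    rw [max_eq_left (hY.deriv_H_nonneg ξ)]
  rw [e S.init hy]
  simp_rw [fun n => e (S.init_n n) (S.measurable_y n t)]
  exact S.tendsto_mul_deriv_H ht φ.continuous (M := ‖φ‖) (fun x => φ.norm_coe_le_norm x)
    measurable_const (fun _ => measurable_const) (by simp) (by simp)
    (ae_of_all _ fun _ _ => tendsto_const_nhds)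

lemma tendsto_g1 {t : ℝ} (ht : t ∈ Icc 0 T) {φ : ℝ → ℝ} (hφ : Continuous φ)
    (hc : HasCompactSupport φ) :
    Tendsto (fun n => pushIntegral (evo (Xn n) (βn n) t).y (g1 α (evo (Xn n) (βn n) t)) φ) atTop
      (𝓝 (pushIntegral (evo X β t).y (g1 α (evo X β t)) φ)) := by
  obtain ⟨M, hM⟩ := hc.exists_bound_of_continuous hφ
  have e : ∀ {Y : Lag} {b : ℝ → ℝ}, InitData Y E → (∀ η, b η ∈ Ico (0 : ℝ) 1) → Measurable b →
      pushIntegral (evo Y b t).y (g1 α (evo Y b t)) φ =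
        ∫ ξ, φ ((evo Y b t).y ξ) * ((1 - lossAt α Y b t ξ) * deriv Y.H ξ) := by
    intro Y b hY hb hm
    have h1 := g1_evo (α := α) hY hb hm ht.1
    have hy : Measurable (evo Y b t).y := (measurable_evo_y hY hm).comp measurable_prodMk_left
    have h2 : Measurable fun ξ => (1 - lossAt α Y b t ξ) * deriv Y.H ξ :=
      (measurable_const.sub (measurable_lossAt S.coeff hY hm t)).mul (measurable_deriv _)
    have h3 : (fun ξ => φ ((evo Y b t).y ξ) * g1 α (evo Y b t) ξ) =ᵐ[volume]
        fun ξ => φ ((evo Y b t).y ξ) * ((1 - lossAt α Y b t ξ) * deriv Y.H ξ) :=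
      h1.mono fun ξ hξ => by simp only [hξ]
    have h4 : Integrable fun ξ => φ ((evo Y b t).y ξ) * ((1 - lossAt α Y b t ξ) * deriv Y.H ξ) := by
      refine Integrable.bdd_mul (c := M) ?_ (hφ.measurable.comp hy).aestronglyMeasurable
        (ae_of_all _ fun ξ => hM _)
      refine hY.integrable_deriv_H.bdd_mul (c := 1)
        (measurable_const.sub (measurable_lossAt S.coeff hY hm t)).aestronglyMeasurable
        (ae_of_all _ fun ξ => ?_)
      have := lossAt_mem S.coeff Y hb t ξ
      rw [Real.norm_eq_abs, abs_le]; constructor <;> linarith [this.1, this.2]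
    rw [pushIntegral_eq hy (h2.aemeasurable.congr (h1.mono fun ξ hξ => hξ.symm)) hφ
      (h4.congr h3.symm)]
    exact integral_congr_ae h3
  rw [e S.init S.loss.mem S.loss.meas]
  simp_rw [fun n => e (S.init_n n) (S.loss_mem n) (S.loss_meas n)]
  have hb : ∀ {a : ℝ}, a ∈ Ico (0 : ℝ) 1 → |1 - a| ≤ 1 := fun h => by
    rw [abs_le]; constructor <;> linarith [h.1, h.2]
  refine S.tendsto_mul_deriv_H ht hφ hM
    (measurable_const.sub (measurable_lossAt S.coeff S.init S.loss.meas t))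
    (fun n => measurable_const.sub (measurable_lossAt S.coeff (S.init_n n) (S.loss_meas n) t))
    (fun x => hb (lossAt_mem S.coeff _ S.loss.mem _ _))
    (fun n x => hb (lossAt_mem S.coeff _ (S.loss_mem n) _ _)) ?_
  filter_upwards [S.lossAt_tendsto ht] with ξ h hv
  exact (h hv).const_sub 1

-- `φ ∘ y` has compact support because `y - id` is bounded, and the other factor is bounded, so the
-- integrand is integrable.
omit S in
lemma pushIntegral_mul_min {Y : Lag} {b : ℝ → ℝ} {t M : ℝ} (hY : InitData Y E)
    (hb : ∀ η, b η ∈ Icc (0 : ℝ) 1) (hm : Measurable b) (ht : 0 ≤ t) {c : ℝ → ℝ}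
    (hcm : Measurable c) (hcM : ∀ ξ, |c ξ| ≤ M) {φ : ℝ → ℝ} (hφ : Continuous φ)
    (hc : HasCompactSupport φ) :
    pushIntegral (evo Y b t).y (fun ξ => c ξ * min (deriv (evo Y b t).U ξ) 0) φ =
      ∫ ξ, φ ((evo Y b t).y ξ) * (c ξ * min (deriv (evo Y b t).U ξ) 0) := by
  have hy : Measurable (evo Y b t).y := (measurable_evo_y hY hm).comp measurable_prodMk_left
  have hg : Measurable fun ξ => c ξ * min (deriv (evo Y b t).U ξ) 0 :=
    hcm.mul ((measurable_deriv _).min measurable_const)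
  refine pushIntegral_eq hy hg.aemeasurable hφ ?_
  obtain ⟨C, hC⟩ := exists_abs_evo_y_sub_le hY hb hm ht
  have hcy : HasCompactSupport fun ξ => φ ((evo Y b t).y ξ) := by
    obtain ⟨R, hR⟩ := hc.isCompact.isBounded.subset_closedBall 0
    refine HasCompactSupport.of_support_subset_isCompact
      (isCompact_Icc (a := -(R + C)) (b := R + C)) fun ξ hξ => ?_
    have h1 : (evo Y b t).y ξ ∈ Metric.closedBall (0 : ℝ) R := hR (subset_tsupport _ hξ)
    rw [mem_closedBall_zero_iff, Real.norm_eq_abs] at h1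
    have h2 := abs_le.1 (hC ξ)
    have h3 := abs_le.1 h1
    exact ⟨by linarith, by linarith⟩
  obtain ⟨K, hK⟩ := lipschitzWith_evo_y hY hb hm ht
  have hi : Integrable fun ξ => φ ((evo Y b t).y ξ) :=
    (hφ.comp hK.continuous).integrable_of_hasCompactSupport hcy
  refine hi.mul_bdd (c := M * (1 + t)) hg.aestronglyMeasurable ?_
  filter_upwards [abs_deriv_evo_U_le hY hb hm ht] with ξ hξ
  rw [norm_mul]
  refine mul_le_mul (hcM ξ) ?_ (norm_nonneg _) ((abs_nonneg _).trans (hcM ξ))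
  rw [Real.norm_eq_abs]
  refine le_trans ?_ hξ
  rcases le_total (deriv (evo Y b t).U ξ) 0 with h | h
  · rw [min_eq_left h]
  · rw [min_eq_right h]; simp

lemma tendsto_push_mul_min {t M : ℝ} (ht : t ∈ Icc 0 T) {c : ℝ → ℝ} {cn : ℕ → ℝ → ℝ}
    (hcm : Measurable c) (hcnm : ∀ n, Measurable (cn n)) (hcM : ∀ ξ, |c ξ| ≤ M)
    (hcnM : ∀ n ξ, |cn n ξ| ≤ M) (hlim : ∀ ξ, Tendsto (fun n => cn n ξ) atTop (𝓝 (c ξ)))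
    {φ : ℝ → ℝ} (hφ : Continuous φ) (hc : HasCompactSupport φ) :
    Tendsto (fun n => pushIntegral (evo (Xn n) (βn n) t).y
        (fun ξ => cn n ξ * min (deriv (evo (Xn n) (βn n) t).U ξ) 0) φ) atTop
      (𝓝 (pushIntegral (evo X β t).y (fun ξ => c ξ * min (deriv (evo X β t).U ξ) 0) φ)) := by
  rw [pushIntegral_mul_min S.init S.loss.mem_Icc S.loss.meas ht.1 hcm hcM hφ hc]
  simp_rw [fun n => pushIntegral_mul_min (S.init_n n) (S.loss_mem_Icc n) (S.loss_meas n) ht.1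
    (hcnm n) (hcnM n) hφ hc]
  refine S.tendsto_integral_comp (M := M * (1 + t))
    (fn := fun n ξ => cn n ξ * min (deriv (evo (Xn n) (βn n) t).U ξ) 0) ht
    (fun n => ((hcnm n).mul ((measurable_deriv _).min measurable_const)).aestronglyMeasurable)
    (fun n => ?_) ?_ hφ hc
  · filter_upwards [abs_deriv_evo_U_le (S.init_n n) (S.loss_mem_Icc n) (S.loss_meas n) ht.1]
      with ξ hξ
    rw [abs_mul]
    refine mul_le_mul (hcnM n ξ) (le_trans ?_ hξ) (abs_nonneg _) ((abs_nonneg _).trans (hcM ξ))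
    rcases le_total (deriv (evo (Xn n) (βn n) t).U ξ) 0 with h | h
    · rw [min_eq_left h]
    · rw [min_eq_right h]; simp
  · filter_upwards [S.deriv_U_tendsto ht] with ξ h
    exact (hlim ξ).mul (h.min tendsto_const_nhds)

-- `g2` and `g3` are multiples of `min U_ξ 0`, a continuous function of `U_ξ`; in contrast to `g1`,
-- no knowledge of the losses is needed beyond the convergence of `U_ξ`.
omit S in
lemma g2_evo {Y : Lag} (hY : InitData Y E) (b : ℝ → ℝ) (t : ℝ) : g2 α (evo Y b t) =
    fun ξ => derivSupNorm α * E * min (deriv (evo Y b t).U ξ) 0 := by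
  ext ξ
  have : limTop (evo Y b t).H = E := hY.H_top.limUnder_eq
  unfold g2
  rw [this]
  split_ifs with h
  · rw [min_eq_left h.le]
  · rw [min_eq_right (not_lt.1 h), mul_zero]

omit S in
lemma g3_eq (α : ℝ → ℝ) (Y : Lag) : g3 α Y =
    fun ξ => derivSupNorm α * Y.U ξ * min (deriv Y.U ξ) 0 := by
  ext ξ
  unfold g3
  split_ifs with h
  · rw [min_eq_left h.le]
  · rw [min_eq_right (not_lt.1 h), mul_zero]

lemma tendsto_g2 {t : ℝ} (ht : t ∈ Icc 0 T) {φ : ℝ → ℝ} (hφ : Continuous φ)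
    (hc : HasCompactSupport φ) :
    Tendsto (fun n => pushIntegral (evo (Xn n) (βn n) t).y (g2 α (evo (Xn n) (βn n) t)) φ) atTop
      (𝓝 (pushIntegral (evo X β t).y (g2 α (evo X β t)) φ)) := by
  rw [g2_evo S.init]
  simp_rw [fun n => g2_evo (α := α) (S.init_n n) (βn n) t]
  exact S.tendsto_push_mul_min ht measurable_const (fun _ => measurable_const) (fun _ => le_rfl)
    (fun _ _ => le_rfl) (fun _ => tendsto_const_nhds) hφ hc

lemma tendsto_g3 {t : ℝ} (ht : t ∈ Icc 0 T) {φ : ℝ → ℝ} (hφ : Continuous φ)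
    (hc : HasCompactSupport φ) :
    Tendsto (fun n => pushIntegral (evo (Xn n) (βn n) t).y (g3 α (evo (Xn n) (βn n) t)) φ) atTop
      (𝓝 (pushIntegral (evo X β t).y (g3 α (evo X β t)) φ)) := by
  simp_rw [g3_eq]
  obtain ⟨o, ho, hU⟩ := S.exists_U_error ht
  obtain ⟨O, hO⟩ := ho.bddAbove_range
  obtain ⟨K, hK⟩ := lipschitzWith_evo_U S.init S.loss.mem_Icc S.loss.meas ht.1
  obtain ⟨a, b, hab⟩ := hasTails_evo_U S.init S.loss.mem_Icc S.loss.meas ht.1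
  obtain ⟨B, hB⟩ := hab.bounded hK
  have hk := derivSupNorm_nonneg α
  have hb : ∀ {x : ℝ}, |x| ≤ B + |O| → |derivSupNorm α * x| ≤ derivSupNorm α * (B + |O|) :=
    fun hx => by rw [abs_mul, abs_of_nonneg hk]; gcongr
  refine S.tendsto_push_mul_min (M := derivSupNorm α * (B + |O|)) ht
    (hK.continuous.measurable.const_mul _) (fun n => ?_)
    (fun ξ => hb ((hB ξ).trans (by linarith [abs_nonneg O]))) (fun n ξ => hb ?_) (fun ξ => ?_) hφ hc
  · obtain ⟨L, hL⟩ := lipschitzWith_evo_U (S.init_n n) (S.loss_mem_Icc n) (S.loss_meas n) ht.1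
    exact hL.continuous.measurable.const_mul _
  · have h1 := abs_sub_abs_le_abs_sub ((evo (Xn n) (βn n) t).U ξ) ((evo X β t).U ξ)
    have h2 : o n ≤ O := hO ⟨n, rfl⟩
    linarith [hU n ξ, hB ξ, le_abs_self O]
  · refine Tendsto.const_mul _ ?_
    rw [tendsto_iff_dist_tendsto_zero]
    exact squeeze_zero (fun n => dist_nonneg) (fun n => hU n ξ) ho

end StableSeq

/-! ## The projection operator -/

lemma monotone_of_forall_cell {f : ℝ → ℝ} {c : ℝ} (hc : 0 < c)
    (h : ∀ j : ℤ, MonotoneOn f (Icc (j * c) ((j + 1) * c))) : Monotone f := by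
  have hf : ∀ x : ℝ, x ∈ Icc ((⌊x / c⌋ : ℝ) * c) ((⌊x / c⌋ + 1) * c) := fun x => by
    have h1 := Int.floor_le (x / c)
    have h2 := Int.lt_floor_add_one (x / c)
    rw [le_div_iff₀ hc] at h1
    rw [div_lt_iff₀ hc] at h2
    exact ⟨h1, h2.le⟩
  have hint : Monotone fun j : ℤ => f (j * c) := by
    refine monotone_int_of_le_succ fun j => ?_
    have h1 : (j : ℝ) * c ≤ (j + 1) * c := by nlinarith
    have := h j (left_mem_Icc.2 h1) (right_mem_Icc.2 h1) h1
    push_cast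
    exact this
  intro x y hxy
  rcases (Int.floor_le_floor (div_le_div_of_nonneg_right hxy hc.le)).eq_or_lt with h1 | h1
  · exact h _ (hf x) (h1 ▸ hf y) hxy
  · have h2 := h _ (hf x) (right_mem_Icc.2 ((hf x).1.trans (hf x).2)) (hf x).2
    have h3 := h _ (left_mem_Icc.2 ((hf y).1.trans (hf y).2)) (hf y) (hf y).1
    have h4 := hint (Int.add_one_le_iff.2 h1)
    simp only at h4
    push_cast at h4
    exact h2.trans (h4.trans h3)

/-! ### Grid points and cells -/

section Grid

variable {dx : ℝ}

lemma gridX_add_one (dx : ℝ) (i : ℤ) : gridX dx (i + 1) = gridX dx i + dx := by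
  simp only [gridX]; push_cast; ring

lemma gridX_add_two (dx : ℝ) (i : ℤ) : gridX dx (i + 2) = gridX dx i + 2 * dx := by
  simp only [gridX]; push_cast; ring

lemma gridX_two_mul (dx : ℝ) (j : ℤ) : gridX dx (2 * j) = j * (2 * dx) := by
  simp only [gridX]; push_cast; ring

variable (hdx : 0 < dx)
include hdx

lemma cellOf_eq_iff {x : ℝ} {j : ℤ} :
    cellOf dx x = j ↔ x ∈ Ioc (gridX dx (2 * j)) (gridX dx (2 * j + 2)) := by
  have h2 : (0 : ℝ) < 2 * dx := by linarith
  rw [cellOf, sub_eq_iff_eq_add, Int.ceil_eq_iff, lt_div_iff₀ h2, div_le_iff₀ h2, mem_Ioc,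
    gridX_add_two, gridX_two_mul]
  push_cast
  constructor <;> rintro ⟨h3, h4⟩ <;> constructor <;> linarith

lemma mem_cellOf (x : ℝ) :
    x ∈ Ioc (gridX dx (2 * cellOf dx x)) (gridX dx (2 * cellOf dx x + 2)) :=
  (cellOf_eq_iff hdx).1 rfl

lemma cellOf_mono : Monotone (cellOf dx) := fun x y hxy =>
  sub_le_sub_right (Int.ceil_mono (div_le_div_of_nonneg_right hxy (by linarith))) _

lemma exists_cell_Ico (x : ℝ) : ∃ j : ℤ, x ∈ Ico (gridX dx (2 * j)) (gridX dx (2 * j + 2)) := by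
  have h2 : (0 : ℝ) < 2 * dx := by linarith
  refine ⟨⌊x / (2 * dx)⌋, ?_, ?_⟩
  · rw [gridX_two_mul, ← le_div_iff₀ h2]; exact Int.floor_le _
  · have := Int.lt_floor_add_one (x / (2 * dx))
    rw [div_lt_iff₀ h2] at this
    rw [gridX_add_two, gridX_two_mul]; linarith

end Grid

/-! ### Absolutely continuous and singular parts of the initial energy -/

section AcSing

variable {Z : Eul} (h : EulData Z)
include h

lemma EulData.acPart_eq :
    acPart Z.μ = volume.withDensity fun x => ENNReal.ofReal (deriv Z.u x ^ 2) := by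
  rw [acPart, h.eq]
  exact withDensity_congr_ae h.rnDeriv_eq

lemma EulData.acPart_add_singularPart :
    acPart Z.μ + Z.μ.singularPart volume = Z.ν := by
  have := h.finite
  rw [← h.eq, add_comm]
  have : IsFiniteMeasure Z.μ := by rw [h.eq]; exact h.finite
  exact Measure.singularPart_add_rnDeriv _ _

lemma EulData.isFiniteMeasure_acPart : IsFiniteMeasure (acPart Z.μ) := by
  have := h.finite
  exact isFiniteMeasure_of_le Z.ν (h.acPart_add_singularPart ▸ Measure.le_add_right le_rfl)

lemma EulData.isFiniteMeasure_sing : IsFiniteMeasure (Z.μ.singularPart volume) := by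
  have := h.finite
  exact isFiniteMeasure_of_le Z.ν (h.acPart_add_singularPart ▸ Measure.le_add_left le_rfl)

lemma EulData.Fac_add_Fsing (x : ℝ) : Fac Z.μ x + Fsing Z.μ x = Z.ν.real (Iio x) := by
  have := h.isFiniteMeasure_acPart
  have := h.isFiniteMeasure_sing
  have e : Z.ν.real (Iio x) = (acPart Z.μ + Z.μ.singularPart volume).real (Iio x) := by
    rw [h.acPart_add_singularPart]
  rw [e, measureReal_add_apply]
  rfl

lemma EulData.Fac_mono : Monotone (Fac Z.μ) := by
  have := h.isFiniteMeasure_acPart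
  exact monotone_measureReal_Iio (acPart Z.μ)

lemma EulData.Fsing_mono : Monotone (Fsing Z.μ) := by
  have := h.isFiniteMeasure_sing
  exact monotone_measureReal_Iio (Z.μ.singularPart volume)

/-- Cauchy–Schwarz for `u_x`; it makes the radicand in the definition of `q` nonnegative. -/
lemma EulData.sq_sub_le_Fac {a b : ℝ} (hab : a ≤ b) :
    (Z.u b - Z.u a) ^ 2 ≤ (b - a) * (Fac Z.μ b - Fac Z.μ a) := by
  have := h.isFiniteMeasure_acPart
  refine (h.u_prim.sq_sub_le h.memLp_deriv_u hab).trans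
    (mul_le_mul_of_nonneg_left (le_of_eq ?_) (by linarith))
  have h1 : Fac Z.μ b - Fac Z.μ a = (acPart Z.μ).real (Ico a b) := by
    have e : Ico a b = Iio b \ Iio a := by ext x; simp
    rw [e, measureReal_sdiff (Iio_subset_Iio hab) measurableSet_Iio]
    rfl
  rw [h1, measureReal_def, h.acPart_eq, withDensity_apply _ measurableSet_Ico,
    intervalIntegral.integral_of_le hab, integral_Ioc_eq_integral_Ioo, ← integral_Ico_eq_integral_Ioo,
    integral_eq_lintegral_of_nonneg_ae (ae_of_all _ fun x => sq_nonneg _)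
      ((measurable_deriv _).pow_const 2).aestronglyMeasurable]

end AcSing

/-- The slope of the projection in the left half of the cell `j`. -/
noncomputable def slopeL (dx : ℝ) (σ : ℤ → ℤˣ) (Z : Eul) (j : ℤ) : ℝ :=
  diffD dx Z.u j - projSQ dx σ Z j

/-- The slope of the projection in the right half of the cell `j`. -/
noncomputable def slopeR (dx : ℝ) (σ : ℤ → ℤˣ) (Z : Eul) (j : ℤ) : ℝ :=
  diffD dx Z.u j + projSQ dx σ Z j

/-! ### The two slopes of the projection in a cell -/

section Slopes

variable {Z : Eul} (h : EulData Z) {dx : ℝ} (hdx : 0 < dx) (σ : ℤ → ℤˣ)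

include hdx in
lemma slope_add (j : ℤ) : (slopeL dx σ Z j + slopeR dx σ Z j) * dx =
    Z.u (gridX dx (2 * j + 2)) - Z.u (gridX dx (2 * j)) := by
  simp only [slopeL, slopeR, diffD]; field_simp; ring

include h hdx

lemma projQ_sq (j : ℤ) : projQ dx Z j ^ 2 = diffD dx (Fac Z.μ) j - diffD dx Z.u j ^ 2 := by
  refine Real.sq_sqrt (sub_nonneg.2 ?_)
  have h1 := h.sq_sub_le_Fac (a := gridX dx (2 * j)) (b := gridX dx (2 * j + 2))
    (by rw [gridX_add_two]; linarith)
  have e : gridX dx (2 * j + 2) - gridX dx (2 * j) = 2 * dx := by rw [gridX_add_two]; ring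
  rw [e] at h1
  simp only [diffD]
  rw [div_pow, div_le_div_iff₀ (by positivity) (by positivity)]
  nlinarith

lemma projSQ_sq (j : ℤ) : projSQ dx σ Z j ^ 2 = diffD dx (Fac Z.μ) j - diffD dx Z.u j ^ 2 := by
  rw [projSQ, mul_pow, projQ_sq h hdx]
  rcases Int.units_eq_one_or (σ j) with e | e <;> simp [e]

/-- The squares of the slopes add up to `2 ((Du)² + q²) = 2 DF_ac`. With `slope_add` this says that
the projection preserves the increments of `u` and `F_ac` over each cell; the sign merely exchanges
the two slopes. -/
lemma slope_sq_add (j : ℤ) : (slopeL dx σ Z j ^ 2 + slopeR dx σ Z j ^ 2) * dx =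
    Fac Z.μ (gridX dx (2 * j + 2)) - Fac Z.μ (gridX dx (2 * j)) := by
  have h1 := projSQ_sq h hdx σ j
  have h2 : diffD dx (Fac Z.μ) j * (2 * dx) =
      Fac Z.μ (gridX dx (2 * j + 2)) - Fac Z.μ (gridX dx (2 * j)) := by
    simp only [diffD]; field_simp
  rw [← h2]
  simp only [slopeL, slopeR]
  linear_combination 2 * dx * h1

end Slopes

/-! ### Explicit formulas for the projection on half cells -/

section Formulas

variable {Z : Eul} (h : EulData Z) {dx : ℝ} (hdx : 0 < dx) (σ : ℤ → ℤˣ) {j : ℤ} {x : ℝ}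
include hdx

/-- At the midpoint the definition uses the formula of the left half; by `slope_add` the two agree
there, so the half cell may be taken closed. -/
lemma projU_right (hx : x ∈ Icc (gridX dx (2 * j + 1)) (gridX dx (2 * j + 2))) :
    projU dx σ Z x =
      Z.u (gridX dx (2 * j + 2)) + slopeR dx σ Z j * (x - gridX dx (2 * j + 2)) := by
  have h1 := gridX_add_one dx (2 * j)
  have h2 := gridX_add_two dx (2 * j)
  have hc : cellOf dx x = j := (cellOf_eq_iff hdx).2 ⟨by linarith [hx.1], hx.2⟩
  simp only [projU, hc]
  split_ifs with h3
  · have h4 : x = gridX dx (2 * j + 1) := le_antisymm h3 hx.1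
    have := slope_add (Z := Z) hdx σ j
    simp only [slopeL, slopeR] at this ⊢
    rw [h4, h1, h2]
    rw [h2] at this
    linear_combination this
  · rfl

lemma projU_left (hx : x ∈ Icc (gridX dx (2 * j)) (gridX dx (2 * j + 1))) :
    projU dx σ Z x = Z.u (gridX dx (2 * j)) + slopeL dx σ Z j * (x - gridX dx (2 * j)) := by
  have h1 := gridX_add_one dx (2 * j)
  have h2 := gridX_add_two dx (2 * j)
  rcases hx.1.eq_or_lt with h3 | h3
  -- At the left end point `cellOf` returns the preceding cell, whose right formula gives the same
  -- value.
  · rw [← h3]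
    have e : 2 * (j - 1) + 2 = 2 * j := by ring
    have h4 := projU_right (Z := Z) (j := j - 1) (x := gridX dx (2 * j)) hdx σ
      ⟨by have := gridX_add_one dx (2 * (j - 1) + 1); rw [show 2 * (j - 1) + 1 + 1 = 2 * j by ring] at this; linarith, by rw [e]⟩
    rw [h4, e]; ring
  · have hc : cellOf dx x = j := (cellOf_eq_iff hdx).2 ⟨h3, by linarith [hx.2]⟩
    simp only [projU, hc, if_pos hx.2]
    rfl

include h

lemma projFac_right (hx : x ∈ Icc (gridX dx (2 * j + 1)) (gridX dx (2 * j + 2))) :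
    projFac dx σ Z x =
      Fac Z.μ (gridX dx (2 * j + 2)) + slopeR dx σ Z j ^ 2 * (x - gridX dx (2 * j + 2)) := by
  have h1 := gridX_add_one dx (2 * j)
  have h2 := gridX_add_two dx (2 * j)
  have hc : cellOf dx x = j := (cellOf_eq_iff hdx).2 ⟨by linarith [hx.1], hx.2⟩
  have h5 := slope_sq_add h hdx σ j
  simp only [projFac, hc]
  simp only [slopeL, slopeR] at h5 ⊢
  split_ifs with h3
  · have h4 : x = gridX dx (2 * j + 1) := le_antisymm h3 hx.1
    rw [h4, h1, h2]
    rw [h2] at h5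
    linear_combination h5
  · rw [h1]
    rw [h2] at h5 ⊢
    linear_combination (1 / 2) * h5

lemma projFac_left (hx : x ∈ Icc (gridX dx (2 * j)) (gridX dx (2 * j + 1))) :
    projFac dx σ Z x =
      Fac Z.μ (gridX dx (2 * j)) + slopeL dx σ Z j ^ 2 * (x - gridX dx (2 * j)) := by
  have h1 := gridX_add_one dx (2 * j)
  have h2 := gridX_add_two dx (2 * j)
  rcases hx.1.eq_or_lt with h3 | h3
  · rw [← h3]
    have e : 2 * (j - 1) + 2 = 2 * j := by ring
    have h4 := projFac_right (j := j - 1) (x := gridX dx (2 * j)) h hdx σ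
      ⟨by have := gridX_add_one dx (2 * (j - 1) + 1); rw [show 2 * (j - 1) + 1 + 1 = 2 * j by ring] at this; linarith, by rw [e]⟩
    rw [h4, e]; ring
  · have hc : cellOf dx x = j := (cellOf_eq_iff hdx).2 ⟨h3, by linarith [hx.2]⟩
    simp only [projFac, hc, if_pos hx.2]
    rfl

omit h in
lemma monotone_of_half_cells {f : ℝ → ℝ}
    (hl : ∀ j : ℤ, MonotoneOn f (Icc (gridX dx (2 * j)) (gridX dx (2 * j + 1))))
    (hr : ∀ j : ℤ, MonotoneOn f (Icc (gridX dx (2 * j + 1)) (gridX dx (2 * j + 2)))) :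
    Monotone f := by
  refine monotone_of_forall_cell hdx fun i => ?_
  rcases Int.even_or_odd' i with ⟨j, rfl | rfl⟩
  · have := hl j; simp only [gridX] at this; push_cast at this ⊢; exact this
  · have := hr j; simp only [gridX] at this; push_cast at this ⊢
    convert this using 2; ring

lemma projFac_mono : Monotone (projFac dx σ Z) := by
  refine monotone_of_half_cells hdx (fun j x hx y hy hxy => ?_) fun j x hx y hy hxy => ?_
  · rw [projFac_left h hdx σ hx, projFac_left h hdx σ hy]
    have := mul_le_mul_of_nonneg_left hxy (sq_nonneg (slopeL dx σ Z j))
    linarith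
  · rw [projFac_right h hdx σ hx, projFac_right h hdx σ hy]
    have := mul_le_mul_of_nonneg_left hxy (sq_nonneg (slopeR dx σ Z j))
    linarith

/-- The squared slopes times `dx` are bounded by the total absolutely continuous energy. The
Lipschitz bound is expressed through monotonicity of `L x ± u`, which can be checked on half cells.
-/
lemma projU_lipschitz : ∃ K, LipschitzWith K (projU dx σ Z) := by
  have := h.finite
  have := h.isFiniteMeasure_acPart
  set A := (acPart Z.μ).real univ
  have hA : 0 ≤ A := measureReal_nonneg
  set L := √(A / dx)
  have hs : ∀ j, |slopeL dx σ Z j| ≤ L ∧ |slopeR dx σ Z j| ≤ L := fun j => by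
    have h1 := slope_sq_add h hdx σ j
    have h2 : Fac Z.μ (gridX dx (2 * j + 2)) ≤ A := measureReal_mono (subset_univ _)
    have h3 : 0 ≤ Fac Z.μ (gridX dx (2 * j)) := ENNReal.toReal_nonneg
    have h4 := mul_nonneg (sq_nonneg (slopeL dx σ Z j)) hdx.le
    have h5 := mul_nonneg (sq_nonneg (slopeR dx σ Z j)) hdx.le
    exact ⟨Real.abs_le_sqrt (by rw [le_div_iff₀ hdx]; linarith),
      Real.abs_le_sqrt (by rw [le_div_iff₀ hdx]; linarith)⟩
  have hm : ∀ e : ℝ, |e| = 1 → Monotone fun x => L * x + e * projU dx σ Z x := by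
    intro e he
    have key : ∀ s x y : ℝ, |s| ≤ L → x ≤ y → 0 ≤ (L + e * s) * (y - x) := by
      intro s x y hs hxy
      have : |e * s| ≤ L := by rw [abs_mul, he, one_mul]; exact hs
      exact mul_nonneg (by linarith [(abs_le.1 this).1]) (by linarith)
    refine monotone_of_half_cells hdx (fun j x hx y hy hxy => ?_) fun j x hx y hy hxy => ?_
    · rw [projU_left hdx σ hx, projU_left hdx σ hy]
      linarith [key _ x y (hs j).1 hxy]
    · rw [projU_right hdx σ hx, projU_right hdx σ hy]
      linarith [key _ x y (hs j).2 hxy]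
  refine ⟨Real.toNNReal L, LipschitzWith.of_dist_le_mul fun x y => ?_⟩
  rw [Real.coe_toNNReal _ (Real.sqrt_nonneg _), Real.dist_eq, Real.dist_eq]
  wlog hxy : y ≤ x generalizing x y
  · rw [abs_sub_comm, abs_sub_comm x]; exact this y x (by linarith)
  have h1 := hm 1 (by simp) hxy
  have h2 := hm (-1) (by simp) hxy
  simp only at h1 h2
  rw [abs_of_nonneg (sub_nonneg.2 hxy), abs_le]
  constructor <;> linarith

omit h in
lemma projFsing_mono (h : EulData Z) : Monotone fun x => Fsing Z.μ (gridX dx (2 * cellOf dx x + 2)) :=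
  fun x y hxy => h.Fsing_mono (by
    have := cellOf_mono hdx hxy
    have h2 : (2 * cellOf dx x + 2 : ℤ) ≤ 2 * cellOf dx y + 2 := by linarith
    simp only [gridX]
    exact mul_le_mul_of_nonneg_right (by exact_mod_cast h2) hdx.le)

lemma projF_mono : Monotone (projF dx σ Z) := (projFac_mono h hdx σ).add (projFsing_mono hdx h)

/-- The left end point is excluded, since the singular part there still has the value of the
preceding cell. -/
lemma projF_of_mem_left (hx : x ∈ Ioc (gridX dx (2 * j)) (gridX dx (2 * j + 1))) :
    projF dx σ Z x = Fac Z.μ (gridX dx (2 * j)) + slopeL dx σ Z j ^ 2 * (x - gridX dx (2 * j)) +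
      Fsing Z.μ (gridX dx (2 * j + 2)) := by
  have h1 := gridX_add_one dx (2 * j)
  have h2 := gridX_add_two dx (2 * j)
  have hc : cellOf dx x = j := (cellOf_eq_iff hdx).2 ⟨hx.1, by linarith [hx.2]⟩
  rw [projF, projFac_left h hdx σ ⟨hx.1.le, hx.2⟩, hc]

lemma projF_of_mem_right (hx : x ∈ Icc (gridX dx (2 * j + 1)) (gridX dx (2 * j + 2))) :
    projF dx σ Z x = Fac Z.μ (gridX dx (2 * j + 2)) +
      slopeR dx σ Z j ^ 2 * (x - gridX dx (2 * j + 2)) + Fsing Z.μ (gridX dx (2 * j + 2)) := by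
  have h1 := gridX_add_one dx (2 * j)
  have hc : cellOf dx x = j := (cellOf_eq_iff hdx).2 ⟨by linarith [hx.1], hx.2⟩
  rw [projF, projFac_right h hdx σ hx, hc]

lemma projF_gridX (j : ℤ) : projF dx σ Z (gridX dx (2 * j)) = Z.ν.real (Iio (gridX dx (2 * j))) := by
  have e : 2 * (j - 1) + 2 = 2 * j := by ring
  have h1 := gridX_add_one dx (2 * (j - 1) + 1)
  rw [show 2 * (j - 1) + 1 + 1 = 2 * j by ring] at h1
  have := projF_of_mem_right (j := j - 1) (x := gridX dx (2 * j)) h hdx σ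
    ⟨by linarith, by rw [e]⟩
  rw [this, e, sub_self, mul_zero, add_zero, h.Fac_add_Fsing]

/-- `F_Δx` is monotone and agrees with `ν (Iio ·)` at the even grid points, which are at most `2 dx`
away. The upper bound `projF_le` has the same reason. -/
lemma projF_ge (x : ℝ) : Z.ν.real (Iio (x - 2 * dx)) ≤ projF dx σ Z x := by
  have := h.finite
  have h1 := mem_cellOf hdx x
  have h2 := gridX_add_two dx (2 * cellOf dx x)
  refine le_trans ?_ (projF_mono h hdx σ h1.1.le)
  rw [projF_gridX h hdx]
  exact monotone_measureReal_Iio _ (by linarith [h1.2])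

lemma projF_le (x : ℝ) : projF dx σ Z x ≤ Z.ν.real (Iio (x + 2 * dx)) := by
  have := h.finite
  have h1 := mem_cellOf hdx x
  have h2 := gridX_add_two dx (2 * cellOf dx x)
  refine (projF_mono h hdx σ h1.2).trans ?_
  rw [show 2 * cellOf dx x + 2 = 2 * (cellOf dx x + 1) by ring, projF_gridX h hdx]
  refine monotone_measureReal_Iio _ ?_
  rw [show 2 * (cellOf dx x + 1) = 2 * cellOf dx x + 2 by ring]
  linarith [h1.1]

end Formulas

/-- The Stieltjes function is built from right limits; left continuity of `F` recovers its values as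
the masses of open half-lines. -/
lemma measureOfPrimitive_apply {F : ℝ → ℝ} (hF : Monotone F)
    (hl : ∀ x, Tendsto F (𝓝[<] x) (𝓝 (F x))) {E : ℝ} (h0 : Tendsto F atBot (𝓝 0))
    (hE : Tendsto F atTop (𝓝 E)) :
    IsFiniteMeasure (measureOfPrimitive F) ∧ (∀ x, (measureOfPrimitive F).real (Iio x) = F x) ∧
      (measureOfPrimitive F).real univ = E := by
  have e : measureOfPrimitive F = hF.stieltjesFunction.measure := dif_pos hF
  have hs : ∀ x, hF.stieltjesFunction x = Function.rightLim F x := fun x =>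
    hF.stieltjesFunction_eq x
  have h1 : Tendsto hF.stieltjesFunction atBot (𝓝 0) := by
    refine tendsto_of_tendsto_of_tendsto_of_le_of_le h0
      (h0.comp (tendsto_atBot_add_const_right _ 1 tendsto_id)) (fun x => ?_) (fun x => ?_)
    · rw [hs]; exact hF.le_rightLim le_rfl
    · rw [hs]; exact hF.rightLim_le (by simp)
  have h2 : Tendsto hF.stieltjesFunction atTop (𝓝 E) := by
    refine tendsto_of_tendsto_of_tendsto_of_le_of_le hE
      (hE.comp (tendsto_atTop_add_const_right _ 1 tendsto_id)) (fun x => ?_) (fun x => ?_)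
    · rw [hs]; exact hF.le_rightLim le_rfl
    · rw [hs]; exact hF.rightLim_le (by simp)
  have hF0 : ∀ x, 0 ≤ F x := fun x => hF.le_of_tendsto h0 x
  have hE0 : 0 ≤ E := ge_of_tendsto' hE hF0
  have h3 : (measureOfPrimitive F) univ = ENNReal.ofReal E := by
    rw [e, StieltjesFunction.measure_univ _ h1 h2, sub_zero]
  refine ⟨⟨by rw [h3]; exact ENNReal.ofReal_lt_top⟩, fun x => ?_, ?_⟩
  · have h4 : Function.leftLim hF.stieltjesFunction x = F x := by
      refine leftLim_eq_of_tendsto ?_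
      refine tendsto_of_tendsto_of_tendsto_of_le_of_le' (hl x) tendsto_const_nhds ?_ ?_
      · exact Eventually.of_forall fun y => by rw [hs]; exact hF.le_rightLim le_rfl
      · filter_upwards [self_mem_nhdsWithin] with y hy
        rw [hs]; exact hF.rightLim_le hy
    rw [measureReal_def, e, StieltjesFunction.measure_Iio _ h1, h4, sub_zero,
      ENNReal.toReal_ofReal (hF0 x)]
  · rw [measureReal_def, h3, ENNReal.toReal_ofReal hE0]

/-- Tonelli: for `c ≥ 0`, integrating `ν [x - c, x + c)` over `x` gives `2 c ν(ℝ)`. It provides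
square integrability of the projection error of `u`. -/
lemma integrable_measureReal_Ico (ν : Measure ℝ) [IsFiniteMeasure ν] (c : ℝ) :
    Integrable fun x => ν.real (Iio (x + c)) - ν.real (Iio (x - c)) := by
  wlog hc : 0 ≤ c generalizing c
  · refine (this (-c) (by linarith)).neg.congr (ae_of_all _ fun x => ?_)
    simp [sub_eq_add_neg]
  have hm := monotone_measureReal_Iio ν
  have h1 : ∀ x, ν.real (Iio (x + c)) - ν.real (Iio (x - c)) = ν.real (Ico (x - c) (x + c)) := by
    intro x
    have e : Ico (x - c) (x + c) = Iio (x + c) \ Iio (x - c) := by ext y; simp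
    rw [e, measureReal_sdiff (Iio_subset_Iio (by linarith)) measurableSet_Iio]
  have hmeas : Measurable fun x => ν.real (Iio (x + c)) - ν.real (Iio (x - c)) :=
    (hm.measurable.comp (measurable_id.add_const c)).sub
      (hm.measurable.comp (measurable_id.sub_const c))
  refine ⟨hmeas.aestronglyMeasurable, ?_⟩
  rw [hasFiniteIntegral_iff_ofReal (ae_of_all _ fun x => by rw [h1]; exact measureReal_nonneg)]
  have h2 : ∀ x, ENNReal.ofReal (ν.real (Iio (x + c)) - ν.real (Iio (x - c))) =
      ν (Ico (x - c) (x + c)) := fun x => by rw [h1, ofReal_measureReal]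
  simp_rw [h2]
  set A : Set (ℝ × ℝ) := {p | p.1 - c ≤ p.2 ∧ p.2 < p.1 + c}
  have hA : MeasurableSet A := (measurableSet_le (measurable_fst.sub_const c) measurable_snd).inter
    (measurableSet_lt measurable_snd (measurable_fst.add_const c))
  have h3 : (volume.prod ν) A = ∫⁻ x, ν (Ico (x - c) (x + c)) := Measure.prod_apply hA
  have h4 : (volume.prod ν) A = ∫⁻ y, volume ((fun x => (x, y)) ⁻¹' A) ∂ν :=
    Measure.prod_apply_symm hA
  rw [← h3, h4]
  have h5 : ∀ y, volume ((fun x => (x, y)) ⁻¹' A) = ENNReal.ofReal (2 * c) := fun y => by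
    have : (fun x => (x, y)) ⁻¹' A = Ioc (y - c) (y + c) := by
      ext x; simp only [A, mem_preimage, mem_ofPred_eq, mem_Ioc]
      constructor <;> rintro ⟨h6, h7⟩ <;> constructor <;> linarith
    rw [this, Real.volume_Ioc]; congr 1; ring
  simp_rw [h5, lintegral_const]
  exact ENNReal.mul_lt_top ENNReal.ofReal_lt_top (measure_lt_top _ _)

/-! ### The projected data as Eulerian and Lagrangian initial data -/

section Projected

variable {Z : Eul} (h : EulData Z) {dx : ℝ} (hdx : 0 < dx) (σ : ℤ → ℤˣ)
include h hdx

lemma projF_leftCont (x : ℝ) : Tendsto (projF dx σ Z) (𝓝[<] x) (𝓝 (projF dx σ Z x)) := by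
  set j := cellOf dx x with hj
  have hx := mem_cellOf hdx x
  have h1 := gridX_add_one dx (2 * j)
  have h2 := gridX_add_two dx (2 * j)
  rw [← hj] at hx
  by_cases hxm : x ≤ gridX dx (2 * j + 1)
  · have hc : ContinuousAt (fun x => Fac Z.μ (gridX dx (2 * j)) + slopeL dx σ Z j ^ 2 *
        (x - gridX dx (2 * j)) + Fsing Z.μ (gridX dx (2 * j + 2))) x := by fun_prop
    rw [projF_of_mem_left h hdx σ ⟨hx.1, hxm⟩]
    refine (hc.tendsto.mono_left nhdsWithin_le_nhds).congr' ?_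
    filter_upwards [Ioo_mem_nhdsLT hx.1] with y hy
    rw [projF_of_mem_left h hdx σ ⟨hy.1, hy.2.le.trans hxm⟩]
  · rw [not_le] at hxm
    have hc : ContinuousAt (fun x => Fac Z.μ (gridX dx (2 * j + 2)) + slopeR dx σ Z j ^ 2 *
        (x - gridX dx (2 * j + 2)) + Fsing Z.μ (gridX dx (2 * j + 2))) x := by fun_prop
    rw [projF_of_mem_right h hdx σ ⟨hxm.le, hx.2⟩]
    refine (hc.tendsto.mono_left nhdsWithin_le_nhds).congr' ?_
    filter_upwards [Ioo_mem_nhdsLT hxm] with y hy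
    rw [projF_of_mem_right h hdx σ ⟨hy.1.le, hy.2.le.trans hx.2⟩]

lemma proj_measure : IsFiniteMeasure (proj dx σ Z).ν ∧
    (∀ x, (proj dx σ Z).ν.real (Iio x) = projF dx σ Z x) ∧
      (proj dx σ Z).ν.real univ = Z.ν.real univ := by
  have := h.finite
  refine measureOfPrimitive_apply (projF_mono h hdx σ) (projF_leftCont h hdx σ) ?_ ?_
  · exact tendsto_of_tendsto_of_tendsto_of_le_of_le
      ((tendsto_measureReal_Iio_atBot Z.ν).comp (tendsto_atBot_add_const_right _ (-(2 * dx))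
        tendsto_id))
      ((tendsto_measureReal_Iio_atBot Z.ν).comp (tendsto_atBot_add_const_right _ (2 * dx)
        tendsto_id)) (projF_ge h hdx σ) (projF_le h hdx σ)
  · exact tendsto_of_tendsto_of_tendsto_of_le_of_le
      ((tendsto_measureReal_Iio_atTop Z.ν).comp (tendsto_atTop_add_const_right _ (-(2 * dx))
        tendsto_id))
      ((tendsto_measureReal_Iio_atTop Z.ν).comp (tendsto_atTop_add_const_right _ (2 * dx)
        tendsto_id)) (projF_ge h hdx σ) (projF_le h hdx σ)

/-- Off the grid, the projection is differentiable with one of the two slopes of the cell. -/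
lemma proj_hasDerivAt {x : ℝ} (hx : ∀ i : ℤ, x ≠ gridX dx i) : ∃ (j : ℤ) (s : ℝ),
    x ∈ Ioo (gridX dx (2 * j)) (gridX dx (2 * j + 2)) ∧
    (s = slopeL dx σ Z j ∨ s = slopeR dx σ Z j) ∧
    HasDerivAt (projU dx σ Z) s x ∧ HasDerivAt (projF dx σ Z) (s ^ 2) x := by
  set j := cellOf dx x with hj
  have hx' := mem_cellOf hdx x
  have h1 := gridX_add_one dx (2 * j)
  have h2 := gridX_add_two dx (2 * j)
  rw [← hj] at hx'
  have hx2 : x < gridX dx (2 * j + 2) := lt_of_le_of_ne hx'.2 (hx _)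
  have hlin : ∀ c s d : ℝ, HasDerivAt (fun x => c + s * (x - d)) s x := fun c s d => by
    simpa using (((hasDerivAt_id x).sub_const d).const_mul s).const_add c
  rcases lt_or_gt_of_ne (hx (2 * j + 1)) with hlt | hgt
  · refine ⟨j, slopeL dx σ Z j, ⟨hx'.1, hx2⟩, Or.inl rfl, ?_, ?_⟩
    · refine (hlin (Z.u (gridX dx (2 * j))) _ (gridX dx (2 * j))).congr_of_eventuallyEq ?_
      filter_upwards [Ioo_mem_nhds hx'.1 hlt] with y hy
      exact projU_left hdx σ ⟨hy.1.le, hy.2.le⟩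
    · refine ((hlin (Fac Z.μ (gridX dx (2 * j))) _ (gridX dx (2 * j))).add_const
        (Fsing Z.μ (gridX dx (2 * j + 2)))).congr_of_eventuallyEq ?_
      filter_upwards [Ioo_mem_nhds hx'.1 hlt] with y hy
      exact projF_of_mem_left h hdx σ ⟨hy.1, hy.2.le⟩
  · refine ⟨j, slopeR dx σ Z j, ⟨hx'.1, hx2⟩, Or.inr rfl, ?_, ?_⟩
    · refine (hlin (Z.u (gridX dx (2 * j + 2))) _ (gridX dx (2 * j + 2))).congr_of_eventuallyEq ?_
      filter_upwards [Ioo_mem_nhds hgt hx2] with y hy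
      exact projU_right hdx σ ⟨hy.1.le, hy.2.le⟩
    · refine ((hlin (Fac Z.μ (gridX dx (2 * j + 2))) _ (gridX dx (2 * j + 2))).add_const
        (Fsing Z.μ (gridX dx (2 * j + 2)))).congr_of_eventuallyEq ?_
      filter_upwards [Ioo_mem_nhds hgt hx2] with y hy
      exact projF_of_mem_right h hdx σ ⟨hy.1.le, hy.2.le⟩

/-- On each half cell both functions are compared with their common value at its even grid point.
With `A` the absolutely continuous energy of the cell, the affine part contributes `dx A` and the
oscillation of `u` at most `2 dx A`; then `(a + b)² ≤ 2 a² + 2 b²` gives 6. -/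
lemma sq_projU_sub_le (x : ℝ) : (projU dx σ Z x - Z.u x) ^ 2 ≤
    6 * dx * (Z.ν.real (Iio (x + 2 * dx)) - Z.ν.real (Iio (x - 2 * dx))) := by
  have := h.finite
  set j := cellOf dx x with hj
  have hx := mem_cellOf hdx x
  rw [← hj] at hx
  have h1 := gridX_add_one dx (2 * j)
  have h2 := gridX_add_two dx (2 * j)
  set A := Fac Z.μ (gridX dx (2 * j + 2)) - Fac Z.μ (gridX dx (2 * j)) with hA
  have hs := slope_sq_add h hdx σ j
  have hm := monotone_measureReal_Iio Z.ν
  have hA1 : A ≤ Z.ν.real (Iio (x + 2 * dx)) - Z.ν.real (Iio (x - 2 * dx)) := by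
    have a1 := h.Fac_add_Fsing (gridX dx (2 * j + 2))
    have a2 := h.Fac_add_Fsing (gridX dx (2 * j))
    have a3 := h.Fsing_mono (show gridX dx (2 * j) ≤ gridX dx (2 * j + 2) by linarith)
    have a4 : Z.ν.real (Iio (gridX dx (2 * j + 2))) ≤ Z.ν.real (Iio (x + 2 * dx)) :=
      hm (by linarith [hx.1])
    have a5 : Z.ν.real (Iio (x - 2 * dx)) ≤ Z.ν.real (Iio (gridX dx (2 * j))) :=
      hm (by linarith [hx.2])
    linarith
  refine le_trans ?_ (mul_le_mul_of_nonneg_left hA1 (by linarith))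
  have key : ∀ a b : ℝ, a ^ 2 ≤ dx * A → b ^ 2 ≤ 2 * dx * A → (a + b) ^ 2 ≤ 6 * dx * A := by
    intro a b h3 h4; nlinarith [sq_nonneg (a - b)]
  have hsL : 0 ≤ slopeR dx σ Z j ^ 2 * dx := by positivity
  have hsR : 0 ≤ slopeL dx σ Z j ^ 2 * dx := by positivity
  have hsq : ∀ d : ℝ, |d| ≤ dx → d ^ 2 ≤ dx ^ 2 := fun d hd => by
    rw [← sq_abs]; gcongr
  by_cases hxm : x ≤ gridX dx (2 * j + 1)
  · have e : projU dx σ Z x - Z.u x = slopeL dx σ Z j * (x - gridX dx (2 * j)) +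
        -(Z.u x - Z.u (gridX dx (2 * j))) := by
      rw [projU_left hdx σ ⟨hx.1.le, hxm⟩]; ring
    rw [e]
    refine key _ _ ?_ ?_
    · have := hsq (x - gridX dx (2 * j)) (by rw [abs_le]; constructor <;> linarith [hx.1])
      have := mul_le_mul_of_nonneg_left this (sq_nonneg (slopeL dx σ Z j))
      nlinarith
    · rw [neg_sq]
      have a1 := h.sq_sub_le_Fac hx.1.le
      have a2 := h.Fac_mono hx.2
      have a3 := h.Fac_mono hx.1.le
      refine a1.trans ?_
      exact mul_le_mul (by linarith [hx.2]) (by linarith) (by linarith) (by linarith)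
  · rw [not_le] at hxm
    have e : projU dx σ Z x - Z.u x = slopeR dx σ Z j * (x - gridX dx (2 * j + 2)) +
        (Z.u (gridX dx (2 * j + 2)) - Z.u x) := by
      rw [projU_right hdx σ ⟨hxm.le, hx.2⟩]; ring
    rw [e]
    refine key _ _ ?_ ?_
    · have := hsq (x - gridX dx (2 * j + 2)) (by rw [abs_le]; constructor <;> linarith [hx.2])
      have := mul_le_mul_of_nonneg_left this (sq_nonneg (slopeR dx σ Z j))
      nlinarith
    · have a1 := h.sq_sub_le_Fac hx.2
      have a2 := h.Fac_mono hx.2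
      have a3 := h.Fac_mono hx.1.le
      refine a1.trans ?_
      exact mul_le_mul (by linarith [hx.1]) (by linarith) (by linarith) (by linarith)

lemma abs_projU_sub_le (x : ℝ) : |projU dx σ Z x - Z.u x| ≤ √(6 * dx * Z.ν.real univ) := by
  have := h.finite
  refine Real.abs_le_sqrt ((sq_projU_sub_le h hdx σ x).trans ?_)
  have h1 : Z.ν.real (Iio (x + 2 * dx)) ≤ Z.ν.real univ := measureReal_mono (subset_univ _)
  have h2 : 0 ≤ Z.ν.real (Iio (x - 2 * dx)) := measureReal_nonneg
  gcongr
  linarith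

lemma eulData_proj : EulData (proj dx σ Z) := by
  have := h.finite
  obtain ⟨hfin, hIio, huniv⟩ := proj_measure h hdx σ
  obtain ⟨K, hK⟩ := projU_lipschitz h hdx σ
  have hm := monotone_measureReal_Iio Z.ν
  refine ⟨hfin, rfl, hK.isPrimitive, ?_, ?_, ?_⟩
  · obtain ⟨a, b, hab⟩ := h.u_tails
    have hum : Measurable Z.u := (h.u_prim.uniformContinuous h.memLp_deriv_u).continuous.measurable
    have h1 : MemLp (fun x => projU dx σ Z x - Z.u x) 2 volume := by
      refine (memLp_two_iff_integrable_sq (f := fun x => projU dx σ Z x - Z.u x)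
        (hK.continuous.measurable.sub hum).aestronglyMeasurable).2 ?_
      refine ((integrable_measureReal_Ico Z.ν (2 * dx)).const_mul (6 * dx)).mono'
        ((hK.continuous.measurable.sub hum).pow_const 2).aestronglyMeasurable
        (ae_of_all _ fun x => ?_)
      rw [Real.norm_of_nonneg (sq_nonneg _)]
      exact sq_projU_sub_le h hdx σ x
    refine ⟨a, b, ?_⟩
    have h2 := hab.add h1.hasTails
    simpa [proj] using h2
  · obtain ⟨b, hb⟩ := h.G_tails
    have hbd : ∃ C, ∀ x, |Z.ν.real (Iio x)| ≤ C := ⟨Z.ν.real univ, fun x => by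
      rw [abs_of_nonneg measureReal_nonneg]; exact measureReal_mono (subset_univ _)⟩
    refine ⟨b, (hb.comp_add hm.measurable hbd (-(2 * dx))).of_squeeze
      (hb.comp_add hm.measurable hbd (2 * dx)) ?_ (fun x => ?_) fun x => ?_⟩
    · exact (monotone_measureReal_Iio _).measurable
    · rw [hIio]; exact projF_ge h hdx σ x
    · rw [hIio]; exact projF_le h hdx σ x
  · have hg : ∀ᵐ x : ℝ, ∀ i : ℤ, x ≠ gridX dx i := by
      rw [ae_all_iff]
      intro i
      exact Measure.ae_ne volume _
    filter_upwards [hg] with x hx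
    obtain ⟨j, s, -, -, h1, h2⟩ := proj_hasDerivAt h hdx σ hx
    simp_rw [hIio]
    rw [show deriv (proj dx σ Z).u x = s from h1.deriv]
    exact h2

lemma initData_proj : InitData (mapL (proj dx σ Z)) (Z.ν.real univ) := by
  have := (eulData_proj h hdx σ).initData
  rwa [(proj_measure h hdx σ).2.2] at this

/-- The two distribution functions agree at even grid points, so the two characteristics reach these
points at the same labels and always lie in a common cell. -/
lemma mapL_proj_y_lt_iff (ξ : ℝ) (j : ℤ) :
    (mapL (proj dx σ Z)).y ξ < gridX dx (2 * j) ↔ (mapL Z).y ξ < gridX dx (2 * j) := by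
  have := h.finite
  have := (proj_measure h hdx σ).1
  rw [mapL_y_lt_iff, mapL_y_lt_iff, (proj_measure h hdx σ).2.1, projF_gridX h hdx]

lemma mapL_proj_mem_Ico (ξ : ℝ) (j : ℤ) :
    (mapL (proj dx σ Z)).y ξ ∈ Ico (gridX dx (2 * j)) (gridX dx (2 * j + 2)) ↔
      (mapL Z).y ξ ∈ Ico (gridX dx (2 * j)) (gridX dx (2 * j + 2)) := by
  rw [show 2 * j + 2 = 2 * (j + 1) by ring, mem_Ico, mem_Ico, ← not_lt, ← not_lt,
    mapL_proj_y_lt_iff h hdx, mapL_proj_y_lt_iff h hdx]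

lemma abs_mapL_proj_y_sub_le (ξ : ℝ) :
    |(mapL (proj dx σ Z)).y ξ - (mapL Z).y ξ| ≤ 2 * dx := by
  obtain ⟨j, hj⟩ := exists_cell_Ico hdx ((mapL Z).y ξ)
  have h1 := (mapL_proj_mem_Ico h hdx σ ξ j).2 hj
  have h2 := gridX_add_two dx (2 * j)
  rw [abs_le]; constructor <;> linarith [hj.1, hj.2, h1.1, h1.2]

lemma abs_mapL_proj_U_sub_le (ξ : ℝ) : |(mapL (proj dx σ Z)).U ξ - (mapL Z).U ξ| ≤
    √(6 * dx * Z.ν.real univ) + √(2 * dx * Z.ν.real univ) := by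
  have := h.finite
  have h1 : |(mapL (proj dx σ Z)).U ξ - (mapL Z).U ξ| ≤
      |projU dx σ Z ((mapL (proj dx σ Z)).y ξ) - Z.u ((mapL (proj dx σ Z)).y ξ)| +
      |Z.u ((mapL (proj dx σ Z)).y ξ) - Z.u ((mapL Z).y ξ)| := abs_sub_le _ _ _
  refine h1.trans (add_le_add (abs_projU_sub_le h hdx σ _) (Real.abs_le_sqrt ?_))
  have h2 := abs_mapL_proj_y_sub_le h hdx σ ξ
  have key : ∀ a b : ℝ, |b - a| ≤ 2 * dx → (Z.u b - Z.u a) ^ 2 ≤ 2 * dx * Z.ν.real univ := by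
    intro a b hab
    wlog hle : a ≤ b generalizing a b
    · rw [← neg_sq, neg_sub]
      exact this b a (by rwa [abs_sub_comm]) (by linarith)
    refine (h.sq_u_sub_le hle).trans ?_
    rw [abs_of_nonneg (by linarith)] at hab
    exact mul_le_mul hab (measureReal_mono (subset_univ _)) measureReal_nonneg (by linarith)
  exact key _ _ h2

end Projected

/-! ### Labels with vanishing `y_ξ` and the singular energy -/

section FlatSet

variable {Z : Eul} (h : EulData Z)
include h

/-- `ν B` is the integral of `H_ξ` over the labels above `B`. On flat labels the integrand is 1; on
the others it is `y_ξ u_x²`, which contributes exactly the absolutely continuous mass. -/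
lemma EulData.volume_flat_inter {B : Set ℝ} (hB : MeasurableSet B) :
    volume ({ξ | deriv (mapL Z).y ξ = 0} ∩ (mapL Z).y ⁻¹' B) = Z.μ.singularPart volume B := by
  have := h.finite
  have := h.isFiniteMeasure_acPart
  have hE := mapL_energyData Z
  have hm := hE.y_mono.measurable
  have hA : MeasurableSet {ξ | deriv (mapL Z).y ξ = 0} :=
    (measurableSet_singleton (0 : ℝ)).preimage (measurable_deriv _)
  have h1 : Z.ν B = volume ({ξ | deriv (mapL Z).y ξ = 0} ∩ (mapL Z).y ⁻¹' B) +
      acPart Z.μ B := by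
    conv_lhs => rw [← map_mapL_deriv_H Z]
    rw [Measure.map_apply hm hB, withDensity_apply _ (hm hB), ← lintegral_indicator (hm hB),
      h.acPart_eq, withDensity_apply _ hB, ← lintegral_indicator hB,
      ← lintegral_deriv_mul_comp hE.y_mono hE.y_lip hE.y_surjective
        (B.indicator fun x => ENNReal.ofReal (deriv Z.u x ^ 2)),
      ← lintegral_indicator_one (hA.inter (hm hB)), ← lintegral_add_left
        (measurable_one.indicator (hA.inter (hm hB)))]
    refine lintegral_congr_ae ?_
    filter_upwards [h.ae_deriv_mapL, hE.deriv_add] with ξ h2 h3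
    by_cases h4 : (mapL Z).y ξ ∈ B
    · rcases h2 with ⟨h5, -⟩ | ⟨-, -, h5, -⟩
      · have h6 : deriv (mapL Z).H ξ = 1 := by linarith
        simp [indicator, h4, h5, h6]
      · have h6 : deriv (mapL Z).y ξ ≠ 0 := fun e => by simp [e] at h5
        have h7 : deriv (mapL Z).H ξ = deriv (mapL Z).y ξ * deriv Z.u ((mapL Z).y ξ) ^ 2 := by
          linarith
        simp [indicator, h4, h6, h7, ENNReal.ofReal_mul (hE.deriv_y_nonneg ξ)]
    · simp [indicator, h4]
  have h2 : Z.ν B = Z.μ.singularPart volume B + acPart Z.μ B := by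
    rw [add_comm, ← Measure.add_apply, h.acPart_add_singularPart]
  exact (ENNReal.add_left_inj (measure_ne_top (acPart Z.μ) B)).1 (h1.symm.trans h2)

/-- At non-flat labels `1 = y_ξ (1 + u_x²)`, so the change of variables applies. -/
lemma EulData.volume_preimage_sdiff_flat {B : Set ℝ} (hB : MeasurableSet B) :
    volume ((mapL Z).y ⁻¹' B \ {ξ | deriv (mapL Z).y ξ = 0}) = volume B + acPart Z.μ B := by
  have := h.finite
  have hE := mapL_energyData Z
  have hm := hE.y_mono.measurable
  have hA : MeasurableSet {ξ | deriv (mapL Z).y ξ = 0} :=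
    (measurableSet_singleton (0 : ℝ)).preimage (measurable_deriv _)
  rw [h.acPart_eq, withDensity_apply _ hB, ← lintegral_indicator hB,
    ← lintegral_indicator_one ((hm hB).diff hA), ← lintegral_indicator_one hB,
    ← lintegral_add_left (measurable_one.indicator hB),
    ← lintegral_deriv_mul_comp hE.y_mono hE.y_lip hE.y_surjective
      fun x => B.indicator 1 x + B.indicator (fun x => ENNReal.ofReal (deriv Z.u x ^ 2)) x]
  refine lintegral_congr_ae ?_
  filter_upwards [h.ae_deriv_mapL] with ξ h2
  by_cases h4 : (mapL Z).y ξ ∈ B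
  · rcases h2 with ⟨h5, -⟩ | ⟨-, -, h5, -⟩
    · simp [indicator, h4, h5]
    · have h6 : deriv (mapL Z).y ξ ≠ 0 := fun e => by simp [e] at h5
      simp only [indicator, h4, h6, Set.mem_sdiff, mem_preimage, mem_ofPred_eq, not_false_eq_true,
        and_self, if_true, Pi.one_apply]
      rw [← ENNReal.ofReal_one, ← ENNReal.ofReal_add zero_le_one (sq_nonneg _),
        ← ENNReal.ofReal_mul (hE.deriv_y_nonneg ξ), h5]
  · simp [indicator, h4]

end FlatSet

/-! ### Masses of unions of cells under the projection -/

section Cells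

lemma measure_biUnion_cell_congr {m m' : Measure ℝ} {dx : ℝ} (hdx : 0 < dx)
    (hm : ∀ j : ℤ, m (Ico (gridX dx (2 * j)) (gridX dx (2 * j + 2))) =
      m' (Ico (gridX dx (2 * j)) (gridX dx (2 * j + 2)))) (J : Set ℤ) :
    m (⋃ j ∈ J, Ico (gridX dx (2 * j)) (gridX dx (2 * j + 2))) =
      m' (⋃ j ∈ J, Ico (gridX dx (2 * j)) (gridX dx (2 * j + 2))) := by
  have hd : J.PairwiseDisjoint fun j : ℤ => Ico (gridX dx (2 * j)) (gridX dx (2 * j + 2)) := by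
    have key : ∀ i j : ℤ, i < j → Disjoint (Ico (gridX dx (2 * i)) (gridX dx (2 * i + 2)))
        (Ico (gridX dx (2 * j)) (gridX dx (2 * j + 2))) := by
      intro i j hij
      refine Set.disjoint_left.2 fun x hx hx' => ?_
      have h1 : (i : ℝ) + 1 ≤ j := by exact_mod_cast hij
      have h2 := hx.2.trans_le (le_refl _)
      have h3 := hx'.1
      rw [gridX_add_two, gridX_two_mul] at h2
      rw [gridX_two_mul] at h3
      nlinarith
    intro i _ j _ hij
    rcases lt_or_gt_of_ne hij with h1 | h1
    · exact key i j h1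
    · exact (key j i h1).symm
  rw [measure_biUnion J.to_countable hd fun _ _ => measurableSet_Ico,
    measure_biUnion J.to_countable hd fun _ _ => measurableSet_Ico]
  exact tsum_congr fun j => hm j

variable {Z : Eul} (h : EulData Z) {dx : ℝ} (hdx : 0 < dx) (σ : ℤ → ℤˣ)
include h hdx

omit h in
lemma deriv_projU_left {j : ℤ} {x : ℝ} (hx : x ∈ Ioo (gridX dx (2 * j)) (gridX dx (2 * j + 1))) :
    deriv (projU dx σ Z) x = slopeL dx σ Z j := by
  have h1 : projU dx σ Z =ᶠ[𝓝 x] fun x =>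
      Z.u (gridX dx (2 * j)) + slopeL dx σ Z j * (x - gridX dx (2 * j)) := by
    filter_upwards [Ioo_mem_nhds hx.1 hx.2] with z hz
    exact projU_left hdx σ ⟨hz.1.le, hz.2.le⟩
  rw [h1.deriv_eq]
  simp

omit h in
lemma deriv_projU_right {j : ℤ} {x : ℝ}
    (hx : x ∈ Ioo (gridX dx (2 * j + 1)) (gridX dx (2 * j + 2))) :
    deriv (projU dx σ Z) x = slopeR dx σ Z j := by
  have h1 : projU dx σ Z =ᶠ[𝓝 x] fun x =>
      Z.u (gridX dx (2 * j + 2)) + slopeR dx σ Z j * (x - gridX dx (2 * j + 2)) := by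
    filter_upwards [Ioo_mem_nhds hx.1 hx.2] with z hz
    exact projU_right hdx σ ⟨hz.1.le, hz.2.le⟩
  rw [h1.deriv_eq]
  simp

lemma acPart_proj_cell (j : ℤ) :
    acPart (proj dx σ Z).μ (Ico (gridX dx (2 * j)) (gridX dx (2 * j + 2))) =
      acPart Z.μ (Ico (gridX dx (2 * j)) (gridX dx (2 * j + 2))) := by
  have := h.isFiniteMeasure_acPart
  have h1 := gridX_add_one dx (2 * j)
  have h2 := gridX_add_two dx (2 * j)
  have e1 : acPart (proj dx σ Z).μ (Ico (gridX dx (2 * j)) (gridX dx (2 * j + 2))) =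
      ENNReal.ofReal ((slopeL dx σ Z j ^ 2 + slopeR dx σ Z j ^ 2) * dx) := by
    rw [(eulData_proj h hdx σ).acPart_eq, withDensity_apply _ measurableSet_Ico,
      ← Ico_union_Ico_eq_Ico (b := gridX dx (2 * j + 1)) (by linarith) (by linarith),
      lintegral_union measurableSet_Ico (by
        refine Set.disjoint_left.2 fun x hx hx' => absurd hx.2 (not_lt.2 hx'.1)),
      ← restrict_Ioo_eq_restrict_Ico, ← restrict_Ioo_eq_restrict_Ico,
      setLIntegral_congr_fun (s := Ioo (gridX dx (2 * j)) (gridX dx (2 * j + 1)))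
        (g := fun _ => ENNReal.ofReal (slopeL dx σ Z j ^ 2)) measurableSet_Ioo
        (fun x hx => by simp only [proj]; rw [deriv_projU_left hdx σ hx]),
      setLIntegral_congr_fun (s := Ioo (gridX dx (2 * j + 1)) (gridX dx (2 * j + 2)))
        (g := fun _ => ENNReal.ofReal (slopeR dx σ Z j ^ 2)) measurableSet_Ioo
        (fun x hx => by simp only [proj]; rw [deriv_projU_right hdx σ hx]),
      setLIntegral_const, setLIntegral_const, Real.volume_Ioo, Real.volume_Ioo,
      ← ENNReal.ofReal_mul (sq_nonneg _), ← ENNReal.ofReal_mul (sq_nonneg _),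
      ← ENNReal.ofReal_add (mul_nonneg (sq_nonneg _) (by linarith))
        (mul_nonneg (sq_nonneg _) (by linarith))]
    congr 1
    rw [h1, h2]; ring
  have e2 : Ico (gridX dx (2 * j)) (gridX dx (2 * j + 2)) =
      Iio (gridX dx (2 * j + 2)) \ Iio (gridX dx (2 * j)) := by ext x; simp
  rw [e1, slope_sq_add h hdx, ← ofReal_measureReal (μ := acPart Z.μ), e2,
    measureReal_sdiff (Iio_subset_Iio (by linarith)) measurableSet_Iio]
  rfl

/-- The total mass of a cell is determined by the values at even grid points, hence preserved;
subtracting the absolutely continuous mass leaves the singular one. -/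
lemma singularPart_proj_cell (j : ℤ) :
    (proj dx σ Z).μ.singularPart volume (Ico (gridX dx (2 * j)) (gridX dx (2 * j + 2))) =
      Z.μ.singularPart volume (Ico (gridX dx (2 * j)) (gridX dx (2 * j + 2))) := by
  have := h.finite
  have := h.isFiniteMeasure_acPart
  have hp := eulData_proj h hdx σ
  have := hp.finite
  have h2 := gridX_add_two dx (2 * j)
  have e2 : Ico (gridX dx (2 * j)) (gridX dx (2 * j + 2)) =
      Iio (gridX dx (2 * j + 2)) \ Iio (gridX dx (2 * j)) := by ext x; simp
  have e3 : (proj dx σ Z).ν (Ico (gridX dx (2 * j)) (gridX dx (2 * j + 2))) =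
      Z.ν (Ico (gridX dx (2 * j)) (gridX dx (2 * j + 2))) := by
    rw [← ofReal_measureReal, ← ofReal_measureReal (μ := Z.ν), e2,
      measureReal_sdiff (Iio_subset_Iio (by linarith)) measurableSet_Iio,
      measureReal_sdiff (Iio_subset_Iio (by linarith)) measurableSet_Iio,
      (proj_measure h hdx σ).2.1, (proj_measure h hdx σ).2.1, projF_gridX h hdx,
      show 2 * j + 2 = 2 * (j + 1) by ring, projF_gridX h hdx]
  rw [← h.acPart_add_singularPart, ← hp.acPart_add_singularPart, Measure.add_apply,
    Measure.add_apply, acPart_proj_cell h hdx] at e3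
  exact (ENNReal.add_right_inj (measure_ne_top _ _)).1 e3

end Cells

/-- Up to `ε/4` the singular part lives on a compact Lebesgue null set `K`, which for small `dx` is
covered by a union `W` of cells with length plus absolutely continuous energy at most `ε/4`. A label
that is flat for only one of the two data either lies outside `W`, where little singular mass is
left, or inside `W`, where there are few non-flat labels. Both estimates hold for the original and
the projected data, because cell masses are preserved. -/
lemma eventually_volume_symmDiff_flat {Z : Eul} (h : EulData Z) {ε : ℝ≥0∞} (hε : 0 < ε) :
    ∀ᶠ dx in 𝓝[>] (0 : ℝ), ∀ σ, volume (symmDiff {ξ | deriv (mapL Z).y ξ = 0}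
      {ξ | deriv (mapL (proj dx σ Z)).y ξ = 0}) ≤ ε := by
  have := h.finite
  have := h.isFiniteMeasure_acPart
  have := h.isFiniteMeasure_sing
  set sg := Z.μ.singularPart volume
  have hms : sg ⟂ₘ volume := Z.μ.mutuallySingular_singularPart volume
  obtain ⟨N, hN, hN1, hN2⟩ := hms
  have hε4 : ε / 4 ≠ 0 := (ENNReal.div_pos hε.ne' (by norm_num)).ne'
  obtain ⟨K, hKN, hK, hK2⟩ := hN.compl.exists_isCompact_sdiff_lt (measure_ne_top sg Nᶜ) hε4
  have hKc : sg Kᶜ ≤ ε / 4 := by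
    have e : Kᶜ ⊆ N ∪ (Nᶜ \ K) := fun x hx => by
      by_cases hx' : x ∈ N
      · exact Or.inl hx'
      · exact Or.inr ⟨hx', hx⟩
    refine (measure_mono e).trans ((measure_union_le _ _).trans ?_)
    rw [hN1, zero_add]; exact hK2.le
  have hK0 : volume K = 0 := measure_mono_null hKN hN2
  have hK1 : acPart Z.μ K = 0 := (withDensity_absolutelyContinuous _ _) hK0
  have hε8 : 0 < ε / 4 / 2 := ENNReal.div_pos hε4 (by norm_num)
  obtain ⟨O₁, hKO₁, hO₁, hO₁'⟩ := K.exists_isOpen_lt_of_lt (μ := volume) (ε / 4 / 2)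
    (by rwa [hK0])
  obtain ⟨O₂, hKO₂, hO₂, hO₂'⟩ := K.exists_isOpen_lt_of_lt (μ := acPart Z.μ) (ε / 4 / 2)
    (by rwa [hK1])
  set O := O₁ ∩ O₂
  have hKO : K ⊆ O := subset_inter hKO₁ hKO₂
  have hO : IsOpen O := hO₁.inter hO₂
  obtain ⟨δ, hδ, hδO⟩ := hK.exists_thickening_subset_open hO hKO
  filter_upwards [self_mem_nhdsWithin, Ioo_mem_nhdsGT (show (0 : ℝ) < δ / 2 by linarith)]
    with dx hdx hdx' σ
  have hdx : 0 < dx := hdx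
  have hp := eulData_proj h hdx σ
  have := hp.finite
  set C : ℤ → Set ℝ := fun j => Ico (gridX dx (2 * j)) (gridX dx (2 * j + 2)) with hC
  -- The cells that meet `K`; having length `2 dx < δ`, they remain inside the neighbourhood `O` of
  -- `K`.
  set J : Set ℤ := {j | (C j ∩ K).Nonempty}
  set W : Set ℝ := ⋃ j ∈ J, C j with hW
  have hWm : MeasurableSet W := MeasurableSet.biUnion J.to_countable fun _ _ => measurableSet_Ico
  have hKW : K ⊆ W := fun x hx => by
    obtain ⟨j, hj⟩ := exists_cell_Ico hdx x
    exact mem_biUnion (show j ∈ J from ⟨x, hj, hx⟩) hj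
  have hWO : W ⊆ O := by
    refine iUnion₂_subset fun j hj x hx => hδO ?_
    obtain ⟨z, hz, hzK⟩ := hj
    refine Metric.mem_thickening_iff.2 ⟨z, hzK, ?_⟩
    have h2 := gridX_add_two dx (2 * j)
    rw [Real.dist_eq, abs_lt]
    constructor <;> linarith [hx.1, hx.2, hz.1, hz.2, hdx'.2]
  have hWc : Wᶜ = ⋃ j ∈ Jᶜ, C j := by
    ext x
    obtain ⟨j, hj⟩ := exists_cell_Ico hdx x
    have huniq : ∀ i, x ∈ C i → i = j := fun i hi => by
      have a1 := hi.1; have a2 := hi.2; have a3 := hj.1; have a4 := hj.2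
      rw [gridX_two_mul] at a1 a3
      rw [gridX_add_two, gridX_two_mul] at a2 a4
      have b1 : (i : ℝ) < j + 1 := by nlinarith
      have b2 : (j : ℝ) < i + 1 := by nlinarith
      have b1 : i < j + 1 := by exact_mod_cast b1
      have b2 : j < i + 1 := by exact_mod_cast b2
      omega
    simp only [hW, mem_compl_iff, mem_iUnion, not_exists]
    constructor
    · intro h1
      exact ⟨j, fun h2 => h1 j h2 hj, hj⟩
    · rintro ⟨i, hi, hi'⟩ k hk hk'
      rw [huniq k hk', ← huniq i hi'] at hk
      exact hi hk
  have hpre : (mapL (proj dx σ Z)).y ⁻¹' W = (mapL Z).y ⁻¹' W := by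
    ext ξ
    simp only [hW, hC, mem_preimage, mem_iUnion]
    exact exists_congr fun j => exists_congr fun _ => mapL_proj_mem_Ico h hdx σ ξ j
  have hac : acPart (proj dx σ Z).μ W = acPart Z.μ W :=
    measure_biUnion_cell_congr hdx (acPart_proj_cell h hdx σ) J
  have hsg : (proj dx σ Z).μ.singularPart volume Wᶜ = sg Wᶜ := by
    rw [hWc]; exact measure_biUnion_cell_congr hdx (singularPart_proj_cell h hdx σ) Jᶜ
  have key : ∀ Y Y' : Eul, EulData Y → EulData Y' → (mapL Y).y ⁻¹' W = (mapL Y').y ⁻¹' W →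
      Y.μ.singularPart volume Wᶜ ≤ ε / 4 → volume W + acPart Y'.μ W ≤ ε / 4 →
      volume ({ξ | deriv (mapL Y).y ξ = 0} \ {ξ | deriv (mapL Y').y ξ = 0}) ≤ ε / 2 := by
    intro Y Y' hY hY' hpre' h1 h2
    have e : {ξ | deriv (mapL Y).y ξ = 0} \ {ξ | deriv (mapL Y').y ξ = 0} ⊆
        ({ξ | deriv (mapL Y).y ξ = 0} ∩ (mapL Y).y ⁻¹' Wᶜ) ∪
        ((mapL Y').y ⁻¹' W \ {ξ | deriv (mapL Y').y ξ = 0}) := by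
      rintro ξ ⟨hξ, hξ'⟩
      by_cases hw : ξ ∈ (mapL Y').y ⁻¹' W
      · exact Or.inr ⟨hw, hξ'⟩
      · exact Or.inl ⟨hξ, fun h' => hw (hpre' ▸ h')⟩
    refine (measure_mono e).trans ((measure_union_le _ _).trans ?_)
    rw [hY.volume_flat_inter hWm.compl, hY'.volume_preimage_sdiff_flat hWm]
    refine (add_le_add h1 h2).trans (le_of_eq ?_)
    rw [ENNReal.div_add_div_same, ← two_mul, show (4 : ℝ≥0∞) = 2 * 2 by norm_num,
      ENNReal.mul_div_mul_left _ _ (by norm_num) (by norm_num)]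
  have h1 : sg Wᶜ ≤ ε / 4 := (measure_mono (compl_subset_compl.2 hKW)).trans hKc
  have h2 : volume W + acPart Z.μ W ≤ ε / 4 := by
    rw [← ENNReal.add_halves (ε / 4)]
    exact add_le_add ((measure_mono (hWO.trans inter_subset_left)).trans hO₁'.le)
      ((measure_mono (hWO.trans inter_subset_right)).trans hO₂'.le)
  rw [Set.symmDiff_def]
  refine (measure_union_le _ _).trans ((add_le_add
    (key Z _ h hp hpre.symm h1 (hac ▸ h2)) (key _ Z hp h hpre (hsg ▸ h1) h2)).trans ?_)
  rw [ENNReal.add_halves]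

/-- Difference quotients over intervals that contain the base point. -/
lemma eventually_abs_sub_le_of_hasDerivAt {f : ℝ → ℝ} {v x ε : ℝ} (hf : HasDerivAt f v x)
    (hε : 0 < ε) : ∀ᶠ d in 𝓝[>] (0 : ℝ), ∀ a b : ℝ, a ≤ x → x ≤ b → b - a = d →
      |(f b - f a) / d - v| ≤ ε := by
  have h1 := (hasDerivAt_iff_isLittleO.1 hf).bound hε
  obtain ⟨δ, hδ, hball⟩ := Metric.eventually_nhds_iff.1 h1
  filter_upwards [Ioo_mem_nhdsGT hδ] with d hd a b ha hb hab
  have ha' := hball (y := a) (by rw [Real.dist_eq, abs_lt]; constructor <;> linarith [hd.1, hd.2])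
  have hb' := hball (y := b) (by rw [Real.dist_eq, abs_lt]; constructor <;> linarith [hd.1, hd.2])
  simp only [Real.norm_eq_abs, smul_eq_mul] at ha' hb'
  rw [abs_of_nonpos (by linarith : a - x ≤ 0)] at ha'
  rw [abs_of_nonneg (by linarith : 0 ≤ b - x)] at hb'
  have e : (f b - f a) / d - v =
      ((f b - f x - (b - x) * v) - (f a - f x - (a - x) * v)) / d := by
    have : d ≠ 0 := hd.1.ne'
    field_simp
    rw [← hab]; ring
  rw [e, abs_div, abs_of_pos hd.1, div_le_iff₀ hd.1]
  refine (abs_sub _ _).trans ?_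
  rw [← hab]; linarith

/-- `Du` tends to `v`, and `DF_ac` is at most the difference quotient of the full distribution
function, which tends to `v²`. So `q² = DF_ac - (Du)²` becomes small and both slopes are close to
`v`, whatever the sign. -/
lemma eventually_abs_slope_sub_le {Z : Eul} (h : EulData Z) {v x : ℝ} (hu : HasDerivAt Z.u v x)
    (hG : HasDerivAt (fun x => Z.ν.real (Iio x)) (v ^ 2) x) {ε : ℝ} (hε : 0 < ε) :
    ∀ᶠ dx in 𝓝[>] (0 : ℝ), ∀ (σ : ℤ → ℤˣ) (j : ℤ) (s : ℝ),
      x ∈ Ico (gridX dx (2 * j)) (gridX dx (2 * j + 2)) →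
      (s = slopeL dx σ Z j ∨ s = slopeR dx σ Z j) → |s - v| ≤ ε + √(ε * (1 + 2 * |v|)) := by
  have hlim : Tendsto (fun d : ℝ => 2 * d) (𝓝[>] 0) (𝓝[>] 0) := by
    refine tendsto_nhdsWithin_iff.2 ⟨?_, ?_⟩
    · have : Tendsto (fun d : ℝ => 2 * d) (𝓝 0) (𝓝 (2 * 0)) := (continuous_const_mul 2).tendsto 0
      rw [mul_zero] at this
      exact this.mono_left nhdsWithin_le_nhds
    · filter_upwards [self_mem_nhdsWithin] with d hd
      exact mul_pos two_pos (mem_Ioi.1 hd)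
  filter_upwards [self_mem_nhdsWithin, hlim.eventually (eventually_abs_sub_le_of_hasDerivAt hu hε),
    hlim.eventually (eventually_abs_sub_le_of_hasDerivAt hG hε)] with dx hdx h1 h2 σ j s hx hs
  have hdx : 0 < dx := hdx
  have e := gridX_add_two dx (2 * j)
  have h3 := h1 _ _ hx.1 hx.2.le (by rw [e]; ring)
  have h4 := h2 _ _ hx.1 hx.2.le (by rw [e]; ring)
  have h5 := projSQ_sq h hdx σ j
  have h6 : diffD dx (Fac Z.μ) j ≤ (Z.ν.real (Iio (gridX dx (2 * j + 2))) -
      Z.ν.real (Iio (gridX dx (2 * j)))) / (2 * dx) := by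
    rw [diffD]
    refine div_le_div_of_nonneg_right ?_ (by linarith)
    rw [← h.Fac_add_Fsing, ← h.Fac_add_Fsing]
    have := h.Fsing_mono (show gridX dx (2 * j) ≤ gridX dx (2 * j + 2) by linarith)
    linarith
  change |diffD dx Z.u j - v| ≤ ε at h3
  have h7 : projSQ dx σ Z j ^ 2 ≤ ε * (1 + 2 * |v|) := by
    set e := diffD dx Z.u j - v with he
    have e1 : diffD dx Z.u j = v + e := by rw [he]; ring
    have e2 : -(2 * v * e) ≤ 2 * |v| * ε := by
      refine (neg_le_abs _).trans ?_
      rw [abs_mul, abs_mul, abs_two]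
      exact mul_le_mul_of_nonneg_left h3 (by positivity)
    rw [h5, e1]
    nlinarith [(abs_le.1 h4).2, sq_nonneg e]
  have h8 := Real.abs_le_sqrt h7
  rcases hs with rfl | rfl
  · rw [slopeL, show diffD dx Z.u j - projSQ dx σ Z j - v =
      (diffD dx Z.u j - v) - projSQ dx σ Z j by ring]
    exact (abs_sub _ _).trans (add_le_add h3 h8)
  · rw [slopeR, show diffD dx Z.u j + projSQ dx σ Z j - v =
      (diffD dx Z.u j - v) + projSQ dx σ Z j by ring]
    exact (abs_add_le _ _).trans (add_le_add h3 h8)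

/-- For a.e. label, either the projected data are flat, or the Eulerian slope at its position is one
of the slopes of its cell. -/
lemma ae_deriv_mapL_proj {Z : Eul} (h : EulData Z) {dx : ℝ} (hdx : 0 < dx) (σ : ℤ → ℤˣ) :
    ∀ᵐ ξ, deriv (mapL (proj dx σ Z)).y ξ ≠ 0 → ∃ j s,
      (mapL Z).y ξ ∈ Ico (gridX dx (2 * j)) (gridX dx (2 * j + 2)) ∧
      (s = slopeL dx σ Z j ∨ s = slopeR dx σ Z j) ∧
      deriv (mapL (proj dx σ Z)).y ξ * (1 + s ^ 2) = 1 ∧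
      deriv (mapL (proj dx σ Z)).U ξ = s * deriv (mapL (proj dx σ Z)).y ξ := by
  have hp := eulData_proj h hdx σ
  have := hp.finite
  have hE := mapL_energyData (proj dx σ Z)
  have hN : volume (range (gridX dx)) = 0 := (countable_range _).measure_zero _
  filter_upwards [hp.ae_deriv_mapL,
    ae_deriv_eq_zero_of_mem_null hE.y_mono hE.y_lip hE.y_surjective hN] with ξ h1 h2 h3
  rcases h1 with ⟨h4, -⟩ | ⟨-, -, h5, h6⟩
  · exact absurd h4 h3
  · obtain ⟨j, s, hj, hs, h7, -⟩ := proj_hasDerivAt h hdx σ (x := (mapL (proj dx σ Z)).y ξ)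
      fun i e => h3 (h2 ⟨i, e.symm⟩)
    have e : deriv (proj dx σ Z).u ((mapL (proj dx σ Z)).y ξ) = s := h7.deriv
    rw [e] at h5 h6
    exact ⟨j, s, (mapL_proj_mem_Ico h hdx σ ξ j).1 ⟨hj.1.le, hj.2⟩, hs, h5, h6⟩

/-- Along a subsequence, the derivatives of the projected Lagrangian data converge a.e. -/
lemma exists_subseq_proj {Z : Eul} (h : EulData Z) {d : ℕ → ℝ} (hd : Tendsto d atTop (𝓝[>] 0))
    (σ : ℕ → ℤ → ℤˣ) : ∃ φ : ℕ → ℕ, StrictMono φ ∧ (∀ n, 0 < d (φ n)) ∧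
      (∀ᵐ ξ, Tendsto (fun n => deriv (mapL (proj (d (φ n)) (σ (φ n)) Z)).H ξ) atTop
        (𝓝 (deriv (mapL Z).H ξ))) ∧
      (∀ᵐ ξ, Tendsto (fun n => deriv (mapL (proj (d (φ n)) (σ (φ n)) Z)).U ξ) atTop
        (𝓝 (deriv (mapL Z).U ξ))) ∧
      ∀ᵐ ξ, deriv (mapL Z).y ξ = 0 →
        ∀ᶠ n in atTop, deriv (mapL (proj (d (φ n)) (σ (φ n)) Z)).y ξ = 0 := by
  have := h.finite
  have hE := mapL_energyData Z
  have hev : ∀ k : ℕ, ∀ᶠ n in atTop, 0 < d n ∧ volume (symmDiff {ξ | deriv (mapL Z).y ξ = 0}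
      {ξ | deriv (mapL (proj (d n) (σ n) Z)).y ξ = 0}) ≤ (2⁻¹ : ℝ≥0∞) ^ k := fun k => by
    filter_upwards [hd.eventually self_mem_nhdsWithin, hd.eventually
      (eventually_volume_symmDiff_flat h (ε := (2⁻¹ : ℝ≥0∞) ^ k)
        (ENNReal.pow_pos (by norm_num) k))] with n h1 h2
    exact ⟨h1, h2 _⟩
  obtain ⟨φ, hφ, hφ'⟩ := extraction_forall_of_eventually
    (P := fun k n => 0 < d n ∧ volume (symmDiff {ξ | deriv (mapL Z).y ξ = 0}
      {ξ | deriv (mapL (proj (d n) (σ n) Z)).y ξ = 0}) ≤ (2⁻¹ : ℝ≥0∞) ^ k) hev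
  have hdφ : Tendsto (fun n => d (φ n)) atTop (𝓝[>] 0) := hd.comp hφ.tendsto_atTop
  -- The symmetric differences have summable measure along the subsequence; by Borel–Cantelli, at
  -- a.e. label flatness of the two data eventually coincides.
  have hBC := ae_eventually_notMem (μ := volume)
    (s := fun n => symmDiff {ξ | deriv (mapL Z).y ξ = 0}
      {ξ | deriv (mapL (proj (d (φ n)) (σ (φ n)) Z)).y ξ = 0})
    (ne_top_of_le_ne_top (b := ∑' n : ℕ, (2⁻¹ : ℝ≥0∞) ^ n)
      (by rw [ENNReal.tsum_geometric]; simp)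
      (ENNReal.tsum_le_tsum fun n => (hφ' n).2))
  have hall : ∀ᵐ ξ, ∀ n, deriv (mapL (proj (d (φ n)) (σ (φ n)) Z)).y ξ ≠ 0 → ∃ j s,
      (mapL Z).y ξ ∈ Ico (gridX (d (φ n)) (2 * j)) (gridX (d (φ n)) (2 * j + 2)) ∧
      (s = slopeL (d (φ n)) (σ (φ n)) Z j ∨ s = slopeR (d (φ n)) (σ (φ n)) Z j) ∧
      deriv (mapL (proj (d (φ n)) (σ (φ n)) Z)).y ξ * (1 + s ^ 2) = 1 ∧
      deriv (mapL (proj (d (φ n)) (σ (φ n)) Z)).U ξ =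
        s * deriv (mapL (proj (d (φ n)) (σ (φ n)) Z)).y ξ :=
    ae_all_iff.2 fun n => ae_deriv_mapL_proj h (hφ' n).1 _
  have hadd : ∀ᵐ ξ, ∀ n, deriv (mapL (proj (d (φ n)) (σ (φ n)) Z)).y ξ +
      deriv (mapL (proj (d (φ n)) (σ (φ n)) Z)).H ξ = 1 :=
    ae_all_iff.2 fun n => (initData_proj h (hφ' n).1 (σ (φ n))).toEnergyData.deriv_add
  have hrel : ∀ᵐ ξ, ∀ n, deriv (mapL (proj (d (φ n)) (σ (φ n)) Z)).U ξ ^ 2 =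
      deriv (mapL (proj (d (φ n)) (σ (φ n)) Z)).y ξ *
      deriv (mapL (proj (d (φ n)) (σ (φ n)) Z)).H ξ :=
    ae_all_iff.2 fun n => (initData_proj h (hφ' n).1 (σ (φ n))).rel
  have hconv : ∀ᵐ ξ, (deriv (mapL Z).y ξ = 0 →
        ∀ᶠ n in atTop, deriv (mapL (proj (d (φ n)) (σ (φ n)) Z)).y ξ = 0) ∧
      Tendsto (fun n => deriv (mapL (proj (d (φ n)) (σ (φ n)) Z)).y ξ) atTop
        (𝓝 (deriv (mapL Z).y ξ)) ∧
      Tendsto (fun n => deriv (mapL (proj (d (φ n)) (σ (φ n)) Z)).U ξ) atTop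
        (𝓝 (deriv (mapL Z).U ξ)) := by
    filter_upwards [hBC, hall, hrel, h.ae_deriv_mapL] with ξ h1 h2 h4 h5
    have hiff : ∀ᶠ n in atTop, (deriv (mapL Z).y ξ = 0 ↔
        deriv (mapL (proj (d (φ n)) (σ (φ n)) Z)).y ξ = 0) := by
      filter_upwards [h1] with n hn
      simp only [Set.mem_symmDiff, mem_ofPred_eq] at hn
      tauto
    refine ⟨fun h0 => hiff.mono fun n hn => hn.1 h0, ?_⟩
    rcases h5 with ⟨h6, h7⟩ | ⟨h6, h7, h8, h9⟩
    · have e : ∀ᶠ n in atTop, deriv (mapL (proj (d (φ n)) (σ (φ n)) Z)).y ξ = 0 :=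
        hiff.mono fun n hn => hn.1 h6
      rw [h6, h7]
      refine ⟨tendsto_const_nhds.congr' (e.mono fun n hn => hn.symm),
        tendsto_const_nhds.congr' (e.mono fun n hn => ?_)⟩
      have := h4 n
      rw [hn, zero_mul] at this
      exact (pow_eq_zero_iff two_ne_zero).1 this |>.symm
    · have hne : deriv (mapL Z).y ξ ≠ 0 := fun e => by simp [e] at h8
      have h2' : ∀ n, ∃ s, deriv (mapL (proj (d (φ n)) (σ (φ n)) Z)).y ξ ≠ 0 → ∃ j,
          (mapL Z).y ξ ∈ Ico (gridX (d (φ n)) (2 * j)) (gridX (d (φ n)) (2 * j + 2)) ∧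
          (s = slopeL (d (φ n)) (σ (φ n)) Z j ∨ s = slopeR (d (φ n)) (σ (φ n)) Z j) ∧
          deriv (mapL (proj (d (φ n)) (σ (φ n)) Z)).y ξ * (1 + s ^ 2) = 1 ∧
          deriv (mapL (proj (d (φ n)) (σ (φ n)) Z)).U ξ =
            s * deriv (mapL (proj (d (φ n)) (σ (φ n)) Z)).y ξ := fun n => by
        by_cases h0 : deriv (mapL (proj (d (φ n)) (σ (φ n)) Z)).y ξ = 0
        · exact ⟨0, fun h => absurd h0 h⟩
        · obtain ⟨j, s, hs⟩ := h2 n h0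
          exact ⟨s, fun _ => ⟨j, hs⟩⟩
      choose s hs using h2'
      have hs' : ∀ᶠ n in atTop, ∃ j,
          (mapL Z).y ξ ∈ Ico (gridX (d (φ n)) (2 * j)) (gridX (d (φ n)) (2 * j + 2)) ∧
          (s n = slopeL (d (φ n)) (σ (φ n)) Z j ∨ s n = slopeR (d (φ n)) (σ (φ n)) Z j) ∧
          deriv (mapL (proj (d (φ n)) (σ (φ n)) Z)).y ξ * (1 + s n ^ 2) = 1 ∧
          deriv (mapL (proj (d (φ n)) (σ (φ n)) Z)).U ξ =
            s n * deriv (mapL (proj (d (φ n)) (σ (φ n)) Z)).y ξ :=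
        hiff.mono fun n hn => hs n fun e => hne (hn.2 e)
      set v := deriv Z.u ((mapL Z).y ξ) with hv
      -- The slope selected in the cell of `y ξ` tends to `u_x`, which determines the limits of `y_ξ
      -- = 1 / (1 + s²)` and `U_ξ = s y_ξ`.
      have hsv : Tendsto s atTop (𝓝 v) := by
        have hg : Tendsto (fun ε : ℝ => ε + √(ε * (1 + 2 * |v|))) (𝓝[>] 0) (𝓝 0) := by
          have : Continuous fun ε : ℝ => ε + √(ε * (1 + 2 * |v|)) := by fun_prop
          have := this.tendsto 0
          rw [zero_mul, Real.sqrt_zero, add_zero] at this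
          exact this.mono_left nhdsWithin_le_nhds
        rw [Metric.tendsto_nhds]
        intro r hr
        obtain ⟨ε, hε, hε'⟩ := ((hg.eventually (gt_mem_nhds hr)).and self_mem_nhdsWithin).exists
        filter_upwards [hs', hdφ.eventually (eventually_abs_slope_sub_le h h6.hasDerivAt h7 hε')]
          with n hj hn
        obtain ⟨j, a1, a2, -⟩ := hj
        rw [Real.dist_eq]
        exact (hn _ j _ a1 a2).trans_lt hε
      have hyv : Tendsto (fun n => deriv (mapL (proj (d (φ n)) (σ (φ n)) Z)).y ξ) atTop
          (𝓝 (deriv (mapL Z).y ξ)) := by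
        have e : deriv (mapL Z).y ξ = (1 + v ^ 2)⁻¹ := eq_inv_of_mul_eq_one_left h8
        rw [e]
        refine (((hsv.pow 2).const_add 1).inv₀ (by positivity)).congr' ?_
        filter_upwards [hs'] with n hn
        obtain ⟨j, -, -, a3, -⟩ := hn
        exact (eq_inv_of_mul_eq_one_left a3).symm
      refine ⟨hyv, ?_⟩
      rw [h9]
      refine (hsv.mul hyv).congr' ?_
      filter_upwards [hs'] with n hn
      obtain ⟨j, -, -, -, a4⟩ := hn
      exact a4.symm
  refine ⟨φ, hφ, fun n => (hφ' n).1, ?_, hconv.mono fun ξ hξ => hξ.2.2, hconv.mono fun ξ hξ => hξ.1⟩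
  filter_upwards [hconv, hadd, hE.deriv_add] with ξ h1 h2 h3
  have e : deriv (mapL Z).H ξ = 1 - deriv (mapL Z).y ξ := by linarith
  rw [e]
  refine (h1.2.1.const_sub 1).congr fun n => ?_
  linarith [h2 n]

/-! ## Piecewise affine Lagrangian data -/

/-- Lagrangian initial data that are affine between consecutive nodes, where all cells with
nonconstant `U` have width at least `w`. -/
structure CellData (X : Lag) (E : ℝ) (xi : ℤ → ℝ) (w : ℝ) : Prop extends InitData X E where
  xi_mono : Monotone xi
  xi_top : Tendsto xi atTop atTop
  xi_bot : Tendsto xi atBot atBot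
  w_pos : 0 < w
  affine : ∀ i, ∃ y₀ U₀ p r : ℝ, (∀ ξ ∈ Icc (xi i) (xi (i + 1)),
    X.y ξ = y₀ + p * (ξ - xi i) ∧ X.U ξ = U₀ + r * (ξ - xi i)) ∧
    (r ≠ 0 → w ≤ xi (i + 1) - xi i)

/-- Where the distribution function has slope `m`, the function that `y` inverts has slope `1 + m`.
-/
lemma mapL_y_affine (Y : Eul) [IsFiniteMeasure Y.ν] {c d A m : ℝ} (hcd : c < d) (hm : 0 ≤ m)
    (hF : ∀ x ∈ Ioc c d, Y.ν.real (Iio x) = A + m * (x - c)) :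
    Y.ν.real (Iic c) = A ∧ ∀ ξ ∈ Icc (c + A) (d + (A + m * (d - c))),
      (mapL Y).y ξ = c + (ξ - (c + A)) / (1 + m) ∧ (mapL Y).y ξ ∈ Icc c d := by
  have h1 : Y.ν.real (Iic c) = A := by
    refine tendsto_nhds_unique (tendsto_measureReal_Iio_nhdsGT (ν := Y.ν) c) ?_
    have h2 : Tendsto (fun x : ℝ => A + m * (x - c)) (𝓝[>] c) (𝓝 A) := by
      have h3 : Continuous fun x : ℝ => A + m * (x - c) := by fun_prop
      have := h3.tendsto c
      rw [sub_self, mul_zero, add_zero] at this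
      exact this.mono_left nhdsWithin_le_nhds
    refine h2.congr' ?_
    filter_upwards [Ioc_mem_nhdsGT hcd] with x hx
    exact (hF x hx).symm
  refine ⟨h1, fun ξ hξ => ?_⟩
  have hm1 : 0 < 1 + m := by linarith
  set x := c + (ξ - (c + A)) / (1 + m) with hx
  have hxe : (x - c) * (1 + m) = ξ - (c + A) := by rw [hx]; field_simp; ring
  have hcx : c ≤ x := by
    have : 0 ≤ (ξ - (c + A)) / (1 + m) := div_nonneg (by linarith [hξ.1]) hm1.le
    linarith
  have hxd : x ≤ d := by
    by_contra! hlt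
    nlinarith [hξ.2]
  have e : (mapL Y).y ξ = x := by
    rcases hcx.eq_or_lt with h2 | h2
    · have h3 : ξ = c + A := by rw [← h2] at hxe; linarith
      rw [← h2, h3, ← h1]
      exact mapL_y_eq_of_mem (add_le_add_right (measureReal_mono Iio_subset_Iic_self) c) le_rfl
    · have h3 : x + Y.ν.real (Iio x) = ξ := by rw [hF x ⟨h2, hxd⟩]; linarith
      exact mapL_y_eq_of_mem h3.le
        (h3.symm.le.trans (add_le_add_right (measureReal_mono Iio_subset_Iic_self) x))
  rw [e]
  exact ⟨rfl, hcx, hxd⟩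

lemma gridXi_zero (dx : ℝ) (ν : Measure ℝ) (j : ℤ) :
    gridXi dx ν (3 * j) = gridX dx (2 * j) + ν.real (Iio (gridX dx (2 * j))) := by
  have h1 : 3 * j / 3 = j := by omega
  have h2 : 3 * j % 3 = 0 := by omega
  simp only [gridXi, h1, h2, if_true]; rfl

lemma gridXi_one (dx : ℝ) (ν : Measure ℝ) (j : ℤ) :
    gridXi dx ν (3 * j + 1) = gridX dx (2 * j) + ν.real (Iic (gridX dx (2 * j))) := by
  have h1 : (3 * j + 1) / 3 = j := by omega
  have h2 : (3 * j + 1) % 3 = 1 := by omega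
  simp only [gridXi, h1, h2, one_ne_zero, if_true, if_false]; rfl

lemma gridXi_two (dx : ℝ) (ν : Measure ℝ) (j : ℤ) :
    gridXi dx ν (3 * j + 2) = gridX dx (2 * j + 1) + ν.real (Iio (gridX dx (2 * j + 1))) := by
  have h1 : (3 * j + 2) / 3 = j := by omega
  have h2 : (3 * j + 2) % 3 = 2 := by omega
  simp only [gridXi, h1, h2]; rfl

lemma exists_eq_three_mul (i : ℤ) : ∃ j, i = 3 * j ∨ i = 3 * j + 1 ∨ i = 3 * j + 2 :=
  ⟨i / 3, by omega⟩

/-- Every third cell comes from a possible atom at an even grid point: it may be degenerate, and `y`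
and `U` are constant on it. The other cells have width at least `dx`. -/
lemma cellData_proj {Z : Eul} (h : EulData Z) {dx : ℝ} (hdx : 0 < dx) (σ : ℤ → ℤˣ) :
    CellData (mapL (proj dx σ Z)) (Z.ν.real univ) (gridXi dx (proj dx σ Z).ν) dx := by
  obtain ⟨hfin, hIio, huniv⟩ := proj_measure h hdx σ
  set Y := proj dx σ Z with hY
  have g1 : ∀ j : ℤ, gridX dx (2 * j + 1) = gridX dx (2 * j) + dx := fun j => gridX_add_one dx _
  have g2 : ∀ j : ℤ, gridX dx (2 * j + 2) = gridX dx (2 * j) + 2 * dx := fun j => gridX_add_two dx _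
  have hm := monotone_measureReal_Iio Y.ν
  have hle : ∀ x, Y.ν.real (Iio x) ≤ Y.ν.real (Iic x) := fun x =>
    measureReal_mono Iio_subset_Iic_self
  have hlt : ∀ {x z : ℝ}, x < z → Y.ν.real (Iic x) ≤ Y.ν.real (Iio z) := fun hxz =>
    measureReal_mono (Iic_subset_Iio.2 hxz)
  have e3 : ∀ j : ℤ, (3 * j + 2 + 1 : ℤ) = 3 * (j + 1) := fun j => by ring
  have w1 : ∀ j, dx ≤ gridXi dx Y.ν (3 * j + 1 + 1) - gridXi dx Y.ν (3 * j + 1) := fun j => by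
    rw [show (3 * j + 1 + 1 : ℤ) = 3 * j + 2 by ring, gridXi_one, gridXi_two]
    have := hlt (show gridX dx (2 * j) < gridX dx (2 * j + 1) by rw [g1]; linarith)
    linarith [g1 j]
  have w2 : ∀ j, dx ≤ gridXi dx Y.ν (3 * j + 2 + 1) - gridXi dx Y.ν (3 * j + 2) := fun j => by
    rw [e3, gridXi_zero, gridXi_two, show 2 * (j + 1) = 2 * j + 2 by ring]
    have := hm (show gridX dx (2 * j + 1) ≤ gridX dx (2 * j + 2) by rw [g1, g2]; linarith)
    simp only at this
    linarith [g1 j, g2 j]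
  have w0 : ∀ j, 0 ≤ gridXi dx Y.ν (3 * j + 1) - gridXi dx Y.ν (3 * j) := fun j => by
    rw [gridXi_one, gridXi_zero]; linarith [hle (gridX dx (2 * j))]
  have hmono : Monotone (gridXi dx Y.ν) := monotone_int_of_le_succ fun i => by
    obtain ⟨j, rfl | rfl | rfl⟩ := exists_eq_three_mul i
    · linarith [w0 j]
    · linarith [w1 j]
    · linarith [w2 j]
  have hnn : ∀ A : Set ℝ, 0 ≤ Y.ν.real A := fun A => measureReal_nonneg
  have hEb : ∀ A : Set ℝ, Y.ν.real A ≤ Z.ν.real univ := fun A => by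
    rw [← huniv]; exact measureReal_mono (subset_univ _)
  -- There are three nodes per length `2 dx`, so the nodes stay within bounded distance of `(2 dx /
  -- 3) i`.
  have lower : ∀ i, (2 * dx / 3) * i - 2 * dx ≤ gridXi dx Y.ν i := fun i => by
    obtain ⟨j, rfl | rfl | rfl⟩ := exists_eq_three_mul i
    · rw [gridXi_zero, gridX_two_mul]; push_cast
      linarith [hnn (Iio ((j : ℝ) * (2 * dx)))]
    · rw [gridXi_one, gridX_two_mul]; push_cast
      linarith [hnn (Iic ((j : ℝ) * (2 * dx)))]
    · rw [gridXi_two, g1, gridX_two_mul]; push_cast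
      linarith [hnn (Iio ((j : ℝ) * (2 * dx) + dx))]
  have upper : ∀ i, gridXi dx Y.ν i ≤ (2 * dx / 3) * i + (dx + Z.ν.real univ) := fun i => by
    obtain ⟨j, rfl | rfl | rfl⟩ := exists_eq_three_mul i
    · rw [gridXi_zero, gridX_two_mul]; push_cast
      linarith [hEb (Iio ((j : ℝ) * (2 * dx)))]
    · rw [gridXi_one, gridX_two_mul]; push_cast
      linarith [hEb (Iic ((j : ℝ) * (2 * dx)))]
    · rw [gridXi_two, g1, gridX_two_mul]; push_cast
      linarith [hEb (Iio ((j : ℝ) * (2 * dx) + dx))]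
  have hc : 0 < 2 * dx / 3 := by linarith
  refine ⟨initData_proj h hdx σ, hmono, ?_, ?_, hdx, ?_⟩
  · refine tendsto_atTop_mono lower ?_
    exact tendsto_atTop_add_const_right _ _
      (Tendsto.const_mul_atTop hc tendsto_intCast_atTop_atTop)
  · refine tendsto_atBot_mono upper ?_
    exact tendsto_atBot_add_const_right _ _
      (Tendsto.const_mul_atBot hc (tendsto_intCast_atBot_iff.2 tendsto_id))
  · intro i
    obtain ⟨j, rfl | rfl | rfl⟩ := exists_eq_three_mul i
    · refine ⟨gridX dx (2 * j), projU dx σ Z (gridX dx (2 * j)), 0, 0, fun ξ hξ => ?_,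
        fun h => absurd rfl h⟩
      rw [gridXi_zero, gridXi_one] at hξ
      have e := mapL_y_eq_of_mem hξ.1 hξ.2
      refine ⟨by rw [e]; ring, ?_⟩
      change projU dx σ Z ((mapL Y).y ξ) = _
      rw [e]; ring
    · have hcd : gridX dx (2 * j) < gridX dx (2 * j + 1) := by rw [g1]; linarith
      obtain ⟨a1, a2⟩ := mapL_y_affine Y hcd (sq_nonneg (slopeL dx σ Z j))
        (A := Fac Z.μ (gridX dx (2 * j)) + Fsing Z.μ (gridX dx (2 * j + 2)))
        fun x hx => by rw [hIio, projF_of_mem_left h hdx σ hx]; ring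
      refine ⟨gridX dx (2 * j), Z.u (gridX dx (2 * j)), 1 / (1 + slopeL dx σ Z j ^ 2),
        slopeL dx σ Z j / (1 + slopeL dx σ Z j ^ 2), fun ξ hξ => ?_, fun _ => w1 j⟩
      rw [show (3 * j + 1 + 1 : ℤ) = 3 * j + 2 by ring, gridXi_one, gridXi_two, a1, hIio,
        projF_of_mem_left h hdx σ ⟨hcd, le_rfl⟩] at hξ
      obtain ⟨a3, a4⟩ := a2 ξ ⟨hξ.1, hξ.2.trans (by linarith)⟩
      rw [gridXi_one, a1]
      refine ⟨by rw [a3]; ring, ?_⟩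
      change projU dx σ Z ((mapL Y).y ξ) = _
      rw [projU_left hdx σ a4, a3]; ring
    · have hcd : gridX dx (2 * j + 1) < gridX dx (2 * j + 2) := by rw [g1, g2]; linarith
      obtain ⟨a1, a2⟩ := mapL_y_affine Y hcd (sq_nonneg (slopeR dx σ Z j))
        (A := projF dx σ Z (gridX dx (2 * j + 1)))
        fun x hx => by
          rw [hIio, projF_of_mem_right h hdx σ ⟨hx.1.le, hx.2⟩,
            projF_of_mem_right h hdx σ ⟨le_rfl, hcd.le⟩]; ring
      refine ⟨gridX dx (2 * j + 1), Z.u (gridX dx (2 * j + 2)) - slopeR dx σ Z j * dx,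
        1 / (1 + slopeR dx σ Z j ^ 2),
        slopeR dx σ Z j / (1 + slopeR dx σ Z j ^ 2), fun ξ hξ => ?_, fun _ => w2 j⟩
      rw [e3, gridXi_two, gridXi_zero, show 2 * (j + 1) = 2 * j + 2 by ring, hIio, hIio] at hξ
      have e4 : projF dx σ Z (gridX dx (2 * j + 2)) = projF dx σ Z (gridX dx (2 * j + 1)) +
          slopeR dx σ Z j ^ 2 * (gridX dx (2 * j + 2) - gridX dx (2 * j + 1)) := by
        rw [projF_of_mem_right h hdx σ ⟨hcd.le, le_rfl⟩,
          projF_of_mem_right h hdx σ ⟨le_rfl, hcd.le⟩]; ring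
      obtain ⟨a3, a4⟩ := a2 ξ ⟨hξ.1, hξ.2.trans (by rw [e4])⟩
      rw [gridXi_two, hIio]
      refine ⟨by rw [a3]; ring, ?_⟩
      change projU dx σ Z ((mapL Y).y ξ) = _
      rw [projU_right hdx σ a4, a3, g1, g2]; ring

namespace CellData

variable {X : Lag} {E : ℝ} {xi : ℤ → ℝ} {w : ℝ} (h : CellData X E xi w)
include h

/-- The index of the cell that contains `ξ`. -/
lemma sSup_mem (ξ : ℝ) : xi (sSup {i : ℤ | xi i ≤ ξ}) ≤ ξ ∧ ξ < xi (sSup {i : ℤ | xi i ≤ ξ} + 1) := by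
  have hne : {i : ℤ | xi i ≤ ξ}.Nonempty := (h.xi_bot.eventually (eventually_le_atBot ξ)).exists
  have hbdd : BddAbove {i : ℤ | xi i ≤ ξ} := by
    obtain ⟨N, hN⟩ := (h.xi_top.eventually (eventually_gt_atTop ξ)).exists
    refine ⟨N, fun i hi => ?_⟩
    by_contra! hlt
    exact absurd (h.xi_mono hlt.le) (not_le.2 (lt_of_le_of_lt hi hN))
  refine ⟨Int.csSup_mem hne hbdd, ?_⟩
  by_contra! hle
  have := le_csSup hbdd (show sSup {i : ℤ | xi i ≤ ξ} + 1 ∈ {i : ℤ | xi i ≤ ξ} from hle)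
  omega

omit h in
lemma _root_.HunterSaxton.cell_unique (hm : Monotone xi) {i j : ℤ} {ξ : ℝ} (hi : xi i ≤ ξ)
    (hi' : ξ < xi (i + 1)) (hj : xi j ≤ ξ) (hj' : ξ < xi (j + 1)) : i = j := by
  rcases lt_trichotomy i j with h1 | h1 | h1
  · exact absurd (hm (show i + 1 ≤ j from h1)) (not_le.2 (hj.trans_lt hi'))
  · exact h1
  · exact absurd (hm (show j + 1 ≤ i from h1)) (not_le.2 (hi.trans_lt hj'))

lemma sSup_eq {i : ℤ} {ξ : ℝ} (hi : xi i ≤ ξ) (hi' : ξ < xi (i + 1)) :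
    sSup {i : ℤ | xi i ≤ ξ} = i :=
  cell_unique h.xi_mono (h.sSup_mem ξ).1 (h.sSup_mem ξ).2 hi hi'

lemma measurable_cell (b : ℤ → ℝ) : Measurable fun ξ => b (sSup {i : ℤ | xi i ≤ ξ}) := by
  have hm : Monotone fun ξ => sSup {i : ℤ | xi i ≤ ξ} := fun ξ η hξη => by
    by_contra! hlt
    have h1 := h.xi_mono (show sSup {i : ℤ | xi i ≤ η} + 1 ≤ sSup {i : ℤ | xi i ≤ ξ} from hlt)
    linarith [(h.sSup_mem η).2, (h.sSup_mem ξ).1]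
  exact (measurable_of_countable b).comp hm.measurable

lemma ae_mem_Ioo : ∀ᵐ ξ, ∃ i, ξ ∈ Ioo (xi i) (xi (i + 1)) := by
  have h1 : ∀ᵐ ξ : ℝ, ∀ i, ξ ≠ xi i := ae_all_iff.2 fun i => Measure.ae_ne volume _
  filter_upwards [h1] with ξ hξ
  exact ⟨_, lt_of_le_of_ne (h.sSup_mem ξ).1 (hξ _).symm, (h.sSup_mem ξ).2⟩

lemma derivs_eq {i : ℤ} {ξ η : ℝ} (hξ : ξ ∈ Ioo (xi i) (xi (i + 1)))
    (hη : η ∈ Ioo (xi i) (xi (i + 1))) : deriv X.y ξ = deriv X.y η ∧ deriv X.U ξ = deriv X.U η ∧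
      deriv X.H ξ = deriv X.H η := by
  obtain ⟨y₀, U₀, p, r, h1, -⟩ := h.affine i
  have key : ∀ ξ ∈ Ioo (xi i) (xi (i + 1)), deriv X.y ξ = p ∧ deriv X.U ξ = r ∧
      deriv X.H ξ = 1 - p := by
    intro ξ hξ
    have hn := Ioo_mem_nhds hξ.1 hξ.2
    have ey : X.y =ᶠ[𝓝 ξ] fun ξ => y₀ + p * (ξ - xi i) := by
      filter_upwards [hn] with z hz
      exact (h1 z (Ioo_subset_Icc_self hz)).1
    have eU : X.U =ᶠ[𝓝 ξ] fun ξ => U₀ + r * (ξ - xi i) := by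
      filter_upwards [hn] with z hz
      exact (h1 z (Ioo_subset_Icc_self hz)).2
    have eH : X.H =ᶠ[𝓝 ξ] fun ξ => ξ - (y₀ + p * (ξ - xi i)) := by
      filter_upwards [ey] with z hz
      rw [← hz]; linarith [h.add_eq z]
    refine ⟨by rw [ey.deriv_eq]; simp, by rw [eU.deriv_eq]; simp, ?_⟩
    rw [eH.deriv_eq]
    have := (hasDerivAt_id ξ).sub ((((hasDerivAt_id ξ).sub_const (xi i)).const_mul p).const_add y₀)
    rw [mul_one] at this
    exact this.deriv
  obtain ⟨a1, a2, a3⟩ := key ξ hξ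
  obtain ⟨b1, b2, b3⟩ := key η hη
  exact ⟨a1.trans b1.symm, a2.trans b2.symm, a3.trans b3.symm⟩

/-- The derivatives are constant inside a cell, so relations that hold a.e. hold at each of its
interior points. -/
lemma regularAt {i : ℤ} {ξ : ℝ} (hξ : ξ ∈ Ioo (xi i) (xi (i + 1))) : RegularAt X ξ := by
  have h1 : (volume.restrict (Ioo (xi i) (xi (i + 1)))) ≠ 0 := by
    rw [Ne, Measure.restrict_eq_zero, Real.volume_Ioo, ENNReal.ofReal_eq_zero]
    linarith [hξ.1.trans hξ.2]
  have : (ae (volume.restrict (Ioo (xi i) (xi (i + 1))))).NeBot := ae_neBot.2 h1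
  obtain ⟨η, h2, h3⟩ := ((ae_restrict_of_ae (s := Ioo (xi i) (xi (i + 1))) h.ae_regularAt).and
    (ae_restrict_mem measurableSet_Ioo)).exists
  obtain ⟨e1, e2, e3⟩ := h.derivs_eq hξ h3
  exact ⟨e1 ▸ h2.y_nonneg, e3 ▸ h2.H_nonneg, by rw [e1, e3]; exact h2.add_eq,
    by rw [e1, e2, e3]; exact h2.rel⟩

lemma mid_mem {i : ℤ} (hi : xi i ≠ xi (i + 1)) :
    (xi i + xi (i + 1)) / 2 ∈ Ioo (xi i) (xi (i + 1)) := by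
  have := lt_of_le_of_ne (h.xi_mono (show i ≤ i + 1 by omega)) hi
  constructor <;> linarith

lemma hasSum_integral {f : ℝ → ℝ} (hf : Integrable f) {g : ℤ → ℝ}
    (hg : ∀ i, ∀ ξ ∈ Ioo (xi i) (xi (i + 1)), f ξ = g i) :
    HasSum (fun i => g i * (xi (i + 1) - xi i)) (∫ ξ, f ξ) := by
  have hU : (⋃ i : ℤ, Ico (xi i) (xi (i + 1))) = univ := eq_univ_of_forall fun ξ =>
    mem_iUnion.2 ⟨_, h.sSup_mem ξ⟩
  have hd : Pairwise fun i j : ℤ => Disjoint (Ico (xi i) (xi (i + 1))) (Ico (xi j) (xi (j + 1))) :=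
    fun i j hij => Set.disjoint_left.2 fun ξ hi hj =>
      hij (cell_unique h.xi_mono hi.1 hi.2 hj.1 hj.2)
  have h1 := hasSum_integral_iUnion (μ := volume) (f := f) (fun i : ℤ => measurableSet_Ico) hd
    hf.integrableOn
  rw [hU, setIntegral_univ] at h1
  refine h1.congr_fun fun i => ?_
  rw [integral_Ico_eq_integral_Ioo, setIntegral_congr_fun measurableSet_Ioo (hg i),
    setIntegral_const, measureReal_def, Real.volume_Ioo, ENNReal.toReal_ofReal
      (sub_nonneg.2 (h.xi_mono (by omega))), smul_eq_mul, mul_comm]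

omit h in
lemma intervalIntegral_eq {f : ℝ → ℝ} {g : ℝ} {i : ℤ}
    (hg : ∀ ξ ∈ Ioo (xi i) (xi (i + 1)), f ξ = g) {ξ : ℝ} (hξ : ξ ∈ Icc (xi i) (xi (i + 1))) :
    ∫ η in (xi i)..ξ, f η = g * (ξ - xi i) := by
  rw [intervalIntegral.integral_of_le hξ.1, integral_Ioc_eq_integral_Ioo,
    setIntegral_congr_fun (g := fun _ => g) measurableSet_Ioo
      (fun z hz => hg z ⟨hz.1, hz.2.trans_le hξ.2⟩),
    setIntegral_const, measureReal_def, Real.volume_Ioo, ENNReal.toReal_ofReal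
      (sub_nonneg.2 hξ.1), smul_eq_mul, mul_comm]

/-- Only finitely many waves break in a bounded time interval. -/
lemma finite_breaking (T : ℝ) : {i : ℤ | xi i ≠ xi (i + 1) ∧
    deriv X.U ((xi i + xi (i + 1)) / 2) < 0 ∧ breakTime X ((xi i + xi (i + 1)) / 2) ≤ T}.Finite := by
  set S := {i : ℤ | xi i ≠ xi (i + 1) ∧
    deriv X.U ((xi i + xi (i + 1)) / 2) < 0 ∧ breakTime X ((xi i + xi (i + 1)) / 2) ≤ T}
  set g : ℤ → ℝ := fun i => deriv X.H ((xi i + xi (i + 1)) / 2)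
  have hs := (h.hasSum_integral h.integrable_deriv_H (g := g) fun i ξ hξ =>
    (h.derivs_eq hξ (h.mid_mem (hξ.1.trans hξ.2).ne)).2.2).summable
  -- The least energy of a cell that breaks by time `T`: its width is at least `w`, and `H_ξ (1 +
  -- τ²/4) = 1` with `τ ≤ T`. Since the cell energies are summable, only finitely many can exceed
  -- it.
  have hpos : 0 < w * (4 / (4 + T ^ 2)) := by have := h.w_pos; positivity
  have h1 := hs.tendsto_cofinite_zero.eventually (gt_mem_nhds hpos)
  refine (Filter.eventually_cofinite.1 h1).subset fun i ⟨hi, hU, hT⟩ => ?_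
  rw [mem_ofPred_eq, not_lt]
  have hmid := h.mid_mem hi
  have hr := h.regularAt hmid
  obtain ⟨hy, hH, hb, e1, e2⟩ := hr.pos_of_neg hU
  obtain ⟨y₀, U₀, p, r, h2, h3⟩ := h.affine i
  have hw : w ≤ xi (i + 1) - xi i := by
    refine h3 fun hr0 => hU.ne ?_
    have eU : X.U =ᶠ[𝓝 ((xi i + xi (i + 1)) / 2)] fun _ => U₀ := by
      filter_upwards [Ioo_mem_nhds hmid.1 hmid.2] with z hz
      rw [(h2 z (Ioo_subset_Icc_self hz)).2, hr0, zero_mul, add_zero]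
    rw [eU.deriv_eq, deriv_const]
  have hg : 4 / (4 + T ^ 2) ≤ g i := by
    rw [div_le_iff₀ (by positivity)]
    have h4 := hr.add_eq
    have h5 : breakTime X ((xi i + xi (i + 1)) / 2) ^ 2 ≤ T ^ 2 := by gcongr
    change 4 ≤ deriv X.H _ * (4 + T ^ 2)
    nlinarith
  rw [mul_comm]
  exact mul_le_mul hg hw h.w_pos.le hr.H_nonneg

end CellData

/-! ## The scheme as an evolution with prescribed losses -/

/-- The finite sums telescope, and the nodes tend to `-∞`. -/
lemma leftSum_eq {F : ℝ → ℝ} {xi : ℤ → ℝ} {a : ℤ → ℝ} {L : ℝ} (hxi : Tendsto xi atBot atBot)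
    (hF : Tendsto F atBot (𝓝 L)) (ha : ∀ i, a i = F (xi (i + 1)) - F (xi i)) (j : ℤ) :
    leftSum a j = F (xi j) - L := by
  have h1 : ∀ n : ℕ, ∑ m ∈ Finset.Ico (j - (n : ℤ)) j, a m = F (xi j) - F (xi (j - n)) := by
    intro n
    induction n with
    | zero => simp
    | succ k ih =>
      have e : Finset.Ico (j - ((k + 1 : ℕ) : ℤ)) j =
          insert (j - ((k + 1 : ℕ) : ℤ)) (Finset.Ico (j - (k : ℤ)) j) := by
        ext m; simp only [Finset.mem_Ico, Finset.mem_insert]; push_cast; omega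
      rw [e, Finset.sum_insert (by rw [Finset.mem_Ico]; push_cast; omega), ih, ha,
        show j - ((k + 1 : ℕ) : ℤ) + 1 = j - (k : ℤ) by push_cast; ring]
      ring
  refine Tendsto.limUnder_eq ?_
  simp_rw [h1]
  refine (hF.comp (hxi.comp ?_)).const_sub (F (xi j))
  exact tendsto_atBot_add_const_left _ j
    (tendsto_neg_atTop_atBot.comp tendsto_natCast_atTop_atTop)

lemma interpolate_eq {f : ℝ → ℝ} {xi : ℤ → ℝ} {v : ℤ → ℝ} (hv : ∀ i, v i = f (xi i)) {ξ : ℝ}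
    (h1 : xi (sSup {i : ℤ | xi i ≤ ξ}) ≤ ξ) (h2 : ξ < xi (sSup {i : ℤ | xi i ≤ ξ} + 1))
    (hf : ∃ s, ∀ η ∈ Icc (xi (sSup {i : ℤ | xi i ≤ ξ})) (xi (sSup {i : ℤ | xi i ≤ ξ} + 1)),
      f η = f (xi (sSup {i : ℤ | xi i ≤ ξ})) + s * (η - xi (sSup {i : ℤ | xi i ≤ ξ}))) :
    interpolate xi v ξ = f ξ := by
  obtain ⟨s, hs⟩ := hf
  set j := sSup {i : ℤ | xi i ≤ ξ} with hj
  have h3 : xi (j + 1) - xi j ≠ 0 := by linarith [h1.trans_lt h2]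
  simp only [interpolate, ← hj, hv]
  rw [hs ξ ⟨h1, h2.le⟩, hs (xi (j + 1)) ⟨(h1.trans_lt h2).le, le_rfl⟩]
  field_simp
  ring

lemma evolve_congr {m : Mesh} {b b' : ℤ → ℝ} {c : State} {s t : ℝ}
    (h : ∀ j, ENNReal.ofReal s < m.tau j → m.tau j ≤ ENNReal.ofReal t → b j = b' j) :
    evolve m b c s t = evolve m b' c s t := by
  have e : energyLoss m b c s t = energyLoss m b' c s t := by
    ext j; unfold energyLoss
    split_ifs with h'
    · rw [h j h'.1 h'.2]
    · rfl
  simp only [evolve, e]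

lemma evolve_self (m : Mesh) (b : ℤ → ℝ) (c : State) (s : ℝ) : evolve m b c s s = c := by
  have e : ∀ j, energyLoss m b c s s j = 0 := fun j => if_neg fun h => absurd h.1 (not_lt.2 h.2)
  simp [evolve, e]

-- Semigroup property: a cell breaks at most once, so its loss falls into exactly one of the two
-- time intervals, and the rest is expansion of squares. Finiteness of the set of breaking cells
-- turns the series into finite sums, which can be rearranged.
open Classical in
lemma evolve_evolve {m : Mesh} {b b' : ℤ → ℝ} {c : State} {s t : ℝ} (hst : s ≤ t)
    (hfin : {j | 0 < m.tau j ∧ m.tau j ≤ ENNReal.ofReal t ∧ m.width j ≠ 0}.Finite)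
    (hsum : Summable fun j => c.VXi j * m.width j) :
    evolve m b' (evolve m b c 0 s) s t =
      evolve m (fun j => if ENNReal.ofReal s < m.tau j then b' j else b j) c 0 t := by
  set b'' : ℤ → ℝ := fun j => if ENNReal.ofReal s < m.tau j then b' j else b j
  set l₁ := energyLoss m b c 0 s with hl₁
  set l₂ := energyLoss m b' (evolve m b c 0 s) s t with hl₂
  set l := energyLoss m b'' c 0 t with hl
  have hle : ENNReal.ofReal s ≤ ENNReal.ofReal t := ENNReal.ofReal_le_ofReal hst
  have hcase : ∀ j, l j = l₁ j + l₂ j := fun j => by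
    simp only [hl, hl₁, hl₂, energyLoss, evolve, b'', ENNReal.ofReal_zero]
    by_cases h0 : 0 < m.tau j
    · by_cases h1 : m.tau j ≤ ENNReal.ofReal s
      · simp [h0, h1, h1.trans hle, not_lt.2 h1]
      · have h1' := not_le.1 h1
        by_cases h2 : m.tau j ≤ ENNReal.ofReal t <;> simp [h0, h1, h1', h2]
    · have h0' : m.tau j = 0 := by simpa using h0
      simp [h0']
  have hz₁ : ∀ j, j ∉ hfin.toFinset → l₁ j * m.width j = 0 := fun j hj => by
    by_contra hne
    obtain ⟨h1, h2⟩ := mul_ne_zero_iff.1 hne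
    simp only [hl₁, energyLoss, ENNReal.ofReal_zero] at h1
    split_ifs at h1 with h3
    · exact hj (hfin.mem_toFinset.2 ⟨h3.1, h3.2.trans hle, h2⟩)
    · exact h1 rfl
  have hz₂ : ∀ j, j ∉ hfin.toFinset → l₂ j * m.width j = 0 := fun j hj => by
    by_contra hne
    obtain ⟨h1, h2⟩ := mul_ne_zero_iff.1 hne
    simp only [hl₂, energyLoss] at h1
    split_ifs at h1 with h3
    · exact hj (hfin.mem_toFinset.2 ⟨lt_of_le_of_lt bot_le h3.1, h3.2, h2⟩)
    · exact h1 rfl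
  have t₁ : ∀ f : ℤ → ℝ, ∑' j, l₁ j * m.width j * f j =
      ∑ j ∈ hfin.toFinset, l₁ j * m.width j * f j := fun f =>
    tsum_eq_sum fun j hj => by rw [hz₁ j hj, zero_mul]
  have t₂ : ∀ f : ℤ → ℝ, ∑' j, l₂ j * m.width j * f j =
      ∑ j ∈ hfin.toFinset, l₂ j * m.width j * f j := fun f =>
    tsum_eq_sum fun j hj => by rw [hz₂ j hj, zero_mul]
  have t₃ : ∀ f : ℤ → ℝ, ∑' j, l j * m.width j * f j =
      ∑ j ∈ hfin.toFinset, l j * m.width j * f j := fun f =>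
    tsum_eq_sum fun j hj => by rw [hcase, add_mul, hz₁ j hj, hz₂ j hj]; ring
  have hV : (evolve m b c 0 s).VTotal m =
      c.VTotal m - ∑ j ∈ hfin.toFinset, l₁ j * m.width j := by
    have hs₁ : Summable fun j => l₁ j * m.width j :=
      summable_of_ne_finset_zero (s := hfin.toFinset) hz₁
    have e : ∑ j ∈ hfin.toFinset, l₁ j * m.width j = ∑' j, l₁ j * m.width j :=
      (tsum_eq_sum hz₁).symm
    rw [e, State.VTotal, State.VTotal, ← hsum.tsum_sub hs₁]
    refine tsum_congr fun j => ?_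
    simp only [evolve, ← hl₁]; ring
  have hVX : ∀ j, (evolve m b c 0 s).VXi j = c.VXi j - l₁ j := fun j => rfl
  have hUX : ∀ j, (evolve m b c 0 s).UXi j = c.UXi j + 1 / 2 * c.VXi j * (s - 0)
    - 1 / 2 * l₁ j * (s - (m.tau j).toReal) := fun j => rfl
  have hZX : ∀ j, (evolve m b c 0 s).zetaXi j =
    c.zetaXi j + c.UXi j * (s - 0) + 1 / 4 * c.VXi j * (s - 0) ^ 2
    - 1 / 4 * l₁ j * (s - (m.tau j).toReal) ^ 2 := fun j => rfl
  have hUI : (evolve m b c 0 s).UInf = c.UInf - 1 / 4 * c.VTotal m * (s - 0)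
    + 1 / 4 * ∑ j ∈ hfin.toFinset, l₁ j * m.width j * (s - (m.tau j).toReal) := by
    rw [← t₁]; rfl
  have hZI : (evolve m b c 0 s).zetaInf = c.zetaInf + c.UInf * (s - 0)
    - 1 / 8 * c.VTotal m * (s - 0) ^ 2
    + 1 / 8 * ∑ j ∈ hfin.toFinset, l₁ j * m.width j * (s - (m.tau j).toReal) ^ 2 := by
    rw [← t₁]; rfl
  have ext : ∀ A B : State, (∀ j, A.zetaXi j = B.zetaXi j) → (∀ j, A.UXi j = B.UXi j) →
      (∀ j, A.VXi j = B.VXi j) → A.zetaInf = B.zetaInf → A.UInf = B.UInf → A = B := by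
    rintro ⟨a1, a2, a3, a4, a5⟩ ⟨b1, b2, b3, b4, b5⟩ h1 h2 h3 h4 h5
    simp only at h1 h2 h3 h4 h5
    rw [funext h1, funext h2, funext h3, h4, h5]
  refine ext _ _ (fun j => ?_) (fun j => ?_) (fun j => ?_) ?_ ?_
  · change (evolve m b c 0 s).zetaXi j + (evolve m b c 0 s).UXi j * (t - s) +
      1 / 4 * (evolve m b c 0 s).VXi j * (t - s) ^ 2 -
      1 / 4 * l₂ j * (t - (m.tau j).toReal) ^ 2 = c.zetaXi j + c.UXi j * (t - 0) +
      1 / 4 * c.VXi j * (t - 0) ^ 2 - 1 / 4 * l j * (t - (m.tau j).toReal) ^ 2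
    rw [hVX, hUX, hZX, hcase]; ring
  · change (evolve m b c 0 s).UXi j + 1 / 2 * (evolve m b c 0 s).VXi j * (t - s) -
      1 / 2 * l₂ j * (t - (m.tau j).toReal) = c.UXi j + 1 / 2 * c.VXi j * (t - 0) -
      1 / 2 * l j * (t - (m.tau j).toReal)
    rw [hVX, hUX, hcase]; ring
  · change (evolve m b c 0 s).VXi j - l₂ j = c.VXi j - l j
    rw [hVX, hcase]; ring
  · change (evolve m b c 0 s).zetaInf + (evolve m b c 0 s).UInf * (t - s) -
      1 / 8 * (evolve m b c 0 s).VTotal m * (t - s) ^ 2 +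
      1 / 8 * ∑' j, l₂ j * m.width j * (t - (m.tau j).toReal) ^ 2 =
      c.zetaInf + c.UInf * (t - 0) - 1 / 8 * c.VTotal m * (t - 0) ^ 2 +
      1 / 8 * ∑' j, l j * m.width j * (t - (m.tau j).toReal) ^ 2
    rw [hV, hUI, hZI, t₂, t₃]
    have e : ∑ j ∈ hfin.toFinset, l j * m.width j * (t - (m.tau j).toReal) ^ 2 =
        ∑ j ∈ hfin.toFinset, l₁ j * m.width j * (s - (m.tau j).toReal) ^ 2 +
        2 * (t - s) * ∑ j ∈ hfin.toFinset, l₁ j * m.width j * (s - (m.tau j).toReal) +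
        (t - s) ^ 2 * ∑ j ∈ hfin.toFinset, l₁ j * m.width j +
        ∑ j ∈ hfin.toFinset, l₂ j * m.width j * (t - (m.tau j).toReal) ^ 2 := by
      rw [Finset.mul_sum, Finset.mul_sum, ← Finset.sum_add_distrib, ← Finset.sum_add_distrib,
        ← Finset.sum_add_distrib]
      refine Finset.sum_congr rfl fun j _ => ?_
      rw [hcase]; ring
    rw [e]; ring
  · change (evolve m b c 0 s).UInf - 1 / 4 * (evolve m b c 0 s).VTotal m * (t - s) +
      1 / 4 * ∑' j, l₂ j * m.width j * (t - (m.tau j).toReal) =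
      c.UInf - 1 / 4 * c.VTotal m * (t - 0) +
      1 / 4 * ∑' j, l j * m.width j * (t - (m.tau j).toReal)
    rw [hV, hUI, t₂, t₃]
    have e : ∑ j ∈ hfin.toFinset, l j * m.width j * (t - (m.tau j).toReal) =
        ∑ j ∈ hfin.toFinset, l₁ j * m.width j * (s - (m.tau j).toReal) +
        (t - s) * ∑ j ∈ hfin.toFinset, l₁ j * m.width j +
        ∑ j ∈ hfin.toFinset, l₂ j * m.width j * (t - (m.tau j).toReal) := by
      rw [Finset.mul_sum, ← Finset.sum_add_distrib, ← Finset.sum_add_distrib]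
      refine Finset.sum_congr rfl fun j _ => ?_
      rw [hcase]; ring
    rw [e]; ring

namespace CellData

variable {X : Lag} {E : ℝ} {xi : ℤ → ℝ} {w : ℝ} (h : CellData X E xi w)
include h

/-- In a nondegenerate cell, finite positive wave breaking times correspond to `U_ξ < 0`. -/
lemma tau_eq {i : ℤ} {ξ : ℝ} (hξ : ξ ∈ Ioo (xi i) (xi (i + 1))) :
    (deriv X.U ξ < 0 → (initMesh X xi).tau i = ENNReal.ofReal (breakTime X ξ) ∧
      0 < breakTime X ξ) ∧
    (¬ deriv X.U ξ < 0 → (initMesh X xi).tau i = 0 ∨ (initMesh X xi).tau i = ⊤) := by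
  have hne : xi i ≠ xi (i + 1) := (hξ.1.trans hξ.2).ne
  have hmid := h.mid_mem hne
  obtain ⟨e1, e2, -⟩ := h.derivs_eq hξ hmid
  have e : (initMesh X xi).tau i = waveBreak X ((xi i + xi (i + 1)) / 2) := if_neg hne
  have eb : breakTime X ξ = breakTime X ((xi i + xi (i + 1)) / 2) := by
    simp only [breakTime, e1, e2]
  rw [e, eb, e2]
  refine ⟨(h.regularAt hmid).waveBreak_eq, fun h' => ?_⟩
  unfold waveBreak
  split_ifs
  · exact Or.inl rfl
  · exact Or.inr rfl

lemma finite_tau (T : ℝ) : {j | 0 < (initMesh X xi).tau j ∧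
    (initMesh X xi).tau j ≤ ENNReal.ofReal T}.Finite := by
  refine (h.finite_breaking T).subset fun j hj => ?_
  have hne : xi j ≠ xi (j + 1) := fun e => by
    have := hj.1
    simp [initMesh, e] at this
  have hmid := h.mid_mem hne
  have ht := h.tau_eq hmid
  by_cases hU : deriv X.U ((xi j + xi (j + 1)) / 2) < 0
  · refine ⟨hne, hU, ?_⟩
    have h1 := hj.2
    obtain ⟨h2, h3⟩ := ht.1 hU
    rw [h2] at h1
    by_contra! hlt
    exact absurd h1 (not_le.2 ((ENNReal.ofReal_lt_ofReal_iff h3).2 hlt))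
  · rcases ht.2 hU with h1 | h1
    · exact absurd hj.1 (by simp [h1])
    · exact absurd hj.2 (by simp [h1])

lemma summable_VXi : Summable fun j => (initState X xi).VXi j * (initMesh X xi).width j := by
  have h1 := h.hasSum_integral h.integrable_deriv_H (g := (initState X xi).VXi) fun i ξ hξ => by
    have hne : xi i ≠ xi (i + 1) := (hξ.1.trans hξ.2).ne
    simp only [initState, if_neg hne, h.V_eq]
    exact (h.derivs_eq hξ (h.mid_mem hne)).2.2
  exact h1.summable

variable {b : ℤ → ℝ}

section Evolved

variable {β : ℝ → ℝ} (hβ : ∀ i, ∀ ξ ∈ Ioo (xi i) (xi (i + 1)), β ξ = b i) {t : ℝ} (ht : 0 ≤ t)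
include hβ

/-- The densities of the scheme in the cells. -/
lemma evolve_dens {i : ℤ} {ξ : ℝ} (hξ : ξ ∈ Ioo (xi i) (xi (i + 1))) :
    (evolve (initMesh X xi) b (initState X xi) 0 t).VXi i = dens0 X β t ξ ∧
    (evolve (initMesh X xi) b (initState X xi) 0 t).UXi i =
      deriv X.U ξ + 1 / 2 * dens1 X β t ξ ∧
    (evolve (initMesh X xi) b (initState X xi) 0 t).zetaXi i + 1 =
      deriv X.y ξ + t * deriv X.U ξ + 1 / 2 * dens2 X β t ξ ∧
    energyLoss (initMesh X xi) b (initState X xi) 0 t i *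
      (t - ((initMesh X xi).tau i).toReal) = β ξ * elapsed X t ξ * deriv X.H ξ ∧
    energyLoss (initMesh X xi) b (initState X xi) 0 t i *
      (t - ((initMesh X xi).tau i).toReal) ^ 2 = β ξ * elapsed X t ξ ^ 2 * deriv X.H ξ ∧
    (initState X xi).VXi i = deriv X.H ξ := by
  have hne : xi i ≠ xi (i + 1) := (hξ.1.trans hξ.2).ne
  have hmid := h.mid_mem hne
  obtain ⟨e1, e2, e3⟩ := h.derivs_eq hξ hmid
  have hV : (initState X xi).VXi i = deriv X.H ξ := by
    simp only [initState, if_neg hne, h.V_eq, e3]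
  have hU : (initState X xi).UXi i = deriv X.U ξ := by
    simp only [initState, if_neg hne, e2]
  have hz : (initState X xi).zetaXi i = deriv X.y ξ - 1 := by
    simp only [initState, if_neg hne, e1]
  have hl : energyLoss (initMesh X xi) b (initState X xi) 0 t i =
      β ξ * broken X t ξ * deriv X.H ξ ∧
    energyLoss (initMesh X xi) b (initState X xi) 0 t i *
      (t - ((initMesh X xi).tau i).toReal) = β ξ * elapsed X t ξ * deriv X.H ξ ∧
    energyLoss (initMesh X xi) b (initState X xi) 0 t i *
      (t - ((initMesh X xi).tau i).toReal) ^ 2 = β ξ * elapsed X t ξ ^ 2 * deriv X.H ξ := by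
    simp only [energyLoss, hV, hβ i ξ hξ, ENNReal.ofReal_zero]
    by_cases hneg : deriv X.U ξ < 0
    · obtain ⟨ht1, ht2⟩ := (h.tau_eq hξ).1 hneg
      rw [ht1, ENNReal.toReal_ofReal ht2.le]
      have hpos : 0 < ENNReal.ofReal (breakTime X ξ) := ENNReal.ofReal_pos.2 ht2
      by_cases hle : breakTime X ξ ≤ t
      · have h1 : ENNReal.ofReal (breakTime X ξ) ≤ ENNReal.ofReal t := ENNReal.ofReal_le_ofReal hle
        rw [if_pos ⟨hpos, h1⟩]
        simp only [broken, elapsed, hneg, hle, and_self, if_true,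
          max_eq_left (sub_nonneg.2 hle)]
        refine ⟨by ring, by ring, by ring⟩
      · have h1 : ¬ ENNReal.ofReal (breakTime X ξ) ≤ ENNReal.ofReal t := by
          rw [not_le, ENNReal.ofReal_lt_ofReal_iff ht2]; exact not_le.1 hle
        rw [if_neg (fun h' => h1 h'.2)]
        simp only [broken, elapsed, hneg, hle, and_false, if_true, if_false,
          max_eq_right (sub_nonpos.2 (not_le.1 hle).le)]
        refine ⟨by ring, by ring, by ring⟩
    · have h0 : ¬ (0 < (initMesh X xi).tau i ∧ (initMesh X xi).tau i ≤ ENNReal.ofReal t) := by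
        rcases (h.tau_eq hξ).2 hneg with h1 | h1 <;> simp [h1]
      rw [if_neg h0]
      simp [broken, elapsed, hneg]
  obtain ⟨hl0, hl1, hl2⟩ := hl
  refine ⟨?_, ?_, ?_, hl1, hl2, hV⟩
  · simp only [evolve, hl0, hV, dens0]; ring
  · have e : (evolve (initMesh X xi) b (initState X xi) 0 t).UXi i =
      (initState X xi).UXi i + 1 / 2 * (initState X xi).VXi i * (t - 0) -
      1 / 2 * (energyLoss (initMesh X xi) b (initState X xi) 0 t i *
        (t - ((initMesh X xi).tau i).toReal)) := by simp only [evolve]; ring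
    rw [e, hl1, hU, hV, dens1]; ring
  · have e : (evolve (initMesh X xi) b (initState X xi) 0 t).zetaXi i =
      (initState X xi).zetaXi i + (initState X xi).UXi i * (t - 0) +
      1 / 4 * (initState X xi).VXi i * (t - 0) ^ 2 -
      1 / 4 * (energyLoss (initMesh X xi) b (initState X xi) 0 t i *
        (t - ((initMesh X xi).tau i).toReal) ^ 2) := by simp only [evolve]; ring
    rw [e, hl2, hU, hV, hz, dens2]; ring

variable (hb : ∀ η, β η ∈ Icc (0 : ℝ) 1) (hβm : Measurable β)
include hb hβm

omit hβ hb hβm in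
lemma affine_deriv {i : ℤ} (hne : xi i ≠ xi (i + 1)) {ξ : ℝ} (hξ : ξ ∈ Icc (xi i) (xi (i + 1))) :
    X.y ξ = X.y (xi i) + deriv X.y ((xi i + xi (i + 1)) / 2) * (ξ - xi i) ∧
    X.U ξ = X.U (xi i) + deriv X.U ((xi i + xi (i + 1)) / 2) * (ξ - xi i) := by
  have hmid := h.mid_mem hne
  obtain ⟨y₀, U₀, p, r, h1, -⟩ := h.affine i
  have ey : X.y =ᶠ[𝓝 ((xi i + xi (i + 1)) / 2)] fun ξ => y₀ + p * (ξ - xi i) := by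
    filter_upwards [Ioo_mem_nhds hmid.1 hmid.2] with z hz
    exact (h1 z (Ioo_subset_Icc_self hz)).1
  have eU : X.U =ᶠ[𝓝 ((xi i + xi (i + 1)) / 2)] fun ξ => U₀ + r * (ξ - xi i) := by
    filter_upwards [Ioo_mem_nhds hmid.1 hmid.2] with z hz
    exact (h1 z (Ioo_subset_Icc_self hz)).2
  have e1 : deriv X.y ((xi i + xi (i + 1)) / 2) = p := by rw [ey.deriv_eq]; simp
  have e2 : deriv X.U ((xi i + xi (i + 1)) / 2) = r := by rw [eU.deriv_eq]; simp
  obtain ⟨a1, a2⟩ := h1 ξ hξ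
  obtain ⟨a3, a4⟩ := h1 (xi i) ⟨le_rfl, h.xi_mono (by omega)⟩
  rw [e1, e2, a1, a2, a3, a4]
  constructor <;> ring

/-- The densities are constant in a cell, so their primitives are affine there, with the cell values
of the scheme as slopes. -/
lemma evo_affine (ht : 0 ≤ t) (i : ℤ) {ξ : ℝ} (hξ : ξ ∈ Icc (xi i) (xi (i + 1))) :
    (evo X β t).V ξ = (evo X β t).V (xi i) +
      (evolve (initMesh X xi) b (initState X xi) 0 t).VXi i * (ξ - xi i) ∧
    (evo X β t).U ξ = (evo X β t).U (xi i) +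
      (evolve (initMesh X xi) b (initState X xi) 0 t).UXi i * (ξ - xi i) ∧
    (evo X β t).y ξ = (evo X β t).y (xi i) +
      ((evolve (initMesh X xi) b (initState X xi) 0 t).zetaXi i + 1) * (ξ - xi i) := by
  by_cases hne : xi i = xi (i + 1)
  · have e : ξ = xi i := le_antisymm (hne ▸ hξ.2) hξ.1
    rw [e, sub_self]; simp
  obtain ⟨a1, a2⟩ := h.affine_deriv hne hξ
  have hmid := h.mid_mem hne
  set c := evolve (initMesh X xi) b (initState X xi) 0 t
  have hE := h.toEnergyData
  have i0 := integral_Iic_sub (integrable_dens0 hE hb hβm t) (xi i) ξ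
  have i1 := integral_Iic_sub (integrable_dens1 hE hb hβm ht) (xi i) ξ
  have i2 := integral_Iic_sub (integrable_dens2 hE hb hβm ht) (xi i) ξ
  rw [intervalIntegral_eq (g := c.VXi i)
    (fun z hz => ((h.evolve_dens hβ hz).1).symm) hξ] at i0
  rw [intervalIntegral_eq (g := 2 * (c.UXi i - deriv X.U ((xi i + xi (i + 1)) / 2)))
    (fun z hz => by
      have := (h.evolve_dens hβ (t := t) hz).2.1
      rw [(h.derivs_eq hz hmid).2.1] at this
      linarith) hξ] at i1
  rw [intervalIntegral_eq (g := 2 * (c.zetaXi i + 1 - deriv X.y ((xi i + xi (i + 1)) / 2) -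
      t * deriv X.U ((xi i + xi (i + 1)) / 2)))
    (fun z hz => by
      have := (h.evolve_dens hβ (t := t) hz).2.2.1
      rw [(h.derivs_eq hz hmid).2.1, (h.derivs_eq hz hmid).1] at this
      linarith) hξ] at i2
  refine ⟨?_, ?_, ?_⟩
  · simp only [evo]; linarith
  · simp only [evo]; rw [a2]; linarith
  · simp only [evo]; rw [a1, a2]; linarith

/-- The left asymptotes of the scheme are those of the evolution. -/
lemma tendsto_evo_atBot (ht : 0 ≤ t) :
    Tendsto (evo X β t).V atBot (𝓝 0) ∧
    Tendsto (evo X β t).U atBot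
      (𝓝 (evolve (initMesh X xi) b (initState X xi) 0 t).UInf) ∧
    Tendsto (fun ξ => (evo X β t).y ξ - ξ) atBot
      (𝓝 (evolve (initMesh X xi) b (initState X xi) 0 t).zetaInf) := by
  have hE := h.toEnergyData
  obtain ⟨a, a', ha⟩ := h.U_tails
  obtain ⟨K, hK⟩ := h.U_lip
  have hUa := ha.tendsto_atBot hK.uniformContinuous
  have l0 : Tendsto (fun ξ => ∫ η in Iic ξ, dens0 X β t η) atBot (𝓝 0) :=
    tendsto_integral_Iic_zero tendsto_id
  have l1 : Tendsto (fun ξ => ∫ η in Iic ξ, dens1 X β t η) atBot (𝓝 0) :=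
    tendsto_integral_Iic_zero tendsto_id
  have l2 : Tendsto (fun ξ => ∫ η in Iic ξ, dens2 X β t η) atBot (𝓝 0) :=
    tendsto_integral_Iic_zero tendsto_id
  have hz0 : (initState X xi).zetaInf = 0 := by
    refine Tendsto.limUnder_eq ?_
    have : Tendsto (fun ξ => -X.H ξ) atBot (𝓝 (-0)) := h.H_bot.neg
    rw [neg_zero] at this
    refine (this.comp h.xi_bot).congr fun j => ?_
    simp only [Function.comp]; linarith [h.add_eq (xi j)]
  have hU0 : (initState X xi).UInf = a := (hUa.comp h.xi_bot).limUnder_eq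
  have hVT : (initState X xi).VTotal (initMesh X xi) = E := by
    have h1 := h.hasSum_integral h.integrable_deriv_H (g := (initState X xi).VXi) fun i ξ hξ =>
      (h.evolve_dens hβ (t := t) hξ).2.2.2.2.2.symm
    rw [h.integral_deriv_H] at h1
    exact h1.tsum_eq
  have i1 : Integrable fun ξ => β ξ * elapsed X t ξ * deriv X.H ξ :=
    ((h.integrable_deriv_H.const_mul t).sub (integrable_dens1 hE hb hβm ht)).congr
      (ae_of_all _ fun ξ => by simp only [Pi.sub_apply, dens1]; ring)
  have i2 : Integrable fun ξ => β ξ * elapsed X t ξ ^ 2 * deriv X.H ξ :=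
    ((h.integrable_deriv_H.const_mul (t ^ 2)).sub
      ((integrable_dens2 hE hb hβm ht).const_mul 2)).congr
      (ae_of_all _ fun ξ => by simp only [Pi.sub_apply, dens2]; ring)
  have s1 := h.hasSum_integral i1 fun i ξ hξ => (h.evolve_dens hβ (t := t) hξ).2.2.2.1.symm
  have s2 := h.hasSum_integral i2 fun i ξ hξ => (h.evolve_dens hβ (t := t) hξ).2.2.2.2.1.symm
  have e1 : ∫ η, dens1 X β t η = t * E - ∫ ξ, β ξ * elapsed X t ξ * deriv X.H ξ := by
    rw [← h.integral_deriv_H, ← integral_const_mul,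
      ← integral_sub (h.integrable_deriv_H.const_mul t) i1]
    refine integral_congr_ae (ae_of_all _ fun ξ => ?_)
    simp only [dens1]; ring
  have e2 : ∫ η, dens2 X β t η =
      t ^ 2 / 2 * E - 1 / 2 * ∫ ξ, β ξ * elapsed X t ξ ^ 2 * deriv X.H ξ := by
    rw [← h.integral_deriv_H, ← integral_const_mul, ← integral_const_mul,
      ← integral_sub (h.integrable_deriv_H.const_mul _) (i2.const_mul _)]
    refine integral_congr_ae (ae_of_all _ fun ξ => ?_)
    simp only [dens2]; ring
  refine ⟨l0, ?_, ?_⟩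
  · have e : (evolve (initMesh X xi) b (initState X xi) 0 t).UInf =
        a + 1 / 2 * 0 - 1 / 4 * ∫ η, dens1 X β t η := by
      simp only [evolve]
      rw [hU0, hVT, e1, ← s1.tsum_eq]
      have : ∀ j, energyLoss (initMesh X xi) b (initState X xi) 0 t j * (initMesh X xi).width j *
          (t - ((initMesh X xi).tau j).toReal) = energyLoss (initMesh X xi) b (initState X xi) 0 t j *
          (t - ((initMesh X xi).tau j).toReal) * (xi (j + 1) - xi j) := fun j => by
        simp only [Mesh.width, initMesh]; ring
      simp_rw [this]; ring
    rw [e]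
    exact (hUa.add (l1.const_mul (1 / 2))).sub_const _
  · have e : (evolve (initMesh X xi) b (initState X xi) 0 t).zetaInf =
        -0 + t * a + 1 / 2 * 0 - 1 / 4 * ∫ η, dens2 X β t η := by
      simp only [evolve]
      rw [hU0, hVT, hz0, e2, ← s2.tsum_eq]
      have : ∀ j, energyLoss (initMesh X xi) b (initState X xi) 0 t j * (initMesh X xi).width j *
          (t - ((initMesh X xi).tau j).toReal) ^ 2 =
          energyLoss (initMesh X xi) b (initState X xi) 0 t j *
          (t - ((initMesh X xi).tau j).toReal) ^ 2 * (xi (j + 1) - xi j) := fun j => by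
        simp only [Mesh.width, initMesh]; ring
      simp_rw [this]; ring
    rw [e]
    refine (((h.H_bot.neg.add (hUa.const_mul t)).add (l2.const_mul (1 / 2))).sub_const _).congr
      fun ξ => ?_
    simp only [evo]; linarith [h.add_eq ξ]

lemma evolve_nodes (ht : 0 ≤ t) (j : ℤ) :
    (evolve (initMesh X xi) b (initState X xi) 0 t).VNode (initMesh X xi) j =
      (evo X β t).V (xi j) ∧
    (evolve (initMesh X xi) b (initState X xi) 0 t).UNode (initMesh X xi) j =
      (evo X β t).U (xi j) ∧
    (evolve (initMesh X xi) b (initState X xi) 0 t).yNode (initMesh X xi) j =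
      (evo X β t).y (xi j) := by
  obtain ⟨l0, l1, l2⟩ := h.tendsto_evo_atBot hβ hb hβm ht
  have haff : ∀ i, _ := fun i => h.evo_affine hβ hb hβm ht i (ξ := xi (i + 1))
    ⟨h.xi_mono (by omega), le_rfl⟩
  have hw : ∀ i, (initMesh X xi).width i = xi (i + 1) - xi i := fun i => rfl
  refine ⟨?_, ?_, ?_⟩
  · rw [State.VNode, leftSum_eq h.xi_bot l0 fun i => by rw [hw, (haff i).1]; ring, sub_zero]
  · rw [State.UNode, leftSum_eq h.xi_bot l1 fun i => by rw [hw, (haff i).2.1]; ring]; ring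
  · rw [State.yNode, State.zetaNode,
      leftSum_eq h.xi_bot l2 fun i => by rw [hw, (haff i).2.2]; ring]
    simp only [initMesh]; ring

/-- The evolution is affine in every cell, so linear interpolation of its node values reproduces it.
-/
lemma toLag_evolve (ht : 0 ≤ t) :
    (evolve (initMesh X xi) b (initState X xi) 0 t).toLag (initMesh X xi) = evo X β t := by
  have hnode := h.evolve_nodes hβ hb hβm ht
  have haff : ∀ i, _ := fun i ξ hξ => h.evo_affine hβ hb hβm ht i (ξ := ξ) hξ
  have hH : ∀ ξ, ∃ s, ∀ η ∈ Icc (xi (sSup {i : ℤ | xi i ≤ ξ})) (xi (sSup {i : ℤ | xi i ≤ ξ} + 1)),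
      X.H η = X.H (xi (sSup {i : ℤ | xi i ≤ ξ})) + s * (η - xi (sSup {i : ℤ | xi i ≤ ξ})) := by
    intro ξ
    have hc := h.sSup_mem ξ
    refine ⟨1 - deriv X.y ((xi (sSup {i : ℤ | xi i ≤ ξ}) + xi (sSup {i : ℤ | xi i ≤ ξ} + 1)) / 2),
      fun η hη => ?_⟩
    have := (h.affine_deriv (hc.1.trans_lt hc.2).ne hη).1
    linarith [h.add_eq η, h.add_eq (xi (sSup {i : ℤ | xi i ≤ ξ}))]
  have e1 : interpolate xi ((evolve (initMesh X xi) b (initState X xi) 0 t).yNode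
      (initMesh X xi)) = (evo X β t).y := funext fun ξ =>
    interpolate_eq (fun i => (hnode i).2.2) (h.sSup_mem ξ).1 (h.sSup_mem ξ).2
      ⟨_, fun η hη => (haff _ η hη).2.2⟩
  have e2 : interpolate xi ((evolve (initMesh X xi) b (initState X xi) 0 t).UNode
      (initMesh X xi)) = (evo X β t).U := funext fun ξ =>
    interpolate_eq (fun i => (hnode i).2.1) (h.sSup_mem ξ).1 (h.sSup_mem ξ).2
      ⟨_, fun η hη => (haff _ η hη).2.1⟩
  have e3 : interpolate xi ((evolve (initMesh X xi) b (initState X xi) 0 t).VNode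
      (initMesh X xi)) = (evo X β t).V := funext fun ξ =>
    interpolate_eq (fun i => (hnode i).1) (h.sSup_mem ξ).1 (h.sSup_mem ξ).2
      ⟨_, fun η hη => (haff _ η hη).1⟩
  have e4 : interpolate xi (fun j => X.H (xi j)) = X.H := funext fun ξ =>
    interpolate_eq (fun i => rfl) (h.sSup_mem ξ).1 (h.sSup_mem ξ).2 (hH ξ)
  have e : (evolve (initMesh X xi) b (initState X xi) 0 t).toLag (initMesh X xi) =
      ⟨(evo X β t).y, (evo X β t).U, (evo X β t).V, X.H⟩ := by
    rw [← e1, ← e2, ← e3]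
    conv_rhs => rw [← e4]
    rfl
  exact e

end Evolved
end CellData

/-! ## The time steps -/

section TimeSteps

variable {m : Mesh} (hm : ∀ T : ℝ, {j | 0 < m.tau j ∧ m.tau j ≤ ENNReal.ofReal T}.Finite)

lemma nextBreak_le {s : ℝ} {j : ℤ} (hj : ENNReal.ofReal s < m.tau j) :
    nextBreak m s ≤ m.tau j := sInf_le ⟨⟨j, rfl⟩, hj⟩

lemma ofReal_le_nextBreak (s : ℝ) : ENNReal.ofReal s ≤ nextBreak m s :=
  le_sInf fun _ hb => hb.2.le

include hm

lemma finite_range_tau (s T : ℝ) :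
    {b | b ∈ range m.tau ∧ ENNReal.ofReal s < b ∧ b ≤ ENNReal.ofReal T}.Finite := by
  refine ((hm T).image m.tau).subset ?_
  rintro b ⟨⟨j, rfl⟩, h1, h2⟩
  exact ⟨j, ⟨lt_of_le_of_lt bot_le h1, h2⟩, rfl⟩

lemma nextBreak_mem {s T : ℝ} (h : nextBreak m s < ENNReal.ofReal T) :
    nextBreak m s ∈ range m.tau ∧ ENNReal.ofReal s < nextBreak m s := by
  obtain ⟨b, hb, hbT⟩ := sInf_lt_iff.1 h
  obtain ⟨c, hc, hmin⟩ := Set.exists_min_image _ id (finite_range_tau hm s T)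
    ⟨b, hb.1, hb.2, hbT.le⟩
  have e : nextBreak m s = c := by
    refine IsLeast.csInf_eq ⟨⟨hc.1, hc.2.1⟩, fun d hd => ?_⟩
    rcases le_total d (ENNReal.ofReal T) with h1 | h1
    · exact hmin d ⟨hd.1, hd.2, h1⟩
    · exact hc.2.2.trans h1
  rw [e]; exact ⟨hc.1, hc.2.1⟩

/-- The last clause is what accuracy requires: a step that ends strictly after the next breaking
time merges several of them, and such steps are no longer than `dt`. -/
lemma stepTime_spec {T dt s : ℝ} (hs : 0 ≤ s) (hsT : s < T) :
    s < stepTime m T dt s ∧ stepTime m T dt s ≤ T ∧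
    (stepTime m T dt s = T ∨ ENNReal.ofReal (stepTime m T dt s) ∈ range m.tau) ∧
    (nextBreak m s < ENNReal.ofReal (stepTime m T dt s) → stepTime m T dt s ≤ s + dt) := by
  have hT : 0 < T := hs.trans_lt hsT
  unfold stepTime
  split_ifs with h1 h2
  · exact ⟨hsT, le_rfl, Or.inl rfl, fun h => absurd h1 (not_le.2 h)⟩
  · obtain ⟨h3, h4⟩ := nextBreak_mem hm (not_le.1 h1)
    have hne : nextBreak m s ≠ ⊤ := (lt_of_lt_of_le (not_le.1 h1) le_top).ne
    have h5 : nextBreak m s ≤ nextBreak m (nextBreak m s).toReal := by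
      conv_lhs => rw [← ENNReal.ofReal_toReal hne]
      exact ofReal_le_nextBreak _
    set C := {b | b ∈ range m.tau ∧ ENNReal.ofReal s < b ∧
      b ≤ ENNReal.ofReal (min (s + dt) T)}
    have hC : C.Nonempty := by
      refine ⟨_, h3, h4, ?_⟩
      rcases min_choice (s + dt) T with e | e <;> rw [e]
      · exact h5.trans h2.1
      · exact h5.trans h2.2.le
    obtain ⟨c1, c2, c3⟩ := hC.csSup_mem (finite_range_tau hm s (min (s + dt) T))
    have hCt : sSup C ≠ ⊤ := ne_top_of_le_ne_top ENNReal.ofReal_ne_top c3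
    have c4 : s < (sSup C).toReal := (ENNReal.ofReal_lt_iff_lt_toReal hs hCt).1 c2
    have hmin : 0 ≤ min (s + dt) T := by
      by_contra! hlt
      rw [ENNReal.ofReal_of_nonpos hlt.le] at c3
      exact absurd c2 (not_lt.2 (c3.trans bot_le))
    have c5 : (sSup C).toReal ≤ min (s + dt) T := ENNReal.toReal_le_of_le_ofReal hmin c3
    refine ⟨c4, c5.trans (min_le_right _ _), Or.inr ?_, fun _ => c5.trans (min_le_left _ _)⟩
    rw [ENNReal.ofReal_toReal hCt]; exact c1
  · obtain ⟨h3, h4⟩ := nextBreak_mem hm (not_le.1 h1)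
    have hne : nextBreak m s ≠ ⊤ := (lt_of_lt_of_le (not_le.1 h1) le_top).ne
    refine ⟨(ENNReal.ofReal_lt_iff_lt_toReal hs hne).1 h4,
      ENNReal.toReal_le_of_le_ofReal hT.le (not_le.1 h1).le, Or.inr ?_, fun h => ?_⟩
    · rw [ENNReal.ofReal_toReal hne]; exact h3
    · rw [ENNReal.ofReal_toReal hne] at h; exact absurd h (lt_irrefl _)

omit hm in
lemma stepTime_self (T dt : ℝ) : stepTime m T dt T = T := if_pos (ofReal_le_nextBreak T)

variable {T : ℝ} (hT : 0 ≤ T) (dt : ℝ)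
include hT

lemma tstar_mem (k : ℕ) : tstar m T dt k ∈ Icc 0 T := by
  induction k with
  | zero => exact ⟨le_rfl, hT⟩
  | succ k ih =>
    rcases ih.2.eq_or_lt with h1 | h1
    · rw [tstar, h1, stepTime_self]; exact ⟨hT, le_rfl⟩
    · obtain ⟨h2, h3, -⟩ := stepTime_spec hm (dt := dt) ih.1 h1
      exact ⟨ih.1.trans h2.le, h3⟩

lemma tstar_mono : Monotone (tstar m T dt) := monotone_nat_of_le_succ fun k => by
  have ih := tstar_mem hm hT dt k
  rcases ih.2.eq_or_lt with h1 | h1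
  · rw [tstar, h1, stepTime_self]
  · exact (stepTime_spec hm (dt := dt) ih.1 h1).1.le

/-- As long as `T` is not reached, each step ends at a new breaking time, and only finitely many of
them lie in `(0, T]`. -/
lemma exists_tstar_eq : ∃ k, tstar m T dt k = T := by
  by_contra! hne
  have hlt : ∀ k, tstar m T dt k < T := fun k =>
    lt_of_le_of_ne (tstar_mem hm hT dt k).2 (hne k)
  have hstep := fun k => stepTime_spec hm (dt := dt) (tstar_mem hm hT dt k).1 (hlt k)
  have hsm : StrictMono (tstar m T dt) := strictMono_nat_of_lt_succ fun k => (hstep k).1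
  have hpos : ∀ k, 0 < tstar m T dt (k + 1) := fun k =>
    (tstar_mem hm hT dt k).1.trans_lt (hstep k).1
  refine Set.infinite_of_injective_forall_mem
    (f := fun k => ENNReal.ofReal (tstar m T dt (k + 1))) (fun i j hij => ?_) (fun k => ?_)
    (finite_range_tau hm 0 T)
  · have h1 := congrArg ENNReal.toReal hij
    simp only [ENNReal.toReal_ofReal (hpos _).le] at h1
    have := hsm.injective h1
    omega
  · refine ⟨((hstep k).2.2.1).resolve_left (hne (k + 1)), ?_,
      ENNReal.ofReal_le_ofReal (tstar_mem hm hT dt _).2⟩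
    rw [ENNReal.ofReal_zero]; exact ENNReal.ofReal_pos.2 (hpos k)

lemma exists_tstar_interval {b : ℝ} (hb : 0 < b) (hbT : b ≤ T) :
    ∃ k, tstar m T dt k < b ∧ b ≤ tstar m T dt (k + 1) := by
  classical
  obtain ⟨K, hK⟩ := exists_tstar_eq hm hT dt
  have hex : ∃ n, b ≤ tstar m T dt n := ⟨K, hbT.trans hK.symm.le⟩
  have h0 : Nat.find hex ≠ 0 := fun e => by
    have := Nat.find_spec hex
    rw [e] at this
    exact absurd hb (not_lt.2 this)
  refine ⟨Nat.find hex - 1, ?_, ?_⟩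
  · exact not_le.1 (Nat.find_min hex (by omega))
  · rw [Nat.sub_add_cancel (by omega)]; exact Nat.find_spec hex

end TimeSteps

/-! ## The losses of the scheme -/

open Classical in
/-- The fraction of the energy that the scheme removes from the cell `j` at its breaking time. -/
noncomputable def schemeLoss (α : ℝ → ℝ) (m : Mesh) (c₀ : State) (T dt : ℝ) (N : ℕ → ℕ)
    (j : ℤ) : ℝ :=
  if hk : ∃ k, ENNReal.ofReal (tstar m T dt k) < m.tau j ∧
      m.tau j ≤ ENNReal.ofReal (tstar m T dt (k + 1)) then
    iterBeta α m (stateAt α m c₀ T dt N hk.choose) (tstar m T dt hk.choose)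
      (tstar m T dt (hk.choose + 1)) (N hk.choose) j
  else 0

lemma iterBeta_mem {α : ℝ → ℝ} (hα : IsCoefficient α) (m : Mesh) (c : State) (s s' : ℝ) (n : ℕ)
    (j : ℤ) : iterBeta α m c s s' n j ∈ Ico (0 : ℝ) 1 := by
  match n with
  | 0 => simp [iterBeta]
  | 1 => simp [iterBeta]
  | n + 2 =>
    simp only [iterBeta]
    split_ifs
    · exact hα.2 _
    · simp

lemma schemeLoss_mem {α : ℝ → ℝ} (hα : IsCoefficient α) (m : Mesh) (c₀ : State) (T dt : ℝ)
    (N : ℕ → ℕ) (j : ℤ) : schemeLoss α m c₀ T dt N j ∈ Ico (0 : ℝ) 1 := by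
  unfold schemeLoss
  split_ifs
  · exact iterBeta_mem hα _ _ _ _ _ _
  · simp

section SchemeLoss

variable {α : ℝ → ℝ} {m : Mesh} {c₀ : State} {T dt : ℝ} {N : ℕ → ℕ}
  (hm : ∀ T : ℝ, {j | 0 < m.tau j ∧ m.tau j ≤ ENNReal.ofReal T}.Finite) (hT : 0 ≤ T)
include hm hT

/-- The time intervals of different steps are disjoint, so the index picked by `choose` is `k`. -/
lemma schemeLoss_eq {j : ℤ} {k : ℕ} (h1 : ENNReal.ofReal (tstar m T dt k) < m.tau j)
    (h2 : m.tau j ≤ ENNReal.ofReal (tstar m T dt (k + 1))) :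
    schemeLoss α m c₀ T dt N j = iterBeta α m (stateAt α m c₀ T dt N k) (tstar m T dt k)
      (tstar m T dt (k + 1)) (N k) j := by
  have hk : ∃ k, ENNReal.ofReal (tstar m T dt k) < m.tau j ∧
      m.tau j ≤ ENNReal.ofReal (tstar m T dt (k + 1)) := ⟨k, h1, h2⟩
  have key : ∀ i l : ℕ, ENNReal.ofReal (tstar m T dt i) < m.tau j →
      m.tau j ≤ ENNReal.ofReal (tstar m T dt (l + 1)) → i ≤ l := fun i l hi hl => by
    by_contra! hlt
    have := tstar_mono hm hT dt (show l + 1 ≤ i from hlt)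
    exact absurd (hl.trans (ENNReal.ofReal_le_ofReal this)) (not_le.2 hi)
  have e : hk.choose = k := le_antisymm (key _ _ hk.choose_spec.1 h2) (key _ _ h1 hk.choose_spec.2)
  unfold schemeLoss
  rw [dif_pos hk, e]

variable (hsum : Summable fun j => c₀.VXi j * m.width j)
include hsum

lemma evolve_schemeLoss_of_stateAt {k : ℕ} (hk : stateAt α m c₀ T dt N k =
      evolve m (schemeLoss α m c₀ T dt N) c₀ 0 (tstar m T dt k)) {t : ℝ}
    (ht : tstar m T dt k ≤ t) (ht' : t ≤ tstar m T dt (k + 1)) :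
    iterate α m (stateAt α m c₀ T dt N k) (tstar m T dt k) (tstar m T dt (k + 1)) (N k) t =
      evolve m (schemeLoss α m c₀ T dt N) c₀ 0 t := by
  rw [iterate]
  have e : ∀ j, ENNReal.ofReal (tstar m T dt k) < m.tau j → m.tau j ≤ ENNReal.ofReal t →
      iterBeta α m (stateAt α m c₀ T dt N k) (tstar m T dt k) (tstar m T dt (k + 1)) (N k) j =
        schemeLoss α m c₀ T dt N j := fun j h1 h2 =>
    (schemeLoss_eq hm hT h1 (h2.trans (ENNReal.ofReal_le_ofReal ht'))).symm
  rw [evolve_congr e, hk, evolve_evolve ht ((hm t).subset fun j hj => ⟨hj.1, hj.2.1⟩) hsum]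
  simp only [ite_self]

/-- On each time interval only the losses of cells breaking there are used, so all steps combine
into a single evolution from time 0. -/
lemma stateAt_eq (k : ℕ) : stateAt α m c₀ T dt N k =
    evolve m (schemeLoss α m c₀ T dt N) c₀ 0 (tstar m T dt k) := by
  induction k with
  | zero => rw [stateAt, tstar, evolve_self]
  | succ k ih =>
    rw [stateAt]
    exact evolve_schemeLoss_of_stateAt hm hT hsum ih (tstar_mono hm hT dt (by omega)) le_rfl

lemma numState_eq {t : ℝ} (ht : t ∈ Icc 0 T) : numState α m c₀ T dt N t =
    evolve m (schemeLoss α m c₀ T dt N) c₀ 0 t := by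
  obtain ⟨K, hK⟩ := exists_tstar_eq hm hT dt
  have hne : {k : ℕ | t ≤ tstar m T dt (k + 1)}.Nonempty :=
    ⟨K, ht.2.trans (hK.symm.le.trans (tstar_mono hm hT dt (by omega)))⟩
  have h1 := Nat.sInf_mem hne
  rw [numState]
  refine evolve_schemeLoss_of_stateAt hm hT hsum (stateAt_eq hm hT hsum _) ?_ h1
  rcases Nat.eq_zero_or_pos (sInf {k : ℕ | t ≤ tstar m T dt (k + 1)}) with h2 | h2
  · rw [h2]; exact ht.1
  · by_contra! hlt
    have h3 := Nat.notMem_of_lt_sInf (s := {k : ℕ | t ≤ tstar m T dt (k + 1)})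
      (m := sInf {k : ℕ | t ≤ tstar m T dt (k + 1)} - 1) (by omega)
    refine h3 ?_
    rw [mem_ofPred_eq, Nat.sub_add_cancel h2]
    exact hlt.le

end SchemeLoss

/-- A loss at time `τ` influences `ζ` at time `t` through `(t - τ)²`, which vanishes for `τ = t`.
Thus the first iterate already has the correct final positions. -/
lemma yNode_evolve_eq_of_breaks_at_end {m : Mesh} {b b' : ℤ → ℝ} {c : State} {s t : ℝ}
    (ht : 0 ≤ t) (h : ∀ j, ENNReal.ofReal s < m.tau j → m.tau j ≤ ENNReal.ofReal t →
      m.tau j = ENNReal.ofReal t) (j : ℤ) :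
    (evolve m b c s t).yNode m j = (evolve m b' c s t).yNode m j := by
  have key : ∀ b : ℤ → ℝ, ∀ j, energyLoss m b c s t j * (t - (m.tau j).toReal) ^ 2 = 0 := by
    intro b j
    unfold energyLoss
    split_ifs with h1
    · rw [h j h1.1 h1.2, ENNReal.toReal_ofReal ht, sub_self]; ring
    · ring
  have e1 : (evolve m b c s t).zetaXi = (evolve m b' c s t).zetaXi := by
    ext i
    simp only [evolve]
    linarith [key b i, key b' i]
  have e2 : (evolve m b c s t).zetaInf = (evolve m b' c s t).zetaInf := by
    have h0 : ∀ b : ℤ → ℝ, ∑' j, energyLoss m b c s t j * m.width j *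
        (t - (m.tau j).toReal) ^ 2 = 0 := fun b => by
      have : ∀ j, energyLoss m b c s t j * m.width j * (t - (m.tau j).toReal) ^ 2 = 0 := fun j => by
        rw [mul_right_comm, key, zero_mul]
      simp_rw [this, tsum_zero]
    simp only [evolve, h0]
  simp only [State.yNode, State.zetaNode, e1, e2]

namespace CellData

variable {X : Lag} {E : ℝ} {xi : ℤ → ℝ} {w : ℝ} (h : CellData X E xi w)
include h

/-- The losses of the scheme are almost those prescribed by `α`. -/
lemma abs_schemeLoss_sub_le {α : ℝ → ℝ} (hα : IsCoefficient α) {T dt ρ C : ℝ} (hT : 0 ≤ T)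
    (hdt : 0 < dt) (hρ : 0 ≤ ρ) (hC : 0 ≤ C) {N : ℕ → ℕ} {β : ℝ → ℝ}
    (hβ : ∀ i, ∀ ξ ∈ Ioo (xi i) (xi (i + 1)),
      β ξ = schemeLoss α (initMesh X xi) (initState X xi) T dt N i)
    (hb : ∀ η, β η ∈ Icc (0 : ℝ) 1) (hβm : Measurable β)
    (hlip : ∀ s ∈ Icc 0 T, ∀ t ∈ Icc 0 T, ∀ ξ,
      |(evo X β t).y ξ - (evo X β s).y ξ| ≤ C * |t - s|)
    (h2 : ∀ k, nextBreak (initMesh X xi) (tstar (initMesh X xi) T dt k) =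
      ENNReal.ofReal (tstar (initMesh X xi) T dt (k + 1)) → N k = 2)
    (h3 : ∀ k, nextBreak (initMesh X xi) (tstar (initMesh X xi) T dt k) <
      ENNReal.ofReal (tstar (initMesh X xi) T dt (k + 1)) → (N k = 2 ∨ N k = 3) ∧
      ∀ t ∈ Icc (tstar (initMesh X xi) T dt k) (tstar (initMesh X xi) T dt (k + 1)), ∀ j : ℤ,
        |(iterate α (initMesh X xi) (stateAt α (initMesh X xi) (initState X xi) T dt N k)
          (tstar (initMesh X xi) T dt k) (tstar (initMesh X xi) T dt (k + 1)) (N k) t).yNode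
            (initMesh X xi) j -
        (iterate α (initMesh X xi) (stateAt α (initMesh X xi) (initState X xi) T dt N k)
          (tstar (initMesh X xi) T dt k) (tstar (initMesh X xi) T dt (k + 1)) (N k - 1) t).yNode
            (initMesh X xi) j| ≤ ρ)
    {i : ℤ} {ξ : ℝ} (hξ : ξ ∈ Ioo (xi i) (xi (i + 1))) (hU : deriv X.U ξ < 0)
    (hbT : breakTime X ξ ≤ T) :
    |β ξ - α ((evo X β (breakTime X ξ)).y ξ)| ≤ derivSupNorm α * (ρ + C * dt) := by
  have hm := h.finite_tau
  have hsum := h.summable_VXi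
  set m := initMesh X xi with hmd
  set c₀ := initState X xi with hc₀
  obtain ⟨hτ, hpos⟩ := (h.tau_eq hξ).1 hU
  rw [← hmd] at hτ
  set b := breakTime X ξ with hbd
  obtain ⟨k, hk1, hk2⟩ := exists_tstar_interval hm hT dt hpos hbT
  have hk0 := tstar_mem hm hT dt k
  have hk0' := tstar_mem hm hT dt (k + 1)
  set s := tstar m T dt k with hs
  set s' := tstar m T dt (k + 1) with hs'
  have hτ1 : ENNReal.ofReal s < m.tau i := by
    rw [hτ]; exact (ENNReal.ofReal_lt_ofReal_iff hpos).2 hk1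
  have hτ2 : m.tau i ≤ ENNReal.ofReal s' := by rw [hτ]; exact ENNReal.ofReal_le_ofReal hk2
  have hK : 0 ≤ derivSupNorm α := derivSupNorm_nonneg α
  -- At its breaking time the cell has collapsed to a point, so the left node used by the scheme has
  -- the same position as the label `ξ`.
  have hflat : (evo X β b).y ξ = (evo X β b).y (xi i) := by
    have e1 := (h.evo_affine hβ hb hβm hpos.le i (Ioo_subset_Icc_self hξ)).2.2
    have e2 := (h.evolve_dens hβ (t := b) hξ).2.2.1
    have e3 := ((h.regularAt hξ).formulas_of_le (β := β) hU (le_refl b)).1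
    rw [e2, e3, ← hbd, sub_self] at e1
    rw [e1]; ring
  have hstate : stateAt α m c₀ T dt N (k + 1) = evolve m (schemeLoss α m c₀ T dt N) c₀ 0 s' :=
    stateAt_eq hm hT hsum (k + 1)
  have hy' : (stateAt α m c₀ T dt N (k + 1)).yNode m i = (evo X β s').y (xi i) := by
    rw [hstate]; exact (h.evolve_nodes hβ hb hβm hk0'.1 i).2.2
  have hloss : β ξ = iterBeta α m (stateAt α m c₀ T dt N k) s s' (N k) i := by
    rw [hβ i ξ hξ]; exact schemeLoss_eq hm hT hτ1 hτ2
  have hiter : ∀ n, iterBeta α m (stateAt α m c₀ T dt N k) s s' (n + 2) i =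
      α ((iterate α m (stateAt α m c₀ T dt N k) s s' (n + 1) s').yNode m i) := fun n =>
    if_pos ⟨hτ1, hτ2⟩
  have hlast : stateAt α m c₀ T dt N (k + 1) =
    iterate α m (stateAt α m c₀ T dt N k) s s' (N k) s' := rfl
  -- If the step ends at the next breaking time, the second iterate uses the exact loss. Otherwise
  -- the step is no longer than `dt`, and the error consists of the termination tolerance and of the
  -- motion between breaking and the end of the step.
  rcases (nextBreak_le hτ1 |>.trans hτ2).eq_or_lt with hnb | hnb
  · have hbs : b = s' := by
      have h4 := nextBreak_le hτ1
      rw [hnb, hτ, ENNReal.ofReal_le_ofReal_iff hpos.le] at h4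
      exact le_antisymm hk2 h4
    have hN := h2 k hnb
    have e : (iterate α m (stateAt α m c₀ T dt N k) s s' (0 + 1) s').yNode m i =
        (stateAt α m c₀ T dt N (k + 1)).yNode m i := by
      rw [hlast]
      refine yNode_evolve_eq_of_breaks_at_end hk0'.1 (fun j hj1 hj2 => ?_) i
      exact le_antisymm hj2 (hnb ▸ nextBreak_le hj1)
    rw [hloss, hN, hiter 0, e, hy', hflat, hbs, sub_self, abs_zero]
    positivity
  · obtain ⟨hN, hterm⟩ := h3 k hnb
    have hdt' : s' ≤ s + dt := by
      rcases hk0.2.eq_or_lt with h5 | h5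
      · have : s' = T := by rw [hs', tstar, ← hs, h5, stepTime_self]
        linarith
      · exact (stepTime_spec hm (dt := dt) hk0.1 h5).2.2.2 hnb
    have h6 := hterm s' ⟨(hk1.trans_le hk2).le, le_rfl⟩ i
    rw [← hlast, hy'] at h6
    have hβe : β ξ =
        α ((iterate α m (stateAt α m c₀ T dt N k) s s' (N k - 1) s').yNode m i) := by
      rw [hloss]
      rcases hN with e | e <;> rw [e]
      · exact hiter 0
      · exact hiter 1
    rw [hβe, hflat]
    refine (hα.abs_sub_le _ _).trans (mul_le_mul_of_nonneg_left ?_ hK)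
    have h7 := hlip b ⟨hpos.le, hbT⟩ s' hk0' (xi i)
    have h8 : C * |s' - b| ≤ C * dt := by
      refine mul_le_mul_of_nonneg_left ?_ hC
      rw [abs_of_nonneg (by linarith)]; linarith
    rw [abs_sub_comm] at h6
    exact (abs_sub_le _ _ _).trans (add_le_add h6 (h7.trans h8))

end CellData

/-! ## Convergence of the scheme -/

/-- The numerical solution is an evolution of the projected data, whose losses are almost those
prescribed by `α`. -/
lemma exists_numLag_eq {α : ℝ → ℝ} (hα : IsCoefficient α) {T : ℝ} (hT : 0 ≤ T) {Z : Eul}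
    (h : EulData Z) {dx : ℝ} (hdx : 0 < dx) {p : Params} (hp : Admissible α T dx p Z) :
    ∃ β : ℝ → ℝ, Measurable β ∧ (∀ η, β η ∈ Ico (0 : ℝ) 1) ∧
      (∀ t ∈ Icc 0 T, numLag α T dx p Z t = evo (mapL (proj dx p.sign Z)) β t) ∧
      ∀ B, (∀ ξ, |(mapL (proj dx p.sign Z)).U ξ| ≤ B) →
        ∀ᵐ η, deriv (mapL (proj dx p.sign Z)).U η < 0 →
          breakTime (mapL (proj dx p.sign Z)) η ≤ T →
          |β η - α ((evo (mapL (proj dx p.sign Z)) β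
            (breakTime (mapL (proj dx p.sign Z)) η)).y η)| ≤
          derivSupNorm α * (1 / 8 * Z.ν.real univ * p.dt ^ 2 * dx +
            (B + T * Z.ν.real univ / 4) * p.dt) := by
  have hc := cellData_proj h hdx p.sign
  set X := mapL (proj dx p.sign Z)
  set xi := gridXi dx (proj dx p.sign Z).ν
  set b := schemeLoss α (initMesh X xi) (initState X xi) T p.dt p.iter with hbd
  set β : ℝ → ℝ := fun ξ => b (sSup {i : ℤ | xi i ≤ ξ}) with hβd
  have hβm : Measurable β := hc.measurable_cell b
  have hmem : ∀ η, β η ∈ Ico (0 : ℝ) 1 := fun η => schemeLoss_mem hα _ _ _ _ _ _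
  have hb : ∀ η, β η ∈ Icc (0 : ℝ) 1 := fun η => Ico_subset_Icc_self (hmem η)
  have hβ : ∀ i, ∀ ξ ∈ Ioo (xi i) (xi (i + 1)), β ξ = b i := fun i ξ hξ => by
    simp only [hβd, hc.sSup_eq hξ.1.le hξ.2]
  refine ⟨β, hβm, hmem, fun t ht => ?_, fun B hB => ?_⟩
  · rw [← hc.toLag_evolve hβ hb hβm ht.1]
    change (numState α (initMesh X xi) (initState X xi) T p.dt p.iter t).toLag (initMesh X xi) = _
    rw [numState_eq hc.finite_tau hT hc.summable_VXi ht]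
  · have hE := hc.E_nonneg
    have hB0 : 0 ≤ B := (abs_nonneg _).trans (hB 0)
    filter_upwards [hc.ae_mem_Ioo] with ξ hξ hU hbT
    obtain ⟨i, hi⟩ := hξ
    refine hc.abs_schemeLoss_sub_le hα hT hp.dt_pos (by positivity) (by positivity) hβ hb hβm
      (fun s hs t ht ξ => abs_evo_y_sub_time_le hc.toInitData hb hβm hB hs ht ξ) hp.iter_two
      hp.iter_else hi hU hbT

section Convergence

variable {α : ℝ → ℝ} (hα : IsCoefficient α) {T : ℝ} (hT : 0 ≤ T) {Z : Eul} (h : EulData Z)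
  {p : ℝ → Params} (hp : ∀ dx : ℝ, 0 < dx → Admissible α T dx (p dx) Z)
include hα hT h hp

/-- The derivatives of the projected data converge a.e. only along a subsequence, so the stability
hypotheses are verified there. The restriction on `dt` makes the error in the losses vanish in the
limit. -/
lemma exists_stableSeq {β : ℝ → ℝ} (hβ : IsLoss α (mapL Z) β) {d : ℕ → ℝ}
    (hd : Tendsto d atTop (𝓝[>] 0)) : ∃ (φ : ℕ → ℕ) (βn : ℕ → ℝ → ℝ) (δ : ℕ → ℝ),
      StableSeq α T (Z.ν.real univ) (mapL Z) β
        (fun n => mapL (proj (d (φ n)) (p (d (φ n))).sign Z)) βn δ ∧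
      ∀ n, ∀ t ∈ Icc 0 T, numLag α T (d (φ n)) (p (d (φ n))) Z t =
        evo (mapL (proj (d (φ n)) (p (d (φ n))).sign Z)) (βn n) t := by
  obtain ⟨φ, hφ, hpos, hH, hU, hflat⟩ := exists_subseq_proj h hd fun n => (p (d n)).sign
  have hdφ : Tendsto (fun n => d (φ n)) atTop (𝓝 0) :=
    (hd.comp hφ.tendsto_atTop).mono_right nhdsWithin_le_nhds
  have hin := h.initData
  set E := Z.ν.real univ with hEd
  have hE : 0 ≤ E := hin.E_nonneg
  set K := derivSupNorm α with hK
  have hK0 : 0 ≤ K := derivSupNorm_nonneg α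
  obtain ⟨a, a', ha⟩ := hin.U_tails
  obtain ⟨L, hL⟩ := hin.U_lip
  obtain ⟨B, hB⟩ := ha.bounded hL
  have hB0 : 0 ≤ B := (abs_nonneg _).trans (hB 0)
  choose βn hβm hβmem hnum hloss using fun n =>
    exists_numLag_eq hα hT h (hpos n) (hp (d (φ n)) (hpos n))
  set R : ℝ → ℝ := fun x => √(6 * x * E) + √(2 * x * E) with hR
  have hR0 : ∀ x, 0 ≤ R x := fun x => by positivity
  have hBn : ∀ n ξ, |(mapL (proj (d (φ n)) (p (d (φ n))).sign Z)).U ξ| ≤ B + R (d (φ n)) :=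
    fun n ξ => by
    have h1 := abs_mapL_proj_U_sub_le h (hpos n) (p (d (φ n))).sign ξ
    have h2 := abs_add_le ((mapL Z).U ξ)
      ((mapL (proj (d (φ n)) (p (d (φ n))).sign Z)).U ξ - (mapL Z).U ξ)
    rw [add_sub_cancel] at h2
    exact h2.trans (add_le_add (hB ξ) h1)
  -- One bound for all errors: `2 x` for `y`, `R x` for `U`, `x²` for the termination tolerance, and
  -- the motion during a step of length `dt ≤ √(8 x / (K E))`. If `K E = 0`, the quotient is 0 by
  -- convention, and `D` is still continuous with `D 0 = 0`.
  set D : ℝ → ℝ := fun x => 2 * x + R x + x ^ 2 +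
    K * ((B + R x + T * E / 4) * √(8 * x / (K * E))) with hD
  have hDc : Continuous D := by simp only [hD, hR]; fun_prop
  have hD0 : D 0 = 0 := by simp [hD, hR]
  have hD1 : ∀ x, 0 ≤ x → R x ≤ D x ∧ 2 * x ≤ D x ∧ 0 ≤ D x ∧
      x ^ 2 + K * ((B + R x + T * E / 4) * √(8 * x / (K * E))) ≤ D x := fun x hx => by
    have h1 : 0 ≤ K * ((B + R x + T * E / 4) * √(8 * x / (K * E))) := by
      have := hR0 x; positivity
    have h2 := hR0 x
    have h3 := sq_nonneg x
    simp only [hD]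
    refine ⟨by linarith, by linarith, by linarith, by linarith⟩
  refine ⟨φ, βn, fun n => D (d (φ n)), ?_, hnum⟩
  refine
    { coeff := hα, T_nonneg := hT, init := hin
      init_n := fun n => initData_proj h (hpos n) _
      δ_nonneg := fun n => (hD1 _ (hpos n).le).2.2.1
      δ_tendsto := hD0 ▸ (hDc.tendsto 0).comp hdφ
      y_le := fun n ξ => (abs_mapL_proj_y_sub_le h (hpos n) _ ξ).trans (hD1 _ (hpos n).le).2.1
      U_le := fun n ξ => (abs_mapL_proj_U_sub_le h (hpos n) _ ξ).trans (hD1 _ (hpos n).le).1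
      H_tendsto := hH, U_tendsto := hU, flat := hflat, loss := hβ
      loss_meas := hβm, loss_mem := hβmem, loss_le := fun n => ?_ }
  have hxn := initData_proj h (hpos n) (p (d (φ n))).sign
  -- If `K E = 0`, there is no upper bound for `dt`. But if `E = 0` no label breaks, and if `K = 0`
  -- the bound for the error in the losses vanishes.
  have hE0 : E = 0 → ∀ᵐ η, deriv (mapL (proj (d (φ n)) (p (d (φ n))).sign Z)).H η = 0 := by
    intro e
    have h1 := hxn.integral_deriv_H
    rw [← hEd, e, integral_eq_zero_iff_of_nonneg hxn.deriv_H_nonneg hxn.integrable_deriv_H] at h1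
    exact h1
  by_cases e : E = 0
  · filter_upwards [hE0 e, hxn.ae_regularAt] with η h1 h2 h3
    exact absurd (h2.pos_of_neg h3).2.1 (by simp [h1])
  filter_upwards [hloss n _ (hBn n)] with η h1 h2 h3
  refine (h1 h2 h3).trans (le_trans ?_ (hD1 _ (hpos n).le).2.2.2)
  rcases hK0.eq_or_lt with h4 | h4
  · rw [← hK, ← h4, zero_mul, zero_mul, add_zero]; positivity
  have hKE : 0 < K * E := mul_pos h4 (lt_of_le_of_ne hE (Ne.symm e))
  have hadm := hp (d (φ n)) (hpos n)
  have h5 : K * E * (p (d (φ n))).dt ^ 2 ≤ 8 * d (φ n) := hadm.dt_le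
  have h6 : (p (d (φ n))).dt ≤ √(8 * d (φ n) / (K * E)) :=
    Real.le_sqrt_of_sq_le (by rw [le_div_iff₀ hKE]; linarith)
  have h7 : 0 ≤ B + R (d (φ n)) + T * E / 4 := by have := hR0 (d (φ n)); positivity
  rw [mul_add]
  refine add_le_add ?_ (mul_le_mul_of_nonneg_left (mul_le_mul_of_nonneg_left h6 h7) hK0)
  nlinarith [hpos n]

variable {t : ℝ} (ht : t ∈ Icc 0 T)
include ht

/-- Every sequence of mesh sizes tending to 0 has a subsequence along which the functional
converges, and the limit is always the same; hence it converges as `dx → 0`. -/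
lemma tendsto_numLag {A : Type*} [TopologicalSpace A] {β : ℝ → ℝ} (hβ : IsLoss α (mapL Z) β)
    (F : Lag → A) (hF : ∀ (Xn : ℕ → Lag) (βn : ℕ → ℝ → ℝ) (δ : ℕ → ℝ),
      StableSeq α T (Z.ν.real univ) (mapL Z) β Xn βn δ →
      Tendsto (fun n => F (evo (Xn n) (βn n) t)) atTop (𝓝 (F (evo (mapL Z) β t)))) :
    Tendsto (fun dx => F (numLag α T dx (p dx) Z t)) (𝓝[>] 0) (𝓝 (F (evo (mapL Z) β t))) := by
  refine tendsto_of_subseq_tendsto fun d hd => ?_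
  obtain ⟨φ, βn, δ, S, hnum⟩ := exists_stableSeq hα hT h hp hβ hd
  refine ⟨φ, ?_⟩
  simp_rw [fun n => hnum n t ht]
  exact hF _ _ _ S

end Convergence

lemma isFiniteMeasure_mapM_ν {X : Lag} (hX : Integrable (deriv X.H)) :
    IsFiniteMeasure (mapM X).ν := by
  have := isFiniteMeasure_withDensity_ofReal hX.2
  exact Measure.isFiniteMeasure_map _ _

end HunterSaxton

theorem theorem4p9 (α : ℝ → ℝ) (hα : IsCoefficient α) (T : ℝ) (hT : 0 ≤ T)
    (Z : Eul) (hZ : MemD0 Z)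
    (p : ℝ → Params) (hp : ∀ dx : ℝ, 0 < dx → Admissible α T dx (p dx) Z)
    (t : ℝ) (ht : t ∈ Icc 0 T) :
    MemE2 (exactEul α Z t).u ∧
    (∀ᶠ dx in 𝓝[>] (0 : ℝ), MemE2 (numEul α T dx (p dx) Z t).u) ∧
    TendstoLInf (fun dx => (numEul α T dx (p dx) Z t).u) (𝓝[>] 0) (exactEul α Z t).u ∧
    TendstoWeakL2 (fun dx => deriv (numEul α T dx (p dx) Z t).u) (𝓝[>] 0)
      (deriv (exactEul α Z t).u) ∧
    TendstoNarrow (fun dx => (numEul α T dx (p dx) Z t).ν) (𝓝[>] 0) (exactEul α Z t).ν ∧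
    ∀ g ∈ ({g1 α, g2 α, g3 α} : Set (Lag → ℝ → ℝ)),
      TendstoPush (fun dx => (numLag α T dx (p dx) Z t).y)
        (fun dx => g (numLag α T dx (p dx) Z t)) (𝓝[>] 0)
        (exactLag α Z t).y (g (exactLag α Z t)) := by
  have h := hZ.eulData
  have hin := h.initData
  obtain ⟨β, hβ, hex⟩ := exists_exactLag_eq hα hin
  have hnum : ∀ᶠ dx in 𝓝[>] (0 : ℝ), ∃ b : ℝ → ℝ, Measurable b ∧ (∀ η, b η ∈ Icc (0 : ℝ) 1) ∧
      InitData (mapL (proj dx (p dx).sign Z)) (Z.ν.real univ) ∧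
      numLag α T dx (p dx) Z t = evo (mapL (proj dx (p dx).sign Z)) b t := by
    filter_upwards [self_mem_nhdsWithin] with dx hdx
    obtain ⟨b, h1, h2, h3, -⟩ := exists_numLag_eq hα hT h hdx (hp dx hdx)
    exact ⟨b, h1, fun η => Ico_subset_Icc_self (h2 η), initData_proj h hdx _, h3 t ht⟩
  simp only [exactEul, numEul, hex t ht.1]
  refine ⟨memE2_evo hin hβ.mem_Icc hβ.meas ht.1, ?_, ?_, ⟨?_, ?_, fun φ hφ => ?_⟩,
    ⟨?_, ?_, fun φ => ?_⟩, ?_⟩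
  · filter_upwards [hnum] with dx ⟨b, h1, h2, h3, h4⟩
    rw [h4]; exact memE2_evo h3 h2 h1 ht.1
  -- The L∞ distance to the limit is itself regarded as a functional of the Lagrangian state, with
  -- value 0 at the exact solution.
  · have e : eLpNorm (fun x => (mapM (evo (mapL Z) β t)).u x - (mapM (evo (mapL Z) β t)).u x)
        ⊤ volume = 0 := by simp_rw [sub_self]; exact eLpNorm_zero'
    have := tendsto_numLag hα hT h hp ht hβ
      (fun X => eLpNorm (fun x => (mapM X).u x - (mapM (evo (mapL Z) β t)).u x) ⊤ volume)
      fun Xn βn δ S => by rw [e]; exact S.tendsto_u ht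
    rwa [e] at this
  · filter_upwards [hnum] with dx ⟨b, h1, h2, h3, h4⟩
    rw [h4]; exact (transport_evo h3 h2 h1 ht.1).eulerian.2.1
  · exact (transport_evo hin hβ.mem_Icc hβ.meas ht.1).eulerian.2.1
  · exact tendsto_numLag hα hT h hp ht hβ (fun X => ∫ x, φ x * deriv (mapM X).u x)
      fun Xn βn δ S => S.tendsto_weak ht hφ
  · filter_upwards [hnum] with dx ⟨b, h1, h2, h3, h4⟩
    rw [h4]; exact isFiniteMeasure_mapM_ν h3.integrable_deriv_H
  · exact isFiniteMeasure_mapM_ν hin.integrable_deriv_H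
  · exact tendsto_numLag hα hT h hp ht hβ (fun X => ∫ x, φ x ∂(mapM X).ν)
      fun Xn βn δ S => S.tendsto_nu ht φ
  · rintro g (rfl | rfl | rfl) φ hφ hc
    · exact tendsto_numLag hα hT h hp ht hβ (fun X => pushIntegral X.y (g1 α X) φ)
        fun Xn βn δ S => S.tendsto_g1 ht hφ hc
    · exact tendsto_numLag hα hT h hp ht hβ (fun X => pushIntegral X.y (g2 α X) φ)
        fun Xn βn δ S => S.tendsto_g2 ht hφ hc
    · exact tendsto_numLag hα hT h hp ht hβ (fun X => pushIntegral X.y (g3 α X) φ)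
        fun Xn βn δ S => S.tendsto_g3 ht hφ hc
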